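/- Let $n\ge 3$ and let $X=[x_1\ldots x_n]$ be an $n$-gon in the plane $\mathbb R^2$, that is, a closed polygonal line with edges $[x_i,x_{i+1}]$ (indices modulo $n$). It is \emph{simple} if its vertices are distinct, consecutive edges meet only in their common vertex, and distinct non-consecutive edges are disjoint. A (nondegenerate) square is \emph{inscribed} in $X$ if its four vertices lie on $X$; two squares are the same if they have the same set of vertices. Call $X$ \emph{generic} if (i) no vertex of $X$ is a vertex of a square inscribed in $X$, and (ii) for any four edges $e_1,e_2,e_3,e_4$ of $X$ (in any order, repetitions allowed) there is at most one nondegenerate counterclockwise square $[a_1a_2a_3a_4]$ such that each $a_k$ lies on the line spanned by $e_k$. Then the following holds. (1) Every generic simple polygon has a finite and odd number of inscribed squares. (2) For every $n\ge 3$, almost all $n$-gons, viewed as points of $\mathbb R^{2n}$ with Lebesgue measure, are generic. (3) The genericity assumption in (1) cannot be dropped: every right triangle is a simple polygon with exactly two inscribed squares. -/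

import Mathlib

/-!
The Euclidean plane is modelled by `ℂ` (with its usual distance and Lebesgue measure), so that
multiplication by `Complex.I` is the rotation by a right angle. An `n`-gon is Mathlib's
`Polygon ℂ n`: the cyclic sequence of its `n` vertices. Its `i`-th edge joins vertex `i` to
vertex `finRotate n i`, the cyclic successor of `i`.
-/

/-- The corners, in counterclockwise order, of the square with a side from `a` to `a + v`. -/
noncomputable def squareCorner (a v : ℂ) : Fin 4 → ℂ :=
  ![a, a + v, a + v + Complex.I * v, a + Complex.I * v]

/-- `S` is the set of the four vertices of a (nondegenerate) square in the plane. -/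
def IsSquareVertexSet (S : Set ℂ) : Prop :=
  ∃ a v : ℂ, v ≠ 0 ∧ S = Set.range (squareCorner a v)

/-- A polygon is simple if its vertices are distinct, two consecutive edges have only their
common vertex in common, and two different edges that are not consecutive are disjoint. -/
structure Polygon.IsSimple {n : ℕ} (X : Polygon ℂ n) : Prop where
  injective : Function.Injective X.vertices
  consecutive : ∀ i : Fin n,
    X.edgeSet ℝ i ∩ X.edgeSet ℝ (finRotate n i) = {X (finRotate n i)}
  disjoint : ∀ i j : Fin n, i ≠ j → j ≠ finRotate n i → i ≠ finRotate n j →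
    Disjoint (X.edgeSet ℝ i) (X.edgeSet ℝ j)

/-- The squares inscribed in `X`, that is, the squares whose four vertices lie on the polygonal
line `X`; each square is represented by its set of vertices, hence counted once. -/
def Polygon.inscribedSquares {n : ℕ} (X : Polygon ℂ n) : Set (Set ℂ) :=
  {S | IsSquareVertexSet S ∧ S ⊆ X.boundary ℝ}

/-- The line spanned by the `i`-th edge. -/
noncomputable def Polygon.edgeLine {n : ℕ} (X : Polygon ℂ n) (i : Fin n) : AffineSubspace ℝ ℂ :=
  line[ℝ, X i, X (finRotate n i)]

/-- Genericity of a polygon: no vertex of the polygon is a vertex of an inscribed square, and the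
lines spanned by the edges are in general position in the sense that for any four edges, listed in
any order and with repetitions allowed, there is at most one counterclockwise square whose
consecutive corners lie on the four lines spanned by these edges. -/
structure Polygon.IsGeneric {n : ℕ} (X : Polygon ℂ n) : Prop where
  vertex_notMem : ∀ S ∈ X.inscribedSquares, ∀ i : Fin n, X i ∉ S
  square_unique : ∀ (e : Fin 4 → Fin n) (a v a' v' : ℂ), v ≠ 0 → v' ≠ 0 →
    (∀ k, squareCorner a v k ∈ X.edgeLine (e k)) →
    (∀ k, squareCorner a' v' k ∈ X.edgeLine (e k)) → a = a' ∧ v = v'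

/-! Parity is shown to be invariant under deformation and is then computed for triangles. The
corners of a square are written `a + sqCoeff k * v`. Require one corner to lie in a triangle and the
other three on three segments. This gives four real equations in five real parameters, so for
generic endpoints the solutions form a bounded segment, possibly empty, and each of its two ends
lies on exactly one facet, namely a side of the triangle or an endpoint of a segment. Hence squares
fit into an even number of facets (`GenericFamily.even_card_facet`). Now sum over all triples of
pieces of a closed chain. Every endpoint belongs to two pieces, so the endpoint facets cancel modulo
2 and the three sides of the triangle together carry an even count (`sum_parityOn_sides`). Moving
one vertex of the chain replaces two pieces by two others. The two triangles between old and new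
pieces share a side, so the parity of the squares starting on the changed pieces is preserved
(`hitCount_update`). A square has four labellings, so the labelled count is invariant modulo 8 and
the number of squares modulo 2.

Two difficulties arise. Squares might shrink to a point, and pieces carrying the corners of a square
might share endpoints, which spoils genericity. Both are met by a gap. Simple polygons in a compact
family carry no square of side at most `2 * δ` (`exists_lt_norm`), and by compactness squares close
to these polygons have side less than `δ` or more than `2 * δ` (`exists_gap`). Only the large ones
are counted, on a subdivision whose pieces are short compared with `δ`. Large squares on a generic
polygon are transverse, so their number is stable under small perturbations
(`Subdivision.eventually_hitCount_eq`), and all auxiliary polygons may be perturbed to a generic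
family. The outcome is `parity_of_path`: along a path of simple polygons the parity agrees for
generic polygons near the two ends.

Induction on the number of vertices then uses ears. A simple polygon in general position with at
least four vertices has an ear (`SimpleLoop.exists_ear`, proved with winding numbers). Pushing its
tip to the midpoint of its base is a path of simple polygons, and at the end the tip can be deleted
(`LastEar.exists_modEq`). In a triangle an inscribed square has two vertices on one side, and a side
carries such a square exactly when neither adjacent angle is obtuse (`inscribedSquares_eq`). A
generic triangle thus has one or three squares. In a right triangle the squares on the two legs
coincide, which leaves two.

Genericity almost everywhere holds because each bad event is the vanishing of a determinant that is
polynomial along lines and nonzero for some explicit polygon (`LinePoly.ae_ne_zero`). -/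

section

open MeasureTheory Set Complex ComplexConjugate
open scoped Pointwise

namespace SquarePeg

/-! ### Functions that are polynomial along lines -/

/-- A continuous function whose restriction to every line is a polynomial. -/
structure LinePoly {E : Type*} [AddCommGroup E] [Module ℝ E] [TopologicalSpace E]
    (f : E → ℝ) : Prop where
  cont : Continuous f
  poly : ∀ x y : E, ∃ p : Polynomial ℝ, ∀ s : ℝ, f (x + s • y) = p.eval s

namespace LinePoly

variable {E : Type*} [AddCommGroup E] [Module ℝ E] [TopologicalSpace E] {f g : E → ℝ}

theorem const (c : ℝ) : LinePoly (fun _ : E => c) :=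
  ⟨continuous_const, fun _ _ => ⟨Polynomial.C c, fun _ => by simp⟩⟩

theorem of_linear (L : E →L[ℝ] ℝ) : LinePoly (fun x => L x) :=
  ⟨L.continuous, fun x y => ⟨Polynomial.C (L x) + Polynomial.C (L y) * Polynomial.X,
    fun s => by simp only [map_add, map_smul, smul_eq_mul, Polynomial.eval_add, Polynomial.eval_mul,
      Polynomial.eval_C, Polynomial.eval_X]; ring⟩⟩

theorem add (hf : LinePoly f) (hg : LinePoly g) : LinePoly (fun x => f x + g x) :=
  ⟨hf.cont.add hg.cont, fun x y => by
    obtain ⟨p, hp⟩ := hf.poly x y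
    obtain ⟨q, hq⟩ := hg.poly x y
    exact ⟨p + q, fun s => by simp [hp, hq]⟩⟩

theorem mul (hf : LinePoly f) (hg : LinePoly g) : LinePoly (fun x => f x * g x) :=
  ⟨hf.cont.mul hg.cont, fun x y => by
    obtain ⟨p, hp⟩ := hf.poly x y
    obtain ⟨q, hq⟩ := hg.poly x y
    exact ⟨p * q, fun s => by simp [hp, hq]⟩⟩

theorem neg (hf : LinePoly f) : LinePoly (fun x => -f x) := by
  simpa using (const (-1)).mul hf

theorem sub (hf : LinePoly f) (hg : LinePoly g) : LinePoly (fun x => f x - g x) := by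
  simpa [sub_eq_add_neg] using hf.add hg.neg

theorem sum {ι : Type*} (s : Finset ι) {f : ι → E → ℝ} (hf : ∀ i, LinePoly (f i)) :
    LinePoly (fun x => ∑ i ∈ s, f i x) := by
  classical
  induction s using Finset.induction_on with
  | empty => simpa using const 0
  | insert a s ha ih => simpa [Finset.sum_insert ha] using (hf a).add ih

theorem prod {ι : Type*} (s : Finset ι) {f : ι → E → ℝ} (hf : ∀ i, LinePoly (f i)) :
    LinePoly (fun x => ∏ i ∈ s, f i x) := by
  classical
  induction s using Finset.induction_on with
  | empty => simpa using const 1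
  | insert a s ha ih => simpa [Finset.prod_insert ha] using (hf a).mul ih

theorem det {ι : Type*} [Fintype ι] [DecidableEq ι] {M : E → Matrix ι ι ℝ}
    (hM : ∀ i j, LinePoly (fun x => M x i j)) : LinePoly (fun x => (M x).det) := by
  simp only [Matrix.det_apply']
  exact sum _ fun τ => (const _).mul (prod _ fun i => hM _ _)

end LinePoly

/-- On each line through `x₀` the function is a polynomial that is nonzero at the parameter 0, hence
has finitely many zeros. Fubini turns this into a statement for almost every dilation factor. -/
theorem LinePoly.ae_ne_zero {E : Type*} [NormedAddCommGroup E] [NormedSpace ℝ E]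
    [FiniteDimensional ℝ E] [MeasurableSpace E] [BorelSpace E] (μ : Measure E)
    [μ.IsAddHaarMeasure] {f : E → ℝ} (hf : LinePoly f) {x₀ : E} (h : f x₀ ≠ 0) :
    ∀ᵐ x ∂μ, f x ≠ 0 := by
  have hmeas : MeasurableSet {p : ℝ × E | f (x₀ + p.1 • p.2) ≠ 0} := by
    have : Continuous fun p : ℝ × E => f (x₀ + p.1 • p.2) := hf.cont.comp (by fun_prop)
    exact (isOpen_ne_fun this continuous_const).measurableSet
  have h1 : ∀ᵐ y ∂μ, ∀ᵐ s ∂(volume : Measure ℝ), f (x₀ + s • y) ≠ 0 := by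
    refine Filter.Eventually.of_forall fun y => ?_
    obtain ⟨p, hp⟩ := hf.poly x₀ y
    have hp0 : p ≠ 0 := by
      rintro rfl
      exact h (by simpa using hp 0)
    have : {s : ℝ | ¬ f (x₀ + s • y) ≠ 0} ⊆ (p.roots.toFinset : Set ℝ) := by
      intro s hs
      simp only [ne_eq, not_not, mem_ofPred_eq, hp] at hs
      simp [hp0, hs]
    exact measure_mono_null this (p.roots.toFinset.finite_toSet.measure_zero _)
  have h2 : ∀ᵐ s ∂(volume : Measure ℝ), ∀ᵐ y ∂μ, f (x₀ + s • y) ≠ 0 :=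
    (Measure.ae_ae_comm (μ := μ) (ν := volume) (p := fun y s => f (x₀ + s • y) ≠ 0)
      (measurable_swap hmeas)).1 h1
  -- One nonzero factor `s` suffices, since dilation by `s` and translation by `x₀` respect null
  -- sets.
  obtain ⟨s, hs, hs0⟩ := (h2.and (compl_mem_ae_iff.2 (measure_singleton (0 : ℝ)))).exists
  have hs0 : s ≠ 0 := hs0
  have h3 : μ {x | ¬ f (x₀ + x) ≠ 0} = 0 := by
    have : {y | ¬ f (x₀ + s • y) ≠ 0} = s⁻¹ • {x | ¬ f (x₀ + x) ≠ 0} := by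
      ext y
      simp [Set.mem_inv_smul_set_iff₀ hs0]
    have hs' : μ {y | ¬ f (x₀ + s • y) ≠ 0} = 0 := hs
    rw [this, Measure.addHaar_smul] at hs'
    rcases mul_eq_zero.1 hs' with h' | h'
    · rw [ENNReal.ofReal_eq_zero] at h'
      have : 0 < |(s⁻¹ ^ Module.finrank ℝ E)| := by positivity
      linarith
    · exact h'
  have : {x | ¬ f (x₀ + x) ≠ 0} = (fun x => x₀ + x) ⁻¹' {x | ¬ f x ≠ 0} := rfl
  rw [this, measure_preimage_add] at h3
  exact h3

/-! ### Corners of squares and determinants -/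

/-- The corners of the square spanned by `a`, `v` are the points `a + sqCoeff k * v`. -/
noncomputable def sqCoeff : Fin 4 → ℂ := ![0, 1, 1 + I, I]

@[simp] theorem sqCoeff_zero : sqCoeff 0 = 0 := rfl
@[simp] theorem sqCoeff_one : sqCoeff 1 = 1 := rfl
@[simp] theorem sqCoeff_two : sqCoeff 2 = 1 + I := rfl
@[simp] theorem sqCoeff_three : sqCoeff 3 = I := rfl

theorem squareCorner_apply (a v : ℂ) (k : Fin 4) : squareCorner a v k = a + sqCoeff k * v := by
  fin_cases k <;> simp [squareCorner, sqCoeff]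
  ring

/-- The corner `k` of the square starting at the next corner is the corner `k + 1`. -/
theorem corner_rotate (a v : ℂ) (k : Fin 4) :
    (a + v) + sqCoeff k * (I * v) = a + sqCoeff (k + 1) * v := by
  have hI : I * I = -1 := I_mul_I
  fin_cases k <;> simp [sqCoeff] <;> first | ring1 | linear_combination v * hI

theorem sqCoeff_injective : Function.Injective sqCoeff := by
  intro i j h
  fin_cases i <;> fin_cases j <;> first | rfl | (exfalso; revert h; simp [sqCoeff, Complex.ext_iff])

/-- The planar cross product. -/
def crs (z w : ℂ) : ℝ := z.re * w.im - z.im * w.re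

theorem crs_add (z w w' : ℂ) : crs z (w + w') = crs z w + crs z w' := by
  simp [crs]; ring

theorem crs_sub (z w w' : ℂ) : crs z (w - w') = crs z w - crs z w' := by
  simp [crs]; ring

theorem crs_smul (z w : ℂ) (t : ℝ) : crs z (t • w) = t * crs z w := by
  simp [crs]; ring

theorem crs_self (z : ℂ) : crs z z = 0 := by simp [crs]; ring

theorem crs_eq_zero_iff {z : ℂ} (hz : z ≠ 0) (w : ℂ) : crs z w = 0 ↔ ∃ t : ℝ, w = t • z := by
  constructor
  · intro h
    refine ⟨(w / z).re, ?_⟩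
    have h1 : (w / z).im = 0 := by
      rw [Complex.div_im]
      have : normSq z ≠ 0 := by simpa using hz
      field_simp
      simp only [crs] at h
      linarith
    have : w / z = ((w / z).re : ℂ) := by apply Complex.ext <;> simp [h1]
    rw [Complex.real_smul, ← this]
    field_simp
  · rintro ⟨t, rfl⟩
    rw [crs_smul, crs_self, mul_zero]

theorem crs_eq_zero_of_mem_line {p q z : ℂ} (h : z ∈ line[ℝ, p, q]) : crs (q - p) (z - p) = 0 := by
  obtain ⟨t, rfl⟩ := (mem_affineSpan_pair_iff_exists_lineMap_eq).1 h
  rw [AffineMap.lineMap_apply]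
  simp only [vsub_eq_sub, vadd_eq_add, add_sub_cancel_right, crs_smul, crs_self, mul_zero]

theorem mem_line_iff {p q z : ℂ} (hpq : p ≠ q) : z ∈ line[ℝ, p, q] ↔ crs (q - p) (z - p) = 0 := by
  refine ⟨crs_eq_zero_of_mem_line, fun h => ?_⟩
  obtain ⟨t, ht⟩ := (crs_eq_zero_iff (sub_ne_zero.2 hpq.symm) _).1 h
  refine mem_affineSpan_pair_iff_exists_lineMap_eq.2 ⟨t, ?_⟩
  rw [AffineMap.lineMap_apply, vsub_eq_sub, vadd_eq_add, ← ht]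
  ring

theorem mem_line_of_mem_segment {p q z : ℂ} (h : z ∈ segment ℝ p q) : z ∈ line[ℝ, p, q] := by
  rw [← affineSegment_eq_segment] at h
  obtain ⟨t, -, rfl⟩ := h
  exact AffineMap.lineMap_mem_affineSpan_pair t p q

/-- The matrix of the conditions that the corners of a square `(a, v)` lie on lines with
directions `d k`. -/
noncomputable def sqMatrix (d : Fin 4 → ℂ) : Matrix (Fin 4) (Fin 4) ℝ :=
  Matrix.of fun k => ![-(d k).im, (d k).re, -(conj (sqCoeff k) * d k).im,
    (conj (sqCoeff k) * d k).re]

theorem sqMatrix_mulVec (d : Fin 4 → ℂ) (a v : ℂ) :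
    (sqMatrix d).mulVec ![a.re, a.im, v.re, v.im] = fun k => crs (d k) (a + sqCoeff k * v) := by
  funext k
  simp [Matrix.mulVec, dotProduct, sqMatrix, Fin.sum_univ_four, crs]
  ring

theorem eq_zero_of_sqMatrix_det {d : Fin 4 → ℂ} (hd : (sqMatrix d).det ≠ 0) {a v : ℂ}
    (h : ∀ k, crs (d k) (a + sqCoeff k * v) = 0) : a = 0 ∧ v = 0 := by
  have := Matrix.eq_zero_of_mulVec_eq_zero hd (v := ![a.re, a.im, v.re, v.im])
    (by rw [sqMatrix_mulVec]; funext k; exact h k)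
  have h0 := congrFun this 0
  have h1 := congrFun this 1
  have h2 := congrFun this 2
  have h3 := congrFun this 3
  simp at h0 h1 h2 h3
  exact ⟨Complex.ext h0 h1, Complex.ext h2 h3⟩

theorem sqMatrix_det_ne_zero {d : Fin 4 → ℂ}
    (h : ∀ a v : ℂ, (∀ k, crs (d k) (a + sqCoeff k * v) = 0) → a = 0 ∧ v = 0) :
    (sqMatrix d).det ≠ 0 := by
  intro h0
  obtain ⟨x, hx, hx0⟩ := Matrix.exists_mulVec_eq_zero_iff.2 h0
  have hx' : x = ![(⟨x 0, x 1⟩ : ℂ).re, (⟨x 0, x 1⟩ : ℂ).im, (⟨x 2, x 3⟩ : ℂ).re,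
      (⟨x 2, x 3⟩ : ℂ).im] := by
    funext k; fin_cases k <;> rfl
  rw [hx', sqMatrix_mulVec] at hx0
  obtain ⟨h1, h2⟩ := h _ _ fun k => congrFun hx0 k
  apply hx
  rw [hx', h1, h2]
  funext k; fin_cases k <;> rfl

/-- The matrix of the conditions that, for a square with a corner at a given point, three points
`c k * v` relative to this corner satisfy `crs (d k) (c k * v) + h k = 0`. -/
def cornerMatrix (c d : Fin 3 → ℂ) (h : Fin 3 → ℝ) : Matrix (Fin 3) (Fin 3) ℝ :=
  Matrix.of fun k => ![-(conj (c k) * d k).im, (conj (c k) * d k).re, h k]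

theorem cornerMatrix_mulVec (c d : Fin 3 → ℂ) (h : Fin 3 → ℝ) (v : ℂ) (t : ℝ) :
    (cornerMatrix c d h).mulVec ![v.re, v.im, t] = fun k => crs (d k) (c k * v) + h k * t := by
  funext k
  simp [Matrix.mulVec, dotProduct, cornerMatrix, Fin.sum_univ_three, crs]
  ring

/-- The third column makes the three inhomogeneous equations homogeneous: a solution `v` gives the
kernel vector `(v, 1)`. -/
theorem false_of_cornerMatrix_det {c d : Fin 3 → ℂ} {h : Fin 3 → ℝ}
    (hd : (cornerMatrix c d h).det ≠ 0) {v : ℂ} (hv : ∀ k, crs (d k) (c k * v) + h k = 0) :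
    False := by
  have := Matrix.eq_zero_of_mulVec_eq_zero hd (v := ![v.re, v.im, 1])
    (by rw [cornerMatrix_mulVec]; funext k; simpa using hv k)
  simpa using congrFun this 2

theorem cornerMatrix_det_ne_zero {c d : Fin 3 → ℂ} {h : Fin 3 → ℝ}
    (H : ∀ (v : ℂ) (t : ℝ), (∀ k, crs (d k) (c k * v) + h k * t = 0) → v = 0 ∧ t = 0) :
    (cornerMatrix c d h).det ≠ 0 := by
  intro h0
  obtain ⟨x, hx, hx0⟩ := Matrix.exists_mulVec_eq_zero_iff.2 h0
  have hx' : x = ![(⟨x 0, x 1⟩ : ℂ).re, (⟨x 0, x 1⟩ : ℂ).im, x 2] := by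
    funext k; fin_cases k <;> rfl
  rw [hx', cornerMatrix_mulVec] at hx0
  obtain ⟨h1, h2⟩ := H _ _ fun k => congrFun hx0 k
  apply hx
  rw [hx', h1, h2]
  funext k; fin_cases k <;> rfl

end SquarePeg

end

section

open MeasureTheory Set Complex ComplexConjugate
open scoped Pointwise

namespace SquarePeg

/-! ### Generic families of points -/

theorem linePoly_re {κ : Type*} (i : κ) : LinePoly (fun z : κ → ℂ => (z i).re) :=
  LinePoly.of_linear (reCLM.comp (ContinuousLinearMap.proj (R := ℝ) (φ := fun _ : κ => ℂ) i))

theorem linePoly_im {κ : Type*} (i : κ) : LinePoly (fun z : κ → ℂ => (z i).im) :=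
  LinePoly.of_linear (imCLM.comp (ContinuousLinearMap.proj (R := ℝ) (φ := fun _ : κ => ℂ) i))

/-- A complex valued function with `LinePoly` real and imaginary part. -/
def CLinePoly {E : Type*} [AddCommGroup E] [Module ℝ E] [TopologicalSpace E] (f : E → ℂ) : Prop :=
  LinePoly (fun x => (f x).re) ∧ LinePoly (fun x => (f x).im)

namespace CLinePoly

variable {E : Type*} [AddCommGroup E] [Module ℝ E] [TopologicalSpace E] {f g : E → ℂ}

theorem apply {κ : Type*} (i : κ) : CLinePoly (fun z : κ → ℂ => z i) :=
  ⟨linePoly_re i, linePoly_im i⟩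

theorem sub (hf : CLinePoly f) (hg : CLinePoly g) : CLinePoly (fun x => f x - g x) :=
  ⟨by simpa using hf.1.sub hg.1, by simpa using hf.2.sub hg.2⟩

theorem add (hf : CLinePoly f) (hg : CLinePoly g) : CLinePoly (fun x => f x + g x) :=
  ⟨by simpa using hf.1.add hg.1, by simpa using hf.2.add hg.2⟩

theorem const_mul (c : ℂ) (hf : CLinePoly f) : CLinePoly (fun x => c * f x) :=
  ⟨by simpa using ((LinePoly.const c.re).mul hf.1).sub ((LinePoly.const c.im).mul hf.2),
    by simpa using ((LinePoly.const c.re).mul hf.2).add ((LinePoly.const c.im).mul hf.1)⟩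

theorem crs (hf : CLinePoly f) (hg : CLinePoly g) : LinePoly (fun x => crs (f x) (g x)) :=
  (hf.1.mul hg.2).sub (hf.2.mul hg.1)

theorem sqMatrix_det {d : E → Fin 4 → ℂ} (hd : ∀ k, CLinePoly (fun x => d x k)) :
    LinePoly (fun x => (sqMatrix (d x)).det) := by
  refine LinePoly.det fun k j => ?_
  fin_cases j
  · exact (hd k).2.neg
  · exact (hd k).1
  · exact ((hd k).const_mul _).2.neg
  · exact ((hd k).const_mul _).1

theorem cornerMatrix_det {c : Fin 3 → ℂ} {d : E → Fin 3 → ℂ} {h : E → Fin 3 → ℝ}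
    (hd : ∀ k, CLinePoly (fun x => d x k)) (hh : ∀ k, LinePoly (fun x => h x k)) :
    LinePoly (fun x => (cornerMatrix c (d x) (h x)).det) := by
  refine LinePoly.det fun k j => ?_
  fin_cases j
  · exact ((hd k).const_mul _).2.neg
  · exact ((hd k).const_mul _).1
  · exact hh k

end CLinePoly

/-- If the directions `d k` are parallel to `1` and to `1 + I`, both occurring, a square with
corners on lines with these directions is unique. -/
theorem sqMatrix_det_ne_zero_of_two {d : Fin 4 → ℂ} {b : Fin 4 → Prop}
    (hd : ∀ k, (b k ∧ ∃ r : ℝ, r ≠ 0 ∧ d k = r) ∨ (¬ b k ∧ ∃ r : ℝ, r ≠ 0 ∧ d k = r * (1 + I)))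
    (h1 : ∃ k, b k) (h2 : ∃ k, ¬ b k) : (sqMatrix d).det ≠ 0 := by
  refine sqMatrix_det_ne_zero fun a v h => ?_
  have H : ∀ k, (b k ∧ (a + sqCoeff k * v).im = 0) ∨
      (¬ b k ∧ (a + sqCoeff k * v).im = (a + sqCoeff k * v).re) := by
    intro k
    have hk := h k
    rcases hd k with ⟨hb, r, hr, e⟩ | ⟨hb, r, hr, e⟩
    · refine Or.inl ⟨hb, mul_left_cancel₀ hr ?_⟩
      rw [e] at hk
      simp only [crs, ofReal_re, ofReal_im] at hk
      linarith
    · refine Or.inr ⟨hb, mul_left_cancel₀ hr ?_⟩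
      rw [e] at hk
      simp only [crs, mul_re, mul_im, ofReal_re, ofReal_im, add_re, add_im, one_re, one_im, I_re,
        I_im] at hk ⊢
      linarith
  rw [Fin.exists_fin_succ, Fin.exists_fin_succ, Fin.exists_fin_succ, Fin.exists_fin_one] at h1 h2
  simp only [Complex.ext_iff, zero_re, zero_im]
  -- Of the sixteen distributions of the corners over the two directions, the two constant ones are
  -- excluded by `h1` and `h2`. The others are nonsingular linear systems.
  rcases H 0 with ⟨b0, e0⟩ | ⟨b0, e0⟩ <;> rcases H 1 with ⟨b1, e1⟩ | ⟨b1, e1⟩ <;>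
    rcases H 2 with ⟨b2, e2⟩ | ⟨b2, e2⟩ <;> rcases H 3 with ⟨b3, e3⟩ | ⟨b3, e3⟩ <;>
    simp [sqCoeff] at e0 e1 e2 e3 <;>
    first
      | (refine ⟨⟨?_, ?_⟩, ?_, ?_⟩ <;> linarith)
      | (exfalso; rcases h2 with h | h | h | h <;> exact h ‹_›)
      | (exfalso; rcases h1 with h | h | h | h <;> exact absurd h ‹_›)

/-- A family of points is generic if squares with corners on lines spanned by distinct points are
unique, and there are no squares satisfying too many incidences with points and lines of the
family. -/
structure GenericFamily {κ : Type*} (z : κ → ℂ) : Prop where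
  det : ∀ p q : Fin 4 → κ, (∀ k l, p k ≠ q l) → Function.Injective q →
    (sqMatrix fun k => z (q k) - z (p k)).det ≠ 0
  corner : ∀ (k₀ : Fin 4) (i : κ) (p q : Fin 4 → κ),
    (∀ k, k ≠ k₀ → i ≠ p k ∧ i ≠ q k ∧ p k ≠ q k) → ∀ a v : ℂ, a + sqCoeff k₀ * v = z i →
    ¬ ∀ k, k ≠ k₀ → crs (z (q k) - z (p k)) (a + sqCoeff k * v - z (p k)) = 0
  two : ∀ (k k' k'' : Fin 4) (i i' p q : κ), k ≠ k' → k ≠ k'' → k' ≠ k'' → i ≠ p → i ≠ q →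
    i' ≠ p → i' ≠ q → p ≠ q → ∀ a v : ℂ, a + sqCoeff k * v = z i → a + sqCoeff k' * v = z i' →
    crs (z q - z p) (a + sqCoeff k'' * v - z p) ≠ 0

/-- Each of the three conditions follows from the nonvanishing of a polynomial in the coordinates.
One explicit, highly degenerate family of points per condition shows that this polynomial is not
identically zero. -/
theorem ae_genericFamily (κ : Type*) [Fintype κ] :
    ∀ᵐ z ∂(volume : Measure (κ → ℂ)), GenericFamily z := by
  classical
  have h1 : ∀ᵐ z ∂(volume : Measure (κ → ℂ)), ∀ p q : Fin 4 → κ, (∀ k l, p k ≠ q l) →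
      Function.Injective q → (sqMatrix fun k => z (q k) - z (p k)).det ≠ 0 := by
    refine ae_all_iff.2 fun p => ae_all_iff.2 fun q => ae_all_iff.2 fun hpq => ae_all_iff.2 fun hq => ?_
    refine LinePoly.ae_ne_zero _ (CLinePoly.sqMatrix_det fun k =>
      (CLinePoly.apply _).sub (CLinePoly.apply _))
      (x₀ := fun j => if j = q 0 then 1 else if ∃ k, j = q k then 1 + I else 0) ?_
    have hp : ∀ k, ¬ (p k = q 0) := fun k => hpq k 0
    have hp' : ∀ k, ¬ ∃ l, p k = q l := fun k ⟨l, hl⟩ => hpq k l hl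
    refine sqMatrix_det_ne_zero_of_two (b := fun k => k = 0) (fun k => ?_) ⟨0, rfl⟩ ⟨1, by simp⟩
    by_cases hk : k = 0
    · left
      refine ⟨hk, 1, one_ne_zero, ?_⟩
      simp only [hp, hp', if_false, sub_zero]
      simp [hk]
    · right
      refine ⟨hk, 1, one_ne_zero, ?_⟩
      have : ¬ (q k = q 0) := fun h => hk (hq h)
      simp only [hp, hp', if_false, sub_zero, this, if_pos (⟨k, rfl⟩ : ∃ l, q k = q l),
        ofReal_one, one_mul]
  have h2 : ∀ᵐ z ∂(volume : Measure (κ → ℂ)), ∀ (k₀ : Fin 4) (i : κ) (p q : Fin 4 → κ),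
      (∀ k, k ≠ k₀ → i ≠ p k ∧ i ≠ q k ∧ p k ≠ q k) →
      (cornerMatrix (fun j : Fin 3 => sqCoeff (k₀.succAbove j) - sqCoeff k₀)
        (fun j => z (q (k₀.succAbove j)) - z (p (k₀.succAbove j)))
        (fun j => crs (z (q (k₀.succAbove j)) - z (p (k₀.succAbove j)))
          (z i - z (p (k₀.succAbove j))))).det ≠ 0 := by
    refine ae_all_iff.2 fun k₀ => ae_all_iff.2 fun i => ae_all_iff.2 fun p => ae_all_iff.2 fun q =>
      ae_all_iff.2 fun hpq => ?_
    let t : κ → ℝ := fun j => ((Fintype.equivFin κ j : ℕ) : ℝ)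
    have ht : ∀ j j', t j = t j' → j = j' := by
      intro j j' h
      have : ((Fintype.equivFin κ j : ℕ)) = (Fintype.equivFin κ j' : ℕ) := Nat.cast_injective h
      exact (Fintype.equivFin κ).injective (Fin.ext this)
    -- Witness: the point `i` at 0 and all others at different heights on the line `Re = 1`, so that
    -- the three lines coincide. A square with three collinear corners is degenerate.
    refine LinePoly.ae_ne_zero _ (CLinePoly.cornerMatrix_det
      (fun k => (CLinePoly.apply _).sub (CLinePoly.apply _))
      (fun k => ((CLinePoly.apply _).sub (CLinePoly.apply _)).crs
        ((CLinePoly.apply _).sub (CLinePoly.apply _))))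
      (x₀ := fun j => if j = i then 0 else 1 + t j * I) ?_
    refine cornerMatrix_det_ne_zero fun v T h => ?_
    have key : ∀ j : Fin 3, ((sqCoeff (k₀.succAbove j) - sqCoeff k₀) * v).re = T := by
      intro j
      obtain ⟨h1, h2, h3⟩ := hpq _ (Fin.succAbove_ne k₀ j)
      have := h j
      simp only [h1.symm, h2.symm, if_false, if_true] at this
      have h4 : t (q (k₀.succAbove j)) - t (p (k₀.succAbove j)) ≠ 0 :=
        sub_ne_zero.2 fun h => h3 (ht _ _ h).symm
      apply mul_left_cancel₀ h4
      simp [crs] at this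
      simp only [mul_re, sub_re, sub_im]
      linarith
    have e0 := key 0
    have e1 := key 1
    have e2 := key 2
    simp only [Complex.ext_iff, zero_re, zero_im]
    fin_cases k₀ <;> simp [Fin.succAbove, sqCoeff] at e0 e1 e2 <;>
      refine ⟨⟨?_, ?_⟩, ?_⟩ <;> linarith
  have h3 : ∀ᵐ z ∂(volume : Measure (κ → ℂ)), ∀ (k k' k'' : Fin 4) (i i' p q : κ), k ≠ k' → i ≠ p →
      i ≠ q → i' ≠ p → i' ≠ q → p ≠ q →
      crs (z q - z p) (z i + (sqCoeff k'' - sqCoeff k) / (sqCoeff k' - sqCoeff k) * (z i' - z i)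
        - z p) ≠ 0 := by
    refine ae_all_iff.2 fun k => ae_all_iff.2 fun k' => ae_all_iff.2 fun k'' => ae_all_iff.2 fun i =>
      ae_all_iff.2 fun i' => ae_all_iff.2 fun p => ae_all_iff.2 fun q => ae_all_iff.2 fun hk =>
      ae_all_iff.2 fun h1 => ae_all_iff.2 fun h2 => ae_all_iff.2 fun h3 => ae_all_iff.2 fun h4 =>
      ae_all_iff.2 fun h5 => ?_
    -- Two corners determine the third one linearly. Witness: `p` at 0, `q` at 1 and everything else
    -- at `I`; the square shrinks to the point `I`, which is not on the real axis.
    refine LinePoly.ae_ne_zero _ (((CLinePoly.apply _).sub (CLinePoly.apply _)).crs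
      (((CLinePoly.apply _).add (((CLinePoly.apply _).sub (CLinePoly.apply _)).const_mul _)).sub
        (CLinePoly.apply _))) (x₀ := fun j => if j = p then 0 else if j = q then 1 else I) ?_
    simp [h1, h2, h3, h4, h5.symm, crs]
  filter_upwards [h1, h2, h3] with z g1 g2 g3
  refine ⟨g1, ?_, ?_⟩
  · intro k₀ i p q hpq a v ha H
    refine false_of_cornerMatrix_det (g2 k₀ i p q hpq) (v := v) fun j => ?_
    rw [← crs_add]
    have := H _ (Fin.succAbove_ne k₀ j)
    rw [← ha]
    convert this using 2
    ring
  · intro k k' k'' i i' p q hk _ _ h1 h2 h3 h4 h5 a v hi hi' H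
    apply g3 k k' k'' i i' p q hk h1 h2 h3 h4 h5
    have hne : sqCoeff k' - sqCoeff k ≠ 0 := sub_ne_zero.2 fun h => hk (sqCoeff_injective h).symm
    rw [← H, ← hi, ← hi']
    congr 1
    field_simp
    ring

end SquarePeg

end

section

open MeasureTheory Set Complex ComplexConjugate
open scoped Pointwise

namespace SquarePeg

/-! ### Almost all polygons are generic -/

/-- The direction of the `j`-th edge of the polygon with vertices `x`. -/
def edgeDir {n : ℕ} (x : Fin n → ℂ) (j : Fin n) : ℂ := x (finRotate n j) - x j

theorem cLinePoly_edgeDir {n : ℕ} (j : Fin n) : CLinePoly (fun x : Fin n → ℂ => edgeDir x j) :=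
  (CLinePoly.apply _).sub (CLinePoly.apply _)

/-- Cutting the polygon open at the unused edge `h` leaves the directions of all other edges free.
Edge `e 0` gets direction `1` and the rest get `1 + I`; `pos` counts vertices from the one after
`h`, and the term `-I` corrects everything beyond edge `e 0`. -/
theorem exists_det_ne_zero_of_notMem {n : ℕ} {e : Fin 4 → Fin (n + 1)} (he : ∃ k, e k ≠ e 0)
    {h : Fin (n + 1)} (hh : ∀ k, e k ≠ h) :
    ∃ x : Fin (n + 1) → ℂ, (sqMatrix fun k => edgeDir x (e k)).det ≠ 0 := by
  let pos : Fin (n + 1) → ℕ := fun j => ((j - h - 1 : Fin (n + 1)) : ℕ)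
  have hpos : ∀ j, j ≠ h → pos (j + 1) = pos j + 1 := by
    intro j hj
    have e1 : j + 1 - h - 1 = (j - h - 1) + 1 := by abel
    simp only [pos]
    rw [e1, Fin.val_add_one, if_neg]
    intro hl
    apply hj
    have : j - h - 1 + 1 = 0 := by rw [hl]; simp
    simpa [sub_eq_zero] using this
  have hinj : ∀ j j', pos j = pos j' → j = j' := by
    intro j j' hj
    have := Fin.ext hj
    simpa using this
  refine ⟨fun j => pos j * (1 + I) + if pos (e 0) < pos j then -I else 0, ?_⟩
  refine sqMatrix_det_ne_zero_of_two (b := fun k => e k = e 0) (fun k => ?_) ⟨0, rfl⟩ he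
  by_cases hk : e k = e 0
  · refine Or.inl ⟨hk, 1, one_ne_zero, ?_⟩
    simp only [edgeDir, finRotate_apply, hk, hpos _ (hh 0)]
    simp
    ring
  · refine Or.inr ⟨hk, 1, one_ne_zero, ?_⟩
    simp only [edgeDir, finRotate_apply, hpos _ (hh k)]
    have h1 : pos (e k) ≠ pos (e 0) := fun h => hk (hinj _ _ h)
    have h2 : pos (e 0) < pos (e k) + 1 ↔ pos (e 0) < pos (e k) := by omega
    simp only [h2]
    push_cast
    ring

/-- When all three sides of a triangle are used, two directions do not suffice, because the edges
sum to zero. A single triangle works for every surjective assignment, as a finite check shows. -/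
theorem exists_det_ne_zero_three {e : Fin 4 → Fin 3} (he : Function.Surjective e) :
    ∃ x : Fin 3 → ℂ, (sqMatrix fun k => edgeDir x (e k)).det ≠ 0 := by
  refine ⟨![0, 4, 1 + 2 * I], ?_⟩
  have hd : ∀ (j : Fin 3) (z : ℂ), crs (edgeDir ![0, 4, 1 + 2 * I] j) z = 0 →
      j = 0 ∧ z.im = 0 ∨ j = 1 ∧ -3 * z.im = 2 * z.re ∨ j = 2 ∧ z.im = 2 * z.re := by
    intro j z hz
    fin_cases j <;> simp [edgeDir, crs] at hz
    · left; simpa using hz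
    · right; left; exact ⟨rfl, by linarith⟩
    · right; right; exact ⟨rfl, by linarith⟩
  refine sqMatrix_det_ne_zero fun a v h => ?_
  have H := fun k => hd _ _ (h k)
  have s0 := he 0
  have s1 := he 1
  have s2 := he 2
  rw [Fin.exists_fin_succ, Fin.exists_fin_succ, Fin.exists_fin_succ, Fin.exists_fin_one]
    at s0 s1 s2
  simp only [Complex.ext_iff, zero_re, zero_im]
  have H0 := H 0
  have H1 := H 1
  have H2 := H 2
  have H3 := H 3
  clear H hd h he
  simp only [Fin.succ_zero_eq_one, Fin.succ_one_eq_two] at s0 s1 s2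
  rw [show Fin.succ (2 : Fin 3) = (3 : Fin 4) from rfl] at s0 s1 s2
  generalize e 0 = j0 at *
  generalize e 1 = j1 at *
  generalize e 2 = j2 at *
  generalize e 3 = j3 at *
  rcases H0 with ⟨rfl, e0⟩ | ⟨rfl, e0⟩ | ⟨rfl, e0⟩ <;>
  rcases H1 with ⟨rfl, e1⟩ | ⟨rfl, e1⟩ | ⟨rfl, e1⟩ <;>
  rcases H2 with ⟨rfl, e2⟩ | ⟨rfl, e2⟩ | ⟨rfl, e2⟩ <;>
  rcases H3 with ⟨rfl, e3⟩ | ⟨rfl, e3⟩ | ⟨rfl, e3⟩ <;>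
  first
    | (exfalso; revert s0 s1 s2; decide)
    | (simp [sqCoeff] at e0 e1 e2 e3
       refine ⟨⟨?_, ?_⟩, ?_, ?_⟩ <;> linarith)

/-- Either some edge is unused, or four labels cover all edges and `n` is 3 or 4. For `n = 4` a
parallelogram has only the two directions needed. -/
theorem exists_det_ne_zero {n : ℕ} (hn : 3 ≤ n) {e : Fin 4 → Fin n} (he : ∃ k, e k ≠ e 0) :
    ∃ x : Fin n → ℂ, (sqMatrix fun k => edgeDir x (e k)).det ≠ 0 := by
  by_cases hs : Function.Surjective e
  · have h4 : n ≤ 4 := by simpa using Fintype.card_le_of_surjective e hs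
    obtain rfl | rfl : n = 3 ∨ n = 4 := by omega
    · exact exists_det_ne_zero_three hs
    · refine ⟨![0, 1, 2 + I, 1 + I], ?_⟩
      refine sqMatrix_det_ne_zero_of_two (b := fun k => e k = 0 ∨ e k = 2) (fun k => ?_) ?_ ?_
      · generalize e k = j
        fin_cases j
        · refine Or.inl ⟨by simp, 1, one_ne_zero, ?_⟩
          simp [edgeDir]
        · refine Or.inr ⟨by simp, 1, one_ne_zero, ?_⟩
          simp [edgeDir]
          ring
        · refine Or.inl ⟨by simp, -1, by norm_num, ?_⟩
          simp [edgeDir]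
          ring
        · refine Or.inr ⟨by simp, -1, by norm_num, ?_⟩
          simp [edgeDir]
      · obtain ⟨k, hk⟩ := hs 0
        exact ⟨k, Or.inl hk⟩
      · obtain ⟨k, hk⟩ := hs 1
        exact ⟨k, by simp [hk]⟩
  · simp only [Function.Surjective, not_forall, not_exists] at hs
    obtain ⟨h, hh⟩ := hs
    obtain ⟨m, rfl⟩ : ∃ m, n = m + 1 := ⟨n - 1, by omega⟩
    exact exists_det_ne_zero_of_notMem he hh

/-- If two corners `c * v` and `c' * v` of a square with a corner at the origin lie on a line
through the origin, the square is degenerate. -/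
theorem eq_zero_of_crs {d v : ℂ} (hd : d ≠ 0) {k l : Fin 4} (hkl : k ≠ l) (hk0 : k ≠ 0)
    (hl0 : l ≠ 0) (hk : crs d (sqCoeff k * v) = 0) (hl : crs d (sqCoeff l * v) = 0) : v = 0 := by
  -- Any two different nonzero coefficients span the plane, so both the cross and the inner product
  -- of `d` and `v` vanish. Their squares add up to the product of the squared norms.
  obtain ⟨h1, h2⟩ : d.re * v.im - d.im * v.re = 0 ∧ d.re * v.re + d.im * v.im = 0 := by
    fin_cases k <;> fin_cases l <;> simp [crs, sqCoeff] at hkl hk0 hl0 hk hl <;>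
      constructor <;> linarith
  have h3 : (d.re ^ 2 + d.im ^ 2) * (v.re ^ 2 + v.im ^ 2) = 0 := by
    linear_combination (d.re * v.im - d.im * v.re) * h1 + (d.re * v.re + d.im * v.im) * h2
  have h4 : normSq d * normSq v = 0 := by
    rw [normSq_apply, normSq_apply]; linear_combination h3
  have h5 : normSq d ≠ 0 := by simpa using hd
  simpa [h5] using h4

/-- This is the linear system that arises when one vertex sits at 0 and the others on `Re = 1`.
Lines avoiding the vertex (`N k`) become that vertical line, and lines through it have slope `t k`.
Slopes at least 1 keep the determinants positive in the cases with two sloped lines. -/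
theorem corner_witness {v : ℂ} {T : ℝ} {N : Fin 3 → Prop} {t : Fin 3 → ℝ}
    (hN : ∃ k, N k) (ht : ∀ k, 1 ≤ t k)
    (h : ∀ k, N k ∧ (sqCoeff k.succ * v).re = T ∨
      ¬ N k ∧ (sqCoeff k.succ * v).im = t k * (sqCoeff k.succ * v).re) : v = 0 ∧ T = 0 := by
  rw [Fin.exists_fin_succ, Fin.exists_fin_succ, Fin.exists_fin_one] at hN
  have t0 := ht 0
  have t1 := ht 1
  have t2 := ht 2
  simp only [Complex.ext_iff, zero_re, zero_im]
  rcases h 0 with ⟨b0, e0⟩ | ⟨b0, e0⟩ <;> rcases h 1 with ⟨b1, e1⟩ | ⟨b1, e1⟩ <;>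
    rcases h 2 with ⟨b2, e2⟩ | ⟨b2, e2⟩ <;>
    simp [show (Fin.succ (2 : Fin 3)) = (3 : Fin 4) from rfl] at e0 e1 e2
  · refine ⟨⟨?_, ?_⟩, ?_⟩ <;> linarith
  · have : v.im = 0 := by linarith
    simp only [this, neg_zero, mul_zero] at e2
    refine ⟨⟨?_, ?_⟩, ?_⟩ <;> linarith
  · have h1 : v.im = -v.re := by linarith
    rw [h1] at e1
    have h2 : t 1 * v.re = 0 := by linarith
    have h3 : v.re = 0 := by
      rcases mul_eq_zero.1 h2 with h | h
      · linarith
      · exact h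
    refine ⟨⟨?_, ?_⟩, ?_⟩ <;> linarith
  · have h3 : v.im * (1 + t 1 + t 2 * (t 1 - 1)) = 0 := by
      linear_combination e1 + (t 1 - 1) * e2
    have h4 : 0 < 1 + t 1 + t 2 * (t 1 - 1) := by nlinarith
    have h5 : v.im = 0 := by
      rcases mul_eq_zero.1 h3 with h | h
      · exact h
      · linarith
    rw [h5] at e1 e2
    have : v.re = 0 := by linarith
    refine ⟨⟨?_, ?_⟩, ?_⟩ <;> linarith
  · have : v.re = 0 := by linarith
    rw [this] at e0
    refine ⟨⟨?_, ?_⟩, ?_⟩ <;> linarith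
  · have h3 : v.re * (1 + t 0 * t 2) = 0 := by linear_combination e2 - t 2 * e0
    have h4 : 0 < 1 + t 0 * t 2 := by nlinarith
    have h5 : v.re = 0 := by
      rcases mul_eq_zero.1 h3 with h | h
      · exact h
      · linarith
    rw [h5] at e0
    refine ⟨⟨?_, ?_⟩, ?_⟩ <;> linarith
  · have h3 : v.re * (1 + t 0 + t 1 * (t 0 - 1)) = 0 := by
      linear_combination e1 - (1 + t 1) * e0
    have h4 : 0 < 1 + t 0 + t 1 * (t 0 - 1) := by nlinarith
    have h5 : v.re = 0 := by
      rcases mul_eq_zero.1 h3 with h | h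
      · exact h
      · linarith
    rw [h5] at e0
    refine ⟨⟨?_, ?_⟩, ?_⟩ <;> linarith
  · exfalso
    rcases hN with h | h | h <;> exact absurd h ‹_›

/-- Edges incident to `i` cannot be avoided here, in contrast to `GenericFamily.corner`. The polygon
with vertex `i` at 0 and the others on `Re = 1` at heights `1, 2, …` reduces the claim to
`corner_witness`. -/
theorem exists_cornerMatrix_det_ne_zero {n : ℕ} (hn : 2 ≤ n) (i : Fin n) (e : Fin 3 → Fin n)
    (he : ∃ k, e k ≠ i ∧ finRotate n (e k) ≠ i) :
    ∃ x : Fin n → ℂ, (cornerMatrix (fun k => sqCoeff k.succ) (fun k => edgeDir x (e k))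
      (fun k => crs (edgeDir x (e k)) (x i - x (e k)))).det ≠ 0 := by
  obtain ⟨m, rfl⟩ : ∃ m, n = m + 2 := ⟨n - 2, by omega⟩
  let t : Fin (m + 2) → ℝ := fun j => (j : ℕ) + 1
  have ht : ∀ j j', t j = t j' → j = j' := by
    intro j j' h
    simp only [t, add_left_inj, Nat.cast_inj] at h
    exact Fin.ext h
  have ht1 : ∀ j, 1 ≤ t j := fun j => by simp [t]
  let x : Fin (m + 2) → ℂ := fun j => if j = i then 0 else 1 + t j * I
  have hxi : x i = 0 := if_pos rfl
  have hx : ∀ j, j ≠ i → x j = 1 + t j * I := fun j hj => if_neg hj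
  have hne : ∀ j : Fin (m + 2), finRotate _ j ≠ j := fun j => by simp [finRotate_apply]
  refine ⟨x, cornerMatrix_det_ne_zero fun v T h => ?_⟩
  refine corner_witness (N := fun k => e k ≠ i ∧ finRotate _ (e k) ≠ i)
    (t := fun k => if e k = i then t (finRotate _ (e k)) else t (e k)) he
    (fun k => by split_ifs <;> exact ht1 _) fun k => ?_
  have hk := h k
  by_cases h1 : e k = i
  · refine Or.inr ⟨by simp [h1], ?_⟩
    have h2 : finRotate _ (e k) ≠ i := by rw [← h1]; exact hne _
    simp only [edgeDir, hx _ h2] at hk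
    simp only [h1, hxi, if_true] at hk ⊢
    simp [crs, -finRotate_apply] at hk
    simp only [mul_re, mul_im]
    linarith
  · by_cases h2 : finRotate _ (e k) = i
    · refine Or.inr ⟨by simp [h2], ?_⟩
      simp only [edgeDir, hx _ h1, h2, hxi] at hk
      simp only [h1, if_false]
      simp [crs, -finRotate_apply] at hk
      simp
      linarith
    · refine Or.inl ⟨⟨h1, h2⟩, ?_⟩
      simp only [edgeDir, hx _ h1, hx _ h2, hxi] at hk
      have h4 : t (finRotate _ (e k)) - t (e k) ≠ 0 := sub_ne_zero.2 fun h => hne _ (ht _ _ h)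
      apply mul_left_cancel₀ h4
      simp [crs, -finRotate_apply] at hk
      simp only [mul_re]
      linarith

/-- The vertex set of a square can be described starting from any of its corners. -/
theorem IsSquareVertexSet.exists_eq {S : Set ℂ} (hS : IsSquareVertexSet S) {b : ℂ} (hb : b ∈ S) :
    ∃ v, v ≠ 0 ∧ S = range (squareCorner b v) := by
  obtain ⟨a, v, hv, rfl⟩ := hS
  have rot : ∀ a v : ℂ, range (squareCorner a v) = range (squareCorner (a + v) (I * v)) := by
    intro a v
    have : squareCorner (a + v) (I * v) = squareCorner a v ∘ (fun k => k + 1) := by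
      funext k
      rw [Function.comp, squareCorner_apply, squareCorner_apply, corner_rotate]
    rw [this]
    exact ((Equiv.addRight (1 : Fin 4)).surjective.range_comp _).symm
  have hI : I * I = -1 := I_mul_I
  obtain ⟨k, rfl⟩ := hb
  fin_cases k
  · exact ⟨v, hv, by simp [squareCorner]⟩
  · refine ⟨I * v, mul_ne_zero I_ne_zero hv, ?_⟩
    rw [rot]; simp [squareCorner]
  · refine ⟨I * (I * v), by simpa using hv, ?_⟩
    rw [rot, rot]; simp [squareCorner]
  · refine ⟨I * (I * (I * v)), by simpa using hv, ?_⟩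
    rw [rot, rot, rot]
    congr 2
    simp only [squareCorner, Fin.reduceFinMk, Matrix.cons_val]
    linear_combination v * hI

theorem edgeLine_def {n : ℕ} (x : Fin n → ℂ) (j : Fin n) :
    (Polygon.mk x).edgeLine j = line[ℝ, x j, x (finRotate n j)] := rfl

theorem edgeSet_eq_segment {n : ℕ} (X : Polygon ℂ n) (j : Fin n) :
    X.edgeSet ℝ j = segment ℝ (X j) (X (finRotate n j)) :=
  affineSegment_eq_segment ℝ _ _

theorem crs_corner_eq_zero {n : ℕ} {x : Fin n → ℂ} {j : Fin n} {z : ℂ}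
    (hz : z ∈ (Polygon.mk x).edgeLine j) : crs (edgeDir x j) (z - x j) = 0 :=
  crs_eq_zero_of_mem_line hz

/-- The determinant conditions cover all choices of edges except those in which every line passes
through the given vertex, or in which all four lines coincide. These exceptions are excluded by
elementary geometry once the edges are nondegenerate. -/
theorem ae_isGeneric {n : ℕ} (hn : 3 ≤ n) :
    ∀ᵐ x ∂(volume : Measure (Fin n → ℂ)), (Polygon.mk x).IsGeneric := by
  have h1 : ∀ᵐ x ∂(volume : Measure (Fin n → ℂ)), ∀ e : Fin 4 → Fin n, (∃ k, e k ≠ e 0) →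
      (sqMatrix fun k => edgeDir x (e k)).det ≠ 0 := by
    refine ae_all_iff.2 fun e => ae_all_iff.2 fun he => ?_
    obtain ⟨x, hx⟩ := exists_det_ne_zero hn he
    exact LinePoly.ae_ne_zero _ (CLinePoly.sqMatrix_det fun k => cLinePoly_edgeDir _) hx
  have h2 : ∀ᵐ x ∂(volume : Measure (Fin n → ℂ)), ∀ (i : Fin n) (e : Fin 3 → Fin n),
      (∃ k, e k ≠ i ∧ finRotate n (e k) ≠ i) →
      (cornerMatrix (fun k => sqCoeff k.succ) (fun k => edgeDir x (e k))
      (fun k => crs (edgeDir x (e k)) (x i - x (e k)))).det ≠ 0 := by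
    refine ae_all_iff.2 fun i => ae_all_iff.2 fun e => ae_all_iff.2 fun he => ?_
    obtain ⟨x, hx⟩ := exists_cornerMatrix_det_ne_zero (by omega) i e he
    exact LinePoly.ae_ne_zero _ (CLinePoly.cornerMatrix_det (fun k => cLinePoly_edgeDir _)
      fun k => (cLinePoly_edgeDir _).crs ((CLinePoly.apply _).sub (CLinePoly.apply _))) hx
  have h3 : ∀ᵐ x ∂(volume : Measure (Fin n → ℂ)), ∀ j, edgeDir x j ≠ 0 := by
    refine ae_all_iff.2 fun j => ?_
    have hne : finRotate n j ≠ j := by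
      obtain ⟨m, rfl⟩ : ∃ m, n = m + 2 := ⟨n - 2, by omega⟩
      simp [finRotate_apply]
    have := LinePoly.ae_ne_zero (volume : Measure (Fin n → ℂ)) (cLinePoly_edgeDir j).1
      (x₀ := fun i => if i = j then 1 else 0) (by simp [edgeDir, hne, -finRotate_apply])
    filter_upwards [this] with x hx h
    exact hx (by rw [h]; rfl)
  filter_upwards [h1, h2, h3] with x g1 g2 g3
  constructor
  · intro S hS i hi
    obtain ⟨v, hv, rfl⟩ := IsSquareVertexSet.exists_eq hS.1 hi
    have hmem : ∀ k : Fin 3, ∃ j, squareCorner (x i) v k.succ ∈ (Polygon.mk x).edgeLine j := by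
      intro k
      obtain ⟨j, hj⟩ := mem_iUnion.1 (hS.2 ⟨k.succ, rfl⟩)
      rw [edgeSet_eq_segment] at hj
      exact ⟨j, mem_line_of_mem_segment hj⟩
    choose e he using hmem
    have he' : ∀ k, crs (edgeDir x (e k)) (sqCoeff k.succ * v) +
        crs (edgeDir x (e k)) (x i - x (e k)) = 0 := by
      intro k
      have := crs_corner_eq_zero (he k)
      rw [squareCorner_apply] at this
      rw [← crs_add, ← this]
      congr 1
      ring
    by_cases hinc : ∃ k, e k ≠ i ∧ finRotate n (e k) ≠ i
    · exact false_of_cornerMatrix_det (g2 i e hinc) he'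
    -- Only two edges contain vertex `i`, so two of the other three corners lie on the same line
    -- through `i`, which a nondegenerate square does not allow.
    · push Not at hinc
      have hz : ∀ k, crs (edgeDir x (e k)) (x i - x (e k)) = 0 := by
        intro k
        by_cases h : e k = i
        · simp [h, crs]
        · have := hinc k h
          rw [← this]
          exact crs_self _
      have h0 : ∀ k, crs (edgeDir x (e k)) (sqCoeff k.succ * v) = 0 := by
        intro k
        have := he' k
        rwa [hz k, add_zero] at this
      have hcases : ∀ k, e k = i ∨ e k = (finRotate n).symm i := by
        intro k
        by_cases h : e k = i
        · exact Or.inl h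
        · exact Or.inr ((finRotate n).eq_symm_apply.2 (hinc k h))
      have hdup : ∃ k l : Fin 3, k ≠ l ∧ e k = e l := by
        rcases hcases 0 with a0 | a0 <;> rcases hcases 1 with a1 | a1 <;>
          rcases hcases 2 with a2 | a2
        · exact ⟨0, 1, by decide, a0.trans a1.symm⟩
        · exact ⟨0, 1, by decide, a0.trans a1.symm⟩
        · exact ⟨0, 2, by decide, a0.trans a2.symm⟩
        · exact ⟨1, 2, by decide, a1.trans a2.symm⟩
        · exact ⟨1, 2, by decide, a1.trans a2.symm⟩
        · exact ⟨0, 2, by decide, a0.trans a2.symm⟩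
        · exact ⟨0, 1, by decide, a0.trans a1.symm⟩
        · exact ⟨0, 1, by decide, a0.trans a1.symm⟩
      obtain ⟨k, l, hkl, hekl⟩ := hdup
      have hl := h0 l
      rw [← hekl] at hl
      exact hv (eq_zero_of_crs (g3 _) (fun h => hkl (Fin.succ_injective _ h)) (Fin.succ_ne_zero k)
        (Fin.succ_ne_zero l) (h0 k) hl)
  · intro e a v a' v' hv hv' h h'
    have e1 : ∀ k, crs (edgeDir x (e k)) (a - a' + sqCoeff k * (v - v')) = 0 := by
      intro k
      have e1 := crs_corner_eq_zero (h k)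
      have e2 := crs_corner_eq_zero (h' k)
      rw [squareCorner_apply] at e1 e2
      have e3 := crs_sub (edgeDir x (e k)) (a + sqCoeff k * v - x (e k))
        (a' + sqCoeff k * v' - x (e k))
      rw [e1, e2, sub_zero] at e3
      rw [← e3]
      congr 1
      ring
    by_cases he : ∃ k, e k ≠ e 0
    · obtain ⟨h1, h2⟩ := eq_zero_of_sqMatrix_det (g1 e he) e1
      exact ⟨sub_eq_zero.1 h1, sub_eq_zero.1 h2⟩
    -- All four corners would lie on one line.
    · exfalso
      push Not at he
      have hc : ∀ k, crs (edgeDir x (e 0)) (sqCoeff k * v) = 0 := by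
        intro k
        have e1 := crs_corner_eq_zero (h k)
        have e2 := crs_corner_eq_zero (h 0)
        rw [squareCorner_apply] at e1 e2
        rw [he k] at e1
        have e3 := crs_sub (edgeDir x (e 0)) (a + sqCoeff k * v - x (e 0))
          (a + sqCoeff 0 * v - x (e 0))
        rw [e1, e2, sub_zero] at e3
        rw [← e3]
        congr 1
        simp
      exact hv (eq_zero_of_crs (g3 _) (by decide : (1 : Fin 4) ≠ 3) (by decide) (by decide)
        (hc 1) (hc 3))

end SquarePeg

end

section

open Set Complex ComplexConjugate Filter Topology

namespace SquarePeg

/-! ### Facets of a segment cut out by affine inequalities -/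

/-- If every constraint active at `α` had nonpositive slope, one could move slightly to the left:
active constraints do not decrease there, and the inactive ones stay positive by continuity. -/
theorem exists_zero_of_isLeast {ι : Type*} [Finite ι] {x u : ι → ℝ} {α : ℝ}
    (hα : IsLeast {s : ℝ | ∀ i, 0 ≤ x i + s * u i} α) : ∃ i, x i + α * u i = 0 ∧ 0 < u i := by
  by_contra! hcon
  have h1 : ∀ᶠ s in 𝓝[<] α, ∀ i, 0 ≤ x i + s * u i := by
    refine eventually_all.2 fun i => ?_
    rcases (hα.1 i).lt_or_eq with h | h
    · have : Tendsto (fun s => x i + s * u i) (𝓝[<] α) (𝓝 (x i + α * u i)) :=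
        (Continuous.tendsto (by fun_prop) α).mono_left nhdsWithin_le_nhds
      exact (this.eventually (lt_mem_nhds h)).mono fun _ h => h.le
    · have hu := hcon i h.symm
      filter_upwards [self_mem_nhdsWithin] with s hs
      have hs : s < α := hs
      nlinarith
  obtain ⟨s, hs, hs'⟩ := (h1.and self_mem_nhdsWithin).exists
  have hs' : s < α := hs'
  exact absurd (hα.2 hs) (not_le.2 hs')

/-- A bounded segment cut out by affine inequalities, no two of which become equalities at the
same point, is either empty or meets exactly two of its facets. -/
theorem even_card_facets {ι : Type*} [Fintype ι] {x u : ι → ℝ}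
    (hbdd : ∃ B : ℝ, ∀ s : ℝ, (∀ i, 0 ≤ x i + s * u i) → |s| ≤ B)
    (hone : ∀ s : ℝ, (∀ i, 0 ≤ x i + s * u i) → ∀ i j, x i + s * u i = 0 → x j + s * u j = 0 →
      i = j) :
    Even (Nat.card {i // ∃ s : ℝ, (∀ i, 0 ≤ x i + s * u i) ∧ x i + s * u i = 0}) := by
  classical
  set F : Set ℝ := {s : ℝ | ∀ i, 0 ≤ x i + s * u i} with hF
  by_cases hne : F.Nonempty
  swap
  · have : IsEmpty {i // ∃ s : ℝ, (∀ i, 0 ≤ x i + s * u i) ∧ x i + s * u i = 0} :=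
      ⟨fun ⟨i, s, hs, _⟩ => hne ⟨s, hs⟩⟩
    simp
  obtain ⟨B, hB⟩ := hbdd
  have hclosed : IsClosed F := by
    have : F = ⋂ i, {s : ℝ | 0 ≤ x i + s * u i} := by ext; simp [hF]
    rw [this]
    exact isClosed_iInter fun i => isClosed_le continuous_const (by fun_prop)
  have hcomp : IsCompact F := Metric.isCompact_of_isClosed_isBounded hclosed
    (isBounded_iff_forall_norm_le.2 ⟨B, fun s hs => hB s hs⟩)
  obtain ⟨α, hα⟩ := hcomp.exists_isLeast hne
  obtain ⟨β, hβ⟩ := hcomp.exists_isGreatest hne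
  obtain ⟨i, hi, hui⟩ := exists_zero_of_isLeast hα
  -- The right end is the left end after reversing the parameter, so its facet `j` has negative
  -- slope and differs from `i`.
  have hβ' : IsLeast {s : ℝ | ∀ i, 0 ≤ x i + s * (-u) i} (-β) := by
    refine ⟨fun i => by simpa using hβ.1 i, fun s hs => ?_⟩
    have : -s ∈ F := fun i => by simpa using hs i
    have := hβ.2 this
    linarith
  obtain ⟨j, hj, huj⟩ := exists_zero_of_isLeast hβ'
  simp only [Pi.neg_apply, neg_mul_neg, Left.neg_pos_iff] at hj huj
  have hij : i ≠ j := by rintro rfl; linarith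
  have key : {i // ∃ s : ℝ, (∀ i, 0 ≤ x i + s * u i) ∧ x i + s * u i = 0} =
      {k // k ∈ ({i, j} : Finset ι)} := by
    congr 1
    funext k
    simp only [Finset.mem_insert, Finset.mem_singleton, eq_iff_iff]
    constructor
    · rintro ⟨s, hs, hk⟩
      have hsα : α ≤ s := hα.2 hs
      have hsβ : s ≤ β := hβ.2 hs
      have h1 := hα.1 k
      have h2 := hβ.1 k
      -- A constraint with negative slope can vanish only at `β`, one with positive slope only at
      -- `α`, and one with slope zero would vanish at `α` as well. Uniqueness of the active facet
      -- then identifies `k`.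
      rcases lt_trichotomy (u k) 0 with h | h | h
      · right
        exact hone β hβ.1 _ _ (by nlinarith) hj
      · left
        rw [h] at hk
        exact hone α hα.1 _ _ (by rw [h]; linarith) hi
      · left
        exact hone α hα.1 _ _ (by nlinarith) hi
    · rintro (rfl | rfl)
      · exact ⟨α, hα.1, hi⟩
      · exact ⟨β, hβ.1, hj⟩
  rw [key, Nat.card_eq_fintype_card, Fintype.card_coe, Finset.card_pair hij]
  exact even_two

/-! ### Squares with one corner in a triangle and the others on segments -/

/-- The closed triangle with vertices `x`, `y`, `w`. -/
def tri (x y w : ℂ) : Set ℂ :=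
  {b | ∃ s t : ℝ, 0 ≤ s ∧ 0 ≤ t ∧ s + t ≤ 1 ∧ b = x + s • (y - x) + t • (w - x)}

theorem mem_segment_iff {x y b : ℂ} :
    b ∈ segment ℝ x y ↔ ∃ t : ℝ, 0 ≤ t ∧ t ≤ 1 ∧ b = x + t • (y - x) := by
  rw [segment_eq_image']
  constructor
  · rintro ⟨t, ⟨h0, h1⟩, rfl⟩; exact ⟨t, h0, h1, rfl⟩
  · rintro ⟨t, h0, h1, rfl⟩; exact ⟨t, ⟨h0, h1⟩, rfl⟩

/-- There is a square, possibly degenerate, whose corners lie in the sets `S k`. -/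
def Fits (S : Fin 4 → Set ℂ) : Prop := ∃ a v : ℂ, ∀ k, a + sqCoeff k * v ∈ S k

/-- The labels of the vertices of a triangle and of the endpoints of three segments. -/
abbrev Lab := Fin 3 ⊕ Fin 3 × Bool

/-- The triangle or the segments of a labelled configuration. -/
def cell (c : Lab → ℂ) : Fin 4 → Set ℂ :=
  Fin.cons (tri (c (.inl 0)) (c (.inl 1)) (c (.inl 2)))
    fun k => segment ℝ (c (.inr (k, false))) (c (.inr (k, true)))

/-- The side of the triangle opposite to a vertex, or the triangle together with one endpoint of
one of the segments. -/
noncomputable def facet (c : Lab → ℂ) : Lab → Fin 4 → Set ℂ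
  | .inl i => Function.update (cell c) 0 (segment ℝ (c (.inl (i + 1))) (c (.inl (i + 2))))
  | .inr (k, b) => Function.update (cell c) k.succ {c (.inr (k, b))}

/-- The linear part of the affine function on `ℝ⁵` whose zero is the facet. -/
def facetForm : Lab → (Fin 5 → ℝ) → ℝ
  | .inl i, y => ![-y 0 - y 1, y 0, y 1] i
  | .inr (k, b), y => if b then -![y 2, y 3, y 4] k else ![y 2, y 3, y 4] k

/-- The constant part of the affine function on `ℝ⁵` whose zero is the facet. -/
def facetConst : Lab → ℝ
  | .inl i => ![1, 0, 0] i
  | .inr (_, b) => if b then 1 else 0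

theorem facetForm_add_smul (φ : Lab) (y u : Fin 5 → ℝ) (s : ℝ) :
    facetForm φ (y + s • u) = facetForm φ y + s * facetForm φ u := by
  rcases φ with i | ⟨k, b⟩
  · fin_cases i <;> simp [facetForm]; ring
  · fin_cases k <;> rcases b <;> simp [facetForm] <;> ring

/-- The point of the triangle with given coordinates. -/
noncomputable def triPoint (c : Lab → ℂ) (y : Fin 5 → ℝ) : ℂ :=
  c (.inl 0) + y 0 • (c (.inl 1) - c (.inl 0)) + y 1 • (c (.inl 2) - c (.inl 0))

/-- The point of the `k`-th segment with given coordinates. -/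
noncomputable def segPoint (c : Lab → ℂ) (y : Fin 5 → ℝ) (k : Fin 3) : ℂ :=
  c (.inr (k, false)) + ![y 2, y 3, y 4] k • (c (.inr (k, true)) - c (.inr (k, false)))

/-- The point of the triangle and the points of the segments form a square. -/
def Sol (c : Lab → ℂ) (y : Fin 5 → ℝ) : Prop :=
  ∀ k : Fin 3, triPoint c y + sqCoeff k.succ * (segPoint c y 0 - triPoint c y) = segPoint c y k

/-- Passage to coordinates: two for the point of the triangle and one for each segment. The triangle
and the segments become a polytope in `ℝ⁵` with nine facets, and `Sol` is an affine subspace meeting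
it. -/
theorem fits_facet_iff (c : Lab → ℂ) (φ : Lab) :
    Fits (facet c φ) ↔ ∃ y, Sol c y ∧ (∀ ψ, 0 ≤ facetConst ψ + facetForm ψ y) ∧
      facetConst φ + facetForm φ y = 0 := by
  constructor
  · rintro ⟨a, v, h⟩
    have h0 : ∃ s t : ℝ, 0 ≤ s ∧ 0 ≤ t ∧ s + t ≤ 1 ∧
        a = c (.inl 0) + s • (c (.inl 1) - c (.inl 0)) + t • (c (.inl 2) - c (.inl 0)) ∧
        (φ = .inl 0 → s + t = 1) ∧ (φ = .inl 1 → s = 0) ∧ (φ = .inl 2 → t = 0) := by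
      have h0 := h 0
      simp only [sqCoeff_zero, zero_mul, add_zero] at h0
      rcases φ with i | ⟨k, b⟩
      · simp only [facet, Function.update_self] at h0
        obtain ⟨t, t0, t1, rfl⟩ := mem_segment_iff.1 h0
        fin_cases i
        · refine ⟨1 - t, t, by linarith, t0, by linarith, ?_, by simp, by simp, by simp⟩
          simp; ring
        · refine ⟨0, 1 - t, le_rfl, by linarith, by linarith, ?_, by simp, by simp, by simp⟩
          simp; ring
        · refine ⟨t, 0, t0, le_rfl, by linarith, ?_, by simp, by simp, by simp⟩
          simp
      · rw [facet, Function.update_of_ne (Fin.succ_ne_zero k).symm] at h0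
        obtain ⟨s, t, s0, t0, st, e⟩ := h0
        exact ⟨s, t, s0, t0, st, e, by simp, by simp, by simp⟩
    have hk : ∀ k : Fin 3, ∃ m : ℝ, 0 ≤ m ∧ m ≤ 1 ∧ a + sqCoeff k.succ * v =
        c (.inr (k, false)) + m • (c (.inr (k, true)) - c (.inr (k, false))) ∧
        (φ = .inr (k, false) → m = 0) ∧ (φ = .inr (k, true) → m = 1) := by
      intro k
      have hk := h k.succ
      rcases φ with i | ⟨l, b⟩
      · rw [facet, Function.update_of_ne (Fin.succ_ne_zero k)] at hk
        obtain ⟨t, t0, t1, e⟩ := mem_segment_iff.1 hk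
        exact ⟨t, t0, t1, e, by simp, by simp⟩
      · by_cases hkl : k = l
        · subst hkl
          simp only [facet, Function.update_self, mem_singleton_iff] at hk
          rcases b
          · exact ⟨0, le_rfl, zero_le_one, by simp [hk], by simp, by simp⟩
          · exact ⟨1, zero_le_one, le_rfl, by simp [hk], by simp, by simp⟩
        · rw [facet, Function.update_of_ne (fun h => hkl (Fin.succ_injective _ h))] at hk
          obtain ⟨t, t0, t1, e⟩ := mem_segment_iff.1 hk
          exact ⟨t, t0, t1, e, by simp [Ne.symm hkl], by simp [Ne.symm hkl]⟩
    obtain ⟨s, t, s0, t0, st, ea, f0, f1, f2⟩ := h0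
    choose m m0 m1 em g0 g1 using hk
    have hm : ![m 0, m 1, m 2] = m := by funext k; fin_cases k <;> rfl
    have hA : triPoint c ![s, t, m 0, m 1, m 2] = a := by simp [triPoint, ea]
    have hP : ∀ k, segPoint c ![s, t, m 0, m 1, m 2] k = a + sqCoeff k.succ * v := by
      intro k
      rw [em k, segPoint]
      congr 2
      exact congrFun hm k
    refine ⟨![s, t, m 0, m 1, m 2], ?_, ?_, ?_⟩
    · intro k
      rw [hA, hP, hP]
      simp
    · rintro (i | ⟨k, b⟩)
      · fin_cases i <;> simp [facetConst, facetForm, s0, t0]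
        linarith
      · have e : facetForm (.inr (k, b)) ![s, t, m 0, m 1, m 2] = if b then -m k else m k := by
          simp only [facetForm]
          congr 1
          · congr 1; exact congrFun hm k
          · exact congrFun hm k
        rw [e]
        rcases b <;> simp [facetConst, m0, m1]
    · rcases φ with i | ⟨k, b⟩
      · fin_cases i
        · have := f0 rfl
          simp [facetConst, facetForm]; linarith
        · have := f1 rfl
          simp [facetConst, facetForm, this]
        · have := f2 rfl
          simp [facetConst, facetForm, this]
      · have e : facetForm (.inr (k, b)) ![s, t, m 0, m 1, m 2] = if b then -m k else m k := by
          simp only [facetForm]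
          congr 1
          · congr 1; exact congrFun hm k
          · exact congrFun hm k
        rw [e]
        rcases b
        · simp [facetConst, g0 k rfl]
        · simp [facetConst, g1 k rfl]
  · rintro ⟨y, hy, hpos, h0⟩
    refine ⟨triPoint c y, segPoint c y 0 - triPoint c y, fun k => ?_⟩
    have p0 := hpos (.inl 0)
    have p1 := hpos (.inl 1)
    have p2 := hpos (.inl 2)
    simp [facetConst, facetForm] at p0 p1 p2
    refine Fin.cases ?_ (fun k => ?_) k
    · rw [sqCoeff_zero, zero_mul, add_zero]
      rcases φ with i | ⟨k, b⟩
      · simp only [facet, Function.update_self]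
        fin_cases i <;> simp [facetConst, facetForm] at h0 ⊢
        · refine mem_segment_iff.2 ⟨y 1, p2, by linarith, ?_⟩
          have : y 0 = 1 - y 1 := by linarith
          simp [triPoint, this]; ring
        · refine mem_segment_iff.2 ⟨1 - y 1, by linarith, by linarith, ?_⟩
          simp [triPoint, h0]; ring
        · refine mem_segment_iff.2 ⟨y 0, p1, by linarith, ?_⟩
          simp [triPoint, h0]
      · rw [facet, Function.update_of_ne (Fin.succ_ne_zero k).symm]
        exact ⟨y 0, y 1, p1, p2, by linarith, rfl⟩
    · rw [hy k]
      have q0 := hpos (.inr (k, false))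
      have q1 := hpos (.inr (k, true))
      simp [facetConst, facetForm] at q0 q1
      have hseg : segPoint c y k ∈ cell c k.succ :=
        mem_segment_iff.2 ⟨![y 2, y 3, y 4] k, q0, by linarith, rfl⟩
      rcases φ with i | ⟨l, b⟩
      · rw [facet, Function.update_of_ne (Fin.succ_ne_zero k)]
        exact hseg
      · by_cases hkl : k = l
        · subst hkl
          rw [facet, Function.update_self, mem_singleton_iff, segPoint]
          rcases b <;> simp [facetConst, facetForm] at h0
          · rw [h0]; simp
          · rw [show ![y 2, y 3, y 4] k = 1 by linarith]; simp
        · rw [facet, Function.update_of_ne (fun h => hkl (Fin.succ_injective _ h))]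
          exact hseg

end SquarePeg

end

/-! ### The solutions of a generic configuration form a line that meets the facets one at a time. -/

section

open Set Complex ComplexConjugate Filter Topology

namespace SquarePeg

theorem ne_zero_of_sqMatrix_det {d : Fin 4 → ℂ} (hd : (sqMatrix d).det ≠ 0) (k : Fin 4) :
    d k ≠ 0 := by
  intro h
  apply hd
  refine Matrix.det_eq_zero_of_row_eq_zero k fun j => ?_
  fin_cases j <;> simp [sqMatrix, h]

/-- The linear part of the equations `Sol`. -/
noncomputable def solMap (c : Lab → ℂ) : (Fin 5 → ℝ) →ₗ[ℝ] ℂ × ℂ where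
  toFun y :=
    let A := y 0 • (c (.inl 1) - c (.inl 0)) + y 1 • (c (.inl 2) - c (.inl 0))
    let P := y 2 • (c (.inr (0, true)) - c (.inr (0, false)))
    let Q := y 3 • (c (.inr (1, true)) - c (.inr (1, false)))
    let R := y 4 • (c (.inr (2, true)) - c (.inr (2, false)))
    (A + (1 + I) * (P - A) - Q, A + I * (P - A) - R)
  map_add' y y' := by
    simp only [Pi.add_apply, real_smul, ofReal_add, Prod.mk_add_mk]
    congr 1 <;> ring
  map_smul' t y := by
    simp only [Pi.smul_apply, real_smul, smul_eq_mul, ofReal_mul, RingHom.id_apply, Prod.smul_mk]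
    congr 1 <;> ring

theorem sol_iff_of_sol {c : Lab → ℂ} {y y' : Fin 5 → ℝ} (hy : Sol c y) :
    Sol c y' ↔ solMap c (y' - y) = 0 := by
  have h1 := hy 1
  have h2 := hy 2
  simp only [triPoint, segPoint, real_smul, show Fin.succ (1 : Fin 3) = (2 : Fin 4) from rfl,
    show Fin.succ (2 : Fin 3) = (3 : Fin 4) from rfl, sqCoeff_two, sqCoeff_three, Fin.isValue,
    Matrix.cons_val_zero, Matrix.cons_val_one, Matrix.cons_val] at h1 h2
  have key : solMap c (y' - y) = 0 ↔ (triPoint c y' + (1 + I) * (segPoint c y' 0 - triPoint c y') =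
      segPoint c y' 1 ∧ triPoint c y' + I * (segPoint c y' 0 - triPoint c y') =
      segPoint c y' 2) := by
    simp only [solMap, LinearMap.coe_mk, AddHom.coe_mk, Prod.mk_eq_zero, Pi.sub_apply, real_smul,
      triPoint, segPoint, Matrix.cons_val_zero, Matrix.cons_val_one, Matrix.cons_val, ofReal_sub]
    constructor
    · rintro ⟨e1, e2⟩
      exact ⟨by linear_combination e1 + h1, by linear_combination e2 + h2⟩
    · rintro ⟨e1, e2⟩
      exact ⟨by linear_combination e1 - h1, by linear_combination e2 - h2⟩
  rw [key]
  constructor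
  · intro h
    exact ⟨h 1, h 2⟩
  · rintro ⟨e1, e2⟩ k
    -- The equation for `k = 0` is an identity, since corner 1 is used to define the side `v`; only
    -- two complex equations remain.
    fin_cases k
    · simp [sqCoeff]
    · exact e1
    · exact e2

theorem crs_segPoint (c : Lab → ℂ) (y : Fin 5 → ℝ) (k : Fin 3) :
    crs (c (.inr (k, true)) - c (.inr (k, false))) (segPoint c y k - c (.inr (k, false))) = 0 := by
  rw [segPoint, add_sub_cancel_left, crs_smul, crs_self, mul_zero]

/-- The line spanned by the side of the triangle belonging to a vanishing facet function. -/
theorem crs_triPoint {c : Lab → ℂ} {y : Fin 5 → ℝ} {i : Fin 3}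
    (h : facetConst (.inl i) + facetForm (.inl i) y = 0) :
    crs (c (.inl (i + 2)) - c (.inl (i + 1))) (triPoint c y - c (.inl (i + 1))) = 0 := by
  fin_cases i
  · simp [facetConst, facetForm] at h
    have : y 0 = 1 - y 1 := by linarith
    have e : triPoint c y - c (.inl 1) = y 1 • (c (.inl 2) - c (.inl 1)) := by
      simp [triPoint, this]; ring
    simp [e, crs_smul, crs_self, -real_smul]
  · simp [facetConst, facetForm] at h
    have e : triPoint c y - c (.inl 2) = (1 - y 1) • (c (.inl 0) - c (.inl 2)) := by
      simp [triPoint, h]; ring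
    simp [e, crs_smul, crs_self, -real_smul]
  · simp [facetConst, facetForm] at h
    have e : triPoint c y - c (.inl 0) = y 0 • (c (.inl 1) - c (.inl 0)) := by
      simp [triPoint, h]
    simp [e, crs_smul, crs_self, -real_smul]

theorem triPoint_eq_vertex {c : Lab → ℂ} {y : Fin 5 → ℝ} {i j : Fin 3} (hij : i ≠ j)
    (hi : facetConst (.inl i) + facetForm (.inl i) y = 0)
    (hj : facetConst (.inl j) + facetForm (.inl j) y = 0) : ∃ m, triPoint c y = c (.inl m) := by
  have e : ∀ {y0 y1 : ℝ}, y 0 = y0 → y 1 = y1 → triPoint c y =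
      c (.inl 0) + y0 • (c (.inl 1) - c (.inl 0)) + y1 • (c (.inl 2) - c (.inl 0)) := by
    rintro _ _ rfl rfl; rfl
  fin_cases i <;> fin_cases j <;> simp [facetConst, facetForm] at hij hi hj
  · exact ⟨2, by rw [e hj (by linarith : y 1 = 1)]; simp⟩
  · exact ⟨1, by rw [e (by linarith : y 0 = 1) hj]; simp⟩
  · exact ⟨2, by rw [e hi (by linarith : y 1 = 1)]; simp⟩
  · exact ⟨0, by rw [e hi hj]; simp⟩
  · exact ⟨1, by rw [e (by linarith : y 0 = 1) hi]; simp⟩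
  · exact ⟨0, by rw [e hj hi]; simp⟩

theorem segPoint_eq_endpoint {c : Lab → ℂ} {y : Fin 5 → ℝ} {k : Fin 3} {b : Bool}
    (h : facetConst (.inr (k, b)) + facetForm (.inr (k, b)) y = 0) :
    segPoint c y k = c (.inr (k, b)) := by
  rw [segPoint]
  rcases b <;> simp [facetConst, facetForm] at h
  · rw [h]; simp
  · rw [show ![y 2, y 3, y 4] k = 1 by linarith]; simp

variable {κ : Type*} {z : κ → ℂ} {f : Lab → κ}

/-- Lying on two facets is one incidence too many. Two sides, or a side and an endpoint, put one
corner at a point of the family and the other three on lines (`corner`); endpoints of different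
segments fix two corners and put a third on a line (`two`); the two ends of one segment have
different parameters. -/
theorem GenericFamily.facet_unique (hz : GenericFamily z) (hf : Function.Injective f)
    {y : Fin 5 → ℝ} (hy : Sol (z ∘ f) y) {φ ψ : Lab}
    (hφ : facetConst φ + facetForm φ y = 0) (hψ : facetConst ψ + facetForm ψ y = 0) : φ = ψ := by
  set c := z ∘ f with hc
  set a := triPoint c y with ha
  set v := segPoint c y 0 - triPoint c y with hv
  have hk : ∀ k : Fin 3, a + sqCoeff k.succ * v = segPoint c y k := hy
  have hline := crs_segPoint c y
  by_contra hne
  have mixed : ∀ (i : Fin 3) (k : Fin 3) (b : Bool),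
      facetConst (.inl i) + facetForm (.inl i) y = 0 →
      facetConst (.inr (k, b)) + facetForm (.inr (k, b)) y = 0 → False := by
    intro i k b hi hkb
    refine hz.corner k.succ (f (.inr (k, b)))
      (Fin.cons (f (.inl (i + 1))) fun l => f (.inr (l, false)))
      (Fin.cons (f (.inl (i + 2))) fun l => f (.inr (l, true))) ?_ a v
      ((hk k).trans (segPoint_eq_endpoint hkb)) ?_
    · intro l
      refine Fin.cases (fun _ => ?_) (fun l hl => ?_) l
      · refine ⟨hf.ne (by simp), hf.ne (by simp), hf.ne ?_⟩
        simp
      · have : k ≠ l := fun h => hl (by rw [h])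
        exact ⟨hf.ne (by simp [this]), hf.ne (by simp [this]), hf.ne (by simp)⟩
    · intro l
      refine Fin.cases (fun _ => ?_) (fun l hl => ?_) l
      · simp only [sqCoeff_zero, zero_mul, add_zero, Fin.cons_zero]
        exact crs_triPoint (c := c) hi
      · simp only [Fin.cons_succ, hk]
        exact hline l
  rcases φ with i | ⟨k, b⟩ <;> rcases ψ with j | ⟨l, b'⟩
  · obtain ⟨m, hm⟩ := triPoint_eq_vertex (c := c) (fun h => hne (by rw [h])) hφ hψ
    -- The entries of `p` and `q` at index 0 are dummies, since `corner` ignores the distinguished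
    -- index.
    refine hz.corner 0 (f (.inl m)) (Fin.cons (f (.inl 0)) fun l => f (.inr (l, false)))
      (Fin.cons (f (.inl 0)) fun l => f (.inr (l, true))) ?_ a v
      (by rw [sqCoeff_zero, zero_mul, add_zero]; exact hm) ?_
    · intro l
      refine Fin.cases (fun h => absurd rfl h) (fun l hl => ?_) l
      exact ⟨hf.ne (by simp), hf.ne (by simp), hf.ne (by simp)⟩
    · intro l
      refine Fin.cases (fun h => absurd rfl h) (fun l hl => ?_) l
      simp only [Fin.cons_succ, hk]
      exact hline l
  · exact mixed _ _ _ hφ hψ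
  · exact mixed _ _ _ hψ hφ
  · by_cases hkl : k = l
    · subst hkl
      have hbb : b ≠ b' := fun h => hne (by rw [h])
      rcases b <;> rcases b' <;> simp [facetConst, facetForm] at hbb hφ hψ
      · rw [hφ] at hψ; norm_num at hψ
      · rw [hψ] at hφ; norm_num at hφ
    · obtain ⟨m, hmk, hml⟩ : ∃ m : Fin 3, m ≠ k ∧ m ≠ l := by
        have : ∀ k l : Fin 3, ∃ m : Fin 3, m ≠ k ∧ m ≠ l := by decide
        exact this k l
      refine hz.two k.succ l.succ m.succ (f (.inr (k, b))) (f (.inr (l, b')))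
        (f (.inr (m, false))) (f (.inr (m, true))) (fun h => hkl (Fin.succ_injective _ h))
        (fun h => hmk (Fin.succ_injective _ h).symm) (fun h => hml (Fin.succ_injective _ h).symm)
        (hf.ne (by simp [hmk.symm])) (hf.ne (by simp [hmk.symm])) (hf.ne (by simp [hml.symm]))
        (hf.ne (by simp [hml.symm])) (hf.ne (by simp)) a v
        ((hk k).trans (segPoint_eq_endpoint hφ)) ((hk l).trans (segPoint_eq_endpoint hψ)) ?_
      rw [hk]
      exact hline m

/-- With the second triangle coordinate frozen, the first corner moves parallel to one side, so the
four corners move along four independent directions and the four-line determinant applies. Hence a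
kernel vector is determined by its coordinate `u 1`. -/
theorem GenericFamily.eq_zero_of_solMap (hz : GenericFamily z) (hf : Function.Injective f)
    {u : Fin 5 → ℝ} (hu : solMap (z ∘ f) u = 0) (hu1 : u 1 = 0) : u = 0 := by
  have hd := hz.det (Fin.cons (f (.inl 0)) fun l => f (.inr (l, false)))
    (Fin.cons (f (.inl 1)) fun l => f (.inr (l, true)))
    (fun k l => by
      refine Fin.cases ?_ (fun k => ?_) k <;> refine Fin.cases ?_ (fun l => ?_) l <;>
        exact hf.ne (by simp))
    (by
      intro k l
      refine Fin.cases ?_ (fun k => ?_) k <;> refine Fin.cases ?_ (fun l => ?_) l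
      · simp
      · intro h; exact absurd (hf h) (by simp)
      · intro h; exact absurd (hf h) (by simp)
      · intro h
        have := hf h
        simp only [Sum.inr.injEq, Prod.mk.injEq, and_true] at this
        exact congrArg Fin.succ (Fin.ext (Fin.mk.inj this)))
  simp only [solMap, LinearMap.coe_mk, AddHom.coe_mk, Prod.mk_eq_zero, hu1, zero_smul, add_zero,
    Function.comp_apply] at hu
  obtain ⟨e1, e2⟩ := hu
  set A := u 0 • (z (f (.inl 1)) - z (f (.inl 0))) with hA
  set P := u 2 • (z (f (.inr (0, true))) - z (f (.inr (0, false)))) with hP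
  obtain ⟨h1, h2⟩ := eq_zero_of_sqMatrix_det hd (a := A) (v := P - A) (fun k => by
    fin_cases k
    · simp [hA, crs_smul, crs_self, -real_smul]
    · have : A + sqCoeff 1 * (P - A) = P := by simp
      simp only [Fin.mk_one, this]
      simp only [hP, crs_smul]
      exact mul_eq_zero_of_right _ (crs_self _)
    · have : A + sqCoeff 2 * (P - A) =
          u 3 • (z (f (.inr (1, true))) - z (f (.inr (1, false)))) := by
        rw [sqCoeff_two]; linear_combination e1
      simp only [Fin.reduceFinMk, this, crs_smul]
      exact mul_eq_zero_of_right _ (crs_self _)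
    · have : A + sqCoeff 3 * (P - A) =
          u 4 • (z (f (.inr (2, true))) - z (f (.inr (2, false)))) := by
        rw [sqCoeff_three]; linear_combination e2
      simp only [Fin.reduceFinMk, this, crs_smul]
      exact mul_eq_zero_of_right _ (crs_self _))
  have h3 : P = 0 := by rw [h1, sub_zero] at h2; exact h2
  rw [h1, h3] at e1 e2
  simp only [sub_zero, mul_zero, add_zero, zero_sub, neg_eq_zero] at e1 e2
  have d0 := ne_zero_of_sqMatrix_det hd 0
  have d1 := ne_zero_of_sqMatrix_det hd 1
  have d2 := ne_zero_of_sqMatrix_det hd 2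
  have d3 := ne_zero_of_sqMatrix_det hd 3
  funext k
  fin_cases k
  · exact (smul_eq_zero.1 h1).resolve_right d0
  · exact hu1
  · exact (smul_eq_zero.1 h3).resolve_right d1
  · exact (smul_eq_zero.1 e1).resolve_right d2
  · exact (smul_eq_zero.1 e2).resolve_right d3

/-- In a generic labelled configuration, squares fit into an even number of facets. -/
theorem GenericFamily.even_card_facet (hz : GenericFamily z) (hf : Function.Injective f) :
    Even (Nat.card {φ // Fits (facet (z ∘ f) φ)}) := by
  set c := z ∘ f with hc
  by_cases hex : ∃ y, Sol c y
  swap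
  · have : IsEmpty {φ // Fits (facet c φ)} := by
      refine ⟨fun ⟨φ, h⟩ => hex ?_⟩
      obtain ⟨y, hy, -⟩ := (fits_facet_iff c φ).1 h
      exact ⟨y, hy⟩
    simp
  obtain ⟨y, hy⟩ := hex
  -- Five unknowns against four real equations.
  obtain ⟨u, hu, hu0⟩ : ∃ u, solMap c u = 0 ∧ u ≠ 0 := by
    have : LinearMap.ker (solMap c) ≠ ⊥ := LinearMap.ker_ne_bot_of_finrank_lt (by simp)
    obtain ⟨u, hu, hu0⟩ := Submodule.exists_mem_ne_zero_of_ne_bot this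
    exact ⟨u, hu, hu0⟩
  have hu1 : u 1 ≠ 0 := fun h => hu0 (hz.eq_zero_of_solMap hf hu h)
  have hsol : ∀ s : ℝ, Sol c (y + s • u) := fun s => by
    rw [sol_iff_of_sol hy]; simp [hu]
  have hall : ∀ y', Sol c y' → ∃ s : ℝ, y' = y + s • u := by
    intro y' hy'
    refine ⟨(y' - y) 1 / u 1, ?_⟩
    have h1 := (sol_iff_of_sol hy).1 hy'
    have := hz.eq_zero_of_solMap hf (u := y' - y - ((y' - y) 1 / u 1) • u)
      (by rw [map_sub, map_smul, hu, smul_zero, sub_zero]; exact h1)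
      (by simp [hu1])
    rw [sub_eq_zero] at this
    rw [← this]; abel
  have e := even_card_facets (x := fun φ => facetConst φ + facetForm φ y)
    (u := fun φ => facetForm φ u) ?_ ?_
  · convert e using 2
    congr 1
    funext φ
    rw [fits_facet_iff, eq_iff_iff]
    constructor
    · rintro ⟨y', hy', hp, h0⟩
      obtain ⟨s, rfl⟩ := hall y' hy'
      simp only [facetForm_add_smul, ← add_assoc] at hp h0
      exact ⟨s, hp, h0⟩
    · rintro ⟨s, hp, h0⟩
      refine ⟨y + s • u, hsol s, ?_, ?_⟩
      · simpa only [facetForm_add_smul, ← add_assoc] using hp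
      · simpa only [facetForm_add_smul, ← add_assoc] using h0
  -- Inside the triangle the coordinate `y 1 + s * u 1` stays between 0 and 1, and `u 1 ≠ 0`, which
  -- bounds `s`.
  · refine ⟨(1 + |y 1|) / |u 1|, fun s hs => ?_⟩
    have hpos : 0 < |u 1| := abs_pos.2 hu1
    rw [le_div_iff₀ hpos, ← abs_mul]
    have p0 := hs (.inl 0)
    have p1 := hs (.inl 1)
    have p2 := hs (.inl 2)
    simp [facetConst, facetForm] at p0 p1 p2
    have : |y 1 + s * u 1| ≤ 1 := abs_le.2 ⟨by linarith, by linarith⟩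
    calc |s * u 1| = |(y 1 + s * u 1) - y 1| := by ring_nf
      _ ≤ |y 1 + s * u 1| + |y 1| := abs_sub _ _
      _ ≤ _ := by linarith
  · intro s hs φ ψ h1 h2
    refine hz.facet_unique hf (hsol s) ?_ ?_
    · simpa only [facetForm_add_smul, ← add_assoc] using h1
    · simpa only [facetForm_add_smul, ← add_assoc] using h2

end SquarePeg

end

section

open Set Complex ComplexConjugate Filter Topology

namespace SquarePeg

/-! ### Large squares near a closed polygonal chain -/

/-- There is a square of side length at least `r` whose corners lie in the sets `S k`. -/
def FitsBig (r : ℝ) (S : Fin 4 → Set ℂ) : Prop :=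
  ∃ a v : ℂ, r ≤ ‖v‖ ∧ ∀ k, a + sqCoeff k * v ∈ S k

theorem FitsBig.mono {r : ℝ} {S S' : Fin 4 → Set ℂ} (h : FitsBig r S) (hS : ∀ k, S k ⊆ S' k) :
    FitsBig r S' := by
  obtain ⟨a, v, hv, h⟩ := h
  exact ⟨a, v, hv, fun k => hS k (h k)⟩

theorem one_le_norm_sqCoeff_sub {k l : Fin 4} (h : k ≠ l) : 1 ≤ ‖sqCoeff k - sqCoeff l‖ := by
  have : 1 ≤ normSq (sqCoeff k - sqCoeff l) := by
    fin_cases k <;> fin_cases l <;> simp [sqCoeff, normSq_apply] at h ⊢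
  rw [normSq_eq_norm_sq] at this
  nlinarith [norm_nonneg (sqCoeff k - sqCoeff l)]

theorem norm_le_norm_corner_sub (a v : ℂ) {k l : Fin 4} (h : k ≠ l) :
    ‖v‖ ≤ ‖(a + sqCoeff k * v) - (a + sqCoeff l * v)‖ := by
  have : (a + sqCoeff k * v) - (a + sqCoeff l * v) = (sqCoeff k - sqCoeff l) * v := by ring
  rw [this, norm_mul]
  nlinarith [one_le_norm_sqCoeff_sub h, norm_nonneg v]

theorem fitsBig_rotate {r : ℝ} {S : Fin 4 → Set ℂ} (h : FitsBig r S) :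
    FitsBig r (fun k => S (k + 1)) := by
  obtain ⟨a, v, hv, h⟩ := h
  refine ⟨a + v, I * v, by simpa using hv, fun k => ?_⟩
  rw [corner_rotate]
  exact h _

variable {ι : Type*} (σ : Equiv.Perm ι)

/-- The `i`-th piece of the polygonal chain with vertices `W` and successor function `σ`. -/
def piece (W : ι → ℂ) (i : ι) : Set ℂ := segment ℝ (W i) (W (σ i))

/-- The points at distance at most `η` from a piece. -/
def nearPiece (V : ι → ℂ) (η : ℝ) (i : ι) : Set ℂ := {P | ∃ y ∈ piece σ V i, ‖P - y‖ ≤ η}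

/-- The chain `V` has short pieces, and squares with corners close to `V` are either of side
length less than `δ` or of side length more than `2 * δ`. -/
structure HasGap (V : ι → ℂ) (δ η : ℝ) : Prop where
  pos : 0 < δ
  nonneg : 0 ≤ η
  ne : ∀ i, σ i ≠ i
  short : ∀ i, ‖V (σ i) - V i‖ + 2 * η ≤ δ / 8
  gap : ∀ (e : Fin 4 → ι) (a v : ℂ), (∀ k, a + sqCoeff k * v ∈ nearPiece σ V η (e k)) →
    ‖v‖ < δ ∨ 2 * δ < ‖v‖

variable {σ} {V : ι → ℂ} {δ η : ℝ}

theorem combo_mem_nearPiece {i : ι} {P Q : ℂ} (hP : ‖P - V i‖ ≤ η) (hQ : ‖Q - V (σ i)‖ ≤ η)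
    {t : ℝ} (h0 : 0 ≤ t) (h1 : t ≤ 1) : P + t • (Q - P) ∈ nearPiece σ V η i := by
  refine ⟨V i + t • (V (σ i) - V i), mem_segment_iff.2 ⟨t, h0, h1, rfl⟩, ?_⟩
  have : P + t • (Q - P) - (V i + t • (V (σ i) - V i)) =
      (1 - t) • (P - V i) + t • (Q - V (σ i)) := by
    simp; ring
  rw [this]
  calc _ ≤ ‖(1 - t) • (P - V i)‖ + ‖t • (Q - V (σ i))‖ := norm_add_le _ _
    _ = (1 - t) * ‖P - V i‖ + t * ‖Q - V (σ i)‖ := by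
      rw [norm_smul, norm_smul, Real.norm_of_nonneg h0, Real.norm_of_nonneg (by linarith)]
    _ ≤ (1 - t) * η + t * η := by
      gcongr
    _ = η := by ring

theorem segment_subset_nearPiece {i : ι} {P Q : ℂ} (hP : ‖P - V i‖ ≤ η)
    (hQ : ‖Q - V (σ i)‖ ≤ η) : segment ℝ P Q ⊆ nearPiece σ V η i := by
  intro b hb
  obtain ⟨t, h0, h1, rfl⟩ := mem_segment_iff.1 hb
  exact combo_mem_nearPiece hP hQ h0 h1

theorem norm_combo_le {P Q c : ℂ} (hP : ‖P - c‖ ≤ η) (hQ : ‖Q - c‖ ≤ η) {t : ℝ} (h0 : 0 ≤ t)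
    (h1 : t ≤ 1) : ‖P + t • (Q - P) - c‖ ≤ η := by
  have : P + t • (Q - P) - c = (1 - t) • (P - c) + t • (Q - c) := by
    simp; ring
  rw [this]
  calc _ ≤ ‖(1 - t) • (P - c)‖ + ‖t • (Q - c)‖ := norm_add_le _ _
    _ = (1 - t) * ‖P - c‖ + t * ‖Q - c‖ := by
      rw [norm_smul, norm_smul, Real.norm_of_nonneg h0, Real.norm_of_nonneg (by linarith)]
    _ ≤ (1 - t) * η + t * η := by
      gcongr
    _ = η := by ring

/-- A point of a triangle is a convex combination of the first vertex and a point of the opposite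
side. -/
theorem exists_of_mem_tri {x y w b : ℂ} (h : b ∈ tri x y w) : ∃ t u : ℝ, 0 ≤ t ∧ t ≤ 1 ∧ 0 ≤ u ∧
    u ≤ 1 ∧ b = x + t • ((y + u • (w - y)) - x) := by
  obtain ⟨s, t, s0, t0, st, rfl⟩ := h
  rcases eq_or_lt_of_le (add_nonneg s0 t0) with h | h
  · have hs : s = 0 := by linarith
    have ht : t = 0 := by linarith
    exact ⟨0, 0, le_rfl, zero_le_one, le_rfl, zero_le_one, by simp [hs, ht]⟩
  · refine ⟨s + t, t / (s + t), h.le, st, by positivity, (div_le_one h).2 (by linarith), ?_⟩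
    have h' : (s : ℂ) + t ≠ 0 := by exact_mod_cast h.ne'
    simp only [real_smul]
    push_cast
    field_simp
    ring

theorem tri_subset_nearPiece {i : ι} {P Q R : ℂ} (hP : ‖P - V i‖ ≤ η) (hQ : ‖Q - V (σ i)‖ ≤ η)
    (hR : ‖R - V (σ i)‖ ≤ η) : tri P Q R ⊆ nearPiece σ V η i := by
  intro b hb
  obtain ⟨t, u, t0, t1, u0, u1, rfl⟩ := exists_of_mem_tri hb
  exact combo_mem_nearPiece hP (norm_combo_le hQ hR u0 u1) t0 t1

theorem tri_subset_nearPiece' {i : ι} {P Q R : ℂ} (hP : ‖P - V (σ i)‖ ≤ η) (hQ : ‖Q - V i‖ ≤ η)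
    (hR : ‖R - V i‖ ≤ η) : tri P Q R ⊆ nearPiece σ V η i := by
  intro b hb
  obtain ⟨t, u, t0, t1, u0, u1, rfl⟩ := exists_of_mem_tri hb
  have := combo_mem_nearPiece (norm_combo_le hQ hR u0 u1) hP (t := 1 - t) (by linarith)
    (by linarith)
  convert this using 1
  simp only [real_smul]
  push_cast
  ring

namespace HasGap

theorem dist_vertex (hV : HasGap σ V δ η) {i : ι} {P : ℂ} (hP : P ∈ nearPiece σ V η i) :
    ‖P - V i‖ ≤ δ / 8 ∧ ‖P - V (σ i)‖ ≤ δ / 8 := by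
  obtain ⟨y, hy, hPy⟩ := hP
  obtain ⟨t, h0, h1, rfl⟩ := mem_segment_iff.1 hy
  have hs := hV.short i
  have hη := hV.nonneg
  have hn := norm_nonneg (V (σ i) - V i)
  constructor
  · calc ‖P - V i‖ = ‖(P - (V i + t • (V (σ i) - V i))) + t • (V (σ i) - V i)‖ := by
          congr 1; ring
      _ ≤ ‖P - (V i + t • (V (σ i) - V i))‖ + ‖t • (V (σ i) - V i)‖ := norm_add_le _ _
      _ ≤ η + 1 * ‖V (σ i) - V i‖ := by
          rw [norm_smul, Real.norm_of_nonneg h0]; gcongr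
      _ ≤ δ / 8 := by linarith
  · calc ‖P - V (σ i)‖ =
        ‖(P - (V i + t • (V (σ i) - V i))) + (1 - t) • (V i - V (σ i))‖ := by
          congr 1; simp only [real_smul]; push_cast; ring
      _ ≤ ‖P - (V i + t • (V (σ i) - V i))‖ + ‖(1 - t) • (V i - V (σ i))‖ := norm_add_le _ _
      _ ≤ η + 1 * ‖V (σ i) - V i‖ := by
          rw [norm_smul, Real.norm_of_nonneg (by linarith), norm_sub_rev (V i)]
          gcongr
          linarith
      _ ≤ δ / 8 := by linarith

theorem dist_of_mem (hV : HasGap σ V δ η) {i : ι} {P Q : ℂ} (hP : P ∈ nearPiece σ V η i)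
    (hQ : Q ∈ nearPiece σ V η i) : ‖P - Q‖ ≤ δ / 4 := by
  have h1 := (hV.dist_vertex hP).1
  have h2 := (hV.dist_vertex hQ).1
  calc ‖P - Q‖ = ‖(P - V i) - (Q - V i)‖ := by congr 1; ring
    _ ≤ ‖P - V i‖ + ‖Q - V i‖ := norm_sub_le _ _
    _ ≤ _ := by linarith

/-- The pieces close to the corners of a large square have no common endpoints. -/
theorem disjoint_of_big (hV : HasGap σ V δ η) {e : Fin 4 → ι} {a v : ℂ}
    (h : ∀ k, a + sqCoeff k * v ∈ nearPiece σ V η (e k)) (hv : δ ≤ ‖v‖) {k l : Fin 4}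
    (hkl : k ≠ l) : e k ≠ e l ∧ e k ≠ σ (e l) ∧ σ (e k) ≠ e l ∧ σ (e k) ≠ σ (e l) := by
  have h1 := norm_le_norm_corner_sub a v hkl
  obtain ⟨a1, a2⟩ := hV.dist_vertex (h k)
  obtain ⟨b1, b2⟩ := hV.dist_vertex (h l)
  have hδ := hV.pos
  set P := a + sqCoeff k * v
  set Q := a + sqCoeff l * v
  -- Two corners near a common endpoint would be at distance at most `δ / 4`, whereas corners of the
  -- square are at least `δ` apart.
  have key : ∀ c : ℂ, ‖P - c‖ ≤ δ / 8 → ‖Q - c‖ ≤ δ / 8 → False := by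
    intro c hc hc'
    have : ‖P - Q‖ ≤ ‖P - c‖ + ‖Q - c‖ := by
      calc ‖P - Q‖ = ‖(P - c) - (Q - c)‖ := by congr 1; ring
        _ ≤ _ := norm_sub_le _ _
    linarith
  refine ⟨fun h => key (V (e k)) a1 (h ▸ b1), fun h => key (V (e k)) a1 (h ▸ b2),
    fun h => key (V (σ (e k))) a2 (h ▸ b1), fun h => key (V (σ (e k))) a2 (h ▸ b2)⟩

/-- If one square in a tuple of sets close to pieces is large, all of them are. -/
theorem big_of_big (hV : HasGap σ V δ η) {S : Fin 4 → Set ℂ} {e : Fin 4 → ι}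
    (hS : ∀ k, S k ⊆ nearPiece σ V η (e k)) (hB : FitsBig (2 * δ) S) {a v : ℂ}
    (h : ∀ k, a + sqCoeff k * v ∈ S k) : 2 * δ ≤ ‖v‖ := by
  obtain ⟨a', v', hv', h'⟩ := hB
  have h0 := hV.dist_of_mem (hS 0 (h' 0)) (hS 0 (h 0))
  have h1 := hV.dist_of_mem (hS 1 (h' 1)) (hS 1 (h 1))
  simp only [sqCoeff_zero, zero_mul, add_zero, sqCoeff_one, one_mul] at h0 h1
  have hδ := hV.pos
  -- Each corner varies by at most `δ / 4`, so the side stays above `δ`, and the gap lifts it to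
  -- more than `2 * δ`.
  have : ‖v'‖ ≤ ‖v‖ + δ / 2 := by
    calc ‖v'‖ = ‖v + ((a' + v' - (a + v)) - (a' - a))‖ := by congr 1; ring
      _ ≤ ‖v‖ + ‖(a' + v' - (a + v)) - (a' - a)‖ := norm_add_le _ _
      _ ≤ ‖v‖ + (‖a' + v' - (a + v)‖ + ‖a' - a‖) := by gcongr; exact norm_sub_le _ _
      _ ≤ _ := by linarith
  rcases hV.gap e a v fun k => hS k (h k) with h | h <;> linarith

end HasGap

theorem tri_subset_of_side (c : Lab → ℂ) (i : Fin 3) :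
    segment ℝ (c (.inl (i + 1))) (c (.inl (i + 2))) ⊆
      tri (c (.inl 0)) (c (.inl 1)) (c (.inl 2)) := by
  intro b hb
  obtain ⟨t, h0, h1, rfl⟩ := mem_segment_iff.1 hb
  fin_cases i
  · refine ⟨1 - t, t, by linarith, h0, by linarith, ?_⟩
    simp; ring
  · refine ⟨0, 1 - t, le_rfl, by linarith, by linarith, ?_⟩
    simp; ring
  · refine ⟨t, 0, h0, le_rfl, by linarith, ?_⟩
    simp

theorem facet_subset_cell (c : Lab → ℂ) (φ : Lab) (k : Fin 4) : facet c φ k ⊆ cell c k := by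
  rcases φ with i | ⟨l, b⟩
  · rw [facet]
    by_cases hk : k = 0
    · subst hk
      rw [Function.update_self]
      exact tri_subset_of_side c i
    · rw [Function.update_of_ne hk]
  · rw [facet]
    by_cases hk : k = l.succ
    · subst hk
      rw [Function.update_self, singleton_subset_iff]
      rcases b
      · exact left_mem_segment ℝ _ _
      · exact right_mem_segment ℝ _ _
    · rw [Function.update_of_ne hk]

end SquarePeg

end

section

open Set Complex ComplexConjugate Filter Topology

namespace SquarePeg

variable {ι κ : Type*} {σ : Equiv.Perm ι} {V : ι → ℂ} {δ η : ℝ}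

/-! ### The number of large squares modulo eight -/

/-- The indicator of a proposition with values in `ZMod 2`. -/
noncomputable def ind (p : Prop) : ZMod 2 := open Classical in if p then 1 else 0

theorem ind_congr {p q : Prop} (h : p ↔ q) : ind p = ind q := by rw [propext h]

theorem ind_false {p : Prop} (h : ¬ p) : ind p = 0 := by simp [ind, h]

theorem sum_ind_eq_card {α : Type*} [Fintype α] (p : α → Prop) :
    ∑ x, ind (p x) = (Nat.card {x // p x} : ZMod 2) := by
  classical
  rw [Nat.card_eq_fintype_card, Fintype.card_subtype]
  simp [ind, Finset.sum_boole]

/-- The labels of a triangle, given by three indices, and of three pieces. -/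
def labOf (σ : Equiv.Perm ι) (g : ι → κ) (T : Fin 3 → κ) (t : Fin 3 → ι) : Lab → κ
  | .inl i => T i
  | .inr (k, b) => if b then g (σ (t k)) else g (t k)

/-- A tuple of sets consisting of a set and of pieces of a chain. -/
def withPieces (σ : Equiv.Perm ι) (W : ι → ℂ) (S : Set ℂ) (t : Fin 3 → ι) : Fin 4 → Set ℂ :=
  Fin.cons S fun k => piece σ W (t k)

theorem cell_labOf (z : κ → ℂ) (g : ι → κ) (T : Fin 3 → κ) (t : Fin 3 → ι) :
    cell (z ∘ labOf σ g T t) = withPieces σ (z ∘ g) (tri (z (T 0)) (z (T 1)) (z (T 2))) t := rfl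

theorem facet_inl_labOf (z : κ → ℂ) (g : ι → κ) (T : Fin 3 → κ) (t : Fin 3 → ι) (i : Fin 3) :
    facet (z ∘ labOf σ g T t) (.inl i) =
      withPieces σ (z ∘ g) (segment ℝ (z (T (i + 1))) (z (T (i + 2)))) t := by
  rw [facet, cell_labOf, withPieces, Fin.update_cons_zero]
  rfl

/-- If the cell holds no large square, all terms vanish. If it holds one, then by the gap all its
squares are large, so the size condition can be dropped; and the labels are distinct because large
squares use pieces without common endpoints. This is what `GenericFamily.even_card_facet` needs. -/
theorem even_facet_big {z : κ → ℂ} (hz : GenericFamily z) (hV : HasGap σ V δ η) {g : ι → κ}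
    (hg : Function.Injective g) (hgV : ∀ i, ‖z (g i) - V i‖ ≤ η) {T : Fin 3 → κ}
    (hT : Function.Injective T) {b : ι}
    (htri : tri (z (T 0)) (z (T 1)) (z (T 2)) ⊆ nearPiece σ V η b)
    (hTg : ∀ m i, T m = g i → i = b ∨ i = σ b) (t : Fin 3 → ι) :
    ∑ φ, ind (FitsBig (2 * δ) (facet (z ∘ labOf σ g T t) φ)) = 0 := by
  have hcell : ∀ k, cell (z ∘ labOf σ g T t) k ⊆
      nearPiece σ V η ((Fin.cons b t : Fin 4 → ι) k) := by
    intro k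
    rw [cell_labOf]
    refine Fin.cases ?_ (fun k => ?_) k
    · exact htri
    · exact segment_subset_nearPiece (hgV _) (hgV _)
  by_cases hB : FitsBig (2 * δ) (cell (z ∘ labOf σ g T t))
  swap
  · refine Finset.sum_eq_zero fun φ _ => ind_false fun h => hB ?_
    exact h.mono fun k => facet_subset_cell _ _ _
  have hinj : Function.Injective (labOf σ g T t) := by
    obtain ⟨a, v, hv, h⟩ := hB
    have hdis := fun {k l : Fin 4} (hkl : k ≠ l) => hV.disjoint_of_big (fun k => hcell k (h k))
      (by linarith [hV.pos]) hkl
    have mixed : ∀ (m : Fin 3) (k : Fin 3) (c : Bool),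
        labOf σ g T t (.inl m) ≠ labOf σ g T t (.inr (k, c)) := by
      intro m k c heq
      obtain ⟨h1, h2, h3, h4⟩ := hdis (Fin.succ_ne_zero k)
      simp only [Fin.cons_succ, Fin.cons_zero] at h1 h2 h3 h4
      rcases c
      · rcases hTg _ _ heq with h | h
        · exact h1 h
        · exact h2 h
      · rcases hTg _ _ heq with h | h
        · exact h3 h
        · exact h4 h
    rintro (m | ⟨k, c⟩) (m' | ⟨l, c'⟩) heq
    · rw [hT heq]
    · exact absurd heq (mixed _ _ _)
    · exact absurd heq.symm (mixed _ _ _)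
    · by_cases hkl : k = l
      · subst hkl
        congr 2
        rcases c <;> rcases c' <;> simp only [labOf] at heq
        · rfl
        · exact absurd (hg heq).symm (hV.ne _)
        · exact absurd (hg heq) (hV.ne _)
        · rfl
      · exfalso
        obtain ⟨h1, h2, h3, h4⟩ := hdis (fun h => hkl (Fin.succ_injective _ h) :
          k.succ ≠ l.succ)
        simp only [Fin.cons_succ] at h1 h2 h3 h4
        rcases c <;> rcases c' <;> simp only [labOf] at heq
        · exact h1 (hg heq)
        · exact h2 (hg heq)
        · exact h3 (hg heq)
        · exact h4 (hg heq)
  have hiff : ∀ φ, FitsBig (2 * δ) (facet (z ∘ labOf σ g T t) φ) ↔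
      Fits (facet (z ∘ labOf σ g T t) φ) := by
    intro φ
    constructor
    · rintro ⟨a, v, -, h⟩
      exact ⟨a, v, h⟩
    · rintro ⟨a, v, h⟩
      exact ⟨a, v, hV.big_of_big hcell hB fun k => facet_subset_cell _ _ _ (h k), h⟩
  simp only [hiff]
  rw [sum_ind_eq_card]
  exact (ZMod.natCast_eq_zero_iff_even).2 (hz.even_card_facet hinj)

/-- The parity of the number of triples of pieces carrying three corners of a large square with
fourth corner in `S`. -/
noncomputable def parityOn [Fintype ι] (σ : Equiv.Perm ι) (W : ι → ℂ) (r : ℝ) (S : Set ℂ) :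
    ZMod 2 :=
  ∑ t : Fin 3 → ι, ind (FitsBig r (withPieces σ W S t))

/-- Summed over all triples of pieces, the endpoint facets cancel in pairs because the chain is
closed: the end of one piece is the beginning of the next. Only the sides of the triangle survive
modulo 2. -/
theorem sum_parityOn_sides [Fintype ι] {z : κ → ℂ} (hz : GenericFamily z)
    (hV : HasGap σ V δ η) {g : ι → κ} (hg : Function.Injective g)
    (hgV : ∀ i, ‖z (g i) - V i‖ ≤ η) {T : Fin 3 → κ} (hT : Function.Injective T) {b : ι}
    (htri : tri (z (T 0)) (z (T 1)) (z (T 2)) ⊆ nearPiece σ V η b)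
    (hTg : ∀ m i, T m = g i → i = b ∨ i = σ b) :
    ∑ i : Fin 3, parityOn σ (z ∘ g) (2 * δ) (segment ℝ (z (T (i + 1))) (z (T (i + 2)))) = 0 := by
  classical
  have h1 : ∑ t : Fin 3 → ι, ∑ φ, ind (FitsBig (2 * δ) (facet (z ∘ labOf σ g T t) φ)) = 0 :=
    Finset.sum_eq_zero fun t _ => even_facet_big hz hV hg hgV hT htri hTg t
  simp only [Fintype.sum_sum_type, Finset.sum_add_distrib, Fintype.sum_prod_type,
    Fintype.sum_bool] at h1
  have h2 : ∀ k : Fin 3, ∑ t : Fin 3 → ι,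
      ind (FitsBig (2 * δ) (facet (z ∘ labOf σ g T t) (.inr (k, true)))) =
      ∑ t : Fin 3 → ι, ind (FitsBig (2 * δ) (facet (z ∘ labOf σ g T t) (.inr (k, false)))) := by
    intro k
    -- Advancing the `k`-th piece by one turns an end-point facet into a starting-point facet.
    let τ : (Fin 3 → ι) ≃ (Fin 3 → ι) :=
      Equiv.piCongrRight fun l => if l = k then σ else Equiv.refl ι
    refine Fintype.sum_equiv τ _ _ fun t => ind_congr ?_
    have hτk : τ t k = σ (t k) := by simp [τ]
    have hτl : ∀ l, l ≠ k → τ t l = t l := fun l hl => by simp [τ, hl]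
    have : facet (z ∘ labOf σ g T t) (.inr (k, true)) =
        facet (z ∘ labOf σ g T (τ t)) (.inr (k, false)) := by
      funext l
      simp only [facet, cell_labOf]
      by_cases hl : l = k.succ
      · subst hl
        simp [labOf, hτk]
      · rw [Function.update_of_ne hl, Function.update_of_ne hl]
        revert hl
        refine Fin.cases (fun _ => rfl) (fun l hl => ?_) l
        have : l ≠ k := fun h => hl (by rw [h])
        simp [withPieces, hτl l this]
    rw [this]
  have h3 : ∑ t : Fin 3 → ι, ∑ k : Fin 3,
      ind (FitsBig (2 * δ) (facet (z ∘ labOf σ g T t) (.inr (k, true)))) =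
      ∑ t : Fin 3 → ι, ∑ k : Fin 3,
        ind (FitsBig (2 * δ) (facet (z ∘ labOf σ g T t) (.inr (k, false)))) := by
    rw [Finset.sum_comm, Finset.sum_comm (s := Finset.univ (α := Fin 3 → ι))]
    exact Finset.sum_congr rfl fun k _ => h2 k
  rw [h3, CharTwo.add_self_eq_zero, add_zero, Finset.sum_comm] at h1
  rw [← h1]
  refine Finset.sum_congr rfl fun i _ => ?_
  simp only [parityOn, facet_inl_labOf]

/-- The number of quadruples of pieces carrying the corners of a large square. -/
noncomputable def hitCount (σ : Equiv.Perm ι) (W : ι → ℂ) (r : ℝ) : ℕ :=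
  Nat.card {e : Fin 4 → ι // FitsBig r fun k => piece σ W (e k)}

/-- The number of such quadruples whose first piece belongs to a given set. -/
noncomputable def hitCountOn (σ : Equiv.Perm ι) (W : ι → ℂ) (r : ℝ) (M : Set ι) : ℕ :=
  Nat.card {e : Fin 4 → ι // (FitsBig r fun k => piece σ W (e k)) ∧ e 0 ∈ M}

/-- Relabelling the corners of a square cyclically shifts the distinguished index. Four injections
around the cycle force all four cardinalities to be equal. -/
theorem card_hits_rotate [Finite ι] (W : ι → ℂ) (r : ℝ) (M : Set ι) (k : Fin 4) :
    Nat.card {e : Fin 4 → ι // (FitsBig r fun k => piece σ W (e k)) ∧ e k ∈ M} =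
      hitCountOn σ W r M := by
  have step : ∀ k : Fin 4,
      Nat.card {e : Fin 4 → ι // (FitsBig r fun k => piece σ W (e k)) ∧ e (k + 1) ∈ M} ≤
      Nat.card {e : Fin 4 → ι // (FitsBig r fun k => piece σ W (e k)) ∧ e k ∈ M} := by
    intro k
    refine Nat.card_le_card_of_injective
      (fun e => ⟨fun l => e.1 (l + 1), fitsBig_rotate e.2.1, e.2.2⟩) ?_
    rintro ⟨e, he⟩ ⟨e', he'⟩ h
    simp only [Subtype.mk.injEq] at h ⊢
    funext l
    have := congrFun h (l - 1)
    simpa using this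
  have s0 := step 0
  have s1 := step 1
  have s2 := step 2
  have s3 := step 3
  simp only [show (0 : Fin 4) + 1 = 1 from rfl, show (1 : Fin 4) + 1 = 2 from rfl,
    show (2 : Fin 4) + 1 = 3 from rfl, show (3 : Fin 4) + 1 = 0 from rfl] at s0 s1 s2 s3
  unfold hitCountOn
  fin_cases k
  · rfl
  · exact le_antisymm s0 (s3.trans (s2.trans s1))
  · exact le_antisymm (s1.trans s0) (s3.trans s2)
  · exact le_antisymm (s2.trans (s1.trans s0)) s3

/-- Splitting the quadruples according to whether a piece belongs to `M`, where at most one piece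
can belong to `M`. -/
theorem hitCount_eq [Finite ι] (W : ι → ℂ) (r : ℝ) (M : Set ι)
    (hM : ∀ e : Fin 4 → ι, (FitsBig r fun k => piece σ W (e k)) → ∀ k l, e k ∈ M → e l ∈ M →
      k = l) :
    hitCount σ W r =
      Nat.card {e : Fin 4 → ι // (FitsBig r fun k => piece σ W (e k)) ∧ ∀ k, e k ∉ M} +
        4 * hitCountOn σ W r M := by
  classical
  have := Fintype.ofFinite ι
  have h4 : 4 * hitCountOn σ W r M = ∑ k : Fin 4,
      Nat.card {e : Fin 4 → ι // (FitsBig r fun k => piece σ W (e k)) ∧ e k ∈ M} := by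
    simp only [card_hits_rotate]
    simp
  rw [h4, hitCount]
  simp only [Nat.card_eq_fintype_card, Fintype.card_subtype]
  rw [← Finset.card_biUnion, ← Finset.card_union_of_disjoint]
  · congr 1
    ext e
    simp only [Finset.mem_filter, Finset.mem_univ, true_and, Finset.mem_union, Finset.mem_biUnion]
    by_cases h : ∀ k, e k ∉ M
    · simp [h]
    · push Not at h
      tauto
  · rw [Finset.disjoint_left]
    intro e he he'
    simp only [Finset.mem_filter, Finset.mem_univ, true_and, Finset.mem_biUnion] at he he'
    obtain ⟨k, -, hk⟩ := he'
    exact he.2 k hk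
  · intro k _ l _ hkl
    rw [Function.onFun, Finset.disjoint_left]
    intro e he he'
    simp only [Finset.mem_filter, Finset.mem_univ, true_and] at he he'
    exact hkl (hM e he.1 k l he.2 he'.2)

theorem hitCountOn_cast [Fintype ι] (W : ι → ℂ) (r : ℝ) {i j : ι} (hij : i ≠ j) :
    (hitCountOn σ W r {i, j} : ZMod 2) =
      parityOn σ W r (piece σ W i) + parityOn σ W r (piece σ W j) := by
  classical
  rw [hitCountOn, ← sum_ind_eq_card, ← (Fin.consEquiv fun _ => ι).sum_comp, Fintype.sum_prod_type]
  have h0 : ∀ l, l ≠ i ∧ l ≠ j → ∑ t : Fin 3 → ι, ind ((FitsBig r fun k =>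
      piece σ W ((Fin.consEquiv fun _ => ι) (l, t) k)) ∧
      (Fin.consEquiv fun _ => ι) (l, t) 0 ∈ ({i, j} : Set ι)) = 0 := by
    rintro l ⟨hi, hj⟩
    refine Finset.sum_eq_zero fun t _ => ind_false ?_
    rintro ⟨-, h⟩
    rcases h with h | h
    · exact hi h
    · exact hj h
  rw [Fintype.sum_eq_add i j hij h0]
  unfold parityOn
  congr 1 <;> refine Finset.sum_congr rfl fun t _ => ind_congr ?_
  · have : (fun k => piece σ W ((Fin.consEquiv fun _ => ι) (i, t) k)) =
        withPieces σ W (piece σ W i) t := by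
      funext k; refine Fin.cases rfl (fun k => rfl) k
    rw [this]
    simp
  · have : (fun k => piece σ W ((Fin.consEquiv fun _ => ι) (j, t) k)) =
        withPieces σ W (piece σ W j) t := by
      funext k; refine Fin.cases rfl (fun k => rfl) k
    rw [this]
    simp

/-- Moving one vertex of a generic chain does not change the number of large squares modulo
eight. -/
theorem hitCount_update [Fintype ι] [DecidableEq ι] {z : κ → ℂ} (hz : GenericFamily z)
    (hV : HasGap σ V δ η) {g : ι → κ} (hg : Function.Injective g)
    (hgV : ∀ i, ‖z (g i) - V i‖ ≤ η) {j : ι} {j' : κ} (hj' : ∀ i, g i ≠ j')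
    (hj'V : ‖z j' - V j‖ ≤ η) :
    hitCount σ (z ∘ g) (2 * δ) ≡ hitCount σ (z ∘ Function.update g j j') (2 * δ) [MOD 8] := by
  set i₀ := σ.symm j with hi₀
  have hσi : σ i₀ = j := σ.apply_symm_apply j
  have hne : i₀ ≠ j := fun h => hV.ne i₀ (hσi.trans h.symm)
  set g' := Function.update g j j' with hg'
  have g'j : g' j = j' := Function.update_self ..
  have g'i : ∀ i, i ≠ j → g' i = g i := fun i hi => Function.update_of_ne hi ..
  have hg'V : ∀ i, ‖z (g' i) - V i‖ ≤ η := by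
    intro i
    by_cases h : i = j
    · subst h; rw [g'j]; exact hj'V
    · rw [g'i i h]; exact hgV i
  have hpW : ∀ i, piece σ (z ∘ g) i ⊆ nearPiece σ V η i := fun i =>
    segment_subset_nearPiece (hgV _) (hgV _)
  have hpW' : ∀ i, piece σ (z ∘ g') i ⊆ nearPiece σ V η i := fun i =>
    segment_subset_nearPiece (hg'V _) (hg'V _)
  have hMgen : ∀ W : ι → ℂ, (∀ i, piece σ W i ⊆ nearPiece σ V η i) → ∀ e : Fin 4 → ι,
      (FitsBig (2 * δ) fun k => piece σ W (e k)) → ∀ k l, e k ∈ ({i₀, j} : Set ι) →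
      e l ∈ ({i₀, j} : Set ι) → k = l := by
    rintro W hW e ⟨a, v, hv, h⟩ k l hk hl
    by_contra hkl
    obtain ⟨h1, h2, h3, h4⟩ := hV.disjoint_of_big (fun k => hW _ (h k))
      (by linarith [hV.pos]) hkl
    rcases hk with hk | hk <;> rcases hl with hl | hl <;> rw [hk, hl] at h1 h2 h3 h4
    · exact h1 rfl
    · exact h3 hσi
    · exact h2 hσi.symm
    · exact h1 rfl
  have hsame : ∀ i, i ∉ ({i₀, j} : Set ι) → piece σ (z ∘ g') i = piece σ (z ∘ g) i := by
    intro i hi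
    simp only [mem_insert_iff, mem_singleton_iff, not_or] at hi
    have : σ i ≠ j := fun h => hi.1 (by rw [hi₀, ← h, σ.symm_apply_apply])
    simp only [piece, Function.comp, g'i i hi.2, g'i _ this]
  rw [hitCount_eq _ _ _ (hMgen _ hpW), hitCount_eq _ _ _ (hMgen _ hpW')]
  have hfirst : {e : Fin 4 → ι // (FitsBig (2 * δ) fun k => piece σ (z ∘ g) (e k)) ∧
      ∀ k, e k ∉ ({i₀, j} : Set ι)} = {e : Fin 4 → ι //
      (FitsBig (2 * δ) fun k => piece σ (z ∘ g') (e k)) ∧ ∀ k, e k ∉ ({i₀, j} : Set ι)} := by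
    congr 1
    funext e
    rw [eq_iff_iff]
    refine and_congr_left fun he => ?_
    simp only [hsame _ (he _)]
  rw [hfirst]
  refine Nat.ModEq.add_left _ ?_
  -- Quadruples avoiding the two moved pieces are unaffected, and the others come in fours, so only
  -- the parity of those starting on a moved piece matters.
  change _ ≡ _ [MOD 4 * 2]
  refine Nat.ModEq.mul_left' 4 ?_
  rw [← ZMod.natCast_eq_natCast_iff, hitCountOn_cast _ _ hne, hitCountOn_cast _ _ hne]
  -- A large square with its first corner on a moved piece has no other corner on a moved piece, so
  -- the remaining three pieces may be taken from the old chain.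
  have hpar : ∀ i ∈ ({i₀, j} : Set ι), parityOn σ (z ∘ g') (2 * δ) (piece σ (z ∘ g') i) =
      parityOn σ (z ∘ g) (2 * δ) (piece σ (z ∘ g') i) := by
    intro i hi
    refine Finset.sum_congr rfl fun t _ => ind_congr ?_
    have key : ∀ W : ι → ℂ, (∀ i, piece σ W i ⊆ nearPiece σ V η i) →
        FitsBig (2 * δ) (withPieces σ W (piece σ (z ∘ g') i) t) →
        ∀ k, t k ∉ ({i₀, j} : Set ι) := by
      rintro W hW ⟨a, v, hv, h⟩ k hk
      have hnear : ∀ k, a + sqCoeff k * v ∈ nearPiece σ V η ((Fin.cons i t : Fin 4 → ι) k) := by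
        intro k
        have := h k
        revert this
        refine Fin.cases (fun h => hpW' _ h) (fun k h => hW _ h) k
      obtain ⟨h1, h2, h3, h4⟩ := hV.disjoint_of_big hnear (by linarith [hV.pos])
        (Fin.succ_ne_zero k)
      simp only [Fin.cons_succ, Fin.cons_zero] at h1 h2 h3 h4
      rcases hi with hi | hi <;> rcases hk with hk | hk <;> rw [hi, hk] at h1 h2 h3 h4
      · exact h1 rfl
      · exact h2 hσi.symm
      · exact h3 hσi
      · exact h1 rfl
    have heq : (∀ k, t k ∉ ({i₀, j} : Set ι)) →
        withPieces σ (z ∘ g') (piece σ (z ∘ g') i) t =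
          withPieces σ (z ∘ g) (piece σ (z ∘ g') i) t := by
      intro h
      simp only [withPieces, hsame _ (h _)]
    constructor
    · intro h
      rwa [← heq (key _ hpW' h)]
    · intro h
      rwa [heq (key _ hpW h)]
  rw [hpar i₀ (by simp), hpar j (by simp)]
  -- The triangles on the two sides of the moving vertex share the side from its old to its new
  -- position. In the sum of both relations that side cancels, which equates the old and new pieces.
  have tri₁ := sum_parityOn_sides hz hV hg hgV (T := ![g i₀, g j, j']) (b := i₀)
    (by
      intro k l
      fin_cases k <;> fin_cases l <;>
        simp [hg.eq_iff, hne, hne.symm, hj', fun i => (hj' i).symm])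
    (tri_subset_nearPiece (hgV _) (by rw [hσi]; exact hgV _) (by rw [hσi]; exact hj'V))
    (by
      intro m i h
      fin_cases m
      · exact Or.inl (hg h).symm
      · exact Or.inr ((hg h).symm.trans hσi.symm)
      · exact absurd h.symm (hj' i))
  have tri₂ := sum_parityOn_sides hz hV hg hgV (T := ![g (σ j), g j, j']) (b := j)
    (by
      intro k l
      have := hV.ne j
      fin_cases k <;> fin_cases l <;>
        simp [hg.eq_iff, this, this.symm, hj', fun i => (hj' i).symm])
    (tri_subset_nearPiece' (hgV _) (hgV _) hj'V)
    (by
      intro m i h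
      fin_cases m
      · exact Or.inr (hg h).symm
      · exact Or.inl (hg h).symm
      · exact absurd h.symm (hj' i))
  simp only [Fin.sum_univ_three, show (0 : Fin 3) + 1 = 1 from rfl,
    show (0 : Fin 3) + 2 = 2 from rfl, show (1 : Fin 3) + 1 = 2 from rfl,
    show (1 : Fin 3) + 2 = 0 from rfl, show (2 : Fin 3) + 1 = 0 from rfl,
    show (2 : Fin 3) + 2 = 1 from rfl, Matrix.cons_val] at tri₁ tri₂
  have p1 : piece σ (z ∘ g) i₀ = segment ℝ (z (g i₀)) (z (g j)) := by
    simp only [piece, hσi, Function.comp]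
  have p2 : piece σ (z ∘ g) j = segment ℝ (z (g (σ j))) (z (g j)) := segment_symm ..
  have p3 : piece σ (z ∘ g') i₀ = segment ℝ (z j') (z (g i₀)) := by
    simp only [piece, hσi, Function.comp, g'j, g'i _ hne]
    exact segment_symm ..
  have p4 : piece σ (z ∘ g') j = segment ℝ (z j') (z (g (σ j))) := by
    simp only [piece, Function.comp, g'j, g'i _ (hV.ne j)]
  rw [p1, p2, p3, p4]
  generalize parityOn σ (z ∘ g) (2 * δ) (segment ℝ (z (g i₀)) (z (g j))) = x1 at *
  generalize parityOn σ (z ∘ g) (2 * δ) (segment ℝ (z (g (σ j))) (z (g j))) = x2 at *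
  generalize parityOn σ (z ∘ g) (2 * δ) (segment ℝ (z j') (z (g i₀))) = x3 at *
  generalize parityOn σ (z ∘ g) (2 * δ) (segment ℝ (z j') (z (g (σ j)))) = x4 at *
  generalize parityOn σ (z ∘ g) (2 * δ) (segment ℝ (z (g j)) (z j')) = x5 at *
  clear * - tri₁ tri₂
  revert x1 x2 x3 x4 x5
  decide

/-- Two generic chains close to the same chain carry the same number of large squares modulo
eight. -/
theorem hitCount_modEq [Fintype ι] {z : κ → ℂ} (hz : GenericFamily z) (hV : HasGap σ V δ η)
    {g g' : ι → κ} (hg : Function.Injective g) (hg' : Function.Injective g')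
    (hgg' : ∀ i j, g i ≠ g' j) (hgV : ∀ i, ‖z (g i) - V i‖ ≤ η)
    (hg'V : ∀ i, ‖z (g' i) - V i‖ ≤ η) :
    hitCount σ (z ∘ g) (2 * δ) ≡ hitCount σ (z ∘ g') (2 * δ) [MOD 8] := by
  classical
  -- The vertices are exchanged one at a time; the mixed chains remain injective because `g` and
  -- `g'` have disjoint ranges.
  have key : ∀ s : Finset ι, hitCount σ (z ∘ g) (2 * δ) ≡
      hitCount σ (z ∘ fun i => if i ∈ s then g' i else g i) (2 * δ) [MOD 8] := by
    intro s
    induction s using Finset.induction_on with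
    | empty => simpa using Nat.ModEq.refl _
    | insert j s hj ih =>
      refine ih.trans ?_
      have hupd : (fun i => if i ∈ insert j s then g' i else g i) =
          Function.update (fun i => if i ∈ s then g' i else g i) j (g' j) := by
        funext i
        by_cases h : i = j
        · subst h; simp
        · simp [h]
      rw [hupd]
      refine hitCount_update hz hV ?_ ?_ ?_ (hg'V j)
      · intro a b hab
        dsimp only at hab
        split_ifs at hab
        · exact hg' hab
        · exact absurd hab.symm (hgg' _ _)
        · exact absurd hab (hgg' _ _)
        · exact hg hab
      · intro i
        split_ifs
        · exact hg'V i
        · exact hgV i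
      · intro i h
        split_ifs at h with hi
        · exact hj (hg' h ▸ hi)
        · exact hgg' _ _ h
  simpa using key Finset.univ

end SquarePeg

end

section

open Set Complex ComplexConjugate Filter Topology

namespace SquarePeg

/-! ### Simple polygons carry no small squares -/

/-- A point of the `i`-th edge. -/
noncomputable def edgePt {n : ℕ} (x : Fin n → ℂ) (i : Fin n) (s : ℝ) : ℂ :=
  x i + s • (x (finRotate n i) - x i)

theorem mem_edge_iff {n : ℕ} {X : Polygon ℂ n} {i : Fin n} {b : ℂ} :
    b ∈ X.edgeSet ℝ i ↔ ∃ s : ℝ, 0 ≤ s ∧ s ≤ 1 ∧ b = edgePt X.vertices i s := by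
  rw [edgeSet_eq_segment, mem_segment_iff]
  rfl

theorem edgePt_mem {n : ℕ} (x : Fin n → ℂ) (i : Fin n) {s : ℝ} (h : s ∈ Icc (0 : ℝ) 1) :
    edgePt x i s ∈ (Polygon.mk x).edgeSet ℝ i :=
  mem_edge_iff.2 ⟨s, h.1, h.2, rfl⟩

theorem norm_edgePt_sub_le {n : ℕ} {x y : Fin n → ℂ} {η : ℝ} (h : ∀ i, ‖x i - y i‖ ≤ η)
    (i : Fin n) {s : ℝ} (hs : s ∈ Icc (0 : ℝ) 1) : ‖edgePt x i s - edgePt y i s‖ ≤ η := by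
  have : edgePt x i s - edgePt y i s =
      (1 - s) • (x i - y i) + s • (x (finRotate n i) - y (finRotate n i)) := by
    simp only [edgePt, real_smul]; push_cast; ring
  rw [this]
  calc _ ≤ ‖(1 - s) • (x i - y i)‖ + ‖s • (x (finRotate n i) - y (finRotate n i))‖ :=
        norm_add_le _ _
    _ = (1 - s) * ‖x i - y i‖ + s * ‖x (finRotate n i) - y (finRotate n i)‖ := by
      rw [norm_smul, norm_smul, Real.norm_of_nonneg hs.1,
        Real.norm_of_nonneg (by linarith [hs.2])]
    _ ≤ (1 - s) * η + s * η := by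
      have := hs.1
      have := hs.2
      have h1 := h i
      have h2 := h (finRotate n i)
      gcongr
    _ = η := by ring

theorem finRotate_ne {n : ℕ} (hn : 2 ≤ n) (i : Fin n) : finRotate n i ≠ i := by
  obtain ⟨m, rfl⟩ : ∃ m, n = m + 2 := ⟨n - 2, by omega⟩
  simp [finRotate_apply]

/-- Edges of a simple polygon with a common point are among two consecutive edges. -/
theorem exists_consecutive {n : ℕ} (hn : 2 ≤ n) {X : Polygon ℂ n} (hX : X.IsSimple)
    {e : Fin 4 → Fin n} {P : ℂ} (hP : ∀ k, P ∈ X.edgeSet ℝ (e k)) :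
    ∃ i, ∀ k, e k = i ∨ e k = finRotate n i := by
  have hcons : ∀ k l, e k ≠ e l → e l = finRotate n (e k) ∨ e k = finRotate n (e l) := by
    intro k l hkl
    by_contra! hcon
    exact disjoint_left.1 (hX.disjoint _ _ hkl hcon.1 hcon.2) (hP k) (hP l)
  -- Two consecutive edges through `P` make `P` their common vertex. A third edge would have to
  -- follow the second one, making `P` equal to a second vertex as well.
  have key : ∀ k l, e l = finRotate n (e k) → ∀ m, e m = e k ∨ e m = finRotate n (e k) := by
    intro k l hkl m
    by_contra! hm
    have hPv : P = X (finRotate n (e k)) := by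
      have : P ∈ X.edgeSet ℝ (e k) ∩ X.edgeSet ℝ (finRotate n (e k)) := ⟨hP k, hkl ▸ hP l⟩
      rw [hX.consecutive] at this
      exact this
    rcases hcons l m (by rw [hkl]; exact hm.2.symm) with h | h
    · have : P ∈ X.edgeSet ℝ (e l) ∩ X.edgeSet ℝ (finRotate n (e l)) := ⟨hP l, h ▸ hP m⟩
      rw [hX.consecutive, mem_singleton_iff, hPv] at this
      have := hX.injective this
      rw [hkl] at this
      exact finRotate_ne hn _ this.symm
    · rw [hkl] at h
      exact hm.1 ((finRotate n).injective h).symm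
  by_cases h : ∀ k, e k = e 0
  · exact ⟨e 0, fun k => Or.inl (h k)⟩
  · push Not at h
    obtain ⟨l, hl⟩ := h
    rcases hcons 0 l hl.symm with h | h
    · exact ⟨e 0, key 0 l h⟩
    · exact ⟨e l, key l 0 h⟩

theorem eq_zero_of_collinear {c d a v : ℂ} (hd : d ≠ 0)
    (h : ∀ k, ∃ s : ℝ, a + sqCoeff k * v = c + s • d) : v = 0 := by
  have hc : ∀ k, crs d (sqCoeff k * v) = 0 := by
    intro k
    obtain ⟨s, hs⟩ := h k
    obtain ⟨s', hs'⟩ := h 0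
    simp only [sqCoeff_zero, zero_mul, add_zero] at hs'
    have : sqCoeff k * v = (s - s') • d := by
      rw [hs'] at hs
      simp only [real_smul] at hs ⊢
      push_cast
      linear_combination hs
    rw [this, crs_smul, crs_self, mul_zero]
  exact eq_zero_of_crs hd (by decide : (1 : Fin 4) ≠ 3) (by decide) (by decide) (hc 1) (hc 3)

/-- There is no square with corners on two segments with only a common endpoint in common. -/
theorem eq_zero_of_angle {c u w a v : ℂ} (hu : u ≠ 0) (hw : w ≠ 0)
    (h : ∀ k, ∃ s : ℝ, 0 ≤ s ∧ (a + sqCoeff k * v = c + s • u ∨ a + sqCoeff k * v = c + s • w)) :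
    v = 0 := by
  by_cases hcol : crs u w = 0
  · obtain ⟨r, hr⟩ := (crs_eq_zero_iff hu w).1 hcol
    refine eq_zero_of_collinear (a := a) (c := c) hu fun k => ?_
    obtain ⟨s, -, hs | hs⟩ := h k
    · exact ⟨s, hs⟩
    · refine ⟨s * r, ?_⟩
      rw [hs, hr, smul_smul]
  · -- coordinates with respect to `u`, `w`
    have hlin : ∀ α β : ℝ, α • u + β • w = 0 → α = 0 ∧ β = 0 := by
      intro α β hαβ
      have h1 : crs u (α • u + β • w) = 0 := by rw [hαβ]; simp [crs]
      rw [crs_add, crs_smul, crs_smul, crs_self, mul_zero, zero_add] at h1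
      have hβ : β = 0 := (mul_eq_zero.1 h1).resolve_right hcol
      rw [hβ, zero_smul, add_zero] at hαβ
      exact ⟨(smul_eq_zero.1 hαβ).resolve_right hu, hβ⟩
    have hcoord : ∀ k, ∃ α β : ℝ, 0 ≤ α ∧ 0 ≤ β ∧ (α = 0 ∨ β = 0) ∧
        a + sqCoeff k * v = c + α • u + β • w := by
      intro k
      obtain ⟨s, hs0, hs | hs⟩ := h k
      · exact ⟨s, 0, hs0, le_rfl, Or.inr rfl, by simp [hs]⟩
      · exact ⟨0, s, le_rfl, hs0, Or.inl rfl, by simp [hs]⟩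
    choose α β hα hβ h0 he using hcoord
    have e0 := he 0
    have e1 := he 1
    have e2 := he 2
    have e3 := he 3
    simp only [sqCoeff_zero, sqCoeff_one, sqCoeff_two, sqCoeff_three, zero_mul, one_mul,
      add_zero] at e0 e1 e2 e3
    -- The diagonals of a square have the same midpoint.
    obtain ⟨s1, s2⟩ := hlin (α 0 + α 2 - α 1 - α 3) (β 0 + β 2 - β 1 - β 3) (by
      simp only [real_smul] at e0 e1 e2 e3 ⊢
      push_cast
      linear_combination e1 + e3 - e0 - e2)
    have a0 := hα 0
    have a1 := hα 1
    have a2 := hα 2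
    have a3 := hα 3
    have b0 := hβ 0
    have b1 := hβ 1
    have b2 := hβ 2
    have b3 := hβ 3
    have hallw : (∀ k, α k = 0) → v = 0 := fun h =>
      eq_zero_of_collinear (a := a) (c := c) hw fun k => ⟨β k, by rw [he k, h k]; simp⟩
    have hallu : (∀ k, β k = 0) → v = 0 := fun h =>
      eq_zero_of_collinear (a := a) (c := c) hu fun k => ⟨α k, by rw [he k, h k]; simp⟩
    have same : ∀ k l, k ≠ l → α k = α l → β k = β l → v = 0 := by
      intro k l hkl h1 h2
      have : a + sqCoeff k * v = a + sqCoeff l * v := by rw [he k, he l, h1, h2]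
      have h3 := norm_le_norm_corner_sub a v hkl
      rw [this, sub_self, norm_zero] at h3
      exact norm_le_zero_iff.1 h3
    have hw' : α 0 + α 2 = 0 ∨ α 1 + α 3 = 0 → v = 0 := fun h => hallw fun k => by
      rcases h with h | h <;> fin_cases k <;>
        simp only [Fin.zero_eta, Fin.mk_one, Fin.reduceFinMk] <;> linarith
    have hu' : β 0 + β 2 = 0 ∨ β 1 + β 3 = 0 → v = 0 := fun h => hallu fun k => by
      rcases h with h | h <;> fin_cases k <;>
        simp only [Fin.zero_eta, Fin.mk_one, Fin.reduceFinMk] <;> linarith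
    -- If opposite corners lie on one ray, their other coordinates sum to zero, which by the
    -- midpoint relation and nonnegativity puts all corners on that ray. If both diagonals connect
    -- the two rays, the relation makes two corners coincide.
    rcases h0 0 with h00 | h00 <;> rcases h0 2 with h02 | h02
    · exact hw' (Or.inl (by linarith))
    · rcases h0 1 with h01 | h01 <;> rcases h0 3 with h03 | h03
      · exact hw' (Or.inr (by linarith))
      · exact same 0 1 (by decide) (by linarith) (by linarith)
      · exact same 0 3 (by decide) (by linarith) (by linarith)
      · exact hu' (Or.inr (by linarith))
    · rcases h0 1 with h01 | h01 <;> rcases h0 3 with h03 | h03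
      · exact hw' (Or.inr (by linarith))
      · exact same 2 1 (by decide) (by linarith) (by linarith)
      · exact same 2 3 (by decide) (by linarith) (by linarith)
      · exact hu' (Or.inr (by linarith))
    · exact hu' (Or.inl (by linarith))

theorem eq_zero_of_consecutive {n : ℕ} (hn : 2 ≤ n) {X : Polygon ℂ n} (hX : X.IsSimple)
    {i : Fin n} {e : Fin 4 → Fin n} (he : ∀ k, e k = i ∨ e k = finRotate n i) {a v : ℂ}
    (h : ∀ k, a + sqCoeff k * v ∈ X.edgeSet ℝ (e k)) : v = 0 := by
  set j := finRotate n i with hj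
  have hne : ∀ i, X i ≠ X (finRotate n i) := fun i h => finRotate_ne hn i (hX.injective h).symm
  refine eq_zero_of_angle (c := X j) (u := X i - X j) (w := X (finRotate n j) - X j)
    (a := a) (sub_ne_zero.2 (hne i)) (sub_ne_zero.2 (hne j).symm) ?_
  · intro k
    have hk := h k
    rw [edgeSet_eq_segment] at hk
    rcases he k with h' | h' <;> rw [h'] at hk
    · rw [segment_symm] at hk
      obtain ⟨s, h0, -, hs⟩ := mem_segment_iff.1 hk
      exact ⟨s, h0, Or.inl hs⟩
    · obtain ⟨s, h0, -, hs⟩ := mem_segment_iff.1 hk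
      exact ⟨s, h0, Or.inr hs⟩

theorem norm_sqCoeff_le (k : Fin 4) : ‖sqCoeff k‖ ≤ 2 := by
  fin_cases k <;> simp
  calc ‖(1 : ℂ) + I‖ ≤ ‖(1 : ℂ)‖ + ‖I‖ := norm_add_le _ _
    _ = 2 := by simp; norm_num

theorem mem_boundary_iff {n : ℕ} {X : Polygon ℂ n} {b : ℂ} :
    b ∈ X.boundary ℝ ↔ ∃ i, b ∈ X.edgeSet ℝ i := by
  simp [Polygon.boundary]

theorem exists_pos_forall_le {α : Type*} [Finite α] {ρ : α → ℝ} (h : ∀ e, 0 < ρ e) :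
    ∃ r > 0, ∀ e, r ≤ ρ e := by
  have : ∀ᶠ r in 𝓝[>] (0 : ℝ), ∀ e, r ≤ ρ e :=
    eventually_all.2 fun e => by filter_upwards [Ioc_mem_nhdsGT (h e)] with r hr using hr.2
  obtain ⟨r, hr, hr0⟩ := (this.and self_mem_nhdsWithin).exists
  exact ⟨r, hr0, hr⟩

/-- Polygons close to a compact set of simple polygons carry no small squares. -/
theorem exists_lt_norm {n : ℕ} (hn : 2 ≤ n) {K : Set (Fin n → ℂ)} (hK : IsCompact K)
    (hs : ∀ x ∈ K, (Polygon.mk x).IsSimple) :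
    ∃ δ > 0, ∀ x ∈ K, ∀ y, (Polygon.mk y).IsSimple → (∀ i, ‖y i - x i‖ ≤ δ) →
      ∀ a v : ℂ, v ≠ 0 → (∀ k, a + sqCoeff k * v ∈ (Polygon.mk y).boundary ℝ) →
        2 * δ < ‖v‖ := by
  -- Four edges not contained in a pair of consecutive ones have no common point, so by compactness
  -- four points on them cannot all be close to each other. Within two consecutive edges there is no
  -- square of any size.
  have H : ∀ e : {e : Fin 4 → Fin n // ¬ ∃ i, ∀ k, e k = i ∨ e k = finRotate n i},
      ∃ ρ > 0, ∀ x ∈ K, ∀ τ ∈ Set.pi univ (fun _ : Fin 4 => Icc (0 : ℝ) 1),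
        ρ ≤ ∑ k, ‖edgePt x (e.1 0) (τ 0) - edgePt x (e.1 k) (τ k)‖ := by
    rintro ⟨e, he⟩
    have hC : IsCompact (K ×ˢ Set.pi univ (fun _ : Fin 4 => Icc (0 : ℝ) 1)) :=
      hK.prod (isCompact_univ_pi fun _ => isCompact_Icc)
    have hcont : Continuous fun p : (Fin n → ℂ) × (Fin 4 → ℝ) =>
        ∑ k, ‖edgePt p.1 (e 0) (p.2 0) - edgePt p.1 (e k) (p.2 k)‖ := by
      unfold edgePt
      fun_prop
    obtain ⟨ρ, hρ, h⟩ := hC.exists_forall_le' hcont.continuousOn (a := 0) (by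
      rintro ⟨x, τ⟩ ⟨hx, hτ⟩
      refine lt_of_le_of_ne (Finset.sum_nonneg fun k _ => norm_nonneg _) fun h0 => he ?_
      have h1 := (Finset.sum_eq_zero_iff_of_nonneg fun k _ => norm_nonneg _).1 h0.symm
      refine exists_consecutive hn (hs x hx) (P := edgePt x (e 0) (τ 0)) fun k => ?_
      have := sub_eq_zero.1 (norm_eq_zero.1 (h1 k (Finset.mem_univ _)))
      simp only at this
      rw [this]
      exact edgePt_mem x _ (hτ k trivial))
    exact ⟨ρ, hρ, fun x hx τ hτ => h (x, τ) ⟨hx, hτ⟩⟩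
  choose ρ hρ h using H
  obtain ⟨r, hr, hle⟩ := exists_pos_forall_le hρ
  -- With `‖v‖ ≤ 2 * δ`, corners differ from corner 0 by at most `4 * δ`, and the passage from `y`
  -- to `x` costs `2 * δ`. Four terms of size `6 * δ` total less than `r` for `δ = r / 40`.
  refine ⟨r / 40, by positivity, fun x hx y hy hxy a v hv hb => ?_⟩
  by_contra! hcon
  choose e he using fun k => mem_boundary_iff.1 (hb k)
  have hne : ¬ ∃ i, ∀ k, e k = i ∨ e k = finRotate n i := fun ⟨i, hi⟩ =>
    hv (eq_zero_of_consecutive hn hy hi he)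
  choose τ h0 h1 hτ using fun k => mem_edge_iff.1 (he k)
  have hρr := (hle ⟨e, hne⟩).trans (h ⟨e, hne⟩ x hx τ fun k _ => ⟨h0 k, h1 k⟩)
  have hterm : ∀ k, ‖edgePt x (e 0) (τ 0) - edgePt x (e k) (τ k)‖ ≤ 6 * (r / 40) := by
    intro k
    have e1 := norm_edgePt_sub_le hxy (e 0) ⟨h0 0, h1 0⟩
    have e2 := norm_edgePt_sub_le hxy (e k) ⟨h0 k, h1 k⟩
    have e3 : ‖sqCoeff k * v‖ ≤ 2 * (2 * (r / 40)) := by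
      rw [norm_mul]
      gcongr
      exact norm_sqCoeff_le k
    have : edgePt x (e 0) (τ 0) - edgePt x (e k) (τ k) =
        (edgePt y (e k) (τ k) - edgePt x (e k) (τ k)) -
        (edgePt y (e 0) (τ 0) - edgePt x (e 0) (τ 0)) - sqCoeff k * v := by
      have a1 := hτ 0
      have a2 := hτ k
      simp only [sqCoeff_zero, zero_mul, add_zero] at a1
      linear_combination a2 - a1
    rw [this]
    have n1 := norm_sub_le ((edgePt y (e k) (τ k) - edgePt x (e k) (τ k)) -
        (edgePt y (e 0) (τ 0) - edgePt x (e 0) (τ 0))) (sqCoeff k * v)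
    have n2 := norm_sub_le (edgePt y (e k) (τ k) - edgePt x (e k) (τ k))
        (edgePt y (e 0) (τ 0) - edgePt x (e 0) (τ 0))
    linarith
  have hsum : ∑ k, ‖edgePt x (e 0) (τ 0) - edgePt x (e k) (τ k)‖ ≤ 4 * (6 * (r / 40)) := by
    refine (Finset.sum_le_card_nsmul _ _ _ fun k _ => hterm k).trans ?_
    simp
  simp only at hρr
  linarith

/-- A gap in the side lengths of inscribed squares persists for nearly inscribed squares. -/
theorem exists_gap {n : ℕ} {K : Set (Fin n → ℂ)} (hK : IsCompact K) {δ : ℝ} (hδ : 0 < δ)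
    (hs : ∀ x ∈ K, ∀ a v : ℂ, v ≠ 0 →
      (∀ k, a + sqCoeff k * v ∈ (Polygon.mk x).boundary ℝ) → 2 * δ < ‖v‖) :
    ∃ η > 0, ∀ x ∈ K, ∀ (e : Fin 4 → Fin n) (τ : Fin 4 → ℝ) (a v : ℂ),
      (∀ k, τ k ∈ Icc (0 : ℝ) 1) →
      (∀ k, ‖a + sqCoeff k * v - edgePt x (e k) (τ k)‖ ≤ η) → ‖v‖ < δ ∨ 2 * δ < ‖v‖ := by
  -- For sides in the compact range between `δ` and `2 * δ` there is no inscribed square, so the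
  -- defect, a continuous function, has a positive minimum.
  have H : ∀ e : Fin 4 → Fin n,
      ∃ ρ > 0, ∀ x ∈ K, ∀ τ ∈ Set.pi univ (fun _ : Fin 4 => Icc (0 : ℝ) 1),
        ∀ v ∈ {v : ℂ | δ ≤ ‖v‖ ∧ ‖v‖ ≤ 2 * δ},
        ρ ≤ ∑ k, ‖edgePt x (e 0) (τ 0) + sqCoeff k * v - edgePt x (e k) (τ k)‖ := by
    intro e
    have hA : IsCompact {v : ℂ | δ ≤ ‖v‖ ∧ ‖v‖ ≤ 2 * δ} := by
      have : IsClosed {v : ℂ | δ ≤ ‖v‖} := isClosed_le continuous_const continuous_norm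
      have h2 := (isCompact_closedBall (0 : ℂ) (2 * δ)).inter_left this
      convert h2 using 1
      ext v
      simp
    have hC := hK.prod ((isCompact_univ_pi fun _ : Fin 4 => isCompact_Icc (a := (0 : ℝ))
      (b := 1)).prod hA)
    have hcont : Continuous fun p : (Fin n → ℂ) × (Fin 4 → ℝ) × ℂ =>
        ∑ k, ‖edgePt p.1 (e 0) (p.2.1 0) + sqCoeff k * p.2.2 - edgePt p.1 (e k) (p.2.1 k)‖ := by
      unfold edgePt
      fun_prop
    obtain ⟨ρ, hρ, h⟩ := hC.exists_forall_le' hcont.continuousOn (a := 0) (by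
      rintro ⟨x, τ, v⟩ ⟨hx, hτ, hv⟩
      refine lt_of_le_of_ne (Finset.sum_nonneg fun k _ => norm_nonneg _) fun h0 => ?_
      have h1 := (Finset.sum_eq_zero_iff_of_nonneg fun k _ => norm_nonneg _).1 h0.symm
      have hv0 : v ≠ 0 := norm_pos_iff.1 (hδ.trans_le hv.1)
      refine absurd (hs x hx (edgePt x (e 0) (τ 0)) v hv0 fun k => ?_) (not_lt.2 hv.2)
      have := sub_eq_zero.1 (norm_eq_zero.1 (h1 k (Finset.mem_univ _)))
      simp only at this
      rw [this]
      exact mem_boundary_iff.2 ⟨_, edgePt_mem x _ (hτ k trivial)⟩)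
    exact ⟨ρ, hρ, fun x hx τ hτ v hv => h (x, τ, v) ⟨hx, hτ, hv⟩⟩
  choose ρ hρ h using H
  obtain ⟨r, hr, hle⟩ := exists_pos_forall_le hρ
  refine ⟨r / 16, by positivity, fun x hx e τ a v hτ hb => ?_⟩
  by_contra! hcon
  have hρr := (hle e).trans (h e x hx τ (fun k _ => hτ k) v hcon)
  have hterm : ∀ k, ‖edgePt x (e 0) (τ 0) + sqCoeff k * v - edgePt x (e k) (τ k)‖ ≤
      2 * (r / 16) := by
    intro k
    have e1 := hb 0
    have e2 := hb k
    simp only [sqCoeff_zero, zero_mul, add_zero] at e1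
    have : edgePt x (e 0) (τ 0) + sqCoeff k * v - edgePt x (e k) (τ k) =
        (a + sqCoeff k * v - edgePt x (e k) (τ k)) - (a - edgePt x (e 0) (τ 0)) := by ring
    rw [this]
    have n1 := norm_sub_le (a + sqCoeff k * v - edgePt x (e k) (τ k)) (a - edgePt x (e 0) (τ 0))
    linarith
  have hsum : ∑ k, ‖edgePt x (e 0) (τ 0) + sqCoeff k * v - edgePt x (e k) (τ k)‖ ≤
      4 * (2 * (r / 16)) := by
    refine (Finset.sum_le_card_nsmul _ _ _ fun k _ => hterm k).trans ?_
    simp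
  linarith

end SquarePeg

end

section

open Set Complex ComplexConjugate Filter Topology

namespace SquarePeg

/-! ### Counting inscribed squares with labelled corners -/

/-- The inscribed squares with a distinguished corner: pairs `(a, v)` such that the corners of the
square with a side from `a` to `a + v` lie on the polygon. -/
def labelledSquares {n : ℕ} (X : Polygon ℂ n) : Set (ℂ × ℂ) :=
  {p | p.2 ≠ 0 ∧ ∀ k, p.1 + sqCoeff k * p.2 ∈ X.boundary ℝ}

theorem range_squareCorner_mem {n : ℕ} {X : Polygon ℂ n} {p : ℂ × ℂ}
    (hp : p ∈ labelledSquares X) : range (squareCorner p.1 p.2) ∈ X.inscribedSquares := by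
  refine ⟨⟨p.1, p.2, hp.1, rfl⟩, ?_⟩
  rintro _ ⟨k, rfl⟩
  rw [squareCorner_apply]
  exact hp.2 k

theorem squareCorner_injective {a v : ℂ} (hv : v ≠ 0) : Function.Injective (squareCorner a v) := by
  intro k l h
  rw [squareCorner_apply, squareCorner_apply, add_right_inj] at h
  exact sqCoeff_injective (mul_right_cancel₀ hv h)

theorem mem_edgeLine_of_mem_edgeSet {n : ℕ} {X : Polygon ℂ n} {i : Fin n} {b : ℂ}
    (h : b ∈ X.edgeSet ℝ i) : b ∈ X.edgeLine i :=
  mem_line_of_mem_segment (by rwa [edgeSet_eq_segment] at h)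

/-- By genericity a labelled square is determined by a choice of four edges carrying its corners. -/
theorem finite_labelledSquares {n : ℕ} {X : Polygon ℂ n} (hX : X.IsGeneric) :
    (labelledSquares X).Finite := by
  choose f hf using fun p : labelledSquares X => fun k => mem_boundary_iff.1 (p.2.2 k)
  have hinj : Function.Injective f := by
    intro p q hpq
    obtain ⟨h1, h2⟩ := hX.square_unique (f p) p.1.1 p.1.2 q.1.1 q.1.2 p.2.1 q.2.1
      (fun k => by rw [squareCorner_apply]; exact mem_edgeLine_of_mem_edgeSet (hf p k))
      (fun k => by rw [squareCorner_apply, hpq]; exact mem_edgeLine_of_mem_edgeSet (hf q k))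
    exact Subtype.ext (Prod.ext h1 h2)
  exact Set.finite_coe_iff.1 (Finite.of_injective f hinj)

theorem exists_labelled {n : ℕ} {X : Polygon ℂ n} {S : Set ℂ} (hS : S ∈ X.inscribedSquares)
    {b : ℂ} (hb : b ∈ S) : ∃ v, (b, v) ∈ labelledSquares X ∧ S = range (squareCorner b v) := by
  obtain ⟨v, hv, rfl⟩ := IsSquareVertexSet.exists_eq hS.1 hb
  exact ⟨v, ⟨hv, fun k => hS.2 ⟨k, squareCorner_apply _ _ _⟩⟩, rfl⟩

theorem finite_inscribedSquares {n : ℕ} {X : Polygon ℂ n} (hX : X.IsGeneric) :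
    X.inscribedSquares.Finite := by
  refine ((finite_labelledSquares hX).image fun p => range (squareCorner p.1 p.2)).subset ?_
  intro S hS
  have hS' := hS
  obtain ⟨⟨a, v, hv, rfl⟩, h⟩ := hS'
  exact ⟨(a, v), ⟨hv, fun k => h ⟨k, squareCorner_apply _ _ _⟩⟩, rfl⟩

/-- A square is determined by a corner and its set of vertices. -/
theorem eq_of_range_eq {a v v' : ℂ} (hv : v ≠ 0) (hv' : v' ≠ 0)
    (h : range (squareCorner a v) = range (squareCorner a v')) : v = v' := by
  -- The sum of the vertices depends only on the set and recovers the side.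
  have key : ∀ w : ℂ, w ≠ 0 → ∑ᶠ x ∈ range (squareCorner a w), x = 4 * a + (2 + 2 * I) * w := by
    intro w hw
    rw [finsum_mem_range (squareCorner_injective hw), finsum_eq_sum_of_fintype,
      Fin.sum_univ_four]
    simp only [squareCorner_apply, sqCoeff_zero, sqCoeff_one, sqCoeff_two, sqCoeff_three]
    ring
  have h1 := key v hv
  rw [h, key v' hv'] at h1
  have h2 : (2 + 2 * I : ℂ) ≠ 0 := fun h => by
    have := congrArg re h
    norm_num at this
  exact (mul_left_cancel₀ h2 (add_left_cancel h1)).symm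

theorem ncard_labelledSquares {n : ℕ} {X : Polygon ℂ n} (hX : X.IsGeneric) :
    (labelledSquares X).ncard = 4 * X.inscribedSquares.ncard := by
  have := (finite_inscribedSquares hX).to_subtype
  have : Fintype X.inscribedSquares := Fintype.ofFinite _
  have hcard : ∀ S : X.inscribedSquares, Nat.card (S : Set ℂ) = 4 := by
    rintro ⟨_, ⟨a, v, hv, rfl⟩, -⟩
    rw [Nat.card_congr (Equiv.ofInjective _ (squareCorner_injective hv)).symm]
    simp
  have : ∀ S : X.inscribedSquares, Finite (S : Set ℂ) := fun S =>
    Nat.finite_of_card_ne_zero (by rw [hcard]; norm_num)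
  -- A labelled square amounts to a square together with its first corner, and there are four
  -- choices of that corner.
  let f : labelledSquares X → Σ S : X.inscribedSquares, (S : Set ℂ) := fun p =>
    ⟨⟨range (squareCorner p.1.1 p.1.2), range_squareCorner_mem p.2⟩, p.1.1,
      ⟨0, by simp [squareCorner_apply]⟩⟩
  have hf : Function.Bijective f := by
    constructor
    · rintro ⟨⟨a, v⟩, hp⟩ ⟨⟨a', v'⟩, hp'⟩ h
      simp only [f, Sigma.mk.injEq, Subtype.mk.injEq] at h
      obtain ⟨h1, h2⟩ := h
      have ha : a = a' := by
        have := (Subtype.heq_iff_coe_eq (fun x => by rw [h1])).1 h2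
        exact this
      subst ha
      have := eq_of_range_eq hp.1 hp'.1 h1
      simp only at this
      subst this
      rfl
    · rintro ⟨⟨S, hS⟩, b, hb⟩
      obtain ⟨v, hv, rfl⟩ := exists_labelled hS hb
      exact ⟨⟨(b, v), hv⟩, rfl⟩
  rw [← Nat.card_coe_set_eq, Nat.card_congr (Equiv.ofBijective f hf), Nat.card_sigma]
  simp only [hcard]
  rw [Finset.sum_const, smul_eq_mul, mul_comm, Finset.card_univ, ← Nat.card_eq_fintype_card,
    Nat.card_coe_set_eq]

/-- The edge containing a point of a simple polygon that is not a vertex is unique. -/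
theorem edge_unique {n : ℕ} {X : Polygon ℂ n} (hX : X.IsSimple) {P : ℂ} (hP : ∀ i, P ≠ X i)
    {i j : Fin n} (hi : P ∈ X.edgeSet ℝ i) (hj : P ∈ X.edgeSet ℝ j) : i = j := by
  by_contra hij
  by_cases h1 : j = finRotate n i
  · subst h1
    have : P ∈ X.edgeSet ℝ i ∩ X.edgeSet ℝ (finRotate n i) := ⟨hi, hj⟩
    rw [hX.consecutive] at this
    exact hP _ this
  by_cases h2 : i = finRotate n j
  · subst h2
    have : P ∈ X.edgeSet ℝ j ∩ X.edgeSet ℝ (finRotate n j) := ⟨hj, hi⟩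
    rw [hX.consecutive] at this
    exact hP _ this
  exact disjoint_left.1 (hX.disjoint i j hij h1 h2) hi hj

theorem corner_ne_vertex {n : ℕ} {X : Polygon ℂ n} (hX : X.IsGeneric) {p : ℂ × ℂ}
    (hp : p ∈ labelledSquares X) (k : Fin 4) (i : Fin n) : p.1 + sqCoeff k * p.2 ≠ X i := by
  intro h
  refine hX.vertex_notMem _ (range_squareCorner_mem hp) i ?_
  rw [← h, ← squareCorner_apply]
  exact mem_range_self k

/-! ### Subdivisions of polygons -/

/-- A subdivision of the edges of `n`-gons. The piece `j` is the part of the edge `edge j` between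
the parameters `lo j` and `hi j`. -/
structure Subdivision (n : ℕ) (ι : Type*) where
  /-- The cyclic order of the pieces. -/
  perm : Equiv.Perm ι
  /-- The edge containing a piece. -/
  edge : ι → Fin n
  /-- The parameter of the initial point of a piece. -/
  lo : ι → ℝ
  /-- The parameter of the end point of a piece. -/
  hi : ι → ℝ
  lo_nonneg : ∀ j, 0 ≤ lo j
  lt : ∀ j, lo j < hi j
  hi_le : ∀ j, hi j ≤ 1
  perm_ne : ∀ j, perm j ≠ j
  succ : ∀ (x : Fin n → ℂ) (j : ι),
    edgePt x (edge (perm j)) (lo (perm j)) = edgePt x (edge j) (hi j)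
  cover : ∀ (i : Fin n) (s : ℝ), 0 ≤ s → s ≤ 1 → ∃ j, edge j = i ∧ lo j ≤ s ∧ s ≤ hi j
  unique : ∀ j j' s, edge j = edge j' → lo j < s → s < hi j → lo j' < s → s < hi j' → j = j'

namespace Subdivision

variable {n : ℕ} {ι : Type*} (D : Subdivision n ι)

/-- The vertices of the subdivided polygon. -/
noncomputable def pts (x : Fin n → ℂ) (j : ι) : ℂ := edgePt x (D.edge j) (D.lo j)

theorem pts_perm (x : Fin n → ℂ) (j : ι) : D.pts x (D.perm j) = edgePt x (D.edge j) (D.hi j) :=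
  D.succ x j

theorem pts_sub (x : Fin n → ℂ) (j : ι) :
    D.pts x (D.perm j) - D.pts x j = (D.hi j - D.lo j) • edgeDir x (D.edge j) := by
  rw [pts_perm]
  simp only [pts, edgePt, edgeDir, real_smul]
  push_cast
  ring

theorem mem_piece_iff {x : Fin n → ℂ} {j : ι} {b : ℂ} : b ∈ piece D.perm (D.pts x) j ↔
    ∃ s, D.lo j ≤ s ∧ s ≤ D.hi j ∧ b = edgePt x (D.edge j) s := by
  have hlt := D.lt j
  rw [piece, mem_segment_iff]
  constructor
  · rintro ⟨t, h0, h1, rfl⟩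
    refine ⟨D.lo j + t * (D.hi j - D.lo j), by nlinarith, by nlinarith, ?_⟩
    rw [pts_sub]
    simp only [pts, edgePt, edgeDir, real_smul]
    push_cast
    ring
  · rintro ⟨s, h0, h1, rfl⟩
    have hne : D.hi j - D.lo j ≠ 0 := (sub_pos.2 hlt).ne'
    refine ⟨(s - D.lo j) / (D.hi j - D.lo j), div_nonneg (by linarith) (by linarith),
      (div_le_one (sub_pos.2 hlt)).2 (by linarith), ?_⟩
    rw [pts_sub, smul_smul, div_mul_cancel₀ _ hne]
    simp only [pts, edgePt, edgeDir, real_smul]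
    push_cast
    ring

theorem piece_subset (x : Fin n → ℂ) (j : ι) :
    piece D.perm (D.pts x) j ⊆ (Polygon.mk x).edgeSet ℝ (D.edge j) := by
  intro b hb
  obtain ⟨s, h0, h1, rfl⟩ := D.mem_piece_iff.1 hb
  exact edgePt_mem x _ ⟨(D.lo_nonneg j).trans h0, h1.trans (D.hi_le j)⟩

/-- No vertex of the subdivided polygon is a corner of an inscribed square. -/
def Avoids (x : Fin n → ℂ) : Prop :=
  ∀ p ∈ labelledSquares (Polygon.mk x), ∀ k j, p.1 + sqCoeff k * p.2 ≠ D.pts x j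

theorem interior_of_corner {x : Fin n → ℂ} (hD : D.Avoids x) {p : ℂ × ℂ}
    (hp : p ∈ labelledSquares (Polygon.mk x)) {k : Fin 4} {j : ι} {s : ℝ} (h0 : D.lo j ≤ s)
    (h1 : s ≤ D.hi j) (h : p.1 + sqCoeff k * p.2 = edgePt x (D.edge j) s) :
    D.lo j < s ∧ s < D.hi j := by
  refine ⟨lt_of_le_of_ne h0 ?_, lt_of_le_of_ne h1 ?_⟩
  · rintro rfl
    exact hD p hp k j h
  · rintro rfl
    exact hD p hp k (D.perm j) (by rw [h, pts_perm])

theorem edgePt_injective {x : Fin n → ℂ} {i : Fin n} (h : x (finRotate n i) ≠ x i) :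
    Function.Injective (edgePt x i) := by
  intro s t hst
  simp only [edgePt, add_right_inj] at hst
  exact smul_left_injective ℝ (sub_ne_zero.2 h) hst

theorem piece_unique (hn : 2 ≤ n) {x : Fin n → ℂ} (hx : (Polygon.mk x).IsSimple)
    (hg : (Polygon.mk x).IsGeneric) (hD : D.Avoids x)
    {p : ℂ × ℂ} (hp : p ∈ labelledSquares (Polygon.mk x)) {k : Fin 4} {j j' : ι}
    (hj : p.1 + sqCoeff k * p.2 ∈ piece D.perm (D.pts x) j)
    (hj' : p.1 + sqCoeff k * p.2 ∈ piece D.perm (D.pts x) j') : j = j' := by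
  have he : D.edge j = D.edge j' := edge_unique hx (corner_ne_vertex hg hp k)
    (D.piece_subset x _ hj) (D.piece_subset x _ hj')
  obtain ⟨s, h0, h1, hs⟩ := D.mem_piece_iff.1 hj
  obtain ⟨s', h0', h1', hs'⟩ := D.mem_piece_iff.1 hj'
  have : s = s' := by
    refine edgePt_injective (x := x) (i := D.edge j) (fun h => finRotate_ne hn _ (hx.injective h))
      ?_
    rw [← hs, hs', he]
  subst this
  obtain ⟨a1, a2⟩ := D.interior_of_corner hD hp h0 h1 hs
  obtain ⟨b1, b2⟩ := D.interior_of_corner hD hp h0' h1' hs'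
  exact D.unique j j' s he a1 a2 b1 b2

/-- The quadruples of pieces carrying a square correspond to the labelled squares. -/
theorem hitCount_eq (hn : 2 ≤ n) {x : Fin n → ℂ} (hx : (Polygon.mk x).IsSimple)
    (hg : (Polygon.mk x).IsGeneric) (hD : D.Avoids x) {r : ℝ} (hr : 0 < r)
    (hbig : ∀ p ∈ labelledSquares (Polygon.mk x), r ≤ ‖p.2‖) :
    hitCount D.perm (D.pts x) r = 4 * (Polygon.mk x).inscribedSquares.ncard := by
  rw [← ncard_labelledSquares hg, ← Nat.card_coe_set_eq, hitCount]
  have hex : ∀ (p : labelledSquares (Polygon.mk x)) (k : Fin 4),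
      ∃ j, p.1.1 + sqCoeff k * p.1.2 ∈ piece D.perm (D.pts x) j := by
    intro p k
    obtain ⟨i, hi⟩ := mem_boundary_iff.1 (p.2.2 k)
    obtain ⟨s, h0, h1, hs⟩ := mem_edge_iff.1 hi
    obtain ⟨j, rfl, hj0, hj1⟩ := D.cover i s h0 h1
    exact ⟨j, D.mem_piece_iff.2 ⟨s, hj0, hj1, hs⟩⟩
  choose f hf using hex
  let F : labelledSquares (Polygon.mk x) →
      {e : Fin 4 → ι // FitsBig r fun k => piece D.perm (D.pts x) (e k)} :=
    fun p => ⟨f p, p.1.1, p.1.2, hbig p.1 p.2, hf p⟩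
  refine (Nat.card_congr (Equiv.ofBijective F ⟨?_, ?_⟩)).symm
  -- Injectivity uses uniqueness of the square on given lines. Surjectivity needs that a corner lies
  -- on a single piece, which is where `Avoids` enters.
  · intro p q hpq
    have hpq' : f p = f q := congrArg Subtype.val hpq
    obtain ⟨h1, h2⟩ := hg.square_unique (fun k => D.edge (f p k)) p.1.1 p.1.2 q.1.1 q.1.2
      p.2.1 q.2.1
      (fun k => by
        rw [squareCorner_apply]
        exact mem_edgeLine_of_mem_edgeSet (D.piece_subset x _ (hf p k)))
      (fun k => by
        rw [squareCorner_apply, hpq']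
        exact mem_edgeLine_of_mem_edgeSet (D.piece_subset x _ (hf q k)))
    exact Subtype.ext (Prod.ext h1 h2)
  · rintro ⟨e, a, v, hv, he⟩
    have hp : (a, v) ∈ labelledSquares (Polygon.mk x) :=
      ⟨norm_pos_iff.1 (hr.trans_le hv), fun k =>
        mem_boundary_iff.2 ⟨_, D.piece_subset x _ (he k)⟩⟩
    refine ⟨⟨(a, v), hp⟩, Subtype.ext (funext fun k => ?_)⟩
    exact D.piece_unique hn hx hg hD hp (hf ⟨(a, v), hp⟩ k) (he k)

end Subdivision

end SquarePeg

end

section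

open Set Complex ComplexConjugate Filter Topology

namespace SquarePeg

/-! ### Stability of the number of squares under small perturbations -/

section Stability

variable {ι : Type*} (σ : Equiv.Perm ι)

/-- The point of a piece with a given parameter. -/
noncomputable def piecePt (W : ι → ℂ) (i : ι) (s : ℝ) : ℂ := W i + s • (W (σ i) - W i)

theorem fitsBig_piece_iff {W : ι → ℂ} {r : ℝ} {e : Fin 4 → ι} :
    (FitsBig r fun k => piece σ W (e k)) ↔ ∃ τ : Fin 4 → unitInterval,
      r ≤ ‖piecePt σ W (e 1) (τ 1) - piecePt σ W (e 0) (τ 0)‖ ∧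
      ∀ k, piecePt σ W (e 0) (τ 0) +
        sqCoeff k * (piecePt σ W (e 1) (τ 1) - piecePt σ W (e 0) (τ 0)) =
          piecePt σ W (e k) (τ k) := by
  constructor
  · rintro ⟨a, v, hv, h⟩
    choose τ h0 h1 hτ using fun k => mem_segment_iff.1 (h k)
    have e0 := hτ 0
    have e1 := hτ 1
    simp only [sqCoeff_zero, sqCoeff_one, zero_mul, one_mul, add_zero] at e0 e1
    have hv' : v = piecePt σ W (e 1) (τ 1) - piecePt σ W (e 0) (τ 0) := by
      rw [piecePt, piecePt, ← e0, ← e1]; ring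
    refine ⟨fun k => ⟨τ k, h0 k, h1 k⟩, ?_, fun k => ?_⟩
    · simpa only [← hv'] using hv
    · simp only [← hv']
      rw [piecePt, ← e0, hτ k, piecePt]
  · rintro ⟨τ, hv, h⟩
    refine ⟨piecePt σ W (e 0) (τ 0), _, hv, fun k => ?_⟩
    rw [h k]
    exact mem_segment_iff.2 ⟨τ k, (τ k).2.1, (τ k).2.2, rfl⟩

/-- The parameters on the pieces range over a compact cube, and projection along a compact factor is
a closed map. The side bound is weak, hence closed. -/
theorem isClosed_fitsBig (r : ℝ) (e : Fin 4 → ι) :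
    IsClosed {W : ι → ℂ | FitsBig r fun k => piece σ W (e k)} := by
  have hC : IsClosed {p : (ι → ℂ) × (Fin 4 → unitInterval) |
      r ≤ ‖piecePt σ p.1 (e 1) (p.2 1) - piecePt σ p.1 (e 0) (p.2 0)‖ ∧
      ∀ k, piecePt σ p.1 (e 0) (p.2 0) +
        sqCoeff k * (piecePt σ p.1 (e 1) (p.2 1) - piecePt σ p.1 (e 0) (p.2 0)) =
          piecePt σ p.1 (e k) (p.2 k)} := by
    unfold piecePt
    refine IsClosed.and (isClosed_le (by fun_prop) (by fun_prop)) ?_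
    rw [ofPred_forall]
    exact isClosed_iInter fun k => isClosed_eq (by fun_prop) (by fun_prop)
  have := isClosedMap_fst_of_compactSpace _ hC
  convert this using 1
  ext W
  simp only [mem_ofPred_eq, fitsBig_piece_iff, mem_image, Prod.exists, exists_and_right,
    exists_eq_right]

/-- A square in general position persists under small perturbations. -/
theorem eventually_fitsBig {V : ι → ℂ} {r : ℝ} {e : Fin 4 → ι} {a v : ℂ} {τ : Fin 4 → ℝ}
    (hdet : (sqMatrix fun k => V (σ (e k)) - V (e k)).det ≠ 0) (hv : r < ‖v‖)
    (h0 : ∀ k, 0 < τ k) (h1 : ∀ k, τ k < 1)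
    (h : ∀ k, a + sqCoeff k * v = piecePt σ V (e k) (τ k)) :
    ∀ᶠ W in 𝓝 V, FitsBig r fun k => piece σ W (e k) := by
  set d : (ι → ℂ) → Fin 4 → ℂ := fun W k => W (σ (e k)) - W (e k) with hd
  set M : (ι → ℂ) → Matrix (Fin 4) (Fin 4) ℝ := fun W => sqMatrix (d W) with hM
  have hMc : Continuous M := by
    refine continuous_matrix fun k l => ?_
    simp only [hM, hd, sqMatrix]
    fin_cases l <;> simp <;> fun_prop
  set b : (ι → ℂ) → Fin 4 → ℝ := fun W k => crs (d W k) (W (e k)) with hb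
  have hbc : Continuous b := by
    simp only [hb, hd, crs]
    fun_prop
  -- Cramer's rule gives the square on the four lines as a function of the vertices, continuous near
  -- `V`.
  set y : (ι → ℂ) → Fin 4 → ℝ := fun W => (M W)⁻¹.mulVec (b W) with hy
  have hyc : ContinuousAt y V := by
    have h1 : ContinuousAt (fun W => (M W)⁻¹) V := by
      simp only [Matrix.inv_def, Ring.inverse_eq_inv']
      exact (hMc.matrix_det.continuousAt.inv₀ hdet).smul hMc.matrix_adjugate.continuousAt
    have h2 := h1.prodMk hbc.continuousAt
    exact (Continuous.matrix_mulVec continuous_fst continuous_snd).continuousAt.comp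
      (f := fun W => ((M W)⁻¹, b W)) h2
  set A : (ι → ℂ) → ℂ := fun W => ⟨y W 0, y W 1⟩ with hA
  set U : (ι → ℂ) → ℂ := fun W => ⟨y W 2, y W 3⟩ with hU
  have hyi : ∀ i, ContinuousAt (fun W => y W i) V := fun i => continuousAt_pi.1 hyc i
  have hmk : ∀ {f g : (ι → ℂ) → ℝ}, ContinuousAt f V → ContinuousAt g V →
      ContinuousAt (fun W => (⟨f W, g W⟩ : ℂ)) V := by
    intro f g hf hg
    have : (fun W => (⟨f W, g W⟩ : ℂ)) = fun W => (f W : ℂ) + g W * I := by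
      funext W; exact mk_eq_add_mul_I _ _
    rw [this]
    exact (continuous_ofReal.continuousAt.comp hf).add
      ((continuous_ofReal.continuousAt.comp hg).mul continuousAt_const)
  have hAc : ContinuousAt A V := hmk (hyi 0) (hyi 1)
  have hUc : ContinuousAt U V := hmk (hyi 2) (hyi 3)
  have hsol : ∀ W, (M W).det ≠ 0 → ∀ k, crs (d W k) (A W + sqCoeff k * U W - W (e k)) = 0 := by
    intro W hW k
    have : (M W).mulVec (y W) = b W := by
      rw [hy]
      simp only
      rw [Matrix.mulVec_mulVec, Matrix.mul_nonsing_inv _ (isUnit_iff_ne_zero.2 hW),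
        Matrix.one_mulVec]
    have hyW : y W = ![(A W).re, (A W).im, (U W).re, (U W).im] := by
      funext k; fin_cases k <;> rfl
    rw [hyW, hM, sqMatrix_mulVec] at this
    have hk := congrFun this k
    simp only [hb] at hk
    rw [crs_sub, hk, sub_self]
  have hVsol : A V = a ∧ U V = v := by
    have h2 := eq_zero_of_sqMatrix_det hdet (a := A V - a) (v := U V - v) fun k => by
      have e1 := hsol V hdet k
      have e2 : crs (d V k) (a + sqCoeff k * v - V (e k)) = 0 := by
        rw [h k, piecePt, add_sub_cancel_left, crs_smul]
        simp only [hd]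
        rw [crs_self, mul_zero]
      have : A V - a + sqCoeff k * (U V - v) =
        (A V + sqCoeff k * U V - V (e k)) - (a + sqCoeff k * v - V (e k)) := by ring
      rw [this, crs_sub, e1]
      simp only [hd] at e2 ⊢
      rw [e2, sub_zero]
    exact ⟨sub_eq_zero.1 h2.1, sub_eq_zero.1 h2.2⟩
  have hdV : ∀ k, d V k ≠ 0 := ne_zero_of_sqMatrix_det hdet
  -- These are the positions of the corners on their lines; at `V` they are strictly between 0 and 1
  -- and remain so nearby.
  set s : Fin 4 → (ι → ℂ) → ℝ := fun k W => ((A W + sqCoeff k * U W - W (e k)) / d W k).re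
    with hs
  have hdc : ∀ k, Continuous fun W => d W k := fun k => by simp only [hd]; fun_prop
  have hsc : ∀ k, ContinuousAt (s k) V := by
    intro k
    refine continuous_re.continuousAt.comp (ContinuousAt.div₀ ?_ (hdc k).continuousAt (hdV k))
    exact ((hAc.add (continuousAt_const.mul hUc)).sub (continuous_apply _).continuousAt)
  have hsV : ∀ k, s k V = τ k := by
    intro k
    have : A V + sqCoeff k * U V - V (e k) = τ k * d V k := by
      rw [hVsol.1, hVsol.2, h k]
      simp [piecePt, hd]
    simp only [hs, this, mul_div_assoc, div_self (hdV k), mul_one, ofReal_re]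
  have E1 : ∀ᶠ W in 𝓝 V, (M W).det ≠ 0 :=
    hMc.matrix_det.continuousAt.eventually_ne hdet
  have E2 : ∀ᶠ W in 𝓝 V, ∀ k, d W k ≠ 0 :=
    eventually_all.2 fun k => (hdc k).continuousAt.eventually_ne (hdV k)
  have E3 : ∀ᶠ W in 𝓝 V, r < ‖U W‖ :=
    hUc.norm.eventually_const_lt (by simpa only [hVsol.2] using hv)
  have E4 : ∀ᶠ W in 𝓝 V, ∀ k, 0 < s k W :=
    eventually_all.2 fun k => (hsc k).eventually_const_lt (by rw [hsV]; exact h0 k)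
  have E5 : ∀ᶠ W in 𝓝 V, ∀ k, s k W < 1 :=
    eventually_all.2 fun k => (hsc k).eventually_lt_const (by rw [hsV]; exact h1 k)
  filter_upwards [E1, E2, E3, E4, E5] with W w1 w2 w3 w4 w5
  refine ⟨A W, U W, w3.le, fun k => mem_segment_iff.2 ⟨s k W, (w4 k).le, (w5 k).le, ?_⟩⟩
  obtain ⟨t, ht⟩ := (crs_eq_zero_iff (w2 k) _).1 (hsol W w1 k)
  have : s k W = t := by
    simp only [hs, ht, real_smul, mul_div_assoc, div_self (w2 k), mul_one, ofReal_re]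
  rw [this, ← sub_eq_iff_eq_add']
  exact ht

end Stability

theorem crs_smul_left (z w : ℂ) (t : ℝ) : crs (t • z) w = t * crs z w := by
  simp [crs]; ring

theorem edgeDir_ne_zero {n : ℕ} (hn : 2 ≤ n) {x : Fin n → ℂ} (hx : (Polygon.mk x).IsSimple)
    (i : Fin n) : edgeDir x i ≠ 0 :=
  sub_ne_zero.2 fun h => finRotate_ne hn i (hx.injective h)

/-- The lines carrying an inscribed square of a generic polygon are in general position. -/
theorem det_ne_zero_of_isGeneric {n : ℕ} (hn : 2 ≤ n) {x : Fin n → ℂ}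
    (hx : (Polygon.mk x).IsSimple)
    (hg : (Polygon.mk x).IsGeneric) {a v : ℂ} (hv : v ≠ 0) {e : Fin 4 → Fin n}
    (h : ∀ k, a + sqCoeff k * v ∈ (Polygon.mk x).edgeSet ℝ (e k)) {c : Fin 4 → ℝ}
    (hc : ∀ k, c k ≠ 0) : (sqMatrix fun k => c k • edgeDir x (e k)).det ≠ 0 := by
  refine sqMatrix_det_ne_zero fun a' v' h' => ?_
  have hl : ∀ k, crs (edgeDir x (e k)) (a' + sqCoeff k * v') = 0 := by
    intro k
    have := h' k
    rw [crs_smul_left] at this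
    exact (mul_eq_zero.1 this).resolve_left (hc k)
  -- A kernel vector would produce a whole pencil of squares on the same four lines, contradicting
  -- uniqueness.
  have hline : ∀ s : ℝ, ∀ k, squareCorner (a + s • a') (v + s • v') k ∈
      (Polygon.mk x).edgeLine (e k) := by
    intro s k
    rw [edgeLine_def, mem_line_iff (sub_ne_zero.1 (edgeDir_ne_zero hn hx _)).symm,
      squareCorner_apply]
    have h1 := crs_corner_eq_zero (mem_edgeLine_of_mem_edgeSet (h k))
    have : a + s • a' + sqCoeff k * (v + s • v') - x (e k) =
        (a + sqCoeff k * v - x (e k)) + s • (a' + sqCoeff k * v') := by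
      simp only [real_smul]; ring
    rw [this, ← edgeDir, crs_add, h1, crs_smul, hl k]
    simp
  have key : ∀ s : ℝ, s ≠ 0 → v + s • v' ≠ 0 → a' = 0 ∧ v' = 0 := by
    intro s hs hne
    have h0 := hline 0
    simp only [zero_smul, add_zero] at h0
    obtain ⟨e1, e2⟩ := hg.square_unique e _ _ _ _ hne hv (hline s) h0
    rw [add_eq_left, smul_eq_zero] at e1 e2
    exact ⟨e1.resolve_left hs, e2.resolve_left hs⟩
  -- Uniqueness applies only to nondegenerate squares. Since `v ≠ 0`, at least one of the parameters
  -- 1 and 2 gives such a square.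
  by_cases h1 : v + (1 : ℝ) • v' = 0
  · refine key 2 two_ne_zero fun h2 => hv ?_
    simp only [real_smul] at h1 h2
    push_cast at h1 h2
    linear_combination 2 * h1 - h2
  · exact key 1 one_ne_zero h1

/-- For each quadruple of pieces, carrying a large square is a stable property: if it holds,
transversality preserves it (the sides exceed `r` strictly and no corner is an endpoint); if it
fails, it fails nearby by closedness. -/
theorem Subdivision.eventually_hitCount_eq {n : ℕ} {ι : Type*} [Finite ι] (D : Subdivision n ι)
    (hn : 2 ≤ n)
    {x : Fin n → ℂ} (hx : (Polygon.mk x).IsSimple) (hg : (Polygon.mk x).IsGeneric)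
    (hD : D.Avoids x) {r : ℝ} (hr : 0 < r)
    (hbig : ∀ p ∈ labelledSquares (Polygon.mk x), r < ‖p.2‖) :
    ∀ᶠ W in 𝓝 (D.pts x), hitCount D.perm W r = hitCount D.perm (D.pts x) r := by
  have key : ∀ e : Fin 4 → ι, ∀ᶠ W in 𝓝 (D.pts x),
      ((FitsBig r fun k => piece D.perm W (e k)) ↔
        FitsBig r fun k => piece D.perm (D.pts x) (e k)) := by
    intro e
    by_cases hF : FitsBig r fun k => piece D.perm (D.pts x) (e k)
    · obtain ⟨a, v, hv, h⟩ := hF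
      have hv0 : v ≠ 0 := norm_pos_iff.1 (hr.trans_le hv)
      have hp : (a, v) ∈ labelledSquares (Polygon.mk x) :=
        ⟨hv0, fun k => mem_boundary_iff.2 ⟨_, D.piece_subset x _ (h k)⟩⟩
      choose τ h0 h1 hτ using fun k => mem_segment_iff.1 (h k)
      have hdet : (sqMatrix fun k => D.pts x (D.perm (e k)) - D.pts x (e k)).det ≠ 0 := by
        simp only [D.pts_sub]
        exact det_ne_zero_of_isGeneric hn hx hg hv0 (fun k => D.piece_subset x _ (h k))
          fun k => (sub_pos.2 (D.lt _)).ne'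
      have hτ0 : ∀ k, 0 < τ k := fun k => lt_of_le_of_ne (h0 k) fun h' =>
        hD _ hp k (e k) (by rw [hτ k, ← h']; simp)
      have hτ1 : ∀ k, τ k < 1 := fun k => lt_of_le_of_ne (h1 k) fun h' =>
        hD _ hp k (D.perm (e k)) (by rw [hτ k, h']; simp)
      filter_upwards [eventually_fitsBig D.perm hdet (hbig _ hp) hτ0 hτ1 hτ] with W hW
      exact ⟨fun _ => ⟨a, v, hv, h⟩, fun _ => hW⟩
    · filter_upwards [(isClosed_fitsBig D.perm r e).isOpen_compl.mem_nhds hF] with W hW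
      exact ⟨fun h => absurd h hW, fun h => absurd h hF⟩
  filter_upwards [eventually_all.2 key] with W hW
  exact Nat.card_congr (Equiv.subtypeEquivRight hW)

end SquarePeg

end

section

open Set Complex ComplexConjugate Filter Topology

namespace SquarePeg

/-! ### Existence of fine subdivisions -/

/-- The grid of step `h` has its inner points shifted by a common `θ` in `(0, h)`, of which only
finitely many values are bad. The first gap may reach `2 * h`, so the step is chosen below `ε / 2`.
-/
theorem exists_breakpoints {ε : ℝ} (hε : 0 < ε) {B : Set ℝ} (hB : B.Finite) (hB0 : 0 ∉ B) :
    ∃ (m : ℕ) (t : ℕ → ℝ), t 0 = 0 ∧ t (m + 1) = 1 ∧ (∀ k ≤ m, t k < t (k + 1)) ∧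
      (∀ k ≤ m, t (k + 1) - t k ≤ ε) ∧ ∀ k ≤ m, t k ∉ B := by
  obtain ⟨m, hm⟩ := exists_nat_one_div_lt (half_pos hε)
  have hN : (0 : ℝ) < m + 1 := by positivity
  set h : ℝ := 1 / (m + 1) with hh
  have hNh : (m + 1) * h = 1 := mul_one_div_cancel hN.ne'
  have hpos : 0 < h := by positivity
  have hfin : (⋃ k ∈ Finset.range (m + 1), (fun b => b - k * h) '' B).Finite :=
    (Finset.range (m + 1)).finite_toSet.biUnion fun k _ => hB.image _
  obtain ⟨θ, ⟨hθ0, hθ1⟩, hθ⟩ := ((Ioo_infinite hpos).sdiff hfin).nonempty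
  refine ⟨m, fun k => if k = 0 then 0 else if k = m + 1 then 1 else k * h + θ, by simp, by simp,
    ?_, ?_, ?_⟩
  · intro k hk
    by_cases h0 : k = 0 <;> by_cases h1 : k = m
    · subst h0; subst h1; simp
    · subst h0
      simp [Ne.symm h1]
      positivity
    · subst h1
      simp [h0]
      nlinarith
    · simp [h0, h1, show k ≠ m + 1 by omega]
      nlinarith
  · intro k hk
    by_cases h0 : k = 0 <;> by_cases h1 : k = m
    · subst h0; subst h1; simp at hNh ⊢; linarith
    · subst h0
      simp [Ne.symm h1]
      linarith
    · subst h1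
      simp [h0]
      nlinarith
    · simp [h0, h1, show k ≠ m + 1 by omega]
      nlinarith
  · intro k hk
    by_cases h0 : k = 0
    · simpa [h0] using hB0
    · simp only [h0, if_false, show k ≠ m + 1 by omega]
      intro hmem
      refine hθ (mem_iUnion₂.2 ⟨k, Finset.mem_range.2 (by omega), _, hmem, by simp⟩)

/-- Subdivide every edge of an `n`-gon in the same way. -/
noncomputable def Subdivision.ofBreakpoints {n : ℕ} (hn : 2 ≤ n) {m : ℕ} {t : ℕ → ℝ}
    (h0 : t 0 = 0) (h1 : t (m + 1) = 1) (hlt : ∀ k ≤ m, t k < t (k + 1)) :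
    Subdivision n (Fin n × Fin (m + 1)) where
  perm := Equiv.ofBijective
    (fun p => (if p.2 = Fin.last m then finRotate n p.1 else p.1, p.2 + 1))
    (Finite.injective_iff_bijective.1 (by
      rintro ⟨i, s⟩ ⟨i', s'⟩ h
      simp only [Prod.mk.injEq, add_left_inj] at h
      obtain ⟨h, rfl⟩ := h
      by_cases hs : s = Fin.last m
      · rw [if_pos hs, if_pos hs] at h
        exact Prod.ext ((finRotate n).injective h) rfl
      · rw [if_neg hs, if_neg hs] at h
        exact Prod.ext h rfl))
  edge := fun p => p.1
  lo := fun p => t p.2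
  hi := fun p => t (p.2 + 1)
  lo_nonneg := fun p => by
    have : ∀ k ≤ m, 0 ≤ t k := by
      intro k
      induction k with
      | zero => intro _; rw [h0]
      | succ k ih => intro hk; exact (ih (by omega)).trans (hlt k (by omega)).le
    exact this _ (by omega)
  lt := fun p => hlt _ (by omega)
  hi_le := fun p => by
    have : ∀ k ≤ m, t (m + 1 - k) ≤ 1 := by
      intro k
      induction k with
      | zero => intro _; rw [Nat.sub_zero, h1]
      | succ k ih =>
        intro hk
        refine le_trans ?_ (ih (by omega))
        have := hlt (m + 1 - (k + 1)) (by omega)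
        rw [show m + 1 - (k + 1) + 1 = m + 1 - k by omega] at this
        exact this.le
    have := this (m - p.2) (by omega)
    rwa [show m + 1 - (m - (p.2 : ℕ)) = p.2 + 1 by omega] at this
  perm_ne := by
    rintro ⟨i, s⟩ h
    simp only [Equiv.ofBijective_apply, Prod.mk.injEq] at h
    obtain ⟨h, hs⟩ := h
    by_cases hl : s = Fin.last m
    · rw [if_pos hl] at h
      exact finRotate_ne hn i h
    · have := congrArg Fin.val hs
      rw [Fin.val_add_one, if_neg hl] at this
      omega
  succ := by
    rintro x ⟨i, s⟩
    simp only [Equiv.ofBijective_apply]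
    by_cases hl : s = Fin.last m
    · rw [if_pos hl, hl]
      simp [edgePt, h0, h1, -finRotate_apply]
    · rw [if_neg hl, Fin.val_add_one, if_neg hl]
  cover := by
    intro i s hs0 hs1
    have : ∀ k ≤ m + 1, s ≤ t k → ∃ j ≤ m, t j ≤ s ∧ s ≤ t (j + 1) := by
      intro k
      induction k with
      | zero =>
        intro _ hs
        rw [h0] at hs
        exact ⟨0, by omega, by linarith, by linarith [hlt 0 (by omega)]⟩
      | succ k ih =>
        intro hk hs
        rcases le_total s (t k) with h | h
        · exact ih (by omega) h
        · exact ⟨k, by omega, h, hs⟩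
    obtain ⟨j, hj, ha, hb⟩ := this (m + 1) le_rfl (by rw [h1]; exact hs1)
    exact ⟨(i, ⟨j, by omega⟩), rfl, ha, hb⟩
  unique := by
    have mono : ∀ k l, k ≤ l → l ≤ m + 1 → t k ≤ t l := by
      intro k l hkl
      induction l, hkl using Nat.le_induction with
      | base => intro _; exact le_rfl
      | succ l hl ih => intro h; exact (ih (by omega)).trans (hlt l (by omega)).le
    rintro ⟨i, a⟩ ⟨i', b⟩ s hi a1 a2 b1 b2
    simp only at hi a1 a2 b1 b2
    subst hi
    refine Prod.ext rfl (Fin.ext ?_)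
    rcases lt_trichotomy (a : ℕ) b with h | h | h
    · linarith [mono (a + 1) b h (by omega)]
    · exact h
    · linarith [mono (b + 1) a h (by omega)]

theorem exists_subdivision {n : ℕ} (hn : 2 ≤ n) {ε : ℝ} (hε : 0 < ε) {B : Set ℝ} (hB : B.Finite)
    (hB0 : 0 ∉ B) : ∃ (m : ℕ) (D : Subdivision n (Fin n × Fin (m + 1))),
      (∀ j, D.hi j - D.lo j ≤ ε) ∧ ∀ j, D.lo j ∉ B := by
  obtain ⟨m, t, h0, h1, hlt, hle, hB⟩ := exists_breakpoints hε hB hB0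
  exact ⟨m, Subdivision.ofBreakpoints hn h0 h1 hlt, fun j => hle _ (by omega),
    fun j => hB _ (by omega)⟩

/-- The parameters of the corners of inscribed squares on the edges. -/
def cornerParams {n : ℕ} (x : Fin n → ℂ) : Set ℝ :=
  {s | ∃ p ∈ labelledSquares (Polygon.mk x), ∃ k i, p.1 + sqCoeff k * p.2 = edgePt x i s}

theorem finite_cornerParams {n : ℕ} (hn : 2 ≤ n) {x : Fin n → ℂ} (hx : (Polygon.mk x).IsSimple)
    (hg : (Polygon.mk x).IsGeneric) : (cornerParams x).Finite := by
  have : cornerParams x = ⋃ p ∈ labelledSquares (Polygon.mk x), ⋃ k : Fin 4, ⋃ i : Fin n,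
      edgePt x i ⁻¹' {p.1 + sqCoeff k * p.2} := by
    ext s
    simp only [cornerParams, mem_ofPred_eq, mem_iUnion, mem_preimage, mem_singleton_iff,
      exists_prop]
    simp only [eq_comm]
  rw [this]
  refine (finite_labelledSquares hg).biUnion fun p _ => finite_iUnion fun k =>
    finite_iUnion fun i => (finite_singleton _).preimage (Function.Injective.injOn ?_)
  exact Subdivision.edgePt_injective fun h => finRotate_ne hn i (hx.injective h)

theorem zero_notMem_cornerParams {n : ℕ} {x : Fin n → ℂ}
    (hg : (Polygon.mk x).IsGeneric) : 0 ∉ cornerParams x := by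
  rintro ⟨p, hp, k, i, h⟩
  exact corner_ne_vertex hg hp k i (by simpa [edgePt] using h)

/-! ### Invariance of the parity along paths of simple polygons -/

/-- All the polygons `u k` are perturbed simultaneously so that their vertices form one generic
family, and neighbouring ones are compared near the common centre `c k`. Only the two ends need
counts stable under perturbation. -/
theorem hitCount_modEq_of_chain {ι : Type*} [Fintype ι] {σ : Equiv.Perm ι} {δ η : ℝ} (hη : 0 < η)
    (N : ℕ) {u c : ℕ → ι → ℂ} (hgap : ∀ k < N, HasGap σ (c k) δ η)
    (hu : ∀ k < N, ∀ j, ‖u k j - c k j‖ ≤ η / 2) (hu' : ∀ k < N, ∀ j, ‖u (k + 1) j - c k j‖ ≤ η / 2)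
    {a b : ℕ} (ha : ∀ᶠ W in 𝓝 (u 0), hitCount σ W (2 * δ) = a)
    (hb : ∀ᶠ W in 𝓝 (u N), hitCount σ W (2 * δ) = b) : a ≡ b [MOD 8] := by
  let U : Fin (N + 1) × ι → ℂ := fun p => u p.1 p.2
  have hrow : ∀ k : Fin (N + 1), Continuous fun (z : Fin (N + 1) × ι → ℂ) j => z (k, j) :=
    fun k => by fun_prop
  have T1 : Tendsto (fun (z : Fin (N + 1) × ι → ℂ) j => z (0, j)) (𝓝 U) (𝓝 (u 0)) :=
    (hrow 0).tendsto U
  have T2 : Tendsto (fun (z : Fin (N + 1) × ι → ℂ) j => z (Fin.last N, j)) (𝓝 U) (𝓝 (u N)) :=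
    (hrow (Fin.last N)).tendsto U
  have E1 := T1.eventually ha
  have E2 := T2.eventually hb
  have E3 : ∀ᶠ z in 𝓝 U, ∀ p, ‖z p - U p‖ < η / 2 := by
    refine eventually_all.2 fun p => ?_
    have : Continuous fun z : Fin (N + 1) × ι → ℂ => ‖z p - U p‖ := by fun_prop
    exact this.continuousAt.eventually_lt_const (by simpa using half_pos hη)
  -- A set of full measure is dense, so a generic family exists in the prescribed neighbourhood.
  obtain ⟨z, ⟨z1, z2, z3⟩, hz⟩ := mem_closure_iff_nhds.1
    (MeasureTheory.Measure.dense_of_ae (ae_genericFamily (Fin (N + 1) × ι)) U) _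
    (E1.and (E2.and E3))
  have key : ∀ k : ℕ, ∀ hk : k < N + 1, a ≡
      hitCount σ (fun j => z (⟨k, hk⟩, j)) (2 * δ) [MOD 8] := by
    intro k
    induction k with
    | zero => intro hk; rw [← z1]; rfl
    | succ k ih =>
      intro hk
      refine (ih (by omega)).trans ?_
      have hkN : k < N := by omega
      refine hitCount_modEq hz (hgap k hkN) (g := fun j => (⟨k, by omega⟩, j))
        (g' := fun j => (⟨k + 1, hk⟩, j)) (fun i j h => by simpa using h)
        (fun i j h => by simpa using h) (fun i j h => ?_) (fun j => ?_) (fun j => ?_)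
      · simp at h
      · have h1 := (z3 (⟨k, by omega⟩, j)).le
        have h2 := hu k hkN j
        calc _ = ‖(z (⟨k, by omega⟩, j) - u k j) + (u k j - c k j)‖ := by congr 1; ring
          _ ≤ _ := norm_add_le _ _
          _ ≤ η / 2 + η / 2 := add_le_add h1 h2
          _ = η := by ring
      · have h1 := (z3 (⟨k + 1, hk⟩, j)).le
        have h2 := hu' k hkN j
        calc _ = ‖(z (⟨k + 1, hk⟩, j) - u (k + 1) j) + (u (k + 1) j - c k j)‖ := by
              congr 1; ring
          _ ≤ _ := norm_add_le _ _
          _ ≤ η / 2 + η / 2 := add_le_add h1 h2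
          _ = η := by ring
  have := key N (by omega)
  rw [← z2]
  exact this

/-- The parity of the number of inscribed squares of generic polygons is constant along paths of
simple polygons. -/
theorem parity_of_path {n : ℕ} (hn : 2 ≤ n) {X : ℝ → Fin n → ℂ} (hX : Continuous X)
    (hs : ∀ t ∈ Icc (0 : ℝ) 1, (Polygon.mk (X t)).IsSimple) :
    ∃ η > 0, ∀ y₀ y₁ : Fin n → ℂ, (Polygon.mk y₀).IsSimple → (Polygon.mk y₀).IsGeneric →
      (Polygon.mk y₁).IsSimple → (Polygon.mk y₁).IsGeneric →
      (∀ i, ‖y₀ i - X 0 i‖ ≤ η) → (∀ i, ‖y₁ i - X 1 i‖ ≤ η) →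
      (Polygon.mk y₀).inscribedSquares.ncard ≡ (Polygon.mk y₁).inscribedSquares.ncard
        [MOD 2] := by
  set K : Set (Fin n → ℂ) := X '' Icc 0 1 with hK
  have hKc : IsCompact K := isCompact_Icc.image hX
  have hXK : ∀ t ∈ Icc (0 : ℝ) 1, X t ∈ K := fun t ht => mem_image_of_mem X ht
  have hKs : ∀ x ∈ K, (Polygon.mk x).IsSimple := by rintro _ ⟨t, ht, rfl⟩; exact hs t ht
  obtain ⟨δ, hδ, hδK⟩ := exists_lt_norm hn hKc hKs
  obtain ⟨η₀, hη₀, hgap⟩ := exists_gap hKc hδ fun x hx a v hv hb =>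
    hδK x hx x (hKs x hx) (fun i => by simp [hδ.le]) a v hv hb
  obtain ⟨L, hL⟩ : ∃ L : ℝ, ∀ x ∈ K, ∀ i, ‖edgeDir x i‖ ≤ L := by
    have : ∀ i, ∃ L, ∀ x ∈ K, ‖edgeDir x i‖ ≤ L := fun i =>
      hKc.exists_bound_of_continuousOn (f := fun x => edgeDir x i)
        (by unfold edgeDir; fun_prop)
    choose L hL using this
    refine ⟨∑ i, |L i|, fun x hx i => (hL i x hx).trans ((le_abs_self _).trans ?_)⟩
    exact Finset.single_le_sum (f := fun i => |L i|) (fun i _ => abs_nonneg _)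
      (Finset.mem_univ i)
  -- Pieces will have length at most `δ / 16`; together with `2 * η ≤ δ / 16` this is the bound
  -- required by `HasGap.short`.
  set η := min η₀ (δ / 32) with hη
  have hηpos : 0 < η := lt_min hη₀ (by positivity)
  have hη1 : η ≤ η₀ := min_le_left _ _
  have hη2 : η ≤ δ / 32 := min_le_right _ _
  refine ⟨η / 2, by positivity, fun y₀ y₁ s₀ g₀ s₁ g₁ n₀ n₁ => ?_⟩
  have hL1 : 0 < |L| + 1 := by positivity
  -- One subdivision serves the whole path: it is fine enough for every edge along it, and its
  -- breakpoints avoid the corners of squares inscribed in either end polygon.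
  obtain ⟨m, D, hDε, hDB⟩ := exists_subdivision hn (ε := δ / 16 / (|L| + 1)) (by positivity)
    ((finite_cornerParams hn s₀ g₀).union (finite_cornerParams hn s₁ g₁))
    (by simp [zero_notMem_cornerParams g₀, zero_notMem_cornerParams g₁])
  have hav₀ : D.Avoids y₀ := fun p hp k j h => hDB j (Or.inl ⟨p, hp, k, _, h⟩)
  have hav₁ : D.Avoids y₁ := fun p hp k j h => hDB j (Or.inr ⟨p, hp, k, _, h⟩)
  have hbig₀ : ∀ p ∈ labelledSquares (Polygon.mk y₀), 2 * δ < ‖p.2‖ := fun p hp =>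
    hδK (X 0) (hXK 0 (by simp)) y₀ s₀ (fun i => (n₀ i).trans (by linarith)) p.1 p.2 hp.1 hp.2
  have hbig₁ : ∀ p ∈ labelledSquares (Polygon.mk y₁), 2 * δ < ‖p.2‖ := fun p hp =>
    hδK (X 1) (hXK 1 (by simp)) y₁ s₁ (fun i => (n₁ i).trans (by linarith)) p.1 p.2 hp.1 hp.2
  have hGap : ∀ t ∈ Icc (0 : ℝ) 1, HasGap D.perm (D.pts (X t)) δ η := by
    intro t ht
    refine ⟨hδ, hηpos.le, D.perm_ne, fun j => ?_, fun e a v h => ?_⟩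
    · rw [D.pts_sub, norm_smul, Real.norm_of_nonneg (sub_pos.2 (D.lt j)).le]
      have : (D.hi j - D.lo j) * ‖edgeDir (X t) (D.edge j)‖ ≤ δ / 16 / (|L| + 1) * (|L| + 1) := by
        refine mul_le_mul (hDε j) ?_ (norm_nonneg _) (by positivity)
        linarith [hL _ (hXK t ht) (D.edge j), le_abs_self L]
      rw [div_mul_cancel₀ _ hL1.ne'] at this
      linarith
    · choose y hy hay using h
      choose τ h0 h1 hτ using fun k => D.mem_piece_iff.1 (hy k)
      refine hgap (X t) (hXK t ht) (fun k => D.edge (e k)) τ a v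
        (fun k => ⟨(D.lo_nonneg _).trans (h0 k), (h1 k).trans (D.hi_le _)⟩) fun k => ?_
      rw [← hτ k]
      exact (hay k).trans hη1
  have hpts : ∀ {x y : Fin n → ℂ} {r : ℝ}, (∀ i, ‖x i - y i‖ ≤ r) →
      ∀ j, ‖D.pts x j - D.pts y j‖ ≤ r := fun h j =>
    norm_edgePt_sub_le h _ ⟨D.lo_nonneg j, (D.lt j).le.trans (D.hi_le j)⟩
  obtain ⟨M, hM, hMX⟩ : ∃ M : ℕ, 0 < M ∧ ∀ k < M, ∀ i,
      ‖X ((k + 1 : ℕ) / M) i - X (k / M) i‖ ≤ η / 2 := by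
    obtain ⟨ρ, hρ, hu⟩ := Metric.uniformContinuousOn_iff.1
      (isCompact_Icc.uniformContinuousOn_of_continuous (s := Icc (0 : ℝ) 1) hX.continuousOn) (η / 2)
      (by positivity)
    obtain ⟨M, hM⟩ := exists_nat_one_div_lt hρ
    refine ⟨M + 1, by omega, fun k hk i => ?_⟩
    have hM0 : (0 : ℝ) < M + 1 := by positivity
    have hk' : (k : ℝ) + 1 ≤ M + 1 := by exact_mod_cast hk
    have := hu ((k + 1 : ℕ) / (M + 1 : ℕ)) ⟨by positivity, by push_cast; rwa [div_le_one hM0]⟩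
      (k / (M + 1 : ℕ)) ⟨by positivity, by push_cast; rw [div_le_one hM0]; linarith⟩ (by
        rw [Real.dist_eq, ← sub_div]
        push_cast
        rwa [add_sub_cancel_left, abs_of_pos (by positivity)])
    rw [dist_eq_norm] at this
    exact (norm_le_pi_norm (X ((k + 1 : ℕ) / (M + 1 : ℕ)) - X (k / (M + 1 : ℕ))) i).trans this.le
  have hM0 : (0 : ℝ) < M := by exact_mod_cast hM
  have hmem : ∀ k ≤ M, (k / M : ℝ) ∈ Icc (0 : ℝ) 1 := fun k hk =>
    ⟨by positivity, (div_le_one hM0).2 (by exact_mod_cast hk)⟩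
  -- The polygons `u` are `y₀`, then the samples `X 0, X (1 / M), …, X 1`, then `y₁`. Natural
  -- subtraction makes `c 0 = c 1 = X 0`, so the first centre serves the step from `y₀` to `X 0`.
  let c : ℕ → Fin n → ℂ := fun k => X ((k - 1 : ℕ) / M)
  let u : ℕ → Fin n → ℂ := fun k => if k = 0 then y₀ else if k = M + 2 then y₁ else c k
  have hmod := hitCount_modEq_of_chain hηpos (M + 2) (u := fun k => D.pts (u k))
    (c := fun k => D.pts (c k)) (fun k hk => hGap _ (hmem _ (by omega)))
    (fun k hk => hpts fun i => ?_) (fun k hk => hpts fun i => ?_)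
    (by simpa [u] using D.eventually_hitCount_eq hn s₀ g₀ hav₀ (by positivity) hbig₀)
    (by simpa [u] using D.eventually_hitCount_eq hn s₁ g₁ hav₁ (by positivity) hbig₁)
  · rw [D.hitCount_eq hn s₀ g₀ hav₀ (by positivity) fun p hp => (hbig₀ p hp).le,
      D.hitCount_eq hn s₁ g₁ hav₁ (by positivity) fun p hp => (hbig₁ p hp).le] at hmod
    -- Cancelling the factor 4 in a congruence modulo 8 leaves one modulo 2.
    exact Nat.ModEq.mul_left_cancel' (c := 4) (by norm_num) hmod
  · by_cases h0 : k = 0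
    · subst h0
      simpa [u, c] using n₀ i
    · simp only [u, h0, if_false, show k ≠ M + 2 by omega]
      simpa using (half_pos hηpos).le
  · by_cases h1 : k = M + 1
    · subst h1
      simpa [u, c, div_self hM0.ne'] using n₁ i
    · simp only [u, c, show k + 1 ≠ M + 2 by omega, if_false, Nat.add_sub_cancel,
        show k + 1 ≠ 0 by omega]
      rcases Nat.eq_zero_or_pos k with h0 | h0
      · subst h0
        simpa using (half_pos hηpos).le
      · have := hMX (k - 1) (by omega) i
        rwa [show k - 1 + 1 = k by omega] at this

end SquarePeg

end

section

open Set Complex ComplexConjugate Filter Topology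

namespace SquarePeg

/-! ### Winding numbers of polygonal lines -/

/-- The oriented angle under which the segment from `a` to `b` is seen from `y`. -/
noncomputable def ang (y a b : ℂ) : ℝ := arg ((b - y) / (a - y))

/-- If the quotient were `-t` with `t ≥ 0`, then `y` would be the convex combination of `a` and `b`
with weights `t / (1 + t)` and `1 / (1 + t)`. -/
theorem div_mem_slitPlane {y a b : ℂ} (hy : y ∉ segment ℝ a b) :
    (b - y) / (a - y) ∈ slitPlane := by
  have ha : a - y ≠ 0 := fun h => hy (by rw [← sub_eq_zero.1 h]; exact left_mem_segment ℝ _ _)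
  have hb : b - y ≠ 0 := fun h => hy (by rw [← sub_eq_zero.1 h]; exact right_mem_segment ℝ _ _)
  by_contra hcon
  rw [mem_slitPlane_iff_not_le_zero, not_not, Complex.le_def] at hcon
  simp only [zero_re, zero_im] at hcon
  set t : ℝ := -((b - y) / (a - y)).re with ht
  have ht0 : 0 ≤ t := by rw [ht]; linarith [hcon.1]
  have hdiv : (b - y) / (a - y) = -(t : ℂ) := by
    apply Complex.ext
    · simp [ht]
    · simp [hcon.2]
  have hby : b - y = -(t : ℂ) * (a - y) := by rw [← hdiv, div_mul_cancel₀ _ ha]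
  apply hy
  refine mem_segment_iff.2 ⟨1 / (1 + t), by positivity, ?_, ?_⟩
  · rw [div_le_one (by positivity)]; linarith
  · have h1 : (1 + (t : ℂ)) ≠ 0 := by exact_mod_cast (by positivity : (1 + t) ≠ 0)
    simp only [real_smul]
    push_cast
    field_simp
    linear_combination -hby

theorem continuousOn_ang (a b : ℂ) : ContinuousOn (fun y => ang y a b) (segment ℝ a b)ᶜ := by
  intro y hy
  have ha : a - y ≠ 0 := fun h => hy (by rw [← sub_eq_zero.1 h]; exact left_mem_segment ℝ _ _)
  refine ContinuousAt.continuousWithinAt ?_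
  refine ContinuousAt.comp (f := fun y => (b - y) / (a - y)) (g := arg)
    (continuousAt_arg (div_mem_slitPlane hy)) ?_
  exact ContinuousAt.div₀ (by fun_prop) (by fun_prop) ha

theorem coe_ang {y a b : ℂ} (ha : a ≠ y) (hb : b ≠ y) :
    (ang y a b : Real.Angle) = (arg (b - y) : Real.Angle) - arg (a - y) := by
  rw [ang, arg_div_coe_angle (sub_ne_zero.2 hb) (sub_ne_zero.2 ha)]

/-- Seen from the boundary of a half-plane, angles between points of the half-plane add up. -/
theorem ang_eq_sub {y a b c : ℂ} (ha : (y * c).re < (a * c).re) (hb : (y * c).re < (b * c).re) :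
    ang y a b = arg ((b - y) * c) - arg ((a - y) * c) := by
  have ha' : 0 < ((a - y) * c).re := by rw [sub_mul, sub_re]; linarith
  have hb' : 0 < ((b - y) * c).re := by rw [sub_mul, sub_re]; linarith
  have ha0 : (a - y) * c ≠ 0 := fun h => by rw [h] at ha'; simp at ha'
  have hb0 : (b - y) * c ≠ 0 := fun h => by rw [h] at hb'; simp at hb'
  have hc : c ≠ 0 := right_ne_zero_of_mul ha0
  have h1 := abs_lt.1 (abs_arg_lt_pi_div_two_iff.2 (Or.inl ha'))
  have h2 := abs_lt.1 (abs_arg_lt_pi_div_two_iff.2 (Or.inl hb'))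
  have h3 : (b - y) / (a - y) = ((b - y) * c) / ((a - y) * c) :=
    (mul_div_mul_right _ _ hc).symm
  have h4 : ((ang y a b : ℝ) : Real.Angle) = ((arg ((b - y) * c) - arg ((a - y) * c) : ℝ)) := by
    rw [ang, h3, arg_div_coe_angle hb0 ha0, Real.Angle.coe_sub]
  -- Both arguments lie strictly between `-π / 2` and `π / 2`, so their difference is in `(-π, π)`
  -- and the identity modulo `2 * π` becomes one of real numbers.
  have h5 := congrArg Real.Angle.toReal h4
  have h6 : ((ang y a b : ℝ) : Real.Angle).toReal = ang y a b :=
    Real.Angle.toReal_coe_eq_self_iff.2 ⟨neg_pi_lt_arg _, arg_le_pi _⟩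
  rwa [h6,
    Real.Angle.toReal_coe_eq_self_iff.2 ⟨by linarith, by linarith⟩] at h5

theorem ang_pos_iff {y a b : ℂ} (h : 0 < crs (a - y) (b - y)) : 0 < ang y a b := by
  have hi : 0 < ((b - y) / (a - y)).im := by
    have ha : a - y ≠ 0 := fun h' => by rw [h'] at h; simp [crs] at h
    rw [div_im, ← sub_div]
    refine div_pos ?_ (normSq_pos.2 ha)
    simp only [crs] at h
    linarith
  rw [ang]
  exact lt_of_le_of_ne (arg_nonneg_iff.2 hi.le) fun h0 => by
    have := (arg_eq_zero_iff.1 h0.symm).2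
    linarith

theorem ang_neg_iff {y a b : ℂ} (h : crs (a - y) (b - y) < 0) : ang y a b < 0 := by
  have hi : ((b - y) / (a - y)).im < 0 := by
    have ha : a - y ≠ 0 := fun h' => by rw [h'] at h; simp [crs] at h
    rw [div_im, ← sub_div]
    refine div_neg_of_neg_of_pos ?_ (normSq_pos.2 ha)
    simp only [crs] at h
    linarith
  exact arg_neg_iff.2 hi

/-- The angle described by the closed polygonal line with vertices `f i, …, f j`, seen from `y`. -/
noncomputable def wind (f : ℕ → ℂ) (i j : ℕ) (y : ℂ) : ℝ :=
  ∑ k ∈ Finset.Ico i j, ang y (f k) (f (k + 1)) + ang y (f j) (f i)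

/-- The points of the closed polygonal line with vertices `f i, …, f j`. -/
def trace (f : ℕ → ℂ) (i j : ℕ) : Set ℂ :=
  (⋃ k ∈ Finset.Ico i j, segment ℝ (f k) (f (k + 1))) ∪ segment ℝ (f j) (f i)

theorem continuousOn_wind (f : ℕ → ℂ) (i j : ℕ) : ContinuousOn (wind f i j) (trace f i j)ᶜ := by
  unfold wind
  refine ContinuousOn.add (continuousOn_finsetSum _ fun k hk => ?_) ?_
  · refine (continuousOn_ang _ _).mono (compl_subset_compl.2 ?_)
    exact fun y hy => Or.inl (mem_iUnion₂.2 ⟨k, hk, hy⟩)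
  · exact (continuousOn_ang _ _).mono (compl_subset_compl.2 subset_union_right)

theorem sum_ang_coe {f : ℕ → ℂ} {y : ℂ} {i j : ℕ} (hij : i ≤ j) (h : ∀ k, i ≤ k → k ≤ j → f k ≠ y) :
    ((∑ k ∈ Finset.Ico i j, ang y (f k) (f (k + 1)) : ℝ) : Real.Angle) =
      (arg (f j - y) : Real.Angle) - arg (f i - y) := by
  induction j, hij using Nat.le_induction with
  | base => simp
  | succ j hj ih =>
    rw [Finset.sum_Ico_succ_top hj, Real.Angle.coe_add, ih fun k h1 h2 => h k h1 (by omega),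
      coe_ang (h j hj (by omega)) (h (j + 1) (by omega) le_rfl)]
    abel

theorem vertex_mem_trace {f : ℕ → ℂ} {i j k : ℕ} (hik : i ≤ k) (hkj : k ≤ j) :
    f k ∈ trace f i j := by
  rcases eq_or_lt_of_le hkj with rfl | h
  · exact Or.inr (left_mem_segment ℝ _ _)
  · exact Or.inl (mem_iUnion₂.2 ⟨k, Finset.mem_Ico.2 ⟨hik, h⟩, left_mem_segment ℝ _ _⟩)

/-- Modulo `2 * π` the angles are differences of arguments and telescope around the closed line. -/
theorem exists_wind_eq {f : ℕ → ℂ} {y : ℂ} {i j : ℕ} (hij : i ≤ j) (hy : y ∉ trace f i j) :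
    ∃ m : ℤ, wind f i j y = 2 * Real.pi * m := by
  have hne : ∀ k, i ≤ k → k ≤ j → f k ≠ y := fun k h1 h2 h => hy (h ▸ vertex_mem_trace h1 h2)
  have : ((wind f i j y : ℝ) : Real.Angle) = (0 : ℝ) := by
    rw [wind, Real.Angle.coe_add, sum_ang_coe hij hne, coe_ang (hne j hij le_rfl) (hne i le_rfl hij)]
    simp
  obtain ⟨m, hm⟩ := Real.Angle.angle_eq_iff_two_pi_dvd_sub.1 this
  exact ⟨m, by simpa using hm⟩

/-- The winding number is constant on connected sets off the polygonal line. -/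
theorem wind_eq_of_isPreconnected {f : ℕ → ℂ} {i j : ℕ} (hij : i ≤ j) {S : Set ℂ}
    (hS : IsPreconnected S) (hd : ∀ y ∈ S, y ∉ trace f i j) {y y' : ℂ} (hy : y ∈ S)
    (hy' : y' ∈ S) : wind f i j y = wind f i j y' := by
  have him : IsPreconnected (wind f i j '' S) :=
    hS.image _ ((continuousOn_wind f i j).mono fun y hy => hd y hy)
  by_contra hne
  have key : ∀ a b : ℝ, a ∈ wind f i j '' S → b ∈ wind f i j '' S → a < b → False := by
    intro a b ha hb hab
    obtain ⟨_, hya, rfl⟩ := ha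
    obtain ⟨_, hyb, rfl⟩ := hb
    obtain ⟨m, hm⟩ := exists_wind_eq hij (hd _ hya)
    obtain ⟨m', hm'⟩ := exists_wind_eq hij (hd _ hyb)
    have hpi := Real.pi_pos
    rw [hm, hm'] at hab
    have hmm : (m : ℝ) < m' := by
      by_contra! hcon
      nlinarith
    have hmm' : (m : ℝ) + 1 ≤ m' := by exact_mod_cast hmm
    -- By connectedness a value halfway between two consecutive multiples of `2 * π` would be
    -- attained.
    have hmem : 2 * Real.pi * (m + 1 / 2) ∈ Icc (wind f i j _) (wind f i j _) :=
      ⟨by rw [hm]; nlinarith, by rw [hm']; nlinarith⟩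
    obtain ⟨y, hy, h⟩ := him.Icc_subset ⟨_, hya, rfl⟩ ⟨_, hyb, rfl⟩ hmem
    obtain ⟨l, hl⟩ := exists_wind_eq hij (hd _ hy)
    rw [hl] at h
    have h1 : (l : ℝ) = m + 1 / 2 := mul_left_cancel₀ (by positivity) h
    have h2 : (2 * l : ℝ) = 2 * m + 1 := by linarith
    have h3 : (2 * l : ℤ) = 2 * m + 1 := by exact_mod_cast h2
    omega
  rcases lt_or_gt_of_ne hne with h | h
  · exact key _ _ ⟨y, hy, rfl⟩ ⟨y', hy', rfl⟩ h
  · exact key _ _ ⟨y', hy', rfl⟩ ⟨y, hy, rfl⟩ h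

theorem sum_ang_of_halfPlane {f : ℕ → ℂ} {y c : ℂ} {i j : ℕ} (hij : i ≤ j)
    (h : ∀ k, i ≤ k → k ≤ j → (y * c).re < (f k * c).re) :
    ∑ k ∈ Finset.Ico i j, ang y (f k) (f (k + 1)) = arg ((f j - y) * c) - arg ((f i - y) * c) := by
  induction j, hij using Nat.le_induction with
  | base => simp
  | succ j hj ih =>
    rw [Finset.sum_Ico_succ_top hj, ih fun k h1 h2 => h k h1 (by omega),
      ang_eq_sub (h j hj (by omega)) (h (j + 1) (by omega) le_rfl)]
    ring

theorem triangle_ang_eq_zero {a b d y c : ℂ} (ha : (y * c).re < (a * c).re)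
    (hb : (y * c).re < (b * c).re) (hd : (y * c).re < (d * c).re) :
    ang y a b + ang y b d + ang y d a = 0 := by
  rw [ang_eq_sub ha hb, ang_eq_sub hb hd, ang_eq_sub hd ha]
  ring

/-- From an interior point all three sides are seen with the orientation of the triangle, so the
three angles have the same strict sign. -/
theorem triangle_ang_ne_zero {a b d y : ℂ} {r s t : ℝ} (hr : 0 < r) (hs : 0 < s) (ht : 0 < t)
    (hsum : r + s + t = 1) (hy : y = r • a + s • b + t • d) (hD : crs (b - a) (d - a) ≠ 0) :
    ang y a b + ang y b d + ang y d a ≠ 0 := by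
  obtain rfl : r = 1 - s - t := by linarith
  have h1 : crs (a - y) (b - y) = t * crs (b - a) (d - a) := by
    rw [hy]; simp only [crs, sub_re, sub_im, add_re, add_im, smul_re, smul_im, smul_eq_mul]; ring
  have h2 : crs (b - y) (d - y) = (1 - s - t) * crs (b - a) (d - a) := by
    rw [hy]; simp only [crs, sub_re, sub_im, add_re, add_im, smul_re, smul_im, smul_eq_mul]; ring
  have h3 : crs (d - y) (a - y) = s * crs (b - a) (d - a) := by
    rw [hy]; simp only [crs, sub_re, sub_im, add_re, add_im, smul_re, smul_im, smul_eq_mul]; ring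
  rcases lt_or_gt_of_ne hD with hD | hD
  · have a1 := ang_neg_iff (h1 ▸ mul_neg_of_pos_of_neg ht hD)
    have a2 := ang_neg_iff (h2 ▸ mul_neg_of_pos_of_neg hr hD)
    have a3 := ang_neg_iff (h3 ▸ mul_neg_of_pos_of_neg hs hD)
    linarith
  · have a1 := ang_pos_iff (h1 ▸ mul_pos ht hD)
    have a2 := ang_pos_iff (h2 ▸ mul_pos hr hD)
    have a3 := ang_pos_iff (h3 ▸ mul_pos hs hD)
    linarith

end SquarePeg

end

section

open Set Complex ComplexConjugate Filter Topology

namespace SquarePeg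

/-! ### Coordinates with respect to a corner -/

/-- The coordinate of `y` along `p - x` with respect to the corner `p x q`. -/
noncomputable def coA (x p q y : ℂ) : ℝ := crs (y - x) (q - x) / crs (p - x) (q - x)

/-- The coordinate of `y` along `q - x` with respect to the corner `p x q`. -/
noncomputable def coB (x p q y : ℂ) : ℝ := crs (p - x) (y - x) / crs (p - x) (q - x)

theorem coA_line (x p q y u : ℂ) (t : ℝ) :
    coA x p q (y + t • (u - y)) = coA x p q y + t * (coA x p q u - coA x p q y) := by
  simp only [coA, crs, sub_re, sub_im, add_re, add_im, smul_re, smul_im, smul_eq_mul]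
  ring

theorem coB_line (x p q y u : ℂ) (t : ℝ) :
    coB x p q (y + t • (u - y)) = coB x p q y + t * (coB x p q u - coB x p q y) := by
  simp only [coB, crs, sub_re, sub_im, add_re, add_im, smul_re, smul_im, smul_eq_mul]
  ring

section

variable {x p q : ℂ}

@[simp] theorem coA_self : coA x p q x = 0 := by simp [coA, crs]

@[simp] theorem coB_self : coB x p q x = 0 := by simp [coB, crs]

@[simp] theorem coA_right : coA x p q q = 0 := by simp [coA, crs_self]

@[simp] theorem coB_left : coB x p q p = 0 := by simp [coB, crs_self]

theorem coA_left (hD : crs (p - x) (q - x) ≠ 0) : coA x p q p = 1 := div_self hD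

theorem coB_right (hD : crs (p - x) (q - x) ≠ 0) : coB x p q q = 1 := div_self hD

theorem eq_coord (hD : crs (p - x) (q - x) ≠ 0) (y : ℂ) :
    y = x + coA x p q y • (p - x) + coB x p q y • (q - x) := by
  have h1 : coA x p q y * crs (p - x) (q - x) = crs (y - x) (q - x) := div_mul_cancel₀ _ hD
  have h2 : coB x p q y * crs (p - x) (q - x) = crs (p - x) (y - x) := div_mul_cancel₀ _ hD
  apply Complex.ext
  · refine mul_right_cancel₀ hD ?_
    simp only [add_re, smul_re, smul_eq_mul]
    have : (x.re + coA x p q y * (p - x).re + coB x p q y * (q - x).re) * crs (p - x) (q - x) =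
        x.re * crs (p - x) (q - x) + (coA x p q y * crs (p - x) (q - x)) * (p - x).re +
          (coB x p q y * crs (p - x) (q - x)) * (q - x).re := by ring
    rw [this, h1, h2]
    simp only [crs, sub_re, sub_im]
    ring
  · refine mul_right_cancel₀ hD ?_
    simp only [add_im, smul_im, smul_eq_mul]
    have : (x.im + coA x p q y * (p - x).im + coB x p q y * (q - x).im) * crs (p - x) (q - x) =
        x.im * crs (p - x) (q - x) + (coA x p q y * crs (p - x) (q - x)) * (p - x).im +
          (coB x p q y * crs (p - x) (q - x)) * (q - x).im := by ring
    rw [this, h1, h2]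
    simp only [crs, sub_re, sub_im]
    ring

theorem eq_of_coord (hD : crs (p - x) (q - x) ≠ 0) {y z : ℂ} (hA : coA x p q y = coA x p q z)
    (hB : coB x p q y = coB x p q z) : y = z := by
  rw [eq_coord hD y, hA, hB, ← eq_coord hD z]

theorem coord_sum_sub (u v : ℂ) :
    (coA x p q v + coB x p q v) - (coA x p q u + coB x p q u) =
      crs (v - u) (q - p) / crs (p - x) (q - x) := by
  simp only [coA, coB]
  rw [← add_div, ← add_div, ← sub_div]
  congr 1
  simp only [crs, sub_re, sub_im]
  ring

theorem mem_left_of_coord (hD : crs (p - x) (q - x) ≠ 0) {y : ℂ} (hA : 0 ≤ coA x p q y)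
    (hA1 : coA x p q y ≤ 1) (hB : coB x p q y = 0) : y ∈ segment ℝ x p :=
  mem_segment_iff.2 ⟨_, hA, hA1, by conv_lhs => rw [eq_coord hD y, hB, zero_smul, add_zero]⟩

theorem mem_right_of_coord (hD : crs (p - x) (q - x) ≠ 0) {y : ℂ} (hB : 0 ≤ coB x p q y)
    (hB1 : coB x p q y ≤ 1) (hA : coA x p q y = 0) : y ∈ segment ℝ x q :=
  mem_segment_iff.2 ⟨_, hB, hB1, by conv_lhs => rw [eq_coord hD y, hA, zero_smul, add_zero]⟩

theorem mem_base_of_coord (hD : crs (p - x) (q - x) ≠ 0) {y : ℂ} (hA : 0 ≤ coA x p q y)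
    (hB : 0 ≤ coB x p q y) (h : coA x p q y + coB x p q y = 1) : y ∈ segment ℝ q p := by
  refine mem_segment_iff.2 ⟨coA x p q y, hA, by linarith, ?_⟩
  conv_lhs => rw [eq_coord hD y, show coB x p q y = 1 - coA x p q y by linarith]
  simp only [real_smul]
  push_cast
  ring

theorem coord_of_mem_left {y : ℂ} (h : y ∈ segment ℝ x p) : coB x p q y = 0 := by
  obtain ⟨t, -, -, rfl⟩ := mem_segment_iff.1 h
  rw [coB_line]
  simp

theorem coord_of_mem_right {y : ℂ} (h : y ∈ segment ℝ x q) : coA x p q y = 0 := by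
  obtain ⟨t, -, -, rfl⟩ := mem_segment_iff.1 h
  rw [coA_line]
  simp

theorem coord_of_mem_base (hD : crs (p - x) (q - x) ≠ 0) {y : ℂ} (h : y ∈ segment ℝ q p) :
    0 ≤ coA x p q y ∧ 0 ≤ coB x p q y ∧ coA x p q y + coB x p q y = 1 := by
  obtain ⟨t, h0, h1, rfl⟩ := mem_segment_iff.1 h
  rw [coA_line, coB_line, coA_left hD, coB_right hD]
  simp only [coA_right, coB_left]
  exact ⟨by linarith, by linarith, by ring⟩

/-- A segment entering a triangle without crossing two of its sides has an endpoint in the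
triangle. -/
theorem exists_endpoint_mem (hD : crs (p - x) (q - x) ≠ 0) {u v y : ℂ} (hy : y ∈ segment ℝ u v)
    (hA : 0 ≤ coA x p q y) (hB : 0 ≤ coB x p q y) (hH : coA x p q y + coB x p q y ≤ 1)
    (hyp : y ≠ p) (hyq : y ≠ q) (hp : ∀ z ∈ segment ℝ u v, z ∈ segment ℝ x p → z = p)
    (hq : ∀ z ∈ segment ℝ u v, z ∈ segment ℝ x q → z = q) (hne : crs (v - u) (q - p) ≠ 0) :
    ∃ w, (w = u ∨ w = v) ∧ 0 ≤ coA x p q w ∧ 0 ≤ coB x p q w ∧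
      (coA x p q w + coB x p q w < coA x p q y + coB x p q y ∨ w = y) := by
  -- The endpoint sought is the one with the smaller coordinate sum, that is, on the side of `x`;
  -- this sum is constant only along directions parallel to the base `p q`, which `hne` excludes.
  have key : ∀ u v : ℂ, y ∈ segment ℝ u v → (∀ z ∈ segment ℝ u v, z ∈ segment ℝ x p → z = p) →
      (∀ z ∈ segment ℝ u v, z ∈ segment ℝ x q → z = q) → crs (v - u) (q - p) ≠ 0 →
      coA x p q u + coB x p q u ≤ coA x p q v + coB x p q v →
      0 ≤ coA x p q u ∧ 0 ≤ coB x p q u ∧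
      (coA x p q u + coB x p q u < coA x p q y + coB x p q y ∨ u = y) := by
    intro u v hy hp hq hne huv
    have hlt : coA x p q u + coB x p q u < coA x p q v + coB x p q v := by
      refine lt_of_le_of_ne huv fun h => hne ?_
      have h1 := coord_sum_sub (x := x) (p := p) (q := q) u v
      rw [← h, sub_self, eq_comm, div_eq_zero_iff] at h1
      exact h1.resolve_right hD
    obtain ⟨t, t0, t1, ht⟩ := mem_segment_iff.1 hy
    have hAy : coA x p q y = coA x p q u + t * (coA x p q v - coA x p q u) := by
      rw [ht, coA_line]
    have hBy : coB x p q y = coB x p q u + t * (coB x p q v - coB x p q u) := by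
      rw [ht, coB_line]
    rcases eq_or_lt_of_le t0 with h0 | h0
    · have huy : u = y := by rw [ht, ← h0]; simp
      rw [huy]
      exact ⟨hA, hB, Or.inr rfl⟩
    have hlt' : coA x p q u + coB x p q u < coA x p q y + coB x p q y := by nlinarith
    by_contra hcon
    have hneg : min (coA x p q u) (coB x p q u) < 0 := by
      rw [min_lt_iff]
      by_contra! h
      exact hcon ⟨h.1, h.2, Or.inl hlt'⟩
    -- If `u` were outside the angle at `x`, the path from `y` to `u` would cross one of the two
    -- sides. The crossing point would be `p` or `q`, where the sum is 1; since the sum decreases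
    -- strictly from a value at most 1, this happens only at `y` itself, which is neither.
    set g : ℝ → ℝ := fun s => min (coA x p q (y + s • (u - y))) (coB x p q (y + s • (u - y)))
      with hg
    have hgc : ContinuousOn g (Icc 0 1) := by
      simp only [hg, coA_line, coB_line]
      fun_prop
    have hmem : (0 : ℝ) ∈ Icc (g 1) (g 0) := by
      simp only [hg, one_smul, zero_smul, add_zero, add_sub_cancel]
      exact ⟨hneg.le, le_min hA hB⟩
    obtain ⟨s, ⟨s0, s1⟩, hs⟩ := intermediate_value_Icc' zero_le_one hgc hmem
    set z := y + s • (u - y) with hz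
    have hzseg : z ∈ segment ℝ u v := by
      refine (convex_segment u v).segment_subset hy (left_mem_segment ℝ u v) ?_
      exact mem_segment_iff.2 ⟨s, s0, s1, rfl⟩
    have hsum : coA x p q z + coB x p q z = (coA x p q y + coB x p q y) +
        s * ((coA x p q u + coB x p q u) - (coA x p q y + coB x p q y)) := by
      rw [hz, coA_line, coB_line]; ring
    have hs0 : s = 0 → z = y := fun h => by rw [hz, h]; simp
    have hsle : coA x p q z + coB x p q z ≤ 1 := by nlinarith
    have hsone : coA x p q z + coB x p q z = 1 → s = 0 := by
      intro h
      by_contra hne0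
      have : 0 < s := lt_of_le_of_ne s0 (Ne.symm hne0)
      nlinarith
    simp only [hg] at hs
    rcases min_choice (coA x p q z) (coB x p q z) with h | h
    · have hA0 : coA x p q z = 0 := by rw [← h]; exact hs
      have hB0 : 0 ≤ coB x p q z := by rw [← hs]; exact min_le_right _ _
      have hzq := hq z hzseg (mem_right_of_coord hD hB0 (by linarith) hA0)
      have := hs0 (hsone (by rw [hzq, coB_right hD]; simp))
      exact hyq (this.symm.trans hzq)
    · have hB0 : coB x p q z = 0 := by rw [← h]; exact hs
      have hA0 : 0 ≤ coA x p q z := by rw [← hs]; exact min_le_left _ _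
      have hzp := hp z hzseg (mem_left_of_coord hD hA0 (by linarith) hB0)
      have := hs0 (hsone (by rw [hzp, coA_left hD]; simp))
      exact hyp (this.symm.trans hzp)
  rcases le_total (coA x p q u + coB x p q u) (coA x p q v + coB x p q v) with h | h
  · exact ⟨u, Or.inl rfl, key u v hy hp hq hne h⟩
  · refine ⟨v, Or.inr rfl, key v u ?_ ?_ ?_ ?_ h⟩
    · rwa [segment_symm]
    · rwa [segment_symm]
    · rwa [segment_symm]
    · intro h0
      apply hne
      simp only [crs, sub_re, sub_im] at h0 ⊢
      linarith

theorem triangle_ang_eq_zero_of_crs {a b d y w : ℂ} (ha : 0 < crs (a - y) w)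
    (hb : 0 < crs (b - y) w) (hd : 0 < crs (d - y) w) :
    ang y a b + ang y b d + ang y d a = 0 := by
  have key : ∀ v : ℂ, 0 < crs (v - y) w → (y * ⟨w.im, w.re⟩).re < (v * ⟨w.im, w.re⟩).re := by
    intro v hv
    simp only [crs, sub_re, sub_im] at hv
    simp only [mul_re]
    linarith
  exact triangle_ang_eq_zero (key a ha) (key b hb) (key d hd)

/-- The winding number of a triangle vanishes outside of the triangle. -/
theorem triangle_ang_eq_zero_of_coord (hD : crs (p - x) (q - x) ≠ 0) {y : ℂ}
    (h : coA x p q y < 0 ∨ coB x p q y < 0 ∨ 1 < coA x p q y + coB x p q y) :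
    ang y p x + ang y x q + ang y q p = 0 := by
  have hA : ∀ v : ℂ, crs (v - y) ((crs (p - x) (q - x))⁻¹ • (q - x)) =
      coA x p q v - coA x p q y := by
    intro v
    rw [crs_smul, coA, coA, ← sub_div, div_eq_inv_mul]
    congr 1
    simp only [crs, sub_re, sub_im]; ring
  have hB : ∀ v : ℂ, crs (v - y) ((-(crs (p - x) (q - x))⁻¹) • (p - x)) =
      coB x p q v - coB x p q y := by
    intro v
    rw [crs_smul, coB, coB, ← sub_div, div_eq_inv_mul, neg_mul, ← mul_neg]
    congr 1
    simp only [crs, sub_re, sub_im]; ring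
  have hC : ∀ v : ℂ, crs (v - y) ((-(crs (p - x) (q - x))⁻¹) • (q - p)) =
      (coA x p q y + coB x p q y) - (coA x p q v + coB x p q v) := by
    intro v
    rw [coord_sum_sub, crs_smul, div_eq_inv_mul, neg_mul, ← mul_neg]
    congr 1
    simp only [crs, sub_re, sub_im]; ring
  rcases h with h | h | h
  · refine triangle_ang_eq_zero_of_crs (w := (crs (p - x) (q - x))⁻¹ • (q - x)) ?_ ?_ ?_ <;>
      rw [hA] <;> simp [coA_left hD] <;> linarith
  · refine triangle_ang_eq_zero_of_crs (w := (-(crs (p - x) (q - x))⁻¹) • (p - x)) ?_ ?_ ?_ <;>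
      rw [hB] <;> simp [coB_right hD] <;> linarith
  · refine triangle_ang_eq_zero_of_crs (w := (-(crs (p - x) (q - x))⁻¹) • (q - p)) ?_ ?_ ?_ <;>
      rw [hC] <;> simp [coB_right hD, coA_left hD] <;> linarith

/-- The winding number of a triangle does not vanish inside of the triangle. -/
theorem triangle_ang_ne_zero_of_coord (hD : crs (p - x) (q - x) ≠ 0) {y : ℂ}
    (hA : 0 < coA x p q y) (hB : 0 < coB x p q y) (h : coA x p q y + coB x p q y < 1) :
    ang y p x + ang y x q + ang y q p ≠ 0 := by
  refine triangle_ang_ne_zero (r := coA x p q y) (s := 1 - (coA x p q y + coB x p q y))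
    (t := coB x p q y) hA (by linarith) hB (by ring) ?_ ?_
  · conv_lhs => rw [eq_coord hD y]
    simp only [real_smul]
    push_cast
    ring
  · intro h0
    apply hD
    simp only [crs, sub_re, sub_im] at h0 ⊢
    linarith

end

/-! ### Ears of simple polygons -/

/-- A periodic sequence of points that are the vertices of a simple `n`-gon in general
position. -/
structure SimpleLoop (n : ℕ) (f : ℕ → ℂ) : Prop where
  periodic : ∀ a, f (a + n) = f a
  ne : ∀ a b, a < b → b < a + n → f a ≠ f b
  edge : ∀ a b y, a < b → b < a + n → y ∈ segment ℝ (f a) (f (a + 1)) →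
    y ∈ segment ℝ (f b) (f (b + 1)) → (b = a + 1 ∧ y = f b) ∨ (b + 1 = a + n ∧ y = f a)
  general : ∀ a b c d, a < n → b < n → c < n → d < n → a ≠ b → d ≠ a → d ≠ b → d ≠ c →
    crs (f b - f a) (f d - f c) ≠ 0

/-- The chord from `f i` to `f j` does not meet the part of the polygonal line between its
endpoints, and the rest of the polygonal line lies outside of the polygon with vertices
`f i, …, f j`. -/
structure GoodChord (n : ℕ) (f : ℕ → ℂ) (i j : ℕ) : Prop where
  le : i + 2 ≤ j
  lt : j < n
  clean : ∀ k, i ≤ k → k < j → ∀ y ∈ segment ℝ (f k) (f (k + 1)), y ∈ segment ℝ (f j) (f i) →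
    y = f i ∨ y = f j
  out : ∀ l, j ≤ l → l < n + i → ∀ y ∈ segment ℝ (f l) (f (l + 1)), y = f i ∨ y = f j ∨
    (i = 0 ∧ j + 1 = n) ∨ (y ∉ segment ℝ (f j) (f i) ∧ wind f i j y = 0)

variable {n : ℕ} {f : ℕ → ℂ}

theorem SimpleLoop.goodChord (hf : SimpleLoop n f) (hn : 3 ≤ n) : GoodChord n f 0 (n - 1) := by
  have h1 : f (n - 1 + 1) = f 0 := by
    rw [show n - 1 + 1 = 0 + n by omega, hf.periodic]
  refine ⟨by omega, by omega, fun k _ hk y hy hy' => ?_, fun l hl hl' y hy => ?_⟩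
  · rw [← h1] at hy'
    rcases hf.edge k (n - 1) y (by omega) (by omega) hy hy' with ⟨-, h⟩ | ⟨h, h'⟩
    · exact Or.inr h
    · obtain rfl : k = 0 := by omega
      exact Or.inl h'
  · exact Or.inr (Or.inr (Or.inl ⟨rfl, by omega⟩))

/-- The linear functional is constant along the chord, with its sign chosen so that `f (i + 1)` lies
below it; the minimum is therefore attained away from `i` and `j`. It is unique because a tie would
give a direction parallel to the chord. -/
theorem SimpleLoop.exists_extreme (hf : SimpleLoop n f) {i j : ℕ} (hij : i + 2 ≤ j) (hj : j < n) :
    ∃ (k : ℕ) (c : ℂ), i < k ∧ k < j ∧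
      ∀ m, i ≤ m → m ≤ j → m ≠ k → (f k * c).re < (f m * c).re := by
  obtain ⟨s, hs⟩ : ∃ s : ℝ, s * crs (f j - f i) (f (i + 1) - f i) < 0 := by
    have h0 := hf.general i j i (i + 1) (by omega) hj (by omega) (by omega) (by omega) (by omega)
      (by omega) (by omega)
    rcases lt_or_gt_of_ne h0 with h | h
    · exact ⟨1, by linarith⟩
    · exact ⟨-1, by linarith⟩
  have hs0 : s ≠ 0 := fun h => by rw [h] at hs; simp at hs
  set c : ℂ := ⟨-(s * (f j - f i).im), -(s * (f j - f i).re)⟩ with hc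
  have hφ : ∀ u v : ℂ, (v * c).re - (u * c).re = s * crs (f j - f i) (v - u) := by
    intro u v
    simp only [hc, mul_re, crs, sub_re, sub_im]
    ring
  obtain ⟨k, hk, hmin⟩ := Finset.exists_min_image (Finset.Icc i j) (fun m => (f m * c).re)
    ⟨i, Finset.mem_Icc.2 ⟨le_rfl, by omega⟩⟩
  rw [Finset.mem_Icc] at hk
  have h1 := hmin (i + 1) (Finset.mem_Icc.2 ⟨by omega, by omega⟩)
  have h2 := hφ (f i) (f (i + 1))
  have h3 := hφ (f i) (f j)
  rw [crs_self, mul_zero] at h3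
  have hki : k ≠ i := by rintro rfl; linarith
  have hkj : k ≠ j := by rintro rfl; linarith
  refine ⟨k, c, by omega, by omega, fun m hm1 hm2 hmk => ?_⟩
  refine lt_of_le_of_ne (hmin m (Finset.mem_Icc.2 ⟨hm1, hm2⟩)) fun h => ?_
  have h4 := hφ (f m) (f k)
  rw [h, sub_self, eq_comm, mul_eq_zero] at h4
  exact hf.general i j m k (by omega) hj (by omega) (by omega) (by omega) hki hkj (Ne.symm hmk)
    (h4.resolve_left hs0)

end SquarePeg

end

/-! ### Good chords: crossings near a corner, and winding numbers of the polygon cut off. -/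

section

open Set Complex ComplexConjugate Filter Topology

namespace SquarePeg

/-- The pairs of indices of the edges of the polygon with vertices `f i, …, f j`. -/
def IsEdge (i j a b : ℕ) : Prop := (i ≤ a ∧ a < j ∧ b = a + 1) ∨ (a = j ∧ b = i)

theorem mem_trace_iff {f : ℕ → ℂ} {i j : ℕ} {y : ℂ} :
    y ∈ trace f i j ↔ ∃ a b, IsEdge i j a b ∧ y ∈ segment ℝ (f a) (f b) := by
  constructor
  · rintro (h | h)
    · obtain ⟨k, hk, h⟩ := mem_iUnion₂.1 h
      rw [Finset.mem_Ico] at hk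
      exact ⟨k, k + 1, Or.inl ⟨hk.1, hk.2, rfl⟩, h⟩
    · exact ⟨j, i, Or.inr ⟨rfl, rfl⟩, h⟩
  · rintro ⟨a, b, ⟨h1, h2, rfl⟩ | ⟨rfl, rfl⟩, h⟩
    · exact Or.inl (mem_iUnion₂.2 ⟨a, Finset.mem_Ico.2 ⟨h1, h2⟩, h⟩)
    · exact Or.inr h

variable {n : ℕ} {f : ℕ → ℂ} {i j r : ℕ}

namespace SimpleLoop

theorem crs_corner_ne_zero (hf : SimpleLoop n f) (hr : r + 2 < n) :
    crs (f r - f (r + 1)) (f (r + 2) - f (r + 1)) ≠ 0 :=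
  hf.general (r + 1) r (r + 1) (r + 2) (by omega) (by omega) (by omega) hr (by omega) (by omega)
    (by omega) (by omega)

/-- The edges that are not incident to a vertex meet the edges at this vertex at most in their
other endpoints. -/
theorem edge_meets (hf : SimpleLoop n f) (hG : GoodChord n f i j) (hij : i + 3 ≤ j) (hi : i ≤ r)
    (hj : r + 2 ≤ j) {a b : ℕ} (hab : IsEdge i j a b) (ha : a ≠ r + 1) (hb : b ≠ r + 1) :
    (∀ z ∈ segment ℝ (f a) (f b), z ∈ segment ℝ (f (r + 1)) (f r) → z = f r) ∧
    (∀ z ∈ segment ℝ (f a) (f b), z ∈ segment ℝ (f (r + 1)) (f (r + 2)) → z = f (r + 2)) ∧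
    crs (f b - f a) (f (r + 2) - f r) ≠ 0 := by
  have hjn := hG.lt
  refine ⟨fun z hz hz' => ?_, fun z hz hz' => ?_, ?_⟩
  · rw [segment_symm] at hz'
    rcases hab with ⟨h1, h2, rfl⟩ | ⟨rfl, rfl⟩
    · rcases lt_or_gt_of_ne (show a ≠ r by omega) with h | h
      · rcases hf.edge a r z h (by omega) hz hz' with ⟨-, h'⟩ | ⟨h', -⟩
        · exact h'
        · omega
      · rcases hf.edge r a z h (by omega) hz' hz with ⟨h', -⟩ | ⟨-, h'⟩
        · omega
        · exact h'
    · rcases hG.clean r hi (by omega) z hz' hz with rfl | rfl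
      · rcases Nat.eq_or_lt_of_le hi with rfl | h
        · rfl
        · rcases hf.edge _ r _ h (by omega) (left_mem_segment ℝ _ _) hz' with ⟨-, h'⟩ | ⟨h', -⟩
          · exact h'
          · omega
      · rcases hf.edge r _ _ (by omega) (by omega) hz' (left_mem_segment ℝ _ _) with
          ⟨h', -⟩ | ⟨-, h'⟩
        · omega
        · exact h'
  · rcases hab with ⟨h1, h2, rfl⟩ | ⟨rfl, rfl⟩
    · rcases lt_or_gt_of_ne ha with h | h
      · rcases hf.edge a (r + 1) z h (by omega) hz hz' with ⟨h', -⟩ | ⟨h', -⟩ <;> omega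
      · rcases hf.edge (r + 1) a z h (by omega) hz' hz with ⟨h', h''⟩ | ⟨h', -⟩
        · rw [h'', h']
        · omega
    · rcases hG.clean (r + 1) (by omega) (by omega) z hz' hz with rfl | rfl
      · rcases hf.edge _ (r + 1) _ (by omega) (by omega) (left_mem_segment ℝ _ _) hz' with
          ⟨-, h''⟩ | ⟨h', -⟩
        · exact absurd h'' (hf.ne _ _ (by omega) (by omega))
        · omega
      · rcases hf.edge (r + 1) _ _ (by omega) (by omega) hz' (left_mem_segment ℝ _ _) with
          ⟨h', -⟩ | ⟨h', -⟩
        · rw [h']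
        · omega
  · have hne : a ≠ b ∧ a < n ∧ b < n := by rcases hab with h | h <;> omega
    -- General position requires the last index to differ from `a` and `b`; at least one of `r + 2`
    -- and `r` qualifies.
    by_cases h2 : r + 2 ≠ a ∧ r + 2 ≠ b
    · exact hf.general a b r (r + 2) (by omega) (by omega) (by omega) (by omega) hne.1 h2.1 h2.2
        (by omega)
    · have h3 : r ≠ a ∧ r ≠ b := by rcases hab with h | h <;> omega
      have := hf.general a b (r + 2) r (by omega) (by omega) (by omega) (by omega) hne.1 h3.1 h3.2
        (by omega)
      intro h0
      apply this
      simp only [crs, sub_re, sub_im] at h0 ⊢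
      linarith

/-- If the polygon meets the triangle spanned by the edges at a vertex, there is a vertex in this
triangle. -/
theorem exists_vertex_mem (hf : SimpleLoop n f) (hG : GoodChord n f i j) (hij : i + 3 ≤ j)
    (hi : i ≤ r) (hj : r + 2 ≤ j) {y : ℂ} (hy : y ∈ trace f i j)
    (hA : 0 < coA (f (r + 1)) (f r) (f (r + 2)) y) (hB : 0 < coB (f (r + 1)) (f r) (f (r + 2)) y)
    (hH : coA (f (r + 1)) (f r) (f (r + 2)) y + coB (f (r + 1)) (f r) (f (r + 2)) y ≤ 1) :
    ∃ m, i ≤ m ∧ m ≤ j ∧ m ≠ r + 1 ∧ 0 ≤ coA (f (r + 1)) (f r) (f (r + 2)) (f m) ∧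
      0 ≤ coB (f (r + 1)) (f r) (f (r + 2)) (f m) ∧
      (coA (f (r + 1)) (f r) (f (r + 2)) (f m) + coB (f (r + 1)) (f r) (f (r + 2)) (f m) <
        coA (f (r + 1)) (f r) (f (r + 2)) y + coB (f (r + 1)) (f r) (f (r + 2)) y ∨ f m = y) := by
  have hD := hf.crs_corner_ne_zero (r := r) (by have := hG.lt; omega)
  obtain ⟨a, b, hab, hyab⟩ := mem_trace_iff.1 hy
  by_cases ha : a = r + 1
  · exfalso
    rcases hab with ⟨-, -, rfl⟩ | ⟨rfl, rfl⟩
    · subst ha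
      exact hA.ne' (coord_of_mem_right hyab)
    · omega
  by_cases hb : b = r + 1
  · exfalso
    rcases hab with ⟨-, -, rfl⟩ | ⟨rfl, rfl⟩
    · obtain rfl : a = r := by omega
      rw [segment_symm] at hyab
      exact hB.ne' (coord_of_mem_left hyab)
    · omega
  obtain ⟨h1, h2, h3⟩ := hf.edge_meets hG hij hi hj hab ha hb
  obtain ⟨w, hw, w1, w2, w3⟩ := exists_endpoint_mem hD hyab hA.le hB.le hH
    (by rintro rfl; simp at hB) (by rintro rfl; simp at hA) h1 h2 h3
  have : i ≤ a ∧ a ≤ j ∧ i ≤ b ∧ b ≤ j := by rcases hab with h | h <;> omega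
  rcases hw with rfl | rfl
  · exact ⟨a, by omega, by omega, ha, w1, w2, w3⟩
  · exact ⟨b, by omega, by omega, hb, w1, w2, w3⟩

end SimpleLoop

/-- The winding number does not vanish near an extreme vertex, inside of the corner. -/
theorem wind_ne_zero_of_corner (hi : i ≤ r) (hj : r + 2 ≤ j)
    (hD : crs (f r - f (r + 1)) (f (r + 2) - f (r + 1)) ≠ 0) {y c : ℂ}
    (hc : ∀ m, i ≤ m → m ≤ j → m ≠ r + 1 → (y * c).re < (f m * c).re)
    (hA : 0 < coA (f (r + 1)) (f r) (f (r + 2)) y) (hB : 0 < coB (f (r + 1)) (f r) (f (r + 2)) y)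
    (hH : coA (f (r + 1)) (f r) (f (r + 2)) y + coB (f (r + 1)) (f r) (f (r + 2)) y < 1) :
    wind f i j y ≠ 0 := by
  have h1 := sum_ang_of_halfPlane (f := f) (y := y) (c := c) hi
    fun k h1 h2 => hc k h1 (by omega) (by omega)
  have h2 := sum_ang_of_halfPlane (f := f) (y := y) (c := c) hj
    fun k h1 h2 => hc k (by omega) (by omega) (by omega)
  have h3 := ang_eq_sub (hc j (by omega) le_rfl (by omega)) (hc i le_rfl (by omega) (by omega))
  have h4 := ang_eq_sub (hc (r + 2) (by omega) (by omega) (by omega))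
    (hc r (by omega) (by omega) (by omega))
  have h5 := triangle_ang_ne_zero_of_coord hD hA hB hH
  -- All vertices except `r + 1` lie in one half-plane seen from `y`, so the way from `r + 2` round
  -- to `r` contributes the same angle as the straight segment. The winding number is that of the
  -- corner triangle.
  rw [wind, ← Finset.sum_Ico_consecutive _ hi (show r ≤ j by omega),
    Finset.sum_eq_sum_Ico_succ_bot (show r < j by omega),
    Finset.sum_eq_sum_Ico_succ_bot (show r + 1 < j by omega), h1, h2, h3]
  rw [h4] at h5
  intro h0
  apply h5
  linarith

/-- Vertices in a half-plane seen from `y` can be bypassed by a straight segment, which reduces the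
polygon to a triangle. -/
theorem wind_eq_zero_right {m : ℕ} (hm : r + 2 ≤ m) {y c : ℂ}
    (hc : ∀ l, r + 2 ≤ l → l ≤ m → (y * c).re < (f l * c).re)
    (h : ang y (f (r + 1)) (f (r + 2)) + ang y (f (r + 2)) (f m) + ang y (f m) (f (r + 1)) = 0) :
    wind f (r + 1) m y = 0 := by
  rw [wind, Finset.sum_eq_sum_Ico_succ_bot (show r + 1 < m by omega), sum_ang_of_halfPlane hm hc,
    ← ang_eq_sub (hc (r + 2) le_rfl hm) (hc m hm le_rfl)]
  exact h

theorem wind_eq_zero_left {m : ℕ} (hm : m ≤ r) {y c : ℂ}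
    (hc : ∀ l, m ≤ l → l ≤ r → (y * c).re < (f l * c).re)
    (h : ang y (f m) (f r) + ang y (f r) (f (r + 1)) + ang y (f (r + 1)) (f m) = 0) :
    wind f m (r + 1) y = 0 := by
  rw [wind, Finset.sum_Ico_succ_top hm, sum_ang_of_halfPlane hm hc,
    ← ang_eq_sub (hc m le_rfl hm) (hc r hm le_rfl)]
  exact h

/-- Points close to an extreme vertex are still separated from the other vertices. -/
theorem exists_small {c x : ℂ} {i j k : ℕ}
    (hc : ∀ m, i ≤ m → m ≤ j → m ≠ k → (x * c).re < (f m * c).re) (V : ℂ) (R : ℝ) :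
    ∃ ε : ℝ, 0 < ε ∧ ε < 1 ∧ ε * R < 1 ∧
      ∀ m, i ≤ m → m ≤ j → m ≠ k → ((x + ε • V) * c).re < (f m * c).re := by
  have h1 : ∀ᶠ ε in 𝓝[>] (0 : ℝ), ∀ m ∈ {m | i ≤ m ∧ m ≤ j ∧ m ≠ k},
      ((x + ε • V) * c).re < (f m * c).re := by
    refine (eventually_all_finite ?_).2 fun m hm => ?_
    · exact (Set.finite_Icc i j).subset fun m hm => ⟨hm.1, hm.2.1⟩
    · have : Continuous fun ε : ℝ => ((x + ε • V) * c).re := by fun_prop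
      refine (this.continuousAt.eventually_lt_const ?_).filter_mono nhdsWithin_le_nhds
      simpa using hc m hm.1 hm.2.1 hm.2.2
  have h2 : ∀ᶠ ε in 𝓝[>] (0 : ℝ), ε * R < 1 := by
    have : Continuous fun ε : ℝ => ε * R := by fun_prop
    refine (this.continuousAt.eventually_lt_const ?_).filter_mono nhdsWithin_le_nhds
    simp
  obtain ⟨ε, h3, h4, h5⟩ := (h1.and (h2.and (Ioo_mem_nhdsGT zero_lt_one))).exists
  exact ⟨ε, h5.1, h5.2, h4, fun m m1 m2 m3 => h3 m ⟨m1, m2, m3⟩⟩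

namespace SimpleLoop

/-- The polygonal line does not meet a set inside of the polygon cut off by a good chord. -/
theorem notMem_of_inside (hf : SimpleLoop n f) (hG : GoodChord n f i j) {O : Set ℂ}
    (hO : ∀ y ∈ O, y ∉ trace f i j) (hw : ∀ y ∈ O, wind f i j y ≠ 0) {l : ℕ} (hl : i ≤ l)
    (hl' : l < 2 * n + i) {y : ℂ} (hy : y ∈ segment ℝ (f l) (f (l + 1))) : y ∉ O := by
  have key : ∀ l, i ≤ l → l < n + i → y ∈ segment ℝ (f l) (f (l + 1)) → y ∉ O := by
    intro l hl hl' hy hyO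
    rcases lt_or_ge l j with h | h
    · exact hO y hyO (mem_trace_iff.2 ⟨l, l + 1, Or.inl ⟨hl, h, rfl⟩, hy⟩)
    · have hij := hG.le
      rcases hG.out l h hl' y hy with rfl | rfl | ⟨rfl, h1⟩ | ⟨-, h1⟩
      · exact hO _ hyO (vertex_mem_trace le_rfl (by omega))
      · exact hO _ hyO (vertex_mem_trace (by omega) le_rfl)
      · obtain rfl : l = j := by omega
        rw [h1, show n = 0 + n by omega, hf.periodic] at hy
        exact hO y hyO (mem_trace_iff.2 ⟨l, 0, Or.inr ⟨rfl, rfl⟩, hy⟩)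
      · exact hw y hyO h1
  -- Edges of the cut-off polygon belong to its trace, and the remaining edges have winding number
  -- zero. A second turn round the loop adds nothing.
  rcases lt_or_ge l (n + i) with h | h
  · exact key l hl h hy
  · obtain ⟨l', rfl⟩ : ∃ l', l = l' + n := ⟨l - n, by omega⟩
    rw [show l' + n + 1 = (l' + 1) + n by omega, hf.periodic, hf.periodic] at hy
    exact key l' (by omega) (by omega) hy

theorem isPreconnected_segment_diff {a b : ℂ} {F : Set ℂ}
    (hF : ∀ y ∈ F, y ∈ segment ℝ a b → y = a ∨ y = b) (hab : a ≠ b) :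
    IsPreconnected (segment ℝ a b \ F) := by
  refine (convex_openSegment a b).isPreconnected.subset_closure ?_ ?_
  · intro y hy
    refine ⟨openSegment_subset_segment ℝ a b hy, fun hyF => ?_⟩
    rcases hF y hyF (openSegment_subset_segment ℝ a b hy) with rfl | rfl
    · exact hab (left_mem_openSegment_iff.1 hy)
    · exact hab (right_mem_openSegment_iff.1 hy)
  · rw [closure_openSegment]
    exact sdiff_subset

/-- Consecutive edges are joined at their common vertex, and the two points removed are only the
extreme ends of this arc. -/
theorem isPreconnected_rest (hf : SimpleLoop n f) (hij : i < j) (hj : j < n) :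
    IsPreconnected (⋃ l ∈ Ico j (n + i), segment ℝ (f l) (f (l + 1)) \ {f i, f j}) := by
  have hin : f (n + i) = f i := by rw [add_comm, hf.periodic]
  refine IsPreconnected.biUnion_of_chain ordConnected_Ico (fun l hl => ?_) fun l hl hl' => ?_
  · refine isPreconnected_segment_diff ?_ (hf.ne _ _ (by omega) (by omega))
    rintro y hy hyl
    rw [mem_insert_iff, mem_singleton_iff] at hy
    rcases hy with rfl | rfl
    · right
      rw [← hin] at hyl ⊢
      rcases hf.edge l (n + i) _ hl.2 (by have := hl.1; omega) hyl (left_mem_segment ℝ _ _) with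
        ⟨h, -⟩ | ⟨-, h⟩
      · rw [h]
      · exact absurd h (hf.ne _ _ hl.2 (by have := hl.1; omega)).symm
    · left
      rcases Nat.eq_or_lt_of_le hl.1 with rfl | h
      · rfl
      · rcases hf.edge j l _ h (by have := hl.2; omega) (left_mem_segment ℝ _ _) hyl with
          ⟨-, h'⟩ | ⟨h', -⟩
        · exact h'
        · have := hl.2; omega
  · have h1 := hl.1
    have h2 := hl'.2
    rw [Order.succ_eq_add_one] at h2 ⊢
    refine ⟨f (l + 1), ⟨right_mem_segment ℝ _ _, ?_⟩, left_mem_segment ℝ _ _, ?_⟩ <;>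
    · rintro (h | h)
      · rw [← hin] at h
        exact hf.ne _ _ (by omega) (by omega) h
      · exact hf.ne j (l + 1) (by omega) (by omega) (mem_singleton_iff.1 h).symm

/-- A chord not meeting the polygonal line cuts off a good polygon if one point of the rest lies
outside. -/
theorem goodChord_of_clean (hf : SimpleLoop n f) (hij : i + 2 ≤ j) (hj : j < n)
    (hclean : ∀ l, i ≤ l → l < n + i → ∀ y ∈ segment ℝ (f l) (f (l + 1)),
      y ∈ segment ℝ (f j) (f i) → y = f i ∨ y = f j)
    {l₀ : ℕ} (hl₀ : j ≤ l₀) (hl₀' : l₀ < n + i) {y₀ : ℂ}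
    (hy₀ : y₀ ∈ segment ℝ (f l₀) (f (l₀ + 1))) (hi₀ : y₀ ≠ f i) (hj₀ : y₀ ≠ f j)
    (hw : wind f i j y₀ = 0) : GoodChord n f i j := by
  refine ⟨hij, hj, fun k h1 h2 => hclean k h1 (by omega), fun l h1 h2 y hy => ?_⟩
  by_cases hyi : y = f i
  · exact Or.inl hyi
  by_cases hyj : y = f j
  · exact Or.inr (Or.inl hyj)
  refine Or.inr (Or.inr (Or.inr ⟨fun h => ?_, ?_⟩))
  · rcases hclean l (by omega) h2 y hy h with h | h
    · exact hyi h
    · exact hyj h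
  -- The rest of the loop is connected and avoids the polygon cut off, so the winding number at `y₀`
  -- is the one everywhere on it.
  · rw [← hw]
    refine wind_eq_of_isPreconnected (by omega) (hf.isPreconnected_rest (by omega) hj)
      (fun z hz => ?_) (mem_iUnion₂.2 ⟨l, ⟨h1, h2⟩, hy, by simp [hyi, hyj]⟩)
      (mem_iUnion₂.2 ⟨l₀, ⟨hl₀, hl₀'⟩, hy₀, by simp [hi₀, hj₀]⟩)
    obtain ⟨m, ⟨hm1, hm2⟩, hzm, hzn⟩ := mem_iUnion₂.1 hz
    rw [mem_insert_iff, mem_singleton_iff, not_or] at hzn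
    rw [mem_trace_iff]
    rintro ⟨a, b, ⟨ha1, ha2, rfl⟩ | ⟨rfl, rfl⟩, hzab⟩
    · rcases hf.edge a m z (by omega) (by omega) hzab hzm with ⟨h, rfl⟩ | ⟨h, rfl⟩
      · obtain rfl : m = j := by omega
        exact hzn.2 rfl
      · obtain rfl : a = i := by omega
        exact hzn.1 rfl
    · rcases hclean m (by omega) hm2 z hzm hzab with h | h
      · exact hzn.1 h
      · exact hzn.2 h

end SimpleLoop

end SquarePeg

end

/-! ### Shortening a good chord until it cuts off an ear. -/

section

open Set Complex ComplexConjugate Filter Topology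

namespace SquarePeg

variable {n : ℕ} {f : ℕ → ℂ} {i j r : ℕ}

namespace SimpleLoop

/-- An edge entering the corner triangle would bring a vertex into it. So the triangle misses the
cut-off polygon, and the winding number on it is the nonzero value found near the extreme vertex.
The whole loop therefore avoids the triangle, and its base can serve as a new chord. -/
theorem goodChord_of_empty (hf : SimpleLoop n f) (hG : GoodChord n f i j) (hij : i + 3 ≤ j)
    (hi : i ≤ r) (hj : r + 2 ≤ j) {c : ℂ}
    (hc : ∀ m, i ≤ m → m ≤ j → m ≠ r + 1 → (f (r + 1) * c).re < (f m * c).re)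
    (hempty : ∀ m, i ≤ m → m ≤ j → m ≠ r → m ≠ r + 1 → m ≠ r + 2 →
      coA (f (r + 1)) (f r) (f (r + 2)) (f m) < 0 ∨ coB (f (r + 1)) (f r) (f (r + 2)) (f m) < 0 ∨
      1 < coA (f (r + 1)) (f r) (f (r + 2)) (f m) + coB (f (r + 1)) (f r) (f (r + 2)) (f m)) :
    GoodChord n f r (r + 2) := by
  have hjn := hG.lt
  have hD := hf.crs_corner_ne_zero (r := r) (by omega)
  set x := f (r + 1) with hx
  set p := f r with hp
  set q := f (r + 2) with hq
  -- The base is included without its endpoints, since it must be shown clean; the two sides at `x`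
  -- are excluded, since they belong to the polygon.
  set O : Set ℂ := {y | 0 < coA x p q y ∧ 0 < coB x p q y ∧ coA x p q y + coB x p q y ≤ 1} with hO
  have hOt : ∀ y ∈ O, y ∉ trace f i j := by
    rintro y ⟨hA, hB, hH⟩ hy
    obtain ⟨m, m1, m2, m3, m4, m5, m6⟩ := hf.exists_vertex_mem hG hij hi hj hy hA hB hH
    by_cases hmr : m = r
    · subst hmr
      rcases m6 with h | h
      · rw [coA_left hD, coB_left] at h
        simp only [← hx, ← hq, ← hp] at h
        linarith
      · rw [← h] at hB
        simp [hp] at hB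
    by_cases hmr2 : m = r + 2
    · subst hmr2
      rcases m6 with h | h
      · rw [coB_right hD, coA_right] at h
        simp only [← hx, ← hq, ← hp] at h
        linarith
      · rw [← h] at hA
        simp [hq] at hA
    rcases m6 with h | h
    · rcases hempty m m1 m2 hmr m3 hmr2 with h' | h' | h'
      · linarith
      · linarith
      · simp only [← hx, ← hq, ← hp] at h
        linarith
    · rcases hempty m m1 m2 hmr m3 hmr2 with h' | h' | h'
      · linarith
      · linarith
      · rw [h] at h'
        linarith
  have hOc : Convex ℝ O := by
    rw [convex_iff_segment_subset]
    rintro y ⟨y1, y2, y3⟩ z ⟨z1, z2, z3⟩ w hw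
    obtain ⟨t, t0, t1, rfl⟩ := mem_segment_iff.1 hw
    refine ⟨?_, ?_, ?_⟩
    · rw [coA_line]
      rcases eq_or_lt_of_le t0 with rfl | h
      · simpa using y1
      · nlinarith
    · rw [coB_line]
      rcases eq_or_lt_of_le t0 with rfl | h
      · simpa using y2
      · nlinarith
    · rw [coA_line, coB_line]
      nlinarith
  -- A point of `O` so close to `x` that every other vertex is still in a half-plane; both its
  -- coordinates are `ε / 4`.
  obtain ⟨ε, e0, e1, -, e2⟩ := exists_small hc ((1 / 4 : ℝ) • ((p + q) - (2 : ℝ) • x)) 0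
  set y₀ := x + ε • ((1 / 4 : ℝ) • ((p + q) - (2 : ℝ) • x)) with hy₀
  have hAy : coA x p q y₀ = ε / 4 := by
    have : crs (y₀ - x) (q - x) = ε / 4 * crs (p - x) (q - x) := by
      rw [hy₀]
      simp only [crs, sub_re, sub_im, add_re, add_im, smul_re, smul_im, smul_eq_mul]; ring
    rw [coA, this, mul_div_assoc, div_self hD, mul_one]
  have hBy : coB x p q y₀ = ε / 4 := by
    have : crs (p - x) (y₀ - x) = ε / 4 * crs (p - x) (q - x) := by
      rw [hy₀]
      simp only [crs, sub_re, sub_im, add_re, add_im, smul_re, smul_im, smul_eq_mul]; ring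
    rw [coB, this, mul_div_assoc, div_self hD, mul_one]
  have hy₀O : y₀ ∈ O := ⟨by rw [hAy]; positivity, by rw [hBy]; positivity,
    by rw [hAy, hBy]; linarith⟩
  have hw₀ : wind f i j y₀ ≠ 0 := wind_ne_zero_of_corner hi hj hD e2 hy₀O.1 hy₀O.2.1
    (show coA x p q y₀ + coB x p q y₀ < 1 by rw [hAy, hBy]; linarith)
  have hOw : ∀ y ∈ O, wind f i j y ≠ 0 := fun y hy => by
    rwa [wind_eq_of_isPreconnected (by omega) hOc.isPreconnected hOt hy hy₀O]
  have hclean : ∀ l, r ≤ l → l < n + r → ∀ y ∈ segment ℝ (f l) (f (l + 1)),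
      y ∈ segment ℝ q p → y = p ∨ y = q := by
    intro l h1 h2 y hy hyc
    by_contra! hcon
    obtain ⟨c1, c2, c3⟩ := coord_of_mem_base hD hyc
    refine hf.notMem_of_inside hG hOt hOw (l := l) (by omega) (by omega) hy
      ⟨lt_of_le_of_ne c1 fun h => hcon.2 ?_, lt_of_le_of_ne c2 fun h => hcon.1 ?_, c3.le⟩
    · exact eq_of_coord hD (by rw [← h, coA_right]) (by rw [coB_right hD]; linarith)
    · exact eq_of_coord hD (by rw [coA_left hD]; linarith) (by rw [← h, coB_left])
  -- A vertex outside the triangle certifies that the rest of the loop is outside; `i + 3 ≤ j`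
  -- provides one.
  obtain ⟨m, m1, m2, m3, m4, m5⟩ : ∃ m, i ≤ m ∧ m ≤ j ∧ m ≠ r ∧ m ≠ r + 1 ∧ m ≠ r + 2 := by
    by_cases h : i = r
    · exact ⟨j, by omega, by omega, by omega, by omega, by omega⟩
    · exact ⟨i, by omega, by omega, by omega, by omega, by omega⟩
  have hwm : wind f r (r + 2) (f m) = 0 := by
    have := triangle_ang_eq_zero_of_coord hD (hempty m m1 m2 m3 m4 m5)
    rw [wind, Finset.sum_eq_sum_Ico_succ_bot (by omega), Finset.sum_eq_sum_Ico_succ_bot (by omega)]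
    simp only [Finset.Ico_self, Finset.sum_empty, add_zero]
    exact this
  have hne : ∀ a b, a < n → b < n → a ≠ b → f a ≠ f b := by
    intro a b ha hb hab
    rcases lt_or_gt_of_ne hab with h | h
    · exact hf.ne a b h (by omega)
    · exact (hf.ne b a h (by omega)).symm
  rcases lt_or_gt_of_ne m3 with h | h
  · refine hf.goodChord_of_clean le_rfl (by omega) hclean (l₀ := m + n) (by omega) (by omega)
      (y₀ := f m) ?_ (hne _ _ (by omega) (by omega) m3) (hne _ _ (by omega) (by omega) m5) hwm
    rw [← hf.periodic m]
    exact left_mem_segment ℝ _ _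
  · exact hf.goodChord_of_clean le_rfl (by omega) hclean (l₀ := m) (by omega) (by omega)
      (left_mem_segment ℝ _ _) (hne _ _ (by omega) (by omega) m3)
      (hne _ _ (by omega) (by omega) m5) hwm

/-- Among the vertices in the corner triangle, `m` is farthest from the base. A crossing of the
diagonal from the extreme vertex to `f m` would force a vertex still farther from the base, so the
open diagonal lies inside the polygon cut off, and it yields a shorter chord. -/
theorem exists_goodChord_of_vertex (hf : SimpleLoop n f) (hG : GoodChord n f i j)
    (hij : i + 3 ≤ j) (hi : i ≤ r) (hj : r + 2 ≤ j) {c : ℂ}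
    (hc : ∀ m, i ≤ m → m ≤ j → m ≠ r + 1 → (f (r + 1) * c).re < (f m * c).re)
    {m : ℕ} (m1 : i ≤ m) (m2 : m ≤ j) (m3 : m ≠ r) (m4 : m ≠ r + 1) (m5 : m ≠ r + 2)
    (hA : 0 ≤ coA (f (r + 1)) (f r) (f (r + 2)) (f m))
    (hB : 0 ≤ coB (f (r + 1)) (f r) (f (r + 2)) (f m))
    (hH : coA (f (r + 1)) (f r) (f (r + 2)) (f m) + coB (f (r + 1)) (f r) (f (r + 2)) (f m) ≤ 1)
    (hmin : ∀ l, i ≤ l → l ≤ j → l ≠ r → l ≠ r + 1 → l ≠ r + 2 →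
      0 ≤ coA (f (r + 1)) (f r) (f (r + 2)) (f l) → 0 ≤ coB (f (r + 1)) (f r) (f (r + 2)) (f l) →
      coA (f (r + 1)) (f r) (f (r + 2)) (f m) + coB (f (r + 1)) (f r) (f (r + 2)) (f m) ≤
      coA (f (r + 1)) (f r) (f (r + 2)) (f l) + coB (f (r + 1)) (f r) (f (r + 2)) (f l)) :
    (r + 2 < m ∧ GoodChord n f (r + 1) m) ∨ (m < r ∧ GoodChord n f m (r + 1)) := by
  have hjn := hG.lt
  have hD := hf.crs_corner_ne_zero (r := r) (by omega)
  set x := f (r + 1) with hx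
  set p := f r with hp
  set q := f (r + 2) with hq
  set z := f m with hz
  have hA' : 0 < coA x p q z := by
    refine lt_of_le_of_ne hA fun h => ?_
    rw [coA, eq_comm, div_eq_zero_iff, or_iff_left hD] at h
    refine hf.general (r + 1) (r + 2) (r + 1) m (by omega) (by omega) (by omega) (by omega)
      (by omega) m4 m5 m4 ?_
    simp only [crs, sub_re, sub_im] at h ⊢
    linarith
  have hB' : 0 < coB x p q z := by
    refine lt_of_le_of_ne hB fun h => ?_
    rw [coB, eq_comm, div_eq_zero_iff, or_iff_left hD] at h
    exact hf.general (r + 1) r (r + 1) m (by omega) (by omega) (by omega) (by omega)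
      (by omega) m4 m3 m4 h
  have hxz : x ≠ z := by
    intro h
    rw [← h] at hA'
    simp at hA'
  set O : Set ℂ := openSegment ℝ x z with hO
  have hOcoord : ∀ y ∈ O, ∃ t : ℝ, 0 < t ∧ t < 1 ∧ y = x + t • (z - x) ∧
      coA x p q y = t * coA x p q z ∧ coB x p q y = t * coB x p q z := by
    intro y hy
    rw [hO, openSegment_eq_image'] at hy
    obtain ⟨t, ⟨t0, t1⟩, rfl⟩ := hy
    exact ⟨t, t0, t1, rfl, by simp [coA_line, -real_smul], by simp [coB_line, -real_smul]⟩
  have hOt : ∀ y ∈ O, y ∉ trace f i j := by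
    intro y hyO hy
    obtain ⟨t, t0, t1, -, yA, yB⟩ := hOcoord y hyO
    have hlt : coA x p q y + coB x p q y < coA x p q z + coB x p q z := by
      rw [yA, yB]; nlinarith
    obtain ⟨l, l1, l2, l3, l4, l5, l6⟩ := hf.exists_vertex_mem hG hij hi hj hy
      (show 0 < coA x p q y by rw [yA]; positivity) (show 0 < coB x p q y by rw [yB]; positivity)
      (show coA x p q y + coB x p q y ≤ 1 by linarith)
    have l7 : coA x p q (f l) + coB x p q (f l) < coA x p q z + coB x p q z := by
      rcases l6 with h | h
      · exact lt_trans h hlt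
      · rw [h]; exact hlt
    by_cases hlr : l = r
    · subst hlr
      rw [← hp, coA_left hD, coB_left] at l7
      linarith
    by_cases hlr2 : l = r + 2
    · subst hlr2
      rw [← hq, coB_right hD, coA_right] at l7
      linarith
    exact absurd (hmin l l1 l2 hlr l3 hlr2 l4 l5) (not_le.2 l7)
  -- The winding number is constant along the diagonal and nonzero near its end at the extreme
  -- vertex.
  have hOw : ∀ y ∈ O, wind f i j y ≠ 0 := by
    obtain ⟨ε, e0, e1, e3, e2⟩ := exists_small hc (z - x) 1
    have hy₀ : x + ε • (z - x) ∈ O := by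
      rw [hO, openSegment_eq_image']
      exact ⟨ε, ⟨e0, e1⟩, rfl⟩
    have yA : coA x p q (x + ε • (z - x)) = ε * coA x p q z := by
      rw [coA_line]; simp
    have yB : coB x p q (x + ε • (z - x)) = ε * coB x p q z := by
      rw [coB_line]; simp
    have hw₀ := wind_ne_zero_of_corner hi hj hD e2
      (show 0 < coA x p q (x + ε • (z - x)) by rw [yA]; positivity)
      (show 0 < coB x p q (x + ε • (z - x)) by rw [yB]; positivity)
      (show coA x p q (x + ε • (z - x)) + coB x p q (x + ε • (z - x)) < 1 by
        rw [yA, yB]; nlinarith)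
    intro y hy
    rwa [wind_eq_of_isPreconnected (by omega) (convex_openSegment x z).isPreconnected hOt hy hy₀]
  have hclean : ∀ l, i ≤ l → l < 2 * n + i → ∀ y ∈ segment ℝ (f l) (f (l + 1)),
      y ∈ segment ℝ z x → y = x ∨ y = z := by
    intro l h1 h2 y hy hyc
    by_contra! hcon
    refine hf.notMem_of_inside hG hOt hOw h1 h2 hy ?_
    rw [segment_symm] at hyc
    exact mem_openSegment_of_ne_left_right hcon.1.symm hcon.2.symm hyc
  rcases lt_or_gt_of_ne m4 with h | h
  · right
    refine ⟨by omega, ?_⟩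
    -- The edge at `x` that is not part of the new polygon is tested just off `x`. The new polygon's
    -- winding number there reduces to that of a triangle lying on one side of the parallel to the
    -- diagonal through the test point.
    obtain ⟨ε, e0, e1, -, e2⟩ := exists_small hc (q - x) 0
    have hyB : coB x p q (x + ε • (q - x)) = ε := by
      rw [coB_line, coB_self, coB_right hD]; ring
    have hyA : coA x p q (x + ε • (q - x)) = 0 := by
      rw [coA_line, coA_self, coA_right]; ring
    refine hf.goodChord_of_clean (by omega) (by omega) (fun l h1 h2 y hy hy' =>
      (hclean l (by omega) (by omega) y hy (by rwa [segment_symm])).symm) (l₀ := r + 1) le_rfl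
      (by omega) (y₀ := x + ε • (q - x)) ?_ ?_ ?_ ?_
    · exact mem_segment_iff.2 ⟨ε, e0.le, e1.le, rfl⟩
    · intro h'
      rw [← hz] at h'
      rw [h'] at hyA
      linarith
    · intro h'
      rw [← hx] at h'
      rw [h', coB_self] at hyB
      linarith
    · refine wind_eq_zero_left (by omega) (fun l h1 h2 => e2 l (by omega) (by omega) (by omega)) ?_
      rw [← hx, ← hp, ← hz]
      have hw : ∀ v : ℂ, crs (v - (x + ε • (q - x))) ((crs (p - x) (q - x))⁻¹ • (z - x)) =
          (crs (v - x) (z - x) + ε * (coA x p q z * crs (p - x) (q - x))) /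
            crs (p - x) (q - x) := by
        intro v
        rw [crs_smul, coA, div_mul_cancel₀ _ hD, div_eq_inv_mul]
        congr 1
        simp only [crs, sub_re, sub_im, add_re, add_im, smul_re, smul_im, smul_eq_mul]
        ring
      have hw' : ∀ v : ℂ, crs (v - (x + ε • (q - x))) ((crs (p - x) (q - x))⁻¹ • (z - x)) =
          crs (v - x) (z - x) / crs (p - x) (q - x) + ε * coA x p q z := by
        intro v
        rw [hw]; field_simp
      refine triangle_ang_eq_zero_of_crs (w := (crs (p - x) (q - x))⁻¹ • (z - x)) ?_ ?_ ?_ <;>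
        rw [hw']
      · rw [crs_self]
        simp only [zero_div, zero_add]
        positivity
      · have : crs (p - x) (z - x) / crs (p - x) (q - x) = coB x p q z := rfl
        rw [this]
        positivity
      · simp only [sub_self, crs, zero_re, zero_im, zero_mul, zero_div, zero_add]
        positivity
  · left
    refine ⟨by omega, ?_⟩
    obtain ⟨ε, e0, e1, -, e2⟩ := exists_small hc (p - x) 0
    have hyA : coA x p q (x + ε • (p - x)) = ε := by
      rw [coA_line, coA_self, coA_left hD]; ring
    have hyB : coB x p q (x + ε • (p - x)) = 0 := by
      rw [coB_line, coB_self, coB_left]; ring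
    refine hf.goodChord_of_clean (by omega) (by omega) (fun l h1 h2 y hy hy' =>
      hclean l (by omega) (by omega) y hy hy') (l₀ := r + n) (by omega)
      (by omega) (y₀ := x + ε • (p - x)) ?_ ?_ ?_ ?_
    · rw [show r + n + 1 = r + 1 + n by omega, hf.periodic, hf.periodic, segment_symm]
      exact mem_segment_iff.2 ⟨ε, e0.le, e1.le, rfl⟩
    · intro h'
      rw [← hx] at h'
      rw [h', coA_self] at hyA
      linarith
    · intro h'
      rw [← hz] at h'
      rw [h'] at hyB
      linarith
    · refine wind_eq_zero_right (by omega)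
        (fun l h1 h2 => e2 l (by omega) (by omega) (by omega)) ?_
      rw [← hx, ← hq, ← hz]
      have hw' : ∀ v : ℂ, crs (v - (x + ε • (p - x))) ((-(crs (p - x) (q - x))⁻¹) • (z - x)) =
          - crs (v - x) (z - x) / crs (p - x) (q - x) + ε * coB x p q z := by
        intro v
        rw [crs_smul, coB]
        field_simp
        simp only [crs, sub_re, sub_im, add_re, add_im, smul_re, smul_im, smul_eq_mul]
        ring
      refine triangle_ang_eq_zero_of_crs (w := (-(crs (p - x) (q - x))⁻¹) • (z - x)) ?_ ?_ ?_ <;>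
        rw [hw']
      · simp only [sub_self, crs, zero_re, zero_im, zero_mul, neg_zero, zero_div, zero_add]
        positivity
      · have h1 : -crs (q - x) (z - x) / crs (p - x) (q - x) = coA x p q z := by
          rw [coA]
          congr 1
          simp only [crs]
          ring
        rw [h1]
        positivity
      · rw [crs_self]
        simp only [neg_zero, zero_div, zero_add]
        positivity

/-- At an extreme vertex either the corner triangle is empty and is itself an ear, or a diagonal
from that vertex to a vertex in the triangle cuts off fewer edges. -/
theorem exists_shorter (hf : SimpleLoop n f) (hG : GoodChord n f i j) (hij : i + 3 ≤ j) :
    ∃ i' j', j' - i' < j - i ∧ GoodChord n f i' j' := by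
  classical
  obtain ⟨k, c, hk1, hk2, hc⟩ := hf.exists_extreme (show i + 2 ≤ j by omega) hG.lt
  obtain ⟨r, rfl⟩ : ∃ r, k = r + 1 := ⟨k - 1, by omega⟩
  set H : ℕ → ℝ := fun m =>
    coA (f (r + 1)) (f r) (f (r + 2)) (f m) + coB (f (r + 1)) (f r) (f (r + 2)) (f m) with hH
  set Z : Finset ℕ := (Finset.Icc i j).filter fun m => m ≠ r ∧ m ≠ r + 1 ∧ m ≠ r + 2 ∧
    0 ≤ coA (f (r + 1)) (f r) (f (r + 2)) (f m) ∧
    0 ≤ coB (f (r + 1)) (f r) (f (r + 2)) (f m) ∧ H m ≤ 1 with hZ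
  rcases Z.eq_empty_or_nonempty with h | h
  · refine ⟨r, r + 2, by omega, hf.goodChord_of_empty hG hij (by omega) (by omega) hc ?_⟩
    intro m m1 m2 m3 m4 m5
    by_contra! hcon
    have : m ∈ Z := Finset.mem_filter.2
      ⟨Finset.mem_Icc.2 ⟨m1, m2⟩, m3, m4, m5, hcon.1, hcon.2.1, hcon.2.2⟩
    rw [h] at this
    simp at this
  · obtain ⟨m, hm, hmin⟩ := Finset.exists_min_image Z H h
    obtain ⟨hmI, m3, m4, m5, m6, m7, m8⟩ := Finset.mem_filter.1 hm
    rw [Finset.mem_Icc] at hmI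
    rcases hf.exists_goodChord_of_vertex hG hij (by omega) (by omega) hc hmI.1 hmI.2 m3 m4 m5 m6 m7
      m8 (fun l l1 l2 l3 l4 l5 l6 l7 => by
        by_cases hl : H l ≤ 1
        · exact hmin l (Finset.mem_filter.2 ⟨Finset.mem_Icc.2 ⟨l1, l2⟩, l3, l4, l5, l6, l7, hl⟩)
        · exact m8.trans (not_le.1 hl).le) with ⟨h1, h2⟩ | ⟨h1, h2⟩
    · exact ⟨_, _, by omega, h2⟩
    · exact ⟨_, _, by omega, h2⟩

/-- Every simple polygon in general position with more than three vertices has an ear: a triangle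
spanned by two consecutive edges that does not meet the rest of the polygon. -/
theorem exists_ear (hf : SimpleLoop n f) (hn : 4 ≤ n) : ∃ r, r + 2 < n ∧
    ∀ l, r + 2 ≤ l → l < n + r → ∀ y ∈ segment ℝ (f l) (f (l + 1)),
      0 ≤ coA (f (r + 1)) (f r) (f (r + 2)) y → 0 ≤ coB (f (r + 1)) (f r) (f (r + 2)) y →
      coA (f (r + 1)) (f r) (f (r + 2)) y + coB (f (r + 1)) (f r) (f (r + 2)) y ≤ 1 →
      y = f r ∨ y = f (r + 2) := by
  -- Descent on the number of edges cut off; a good chord over two edges is an ear.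
  have key : ∀ d i j, j - i = d → GoodChord n f i j → ∃ r, GoodChord n f r (r + 2) := by
    intro d
    induction d using Nat.strong_induction_on with
    | _ d ih =>
      intro i j hd hG
      have := hG.le
      by_cases h : j = i + 2
      · exact ⟨i, h ▸ hG⟩
      · obtain ⟨i', j', h1, h2⟩ := hf.exists_shorter hG (by omega)
        exact ih (j' - i') (by omega) i' j' rfl h2
  obtain ⟨r, hG⟩ := key _ 0 (n - 1) rfl (hf.goodChord (by omega))
  have hrn := hG.lt
  have hD := hf.crs_corner_ne_zero hrn
  refine ⟨r, hrn, fun l h1 h2 y hy hA hB hH => ?_⟩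
  rcases hG.out l h1 h2 y hy with h | h | h | ⟨h, hw⟩
  · exact Or.inl h
  · exact Or.inr h
  · omega
  have hw' : ang y (f r) (f (r + 1)) + ang y (f (r + 1)) (f (r + 2)) + ang y (f (r + 2)) (f r) =
      0 := by
    rw [wind, Finset.sum_eq_sum_Ico_succ_bot (by omega),
      Finset.sum_eq_sum_Ico_succ_bot (by omega)] at hw
    simpa using hw
  -- A point of the rest on a leg of the triangle is a common endpoint by simplicity, on the base it
  -- contradicts cleanness, and in the interior it contradicts winding number zero.
  rcases eq_or_lt_of_le hA with hA0 | hA0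
  · have := mem_right_of_coord hD hB (by linarith) hA0.symm
    rcases hf.edge (r + 1) l y (by omega) (by omega) this hy with ⟨h', h''⟩ | ⟨h', -⟩
    · exact Or.inr (by rw [h'', h'])
    · omega
  rcases eq_or_lt_of_le hB with hB0 | hB0
  · have := mem_left_of_coord hD hA (by linarith) hB0.symm
    rw [segment_symm] at this
    rcases hf.edge r l y (by omega) (by omega) this hy with ⟨h, -⟩ | ⟨-, h⟩
    · omega
    · exact Or.inl h
  rcases eq_or_lt_of_le hH with hH0 | hH0
  · exact absurd (mem_base_of_coord hD hA hB hH0) h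
  · exact absurd hw' (triangle_ang_ne_zero_of_coord hD hA0 hB0 hH0)

end SimpleLoop

end SquarePeg

end

section

open Set Complex ComplexConjugate Filter Topology

namespace SquarePeg

/-! ### Squares inscribed in triangles -/

/-- The boundary of a triangle. -/
def triBdry (p q r : ℂ) : Set ℂ := segment ℝ p q ∪ segment ℝ q r ∪ segment ℝ r p

theorem triBdry_swap (p q r : ℂ) : triBdry q p r = triBdry p q r := by
  simp only [triBdry, segment_symm ℝ q p, segment_symm ℝ p r, segment_symm ℝ r q]
  rw [union_right_comm]

theorem triBdry_rotate (p q r : ℂ) : triBdry q r p = triBdry p q r := by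
  simp only [triBdry]
  rw [union_assoc, union_comm]
  ac_rfl

/-- The position of the foot of the altitude from `r` on the side from `p` to `q`. -/
noncomputable def foot (p q r : ℂ) : ℝ := ((r - p) / (q - p)).re

/-- The ratio of the sizes of the triangle above the inscribed square with a side on `p q`
and of the triangle `p q r`, subtracted from one. -/
noncomputable def ratio (p q r : ℂ) : ℝ := 1 / (1 + |((r - p) / (q - p)).im|)

/-- The vertices of the square with a side on `p q` and the other two vertices on the other two
sides of the triangle `p q r`. -/
noncomputable def sideSquare (p q r : ℂ) : Set ℂ :=
  {p + (foot p q r * ratio p q r) • (q - p),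
    p + (1 - (1 - foot p q r) * ratio p q r) • (q - p),
    q + ratio p q r • (r - q), p + ratio p q r • (r - p)}

theorem ratio_pos (p q r : ℂ) : 0 < ratio p q r := by
  unfold ratio
  positivity

theorem one_sub_div {p q r : ℂ} (h : p ≠ q) : (r - q) / (p - q) = 1 - (r - p) / (q - p) := by
  have h1 : p - q ≠ 0 := sub_ne_zero.2 h
  have h2 : q - p ≠ 0 := sub_ne_zero.2 h.symm
  field_simp
  ring

theorem foot_swap {p q r : ℂ} (h : p ≠ q) : foot q p r = 1 - foot p q r := by
  rw [foot, one_sub_div h, sub_re, one_re, foot]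

theorem ratio_swap {p q r : ℂ} (h : p ≠ q) : ratio q p r = ratio p q r := by
  rw [ratio, one_sub_div h, sub_im, one_im, zero_sub, abs_neg, ratio]

theorem sideSquare_swap {p q r : ℂ} (h : p ≠ q) : sideSquare q p r = sideSquare p q r := by
  have e1 : q + (foot q p r * ratio q p r) • (p - q) =
      p + (1 - (1 - foot p q r) * ratio p q r) • (q - p) := by
    rw [foot_swap h, ratio_swap h]
    simp only [real_smul]; push_cast; ring
  have e2 : q + (1 - (1 - foot q p r) * ratio q p r) • (p - q) =
      p + (foot p q r * ratio p q r) • (q - p) := by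
    rw [foot_swap h, ratio_swap h]
    simp only [real_smul]; push_cast; ring
  rw [sideSquare, e1, e2, ratio_swap h, sideSquare]
  ext y
  simp only [mem_insert_iff, mem_singleton_iff]
  tauto

theorem range_squareCorner (a v : ℂ) :
    range (squareCorner a v) = {a, a + v, a + v + I * v, a + I * v} := by
  ext y
  simp only [mem_range, Fin.exists_fin_succ, squareCorner, mem_insert_iff, mem_singleton_iff]
  simp [eq_comm]

section

variable {p q r : ℂ}

theorem apex_eq (hpq : p ≠ q) : r = p + ((r - p) / (q - p)) * (q - p) := by
  rw [div_mul_cancel₀ _ (sub_ne_zero.2 hpq.symm)]; ring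

theorem sideSquare_eq_range (hpq : p ≠ q) (h : 0 < ((r - p) / (q - p)).im) :
    sideSquare p q r = range (squareCorner (p + (foot p q r * ratio p q r) • (q - p))
      ((1 - ratio p q r) • (q - p))) := by
  have hr := apex_eq (r := r) hpq
  set w := (r - p) / (q - p) with hw
  -- With `p, q, r` normalised to `0, 1, w`, the upper vertices have height `ratio * Im w`, which
  -- must equal the side length `1 - ratio`.
  have ht : ratio p q r * w.im = 1 - ratio p q r := by
    rw [ratio, ← hw, abs_of_pos h]
    field_simp
    ring
  have hwt : (ratio p q r : ℂ) * w = ratio p q r * foot p q r + (1 - ratio p q r) * I := by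
    apply Complex.ext
    · simp [foot, ← hw]
    · simp [ht]
  rw [range_squareCorner, sideSquare]
  have e1 : p + (foot p q r * ratio p q r) • (q - p) + (1 - ratio p q r) • (q - p) =
      p + (1 - (1 - foot p q r) * ratio p q r) • (q - p) := by
    simp only [real_smul]; push_cast; ring
  have e2 : p + (1 - (1 - foot p q r) * ratio p q r) • (q - p) +
      I * (1 - ratio p q r) • (q - p) = q + ratio p q r • (r - q) := by
    simp only [real_smul]; push_cast
    linear_combination (-(ratio p q r : ℂ)) * hr - (q - p) * hwt
  have e3 : p + (foot p q r * ratio p q r) • (q - p) +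
      I * (1 - ratio p q r) • (q - p) = p + ratio p q r • (r - p) := by
    simp only [real_smul]; push_cast
    linear_combination (-(ratio p q r : ℂ)) * hr - (q - p) * hwt
  rw [e1, e2, e3]

theorem ratio_lt_one (h : ((r - p) / (q - p)).im ≠ 0) : ratio p q r < 1 := by
  have := abs_pos.2 h
  rw [ratio, div_lt_one (by positivity)]
  linarith

theorem im_swap (hpq : p ≠ q) : ((r - q) / (p - q)).im = -((r - p) / (q - p)).im := by
  rw [one_sub_div hpq]; simp

theorem isSquareVertexSet_sideSquare (hpq : p ≠ q) (h : ((r - p) / (q - p)).im ≠ 0) :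
    IsSquareVertexSet (sideSquare p q r) := by
  have key : ∀ p q : ℂ, p ≠ q → 0 < ((r - p) / (q - p)).im →
      IsSquareVertexSet (sideSquare p q r) := by
    intro p q hpq h
    refine ⟨_, _, ?_, sideSquare_eq_range hpq h⟩
    exact smul_ne_zero (sub_pos.2 (ratio_lt_one h.ne')).ne' (sub_ne_zero.2 hpq.symm)
  rcases lt_or_gt_of_ne h with h | h
  · rw [← sideSquare_swap hpq]
    exact key q p hpq.symm (by rw [im_swap hpq]; linarith)
  · exact key p q hpq h

theorem sideSquare_feet (h0 : 0 ≤ foot p q r) (h1 : foot p q r ≤ 1)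
    (ht : ratio p q r < 1) :
    p + (foot p q r * ratio p q r) • (q - p) ∈ segment ℝ p q ∧
    p + (1 - (1 - foot p q r) * ratio p q r) • (q - p) ∈ segment ℝ p q := by
  have := ratio_pos p q r
  exact ⟨mem_segment_iff.2 ⟨_, by positivity, by nlinarith, rfl⟩,
    mem_segment_iff.2 ⟨_, by nlinarith, by nlinarith, rfl⟩⟩

theorem sideSquare_tops (ht : ratio p q r < 1) :
    q + ratio p q r • (r - q) ∈ segment ℝ q r ∧ p + ratio p q r • (r - p) ∈ segment ℝ r p := by
  have := ratio_pos p q r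
  refine ⟨mem_segment_iff.2 ⟨_, this.le, ht.le, rfl⟩, ?_⟩
  rw [segment_symm]
  exact mem_segment_iff.2 ⟨_, this.le, ht.le, rfl⟩

theorem sideSquare_subset (h : ((r - p) / (q - p)).im ≠ 0)
    (h0 : 0 ≤ foot p q r) (h1 : foot p q r ≤ 1) : sideSquare p q r ⊆ triBdry p q r := by
  have ht := ratio_lt_one h
  obtain ⟨f1, f2⟩ := sideSquare_feet h0 h1 ht
  obtain ⟨t1, t2⟩ := sideSquare_tops ht
  rintro y (rfl | rfl | rfl | rfl)
  · exact Or.inl (Or.inl f1)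
  · exact Or.inl (Or.inl f2)
  · exact Or.inl (Or.inr t1)
  · exact Or.inr t2

/-- In the coordinate where `p` is 0 and `q` is 1, a boundary point is either on the base or at a
fraction `τ` of the height on one of the other two sides. -/
theorem mem_triBdry_coord (hpq : p ≠ q) {z : ℂ} (hz : p + (q - p) * z ∈ triBdry p q r) :
    z.im = 0 ∨ ∃ τ : ℝ, 0 ≤ τ ∧ τ ≤ 1 ∧ z.im = τ * ((r - p) / (q - p)).im ∧
      (z.re = 1 + τ * (foot p q r - 1) ∨ z.re = τ * foot p q r) := by
  have hr := apex_eq (r := r) hpq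
  have hd : q - p ≠ 0 := sub_ne_zero.2 hpq.symm
  set w := (r - p) / (q - p) with hw
  have hf : foot p q r = w.re := rfl
  rcases hz with (hz | hz) | hz
  · obtain ⟨s, -, -, hs⟩ := mem_segment_iff.1 hz
    left
    have : z = s := by
      refine mul_left_cancel₀ hd ?_
      rw [real_smul] at hs
      linear_combination hs
    rw [this]; simp
  · obtain ⟨τ, h0, h1, hs⟩ := mem_segment_iff.1 hz
    right
    have : z = 1 + τ * (w - 1) := by
      refine mul_left_cancel₀ hd ?_
      rw [real_smul] at hs
      linear_combination hs + (τ : ℂ) * hr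
    refine ⟨τ, h0, h1, by rw [this]; simp, Or.inl (by rw [this, hf]; simp)⟩
  · rw [segment_symm] at hz
    obtain ⟨τ, h0, h1, hs⟩ := mem_segment_iff.1 hz
    right
    have : z = τ * w := by
      refine mul_left_cancel₀ hd ?_
      rw [real_smul] at hs
      linear_combination hs + (τ : ℂ) * hr
    refine ⟨τ, h0, h1, by rw [this]; simp, Or.inr (by rw [this, hf]; simp)⟩

/-- A square inscribed in a triangle is determined by the side of the triangle that contains a
side of the square. -/
theorem eq_sideSquare (hpq : p ≠ q) (h : ((r - p) / (q - p)).im ≠ 0) {a v : ℂ} (hv : v ≠ 0)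
    (hS : range (squareCorner a v) ⊆ triBdry p q r) (ha : a ∈ segment ℝ p q)
    (hav : a + v ∈ segment ℝ p q) :
    0 ≤ foot p q r ∧ foot p q r ≤ 1 ∧ range (squareCorner a v) = sideSquare p q r := by
  have key : ∀ p q : ℂ, p ≠ q → 0 < ((r - p) / (q - p)).im →
      range (squareCorner a v) ⊆ triBdry p q r → a ∈ segment ℝ p q → a + v ∈ segment ℝ p q →
      0 ≤ foot p q r ∧ foot p q r ≤ 1 ∧ range (squareCorner a v) = sideSquare p q r := by
    intro p q hpq h hS ha hav
    obtain ⟨s₀, a0, a1, hs₀⟩ := mem_segment_iff.1 ha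
    obtain ⟨s₁, b0, b1, hs₁⟩ := mem_segment_iff.1 hav
    rw [real_smul] at hs₀ hs₁
    have hvd : v = (q - p) * ((s₁ - s₀ : ℝ) : ℂ) := by push_cast; linear_combination hs₁ - hs₀
    have hσ : s₁ - s₀ ≠ 0 := by
      intro h0
      rw [h0] at hvd
      simp at hvd
      exact hv hvd
    have h3 : p + (q - p) * (⟨s₀, s₁ - s₀⟩ : ℂ) ∈ triBdry p q r := by
      have : p + (q - p) * (⟨s₀, s₁ - s₀⟩ : ℂ) = squareCorner a v 3 := by
        rw [squareCorner_apply, sqCoeff_three, hvd, hs₀, mk_eq_add_mul_I]; ring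
      rw [this]
      exact hS (mem_range_self _)
    have h2 : p + (q - p) * (⟨s₁, s₁ - s₀⟩ : ℂ) ∈ triBdry p q r := by
      have : p + (q - p) * (⟨s₁, s₁ - s₀⟩ : ℂ) = squareCorner a v 2 := by
        rw [squareCorner_apply, sqCoeff_two, hvd, hs₀, mk_eq_add_mul_I]; push_cast; ring
      rw [this]
      exact hS (mem_range_self _)
    rcases mem_triBdry_coord hpq h3 with h3 | ⟨τ, t0, t1, ht, h3⟩
    · exact absurd h3 hσ
    rcases mem_triBdry_coord hpq h2 with h2 | ⟨τ', t0', t1', ht', h2⟩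
    · exact absurd h2 hσ
    simp only at ht ht' h3 h2
    obtain rfl : τ = τ' := mul_right_cancel₀ h.ne' (ht.symm.trans ht')
    have hpos : 0 < s₁ - s₀ := lt_of_le_of_ne (by rw [ht]; positivity) hσ.symm
    have hτ : 0 < τ := by
      refine lt_of_le_of_ne t0 fun h0 => hσ ?_
      rw [ht, ← h0, zero_mul]
    -- The upper corners are at equal height, so they cannot share a side. Having the left one on `q
    -- r` and the right one on `r p` would give width `τ - 1 ≤ 0`.
    have hfin : s₀ = τ * foot p q r ∧ s₁ = 1 + τ * (foot p q r - 1) := by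
      rcases h3 with h3 | h3 <;> rcases h2 with h2 | h2
      · linarith
      · nlinarith
      · exact ⟨h3, h2⟩
      · linarith
    obtain ⟨e0, e1⟩ := hfin
    have hτr : τ = ratio p q r := by
      rw [ratio, abs_of_pos h, eq_div_iff (by positivity)]
      nlinarith
    refine ⟨?_, ?_, ?_⟩
    · by_contra! hneg
      nlinarith
    · by_contra! hneg
      nlinarith
    · rw [sideSquare_eq_range hpq h]
      congr 2
      · rw [hs₀, e0, hτr, real_smul, mul_comm (ratio p q r)]
      · rw [hvd, real_smul, mul_comm, e0, e1, hτr]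
        push_cast
        ring
  rcases lt_or_gt_of_ne h with h | h
  · have := key q p hpq.symm (by rw [im_swap hpq]; linarith) (by rwa [triBdry_swap])
      (by rwa [segment_symm]) (by rwa [segment_symm])
    rw [foot_swap hpq, sideSquare_swap hpq] at this
    exact ⟨by linarith [this.2.1], by linarith [this.1], this.2.2⟩
  · exact key p q hpq h hS ha hav

theorem height_of_mem_triBdry {y : ℂ} (hy : y ∈ triBdry p q r) :
    ∃ τ : ℝ, 0 ≤ τ ∧ crs (q - p) (y - p) = τ * crs (q - p) (r - p) := by
  rcases hy with (hy | hy) | hy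
  · obtain ⟨s, -, -, rfl⟩ := mem_segment_iff.1 hy
    refine ⟨0, le_rfl, ?_⟩
    rw [add_sub_cancel_left, crs_smul, crs_self]; simp
  · obtain ⟨s, h0, -, rfl⟩ := mem_segment_iff.1 hy
    refine ⟨s, h0, ?_⟩
    simp only [crs, sub_re, sub_im, add_re, add_im, smul_re, smul_im, smul_eq_mul]; ring
  · obtain ⟨s, -, h1, rfl⟩ := mem_segment_iff.1 hy
    refine ⟨1 - s, by linarith, ?_⟩
    simp only [crs, sub_re, sub_im, add_re, add_im, smul_re, smul_im, smul_eq_mul]; ring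

/-- Opposite vertices of an inscribed square do not lie on the same side. -/
theorem not_opposite (hD : crs (q - p) (r - p) ≠ 0) {a v : ℂ} (hv : v ≠ 0)
    (hS : range (squareCorner a v) ⊆ triBdry p q r) (ha : a ∈ segment ℝ p q)
    (hc : a + (1 + I) * v ∈ segment ℝ p q) : False := by
  have hmem : ∀ k, a + sqCoeff k * v ∈ triBdry p q r := fun k => by
    rw [← squareCorner_apply]; exact hS (mem_range_self k)
  have hline : ∀ y ∈ segment ℝ p q, crs (q - p) (y - p) = 0 := by
    intro y hy
    obtain ⟨s, -, -, rfl⟩ := mem_segment_iff.1 hy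
    rw [add_sub_cancel_left, crs_smul, crs_self, mul_zero]
  obtain ⟨τ, h0, h1⟩ := height_of_mem_triBdry (hmem 1)
  obtain ⟨τ', h0', h1'⟩ := height_of_mem_triBdry (hmem 3)
  have e0 := hline _ ha
  have e2 := hline _ hc
  simp only [sqCoeff_one, sqCoeff_three, one_mul] at h1 h1'
  -- Since the diagonals bisect each other, the heights of the other two corners sum to zero. All
  -- heights have the same sign, so the whole square would lie on one line.
  have hsum : crs (q - p) (a + v - p) + crs (q - p) (a + I * v - p) =
      crs (q - p) (a - p) + crs (q - p) (a + (1 + I) * v - p) := by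
    simp [crs]; ring
  rw [e0, e2, h1, h1', ← add_mul, add_zero, mul_eq_zero, or_iff_left hD] at hsum
  have hτ : τ = 0 := by linarith
  have hτ' : τ' = 0 := by linarith
  rw [hτ, zero_mul] at h1
  rw [hτ', zero_mul] at h1'
  have hd : q - p ≠ 0 := fun h => hD (by rw [h]; simp [crs])
  refine hv (eq_zero_of_crs hd (by decide : (1 : Fin 4) ≠ 3) (by decide) (by decide) ?_ ?_)
  · have : sqCoeff 1 * v = (a + v - p) - (a - p) := by rw [sqCoeff_one]; ring
    rw [this, crs_sub, h1, e0, sub_zero]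
  · have : sqCoeff 3 * v = (a + I * v - p) - (a - p) := by rw [sqCoeff_three]; ring
    rw [this, crs_sub, h1', e0, sub_zero]

/-- Two vertices of an inscribed square on the same side determine the square. -/
theorem eq_sideSquare_of_two (hD : crs (q - p) (r - p) ≠ 0) {S : Set ℂ}
    (hS : IsSquareVertexSet S) (hSb : S ⊆ triBdry p q r) {b b' : ℂ} (hb : b ∈ S) (hb' : b' ∈ S)
    (hbb' : b ≠ b') (h : b ∈ segment ℝ p q) (h' : b' ∈ segment ℝ p q) :
    0 ≤ foot p q r ∧ foot p q r ≤ 1 ∧ S = sideSquare p q r := by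
  have hpq : p ≠ q := fun h => hD (by rw [h]; simp [crs])
  have him : ((r - p) / (q - p)).im ≠ 0 := by
    rw [div_im, ← sub_div]
    refine div_ne_zero ?_ (normSq_pos.2 (sub_ne_zero.2 hpq.symm)).ne'
    intro h0
    apply hD
    simp only [crs]
    linarith
  obtain ⟨v, hv, rfl⟩ := IsSquareVertexSet.exists_eq hS hb
  obtain ⟨k, hk⟩ := hb'
  rw [squareCorner_apply] at hk
  fin_cases k
  · simp at hk
    exact absurd hk hbb'
  · simp at hk
    exact eq_sideSquare hpq him hv hSb h (hk ▸ h')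
  · simp at hk
    exact (not_opposite hD hv hSb h (hk ▸ h')).elim
  · simp at hk
    -- If `b'` is the preceding corner, the square is relabelled to start at `b'`, so that `b`
    -- becomes the next one.
    have hrot : squareCorner b v = squareCorner (b + I * v) (-I * v) ∘ (fun k => k + 1) := by
      funext k
      rw [Function.comp, squareCorner_apply, squareCorner_apply, ← corner_rotate]
      linear_combination (sqCoeff k * v) * I_mul_I
    have hrange : range (squareCorner b v) = range (squareCorner (b + I * v) (-I * v)) := by
      rw [hrot]
      exact (Equiv.addRight (1 : Fin 4)).surjective.range_comp _
    rw [hrange] at hSb ⊢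
    refine eq_sideSquare hpq him (by simpa using hv) hSb (hk ▸ h') ?_
    rw [show b + I * v + -I * v = b by ring]
    exact h

end

end SquarePeg

end

section

open Set Complex ComplexConjugate Filter Topology

namespace SquarePeg

/-! ### Triangles -/

/-- The inner product of the edges at the `i`-th vertex of a triangle. -/
def gram (x : Fin 3 → ℂ) (i : Fin 3) : ℝ :=
  (x (i + 1) - x i).re * (x (i + 2) - x i).re + (x (i + 1) - x i).im * (x (i + 2) - x i).im

/-- Twice the signed area of a triangle. -/
def area (x : Fin 3 → ℂ) : ℝ := crs (x 1 - x 0) (x 2 - x 0)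

theorem crs_eq_area (x : Fin 3 → ℂ) (i : Fin 3) :
    crs (x (i + 1) - x i) (x (i + 2) - x i) = area x := by
  fin_cases i
  · rfl
  · simp only [Fin.mk_one, Fin.reduceAdd, area, crs, sub_re, sub_im]; ring
  · simp only [Fin.reduceFinMk, Fin.reduceAdd, area, crs, sub_re, sub_im]; ring

theorem ne_of_area {x : Fin 3 → ℂ} (h : area x ≠ 0) (i : Fin 3) : x i ≠ x (i + 1) := by
  intro h0
  apply h
  rw [← crs_eq_area x i, h0]
  simp [crs]

theorem im_ne_zero_of_area {x : Fin 3 → ℂ} (h : area x ≠ 0) (i : Fin 3) :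
    ((x (i + 2) - x i) / (x (i + 1) - x i)).im ≠ 0 := by
  rw [div_im, ← sub_div]
  refine div_ne_zero ?_ (normSq_pos.2 (sub_ne_zero.2 (ne_of_area h i).symm)).ne'
  intro h0
  apply h
  rw [← crs_eq_area x i]
  simp only [crs]
  linarith

theorem boundary_eq_triBdry (X : Polygon ℂ 3) (i : Fin 3) :
    X.boundary ℝ = triBdry (X i) (X (i + 1)) (X (i + 2)) := by
  have h0 : X.boundary ℝ = triBdry (X 0) (X 1) (X 2) := by
    ext b
    rw [mem_boundary_iff]
    simp only [edgeSet_eq_segment, Fin.exists_fin_succ, triBdry, mem_union]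
    simp [or_assoc]
  fin_cases i
  · exact h0
  · rw [h0]; exact (triBdry_rotate _ _ _).symm
  · rw [h0]; exact triBdry_rotate _ _ _

/-- The square on the `i`-th side of a triangle. -/
noncomputable def sideSq (x : Fin 3 → ℂ) (i : Fin 3) : Set ℂ :=
  sideSquare (x i) (x (i + 1)) (x (i + 2))

theorem foot_nonneg_iff {x : Fin 3 → ℂ} (h : area x ≠ 0) (i : Fin 3) :
    0 ≤ foot (x i) (x (i + 1)) (x (i + 2)) ↔ 0 ≤ gram x i := by
  have hd := normSq_pos.2 (sub_ne_zero.2 (ne_of_area h i).symm)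
  rw [foot, div_re, ← add_div, le_div_iff₀ hd, zero_mul, gram]
  simp only [mul_comm]

theorem foot_le_one_iff {x : Fin 3 → ℂ} (h : area x ≠ 0) (i : Fin 3) :
    foot (x i) (x (i + 1)) (x (i + 2)) ≤ 1 ↔ 0 ≤ gram x (i + 1) := by
  have hd := normSq_pos.2 (sub_ne_zero.2 (ne_of_area h i).symm)
  have e1 : i + 1 + 1 = i + 2 := by rw [add_assoc]; rfl
  have e2 : i + 1 + 2 = i := by fin_cases i <;> rfl
  rw [foot, div_re, ← add_div, div_le_one hd, gram, e1, e2, normSq_apply]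
  simp only [sub_re, sub_im]
  constructor <;> intro h <;> nlinarith

/-- Four corners on three sides: two of them share a side, and then the square is the one standing
on that side. It fits exactly when the foot of the altitude is on the side, that is, when neither
adjacent angle is obtuse. -/
theorem inscribedSquares_eq {X : Polygon ℂ 3} (h : area X.vertices ≠ 0) :
    X.inscribedSquares =
      sideSq X.vertices '' {i | 0 ≤ gram X.vertices i ∧ 0 ≤ gram X.vertices (i + 1)} := by
  ext S
  constructor
  · rintro ⟨hS, hSb⟩
    obtain ⟨a, v, hv, rfl⟩ := hS
    choose e he using fun k => mem_boundary_iff.1 (hSb (mem_range_self k))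
    obtain ⟨k, l, hkl, hekl⟩ := Fintype.exists_ne_map_eq_of_card_lt e (by simp)
    have hk := he k
    have hl := he l
    rw [← hekl] at hl
    rw [edgeSet_eq_segment, finRotate_apply] at hk hl
    rw [boundary_eq_triBdry X (e k)] at hSb
    obtain ⟨h0, h1, h2⟩ := eq_sideSquare_of_two (by rw [crs_eq_area]; exact h) ⟨a, v, hv, rfl⟩ hSb
      (mem_range_self k) (mem_range_self l) (fun h => hkl (squareCorner_injective hv h)) hk hl
    exact ⟨e k, ⟨(foot_nonneg_iff h _).1 h0, (foot_le_one_iff h _).1 h1⟩, h2.symm⟩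
  · rintro ⟨i, ⟨h0, h1⟩, rfl⟩
    refine ⟨isSquareVertexSet_sideSquare (ne_of_area h i) (im_ne_zero_of_area h i), ?_⟩
    rw [boundary_eq_triBdry X i]
    exact sideSquare_subset (im_ne_zero_of_area h i) ((foot_nonneg_iff h i).2 h0)
      ((foot_le_one_iff h i).2 h1)

/-- The sum is the squared length of the side, so at most one angle is right or obtuse. -/
theorem gram_add_pos {x : Fin 3 → ℂ} (h : area x ≠ 0) (i : Fin 3) :
    0 < gram x i + gram x (i + 1) := by
  have hd := normSq_pos.2 (sub_ne_zero.2 (ne_of_area h i).symm)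
  have e1 : i + 1 + 1 = i + 2 := by rw [add_assoc]; rfl
  have e2 : i + 1 + 2 = i := by fin_cases i <;> rfl
  rw [gram, gram, e1, e2]
  rw [normSq_apply] at hd
  simp only [sub_re, sub_im] at hd ⊢
  nlinarith

/-- Of three collinear vertices one lies between the other two, so that two consecutive edges
overlap. The position `t` of the third vertex decides which. -/
theorem area_ne_zero_of_isSimple {X : Polygon ℂ 3} (hX : X.IsSimple) : area X.vertices ≠ 0 := by
  intro h0
  have hinj := hX.injective
  have h01 : X.vertices 1 - X.vertices 0 ≠ 0 := sub_ne_zero.2 (hinj.ne (by decide))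
  obtain ⟨t, ht⟩ := (crs_eq_zero_iff h01 _).1 h0
  have c0 := hX.consecutive 0
  have c1 := hX.consecutive 1
  have c2 := hX.consecutive 2
  simp only [edgeSet_eq_segment, finRotate_apply, Fin.reduceAdd, zero_add] at c0 c1 c2
  have hx2 : X.vertices 2 = X.vertices 0 + t • (X.vertices 1 - X.vertices 0) := by
    rw [← ht]; ring
  rcases lt_or_ge t 0 with h | h
  · have : X.vertices 0 ∈ segment ℝ (X.vertices 1) (X.vertices 2) := by
      refine mem_segment_iff.2 ⟨1 / (1 - t), by apply div_nonneg <;> linarith,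
        (div_le_one (by linarith)).2 (by linarith), ?_⟩
      have h1 : (1 - t : ℂ) ≠ 0 := by exact_mod_cast (by linarith : (1 - t) ≠ 0)
      rw [hx2]
      simp only [real_smul]
      push_cast
      field_simp
      ring
    have hm : X.vertices 0 ∈ ({X.vertices 1} : Set ℂ) := c0 ▸ ⟨left_mem_segment ℝ _ _, this⟩
    exact absurd (hinj hm) (by decide)
  rcases le_or_gt t 1 with h' | h'
  · have hm : X.vertices 2 ∈ ({X.vertices 0} : Set ℂ) :=
      c2 ▸ ⟨left_mem_segment ℝ _ _, mem_segment_iff.2 ⟨t, h, h', hx2⟩⟩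
    exact absurd (hinj hm) (by decide)
  · have : X.vertices 1 ∈ segment ℝ (X.vertices 2) (X.vertices 0) := by
      rw [segment_symm]
      have h1 : (t : ℂ) ≠ 0 := by exact_mod_cast (by linarith : t ≠ 0)
      refine mem_segment_iff.2 ⟨1 / t, by positivity, (div_le_one (by linarith)).2 h'.le, ?_⟩
      rw [hx2]
      simp only [real_smul]
      push_cast
      field_simp
      ring
    have hm : X.vertices 1 ∈ ({X.vertices 2} : Set ℂ) := c1 ▸ ⟨left_mem_segment ℝ _ _, this⟩
    exact absurd (hinj hm) (by decide)

theorem isSimple_of_area {X : Polygon ℂ 3} (h : area X.vertices ≠ 0) : X.IsSimple := by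
  have hne := ne_of_area h
  refine ⟨?_, fun i => ?_, fun i j h1 h2 h3 => ?_⟩
  · intro i j hij
    by_contra hne'
    rcases (by revert hne'; fin_cases i <;> fin_cases j <;> decide : j = i + 1 ∨ i = j + 1)
      with rfl | rfl
    · exact hne _ hij
    · exact hne _ hij.symm
  · rw [edgeSet_eq_segment, edgeSet_eq_segment, finRotate_apply, finRotate_apply]
    have e1 : i + 1 + 1 = i + 2 := by rw [add_assoc]; rfl
    rw [e1]
    have hD : crs (X.vertices i - X.vertices (i + 1)) (X.vertices (i + 2) - X.vertices (i + 1)) ≠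
        0 := by
      intro h0
      apply h
      rw [← crs_eq_area _ i]
      simp only [crs, sub_re, sub_im] at h0 ⊢
      linarith
    refine Subset.antisymm ?_ ?_
    · rintro y ⟨hy1, hy2⟩
      rw [segment_symm] at hy1
      refine eq_of_coord hD ?_ ?_
      · rw [coord_of_mem_right hy2, coA_self]
      · rw [coord_of_mem_left hy1, coB_self]
    · rintro y rfl
      exact ⟨right_mem_segment ℝ _ _, left_mem_segment ℝ _ _⟩
  · exfalso
    rw [finRotate_apply] at h2 h3
    revert h1 h2 h3
    fin_cases i <;> fin_cases j <;> decide

/-- A generic triangle has one or three inscribed squares. -/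
theorem odd_ncard_of_triangle {X : Polygon ℂ 3} (hX : X.IsSimple) (hg : X.IsGeneric) :
    Odd X.inscribedSquares.ncard := by
  have h := area_ne_zero_of_isSimple hX
  have heq := inscribedSquares_eq h
  -- The square on side `j` has two corners on that side. The square on another side `i`, whose
  -- corners avoid the vertices by genericity, has only one corner there.
  have hinj : InjOn (sideSq X.vertices)
      {i | 0 ≤ gram X.vertices i ∧ 0 ≤ gram X.vertices (i + 1)} := by
    intro i hi j hj hij
    by_contra hne
    have hSi : sideSq X.vertices i ∈ X.inscribedSquares := by
      rw [heq]; exact mem_image_of_mem _ hi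
    have hv : ∀ y ∈ sideSq X.vertices i, ∀ k, y ≠ X k := by
      rintro y hy k rfl
      exact hg.vertex_notMem _ hSi k hy
    have hjne : (X.vertices (j + 1) - X.vertices j) ≠ 0 := sub_ne_zero.2 (ne_of_area h j).symm
    have htj := ratio_lt_one (im_ne_zero_of_area h j)
    have hti := ratio_lt_one (im_ne_zero_of_area h i)
    obtain ⟨u1, u2⟩ := sideSquare_feet ((foot_nonneg_iff h j).2 hj.1)
      ((foot_le_one_iff h j).2 hj.2) htj
    obtain ⟨w1, w2⟩ := sideSquare_feet ((foot_nonneg_iff h i).2 hi.1)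
      ((foot_le_one_iff h i).2 hi.2) hti
    obtain ⟨v1, v2⟩ := sideSquare_tops hti
    have huniq : ∀ y ∈ sideSq X.vertices i,
        y ∈ segment ℝ (X.vertices j) (X.vertices (j + 1)) → ∀ k,
        y ∈ segment ℝ (X.vertices k) (X.vertices (k + 1)) → j = k := by
      intro y hy hyj k hyk
      refine edge_unique hX (hv y hy) ?_ ?_ <;> rw [edgeSet_eq_segment, finRotate_apply] <;>
        assumption
    have e1 : i + 1 + 1 = i + 2 := by rw [add_assoc]; rfl
    have e2 : i + 2 + 1 = i := by fin_cases i <;> rfl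
    have key : ∀ y ∈ sideSq X.vertices i,
        y ∈ segment ℝ (X.vertices j) (X.vertices (j + 1)) →
        y = if j = i + 1 then X.vertices (i + 1) +
            ratio (X.vertices i) (X.vertices (i + 1)) (X.vertices (i + 2)) •
              (X.vertices (i + 2) - X.vertices (i + 1))
          else X.vertices i +
            ratio (X.vertices i) (X.vertices (i + 1)) (X.vertices (i + 2)) •
              (X.vertices (i + 2) - X.vertices i) := by
      intro y hy hyj
      have hu := huniq y hy hyj
      have hy' := hy
      rcases hy' with rfl | rfl | rfl | rfl
      · exact absurd (hu i w1).symm hne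
      · exact absurd (hu i w2).symm hne
      · rw [if_pos (hu (i + 1) (by rw [e1]; exact v1))]
      · rw [if_neg]
        intro h'
        have := hu (i + 2) (by rw [e2]; exact v2)
        rw [h'] at this
        revert this
        clear * -
        fin_cases i <;> decide
    have k1 := key _ (hij ▸ (by simp [sideSq, sideSquare] :
      X.vertices j + (foot (X.vertices j) (X.vertices (j + 1)) (X.vertices (j + 2)) *
        ratio (X.vertices j) (X.vertices (j + 1)) (X.vertices (j + 2))) •
        (X.vertices (j + 1) - X.vertices j) ∈ sideSq X.vertices j)) u1
    have k2 := key _ (hij ▸ (by simp [sideSq, sideSquare] :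
      X.vertices j + (1 - (1 - foot (X.vertices j) (X.vertices (j + 1)) (X.vertices (j + 2))) *
        ratio (X.vertices j) (X.vertices (j + 1)) (X.vertices (j + 2))) •
        (X.vertices (j + 1) - X.vertices j) ∈ sideSq X.vertices j)) u2
    have k3 := k1.trans k2.symm
    rw [add_right_inj] at k3
    have k4 := smul_left_injective ℝ hjne k3
    linarith
  rw [heq, InjOn.ncard_image hinj]
  have g0 := gram_add_pos h 0
  have g1 := gram_add_pos h 1
  have g2 := gram_add_pos h 2
  simp only [Fin.reduceAdd, zero_add] at g0 g1 g2
  by_cases hall : ∀ i, 0 ≤ gram X.vertices i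
  · have : {i | 0 ≤ gram X.vertices i ∧ 0 ≤ gram X.vertices (i + 1)} = univ :=
      eq_univ_of_forall fun i => ⟨hall i, hall _⟩
    rw [this, ncard_univ, Nat.card_eq_fintype_card, Fintype.card_fin]
    decide
  · push Not at hall
    obtain ⟨k, hk⟩ := hall
    -- With an obtuse angle at `k`, only the opposite side qualifies.
    have : {i | 0 ≤ gram X.vertices i ∧ 0 ≤ gram X.vertices (i + 1)} = {k + 1} := by
      ext i
      simp only [mem_ofPred_eq, mem_singleton_iff]
      fin_cases k <;> fin_cases i <;> simp at hk ⊢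
      all_goals first | (constructor <;> linarith) | (intros; linarith)
    rw [this, ncard_singleton]
    decide

/-- At a right angle the squares on both legs have a vertex at `p` and the opposite one on the
hypotenuse. Exchanging the legs inverts `Im w` up to sign, so the two ratios sum to 1. -/
theorem sideSquare_of_right_angle {p q r : ℂ} (hpq : p ≠ q) (hre : ((r - p) / (q - p)).re = 0)
    (him : ((r - p) / (q - p)).im ≠ 0) : sideSquare r p q = sideSquare p q r := by
  set w := (r - p) / (q - p) with hw
  have hqp : q - p ≠ 0 := sub_ne_zero.2 hpq.symm
  have hrp : r - p ≠ 0 := by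
    intro h
    rw [hw, h, zero_div] at him
    exact him rfl
  have hw' : (q - r) / (p - r) = 1 - w⁻¹ := by
    have : p - r ≠ 0 := fun h => hrp (by linear_combination -h)
    rw [hw]
    field_simp
    ring
  have hwI : w = w.im * I := by apply Complex.ext <;> simp [hre]
  have hinv : w⁻¹ = -((w.im⁻¹ : ℝ) : ℂ) * I := by
    rw [hwI, mul_inv, inv_I]
    simp
  have hfoot : foot p q r = 0 := hre
  have hfoot' : foot r p q = 1 := by
    rw [foot, hw', hinv]; simp
  have hratio : ratio r p q = 1 - ratio p q r := by
    have : ((q - r) / (p - r)).im = w.im⁻¹ := by rw [hw', hinv]; simp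
    rw [ratio, ratio, this, ← hw, abs_inv]
    have := abs_pos.2 him
    field_simp
    ring
  rw [sideSquare, sideSquare, hfoot, hfoot', hratio]
  have e1 : r + (1 * (1 - ratio p q r)) • (p - r) = p + ratio p q r • (r - p) := by
    simp only [real_smul]; push_cast; ring
  have e2 : r + (1 - (1 - 1) * (1 - ratio p q r)) • (p - r) =
      p + (0 * ratio p q r) • (q - p) := by
    simp only [real_smul]; push_cast; ring
  have e3 : p + (1 - ratio p q r) • (q - p) = p + (1 - (1 - 0) * ratio p q r) • (q - p) := by
    simp
  have e4 : r + (1 - ratio p q r) • (q - r) = q + ratio p q r • (r - q) := by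
    simp only [real_smul]; push_cast; ring
  rw [e1, e2, e3, e4]
  ext y
  simp only [mem_insert_iff, mem_singleton_iff]
  tauto

/-- A right triangle has exactly two inscribed squares. -/
theorem ncard_of_right_triangle {X : Polygon ℂ 3} (h : area X.vertices ≠ 0) {i : Fin 3}
    (hi : gram X.vertices i = 0) : X.inscribedSquares.ncard = 2 := by
  have g0 := gram_add_pos h i
  have g2 := gram_add_pos h (i + 2)
  have e1 : i + 1 + 1 = i + 2 := by rw [add_assoc]; rfl
  have e2 : i + 2 + 1 = i := by fin_cases i <;> rfl
  have e3 : i + 2 + 2 = i + 1 := by fin_cases i <;> rfl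
  have e4 : i + 1 + 2 = i := by fin_cases i <;> rfl
  rw [e2] at g2
  have hcases : ∀ j : Fin 3, j = i ∨ j = i + 1 ∨ j = i + 2 := by
    intro j
    fin_cases i <;> fin_cases j <;> decide
  have hnonneg : ∀ j, 0 ≤ gram X.vertices j := by
    intro j
    rcases hcases j with rfl | rfl | rfl <;> linarith
  have hsame : sideSq X.vertices (i + 2) = sideSq X.vertices i := by
    rw [sideSq, e2, e3]
    refine sideSquare_of_right_angle (ne_of_area h i) ?_ (im_ne_zero_of_area h i)
    rw [div_re, ← add_div, div_eq_zero_iff]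
    left
    rw [gram] at hi
    linarith
  have hpair : X.inscribedSquares = {sideSq X.vertices i, sideSq X.vertices (i + 1)} := by
    rw [inscribedSquares_eq h]
    ext S
    constructor
    · rintro ⟨j, -, rfl⟩
      rcases hcases j with rfl | rfl | rfl
      · exact Or.inl rfl
      · exact Or.inr rfl
      · exact Or.inl hsame
    · rintro (rfl | rfl)
      · exact ⟨i, ⟨hnonneg _, hnonneg _⟩, rfl⟩
      · exact ⟨i + 1, ⟨hnonneg _, hnonneg _⟩, rfl⟩
  rw [hpair]
  refine ncard_pair fun heq => ?_
  -- The vertex of the right angle is a corner of the square on a leg but not of the one on the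
  -- hypotenuse.
  have hmem : X.vertices i ∈ sideSq X.vertices i := by
    left
    have : foot (X.vertices i) (X.vertices (i + 1)) (X.vertices (i + 2)) = 0 := by
      rw [foot, div_re, ← add_div, div_eq_zero_iff]
      left
      rw [gram] at hi
      linarith
    rw [this]
    simp
  rw [heq, sideSq, e1, e4] at hmem
  have ht := ratio_lt_one (im_ne_zero_of_area h (i + 1))
  rw [e1, e4] at ht
  have hseg : ∀ s : ℝ, X.vertices i ≠
      X.vertices (i + 1) + s • (X.vertices (i + 2) - X.vertices (i + 1)) := by
    intro s hs
    apply h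
    have a1 := congrArg re hs
    have a2 := congrArg im hs
    rw [← crs_eq_area _ i]
    simp only [crs, sub_re, sub_im, add_re, add_im, smul_re, smul_im, smul_eq_mul] at a1 a2 ⊢
    rw [a1, a2]
    ring
  have htop : ∀ u : ℂ, u ≠ X.vertices i → X.vertices i ≠ u +
      ratio (X.vertices (i + 1)) (X.vertices (i + 2)) (X.vertices i) • (X.vertices i - u) := by
    intro u hu hs
    have : (1 - ratio (X.vertices (i + 1)) (X.vertices (i + 2)) (X.vertices i)) •
        (X.vertices i - u) = 0 := by
      rw [sub_smul, one_smul]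
      linear_combination hs
    rcases smul_eq_zero.1 this with h' | h'
    · linarith
    · exact hu (sub_eq_zero.1 h').symm
  rcases hmem with h' | h' | h' | h'
  · exact hseg _ h'
  · exact hseg _ h'
  · refine htop _ ?_ h'
    have := ne_of_area h (i + 2)
    rwa [e2] at this
  · exact htop _ (ne_of_area h i).symm h'

theorem area_ne_zero_of_affineIndependent {X : Polygon ℂ 3}
    (h : AffineIndependent ℝ X.vertices) : area X.vertices ≠ 0 := by
  intro h0
  have h01 : X.vertices 1 - X.vertices 0 ≠ 0 := sub_ne_zero.2 (h.injective.ne (by decide))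
  obtain ⟨t, ht⟩ := (crs_eq_zero_iff h01 _).1 h0
  rw [affineIndependent_iff_not_collinear] at h
  apply h
  rw [collinear_iff_of_mem (mem_range_self 0)]
  refine ⟨X.vertices 1 - X.vertices 0, ?_⟩
  rintro _ ⟨i, rfl⟩
  fin_cases i
  · exact ⟨0, by simp⟩
  · exact ⟨1, by simp⟩
  · exact ⟨t, by rw [← ht]; simp⟩

theorem right_triangle {X : Polygon ℂ 3} (h : AffineIndependent ℝ X.vertices)
    (ha : ∃ i : Fin 3, EuclideanGeometry.angle (X (i + 1)) (X i) (X (i + 2)) = Real.pi / 2) :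
    X.IsSimple ∧ X.inscribedSquares.ncard = 2 := by
  have harea := area_ne_zero_of_affineIndependent h
  obtain ⟨i, hi⟩ := ha
  refine ⟨isSimple_of_area harea, ncard_of_right_triangle harea (i := i) ?_⟩
  rw [EuclideanGeometry.angle, ← InnerProductGeometry.inner_eq_zero_iff_angle_eq_pi_div_two,
    Complex.inner] at hi
  rw [gram]
  simp only [vsub_eq_sub, mul_re, conj_re, conj_im] at hi
  linarith

end SquarePeg

end

section

open Set Complex ComplexConjugate Filter Topology

namespace SquarePeg

/-! ### Polygons indexed by natural numbers -/

/-- The polygon with vertices `g 0, …, g (n - 1)`. -/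
def ngon (n : ℕ) (g : ℕ → ℂ) : Polygon ℂ n := ⟨fun i => g i⟩

theorem val_finRotate {n : ℕ} (i : Fin n) :
    (finRotate n i : ℕ) = if (i : ℕ) + 1 = n then 0 else (i : ℕ) + 1 := by
  obtain ⟨m, rfl⟩ : ∃ m, n = m + 1 := ⟨n - 1, by have := i.2; omega⟩
  rw [finRotate_apply, Fin.val_add_one]
  simp only [Fin.ext_iff, Fin.val_last, Nat.add_right_cancel_iff]

section

variable {n : ℕ} {g : ℕ → ℂ}

theorem ngon_finRotate (hg : g n = g 0) (i : Fin n) :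
    (ngon n g).vertices (finRotate n i) = g (i + 1) := by
  simp only [ngon, val_finRotate]
  split_ifs with h
  · rw [h, hg]
  · rfl

theorem ngon_edgeSet (hg : g n = g 0) (i : Fin n) :
    (ngon n g).edgeSet ℝ i = segment ℝ (g i) (g (i + 1)) := by
  rw [edgeSet_eq_segment, ngon_finRotate hg]
  rfl

theorem ngon_edgeLine (hg : g n = g 0) (i : Fin n) :
    (ngon n g).edgeLine i = line[ℝ, g i, g (i + 1)] := by
  rw [Polygon.edgeLine, ngon_finRotate hg]
  rfl

theorem mem_ngon_boundary (hg : g n = g 0) {y : ℂ} :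
    y ∈ (ngon n g).boundary ℝ ↔ ∃ a < n, y ∈ segment ℝ (g a) (g (a + 1)) := by
  rw [mem_boundary_iff]
  constructor
  · rintro ⟨i, hi⟩
    exact ⟨i, i.2, by rwa [ngon_edgeSet hg] at hi⟩
  · rintro ⟨a, ha, h⟩
    exact ⟨⟨a, ha⟩, by rwa [ngon_edgeSet hg]⟩

/-- With natural indices each pair of edges is considered once, in increasing order; the pair of the
last and the first edge is the only one that wraps around. -/
theorem isSimple_ngon_iff (hn : 3 ≤ n) (hg : g n = g 0) : (ngon n g).IsSimple ↔
    (∀ a b, a < b → b < n → g a ≠ g b) ∧ ∀ a b y, a < b → b < n →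
      y ∈ segment ℝ (g a) (g (a + 1)) → y ∈ segment ℝ (g b) (g (b + 1)) →
      (b = a + 1 ∧ y = g b) ∨ (a = 0 ∧ b + 1 = n ∧ y = g 0) := by
  constructor
  · intro h
    refine ⟨fun a b hab hb heq => ?_, fun a b y hab hb hya hyb => ?_⟩
    · have := h.injective (a₁ := ⟨a, by omega⟩) (a₂ := ⟨b, hb⟩) heq
      rw [Fin.mk.injEq] at this
      omega
    · have ha' : y ∈ (ngon n g).edgeSet ℝ ⟨a, by omega⟩ := by rwa [ngon_edgeSet hg]
      have hb' : y ∈ (ngon n g).edgeSet ℝ ⟨b, hb⟩ := by rwa [ngon_edgeSet hg]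
      by_cases h1 : b = a + 1
      · left
        refine ⟨h1, ?_⟩
        have e : finRotate n ⟨a, by omega⟩ = ⟨b, hb⟩ := by
          apply Fin.ext
          rw [val_finRotate]
          simp only
          rw [if_neg (by omega), h1]
        have := h.consecutive ⟨a, by omega⟩
        rw [e] at this
        have hy : y ∈ ({(ngon n g).vertices ⟨b, hb⟩} : Set ℂ) := this ▸ ⟨ha', hb'⟩
        exact hy
      by_cases h2 : a = 0 ∧ b + 1 = n
      · right
        refine ⟨h2.1, h2.2, ?_⟩
        have e : finRotate n ⟨b, hb⟩ = ⟨a, by omega⟩ := by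
          apply Fin.ext
          rw [val_finRotate]
          simp only
          rw [if_pos h2.2, h2.1]
        have := h.consecutive ⟨b, hb⟩
        rw [e] at this
        have hy : y ∈ ({(ngon n g).vertices ⟨a, by omega⟩} : Set ℂ) := this ▸ ⟨hb', ha'⟩
        rw [← h2.1]
        exact hy
      · refine (disjoint_left.1 (h.disjoint ⟨a, by omega⟩ ⟨b, hb⟩ ?_ ?_ ?_) ha' hb').elim
        · intro h'
          rw [Fin.mk.injEq] at h'
          omega
        · intro h'
          have := congrArg Fin.val h'
          rw [val_finRotate] at this
          simp only at this
          split_ifs at this <;> omega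
        · intro h'
          have := congrArg Fin.val h'
          rw [val_finRotate] at this
          simp only at this
          split_ifs at this <;> omega
  · rintro ⟨h1, h2⟩
    have hv : ∀ i j : Fin n, (i : ℕ) < j → (ngon n g).vertices i ≠ (ngon n g).vertices j :=
      fun i j hij => h1 i j hij j.2
    have hd : ∀ i j : Fin n, (i : ℕ) < j → j ≠ finRotate n i → i ≠ finRotate n j →
        Disjoint ((ngon n g).edgeSet ℝ i) ((ngon n g).edgeSet ℝ j) := by
      intro i j hij hi hj
      rw [disjoint_left]
      intro y hyi hyj
      rw [ngon_edgeSet hg] at hyi hyj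
      rcases h2 i j y hij j.2 hyi hyj with ⟨h, -⟩ | ⟨h, h', -⟩
      · apply hi
        apply Fin.ext
        rw [val_finRotate, if_neg (by have := j.2; omega), h]
      · apply hj
        apply Fin.ext
        rw [val_finRotate, if_pos h', h]
    refine ⟨?_, fun i => ?_, fun i j hij hi hj => ?_⟩
    · intro i j hij
      by_contra hne
      rcases lt_or_gt_of_ne (fun h => hne (Fin.ext h) : (i : ℕ) ≠ j) with h | h
      · exact hv i j h hij
      · exact hv j i h hij.symm
    · refine Subset.antisymm ?_ ?_
      · rintro y ⟨hy1, hy2⟩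
        rw [ngon_edgeSet hg] at hy1 hy2
        rw [mem_singleton_iff]
        by_cases hi : (i : ℕ) + 1 = n
        · have hr : (finRotate n i : ℕ) = 0 := by rw [val_finRotate, if_pos hi]
          rw [hr] at hy2
          rcases h2 0 i y (by omega) i.2 hy2 hy1 with ⟨h, -⟩ | ⟨-, -, h⟩
          · omega
          · rw [h, ngon_finRotate hg, hi, hg]
        · have hr : (finRotate n i : ℕ) = i + 1 := by rw [val_finRotate, if_neg hi]
          rw [hr] at hy2
          rcases h2 i (i + 1) y (by omega) (by have := i.2; omega) hy1 hy2 with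
            ⟨-, h⟩ | ⟨h, h', -⟩
          · rw [h, ngon_finRotate hg]
          · omega
      · rintro y rfl
        refine ⟨?_, ?_⟩
        · rw [ngon_edgeSet hg, ngon_finRotate hg]
          exact right_mem_segment ℝ _ _
        · rw [edgeSet_eq_segment]
          exact left_mem_segment ℝ _ _
    · rcases lt_or_gt_of_ne (fun h => hij (Fin.ext h) : (i : ℕ) ≠ j) with h | h
      · exact hd i j h hi hj
      · exact (hd j i h hj hi).symm

end

/-- The periodic sequence of the vertices of a polygon. -/
def loop {n : ℕ} (hn : 0 < n) (x : Fin n → ℂ) (a : ℕ) : ℂ := x ⟨a % n, Nat.mod_lt a hn⟩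

theorem loop_add {n : ℕ} (hn : 0 < n) (x : Fin n → ℂ) (a : ℕ) :
    loop hn x (a + n) = loop hn x a := by
  simp [loop]

theorem loop_val {n : ℕ} (hn : 0 < n) (x : Fin n → ℂ) {a : ℕ} (ha : a < n) :
    loop hn x a = x ⟨a, ha⟩ := by
  simp only [loop, Nat.mod_eq_of_lt ha]

theorem ngon_loop {n : ℕ} (hn : 0 < n) (x : Fin n → ℂ) : ngon n (loop hn x) = ⟨x⟩ := by
  simp only [ngon]
  congr 1
  funext i
  rw [loop_val hn x i.2]

theorem simpleLoop_of_isSimple {n : ℕ} (hn : 3 ≤ n) {x : Fin n → ℂ}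
    (hx : (Polygon.mk x).IsSimple)
    (hgen : ∀ a b c d, a ≠ b → d ≠ a → d ≠ b → d ≠ c → crs (x b - x a) (x d - x c) ≠ 0) :
    SimpleLoop n (loop (by omega) x) := by
  have hn0 : 0 < n := by omega
  set f := loop hn0 x with hf
  have hper : ∀ a, f (a + n) = f a := loop_add hn0 x
  have hf0 : f n = f 0 := by simpa using hper 0
  rw [← ngon_loop hn0 x, isSimple_ngon_iff hn hf0] at hx
  obtain ⟨h1, h2⟩ := hx
  refine ⟨hper, ?_, ?_, ?_⟩
  · intro a
    induction a using Nat.strong_induction_on with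
    | _ a ih =>
      intro b hab hb
      rcases lt_or_ge a n with ha | ha
      · rcases lt_or_ge b n with hbn | hbn
        · exact h1 a b hab hbn
        · obtain ⟨b', rfl⟩ : ∃ b', b = b' + n := ⟨b - n, by omega⟩
          rw [hper]
          exact (h1 b' a (by omega) ha).symm
      · obtain ⟨a', rfl⟩ : ∃ a', a = a' + n := ⟨a - n, by omega⟩
        obtain ⟨b', rfl⟩ : ∃ b', b = b' + n := ⟨b - n, by omega⟩
        rw [hper, hper]
        exact ih a' (by omega) b' (by omega) (by omega)
  · have hseg : ∀ a, segment ℝ (f (a + n)) (f (a + n + 1)) = segment ℝ (f a) (f (a + 1)) := by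
      intro a
      rw [show a + n + 1 = a + 1 + n by omega, hper, hper]
    intro a
    induction a using Nat.strong_induction_on with
    | _ a ih =>
      intro b y hab hb hya hyb
      rcases lt_or_ge a n with ha | ha
      · rcases lt_or_ge b n with hbn | hbn
        · rcases h2 a b y hab hbn hya hyb with h | ⟨rfl, h, h'⟩
          · exact Or.inl h
          · exact Or.inr ⟨by omega, h'⟩
        · obtain ⟨b', rfl⟩ : ∃ b', b = b' + n := ⟨b - n, by omega⟩
          rw [hseg] at hyb
          rcases h2 b' a y (by omega) ha hyb hya with ⟨h, h'⟩ | ⟨rfl, h, h'⟩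
          · exact Or.inr ⟨by omega, h'⟩
          · exact Or.inl ⟨by omega, by rw [hper]; exact h'⟩
      · obtain ⟨a', rfl⟩ : ∃ a', a = a' + n := ⟨a - n, by omega⟩
        obtain ⟨b', rfl⟩ : ∃ b', b = b' + n := ⟨b - n, by omega⟩
        rw [hseg] at hya hyb
        rcases ih a' (by omega) b' y (by omega) (by omega) hya hyb with ⟨h, h'⟩ | ⟨h, h'⟩
        · exact Or.inl ⟨by omega, by rw [hper]; exact h'⟩
        · exact Or.inr ⟨by omega, by rw [hper]; exact h'⟩
  · intro a b c d ha hb hc hd hab hda hdb hdc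
    rw [hf, loop_val hn0 x ha, loop_val hn0 x hb, loop_val hn0 x hc, loop_val hn0 x hd]
    exact hgen _ _ _ _ (by simpa using hab) (by simpa using hda) (by simpa using hdb)
      (by simpa using hdc)

/-- Almost all polygons have no parallel edges or diagonals. -/
theorem ae_general_position (n : ℕ) : ∀ᵐ x ∂(MeasureTheory.volume : MeasureTheory.Measure (Fin n → ℂ)),
    ∀ a b c d, a ≠ b → d ≠ a → d ≠ b → d ≠ c → crs (x b - x a) (x d - x c) ≠ 0 := by
  rw [MeasureTheory.ae_all_iff]
  intro a
  rw [MeasureTheory.ae_all_iff]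
  intro b
  rw [MeasureTheory.ae_all_iff]
  intro c
  rw [MeasureTheory.ae_all_iff]
  intro d
  by_cases h : a ≠ b ∧ d ≠ a ∧ d ≠ b ∧ d ≠ c
  · obtain ⟨h1, h2, h3, h4⟩ := h
    have hpoly : LinePoly fun x : Fin n → ℂ => crs (x b - x a) (x d - x c) :=
      ((CLinePoly.apply b).sub (CLinePoly.apply a)).crs
        ((CLinePoly.apply d).sub (CLinePoly.apply c))
    have := hpoly.ae_ne_zero MeasureTheory.volume
      -- Witness with cross product 1, whether or not `c` coincides with `a` or `b`.
      (x₀ := fun k => if k = d then I else if k = b then 1 else 0) (by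
        simp only [if_neg h3.symm, if_neg h2.symm, if_neg h4.symm, if_neg h1, if_true]
        split_ifs <;> simp [crs])
    filter_upwards [this] with x hx _ _ _ _ using hx
  · refine Eventually.of_forall fun x h1 h2 h3 h4 => absurd ⟨h1, h2, h3, h4⟩ h

/-! ### Simplicity is an open condition -/

/-- Two segments from `c` overlap only if they have the same direction, i.e. `w / u` is a positive
real. This expresses the condition on consecutive edges by membership in an open set. -/
theorem inter_eq_singleton_iff {c u w : ℂ} (hu : u ≠ 0) (hw : w ≠ 0) :
    segment ℝ (c + u) c ∩ segment ℝ c (c + w) = {c} ↔ -(w / u) ∈ slitPlane := by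
  constructor
  · intro h
    by_contra hcon
    rw [mem_slitPlane_iff_not_le_zero, not_not, Complex.le_def] at hcon
    simp only [neg_re, zero_re, neg_im, zero_im, neg_eq_zero] at hcon
    set t := (w / u).re with ht
    have hwt : w = t * u := by
      have : w / u = t := Complex.ext (by simp [ht]) (by simp [hcon.2])
      rw [← this, div_mul_cancel₀ _ hu]
    have ht0 : 0 < t := lt_of_le_of_ne (by linarith [hcon.1]) fun h0 => hw (by
      rw [hwt, ← h0]; simp)
    have hmem : c + (t / (1 + t)) • u ∈ segment ℝ (c + u) c ∩ segment ℝ c (c + w) := by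
      constructor
      · rw [segment_symm]
        exact mem_segment_iff.2 ⟨t / (1 + t), by positivity,
          (div_le_one (by positivity)).2 (by linarith), by simp⟩
      · refine mem_segment_iff.2 ⟨1 / (1 + t), by positivity,
          (div_le_one (by positivity)).2 (by linarith), ?_⟩
        rw [hwt]
        simp only [real_smul]
        push_cast
        ring
    rw [h, mem_singleton_iff, add_eq_left, smul_eq_zero] at hmem
    rcases hmem with h' | h'
    · exact (by positivity : t / (1 + t) ≠ 0) h'
    · exact hu h'
  · intro h
    refine Subset.antisymm ?_ ?_
    · rintro y ⟨hy1, hy2⟩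
      rw [segment_symm] at hy1
      obtain ⟨s, s0, -, hs⟩ := mem_segment_iff.1 hy1
      obtain ⟨t, t0, -, ht⟩ := mem_segment_iff.1 hy2
      rw [add_sub_cancel_left, real_smul] at hs ht
      rcases eq_or_lt_of_le t0 with rfl | ht0
      · rw [mem_singleton_iff, ht]; simp
      · exfalso
        have hst : (t : ℂ) * w = s * u := by linear_combination hs - ht
        have htc : (t : ℂ) ≠ 0 := by exact_mod_cast ht0.ne'
        have hwu : w / u = ((s / t : ℝ) : ℂ) := by
          push_cast
          field_simp
          linear_combination hst
        rw [hwu, mem_slitPlane_iff_not_le_zero] at h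
        apply h
        rw [← ofReal_neg]
        exact_mod_cast neg_nonpos.2 (by positivity)
    · rintro y rfl
      exact ⟨right_mem_segment ℝ _ _, left_mem_segment ℝ _ _⟩

theorem consecutive_iff {n : ℕ} {x : Fin n → ℂ} {i : Fin n} (h1 : x i ≠ x (finRotate n i))
    (h2 : x (finRotate n i) ≠ x (finRotate n (finRotate n i))) :
    (Polygon.mk x).edgeSet ℝ i ∩ (Polygon.mk x).edgeSet ℝ (finRotate n i) =
      {x (finRotate n i)} ↔
    -((x (finRotate n (finRotate n i)) - x (finRotate n i)) / (x i - x (finRotate n i))) ∈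
      slitPlane := by
  rw [← inter_eq_singleton_iff (c := x (finRotate n i)) (sub_ne_zero.2 h1)
    (sub_ne_zero.2 h2.symm), edgeSet_eq_segment, edgeSet_eq_segment, add_sub_cancel,
    add_sub_cancel]

theorem isClosed_edges_meet {n : ℕ} (i j : Fin n) : IsClosed {x : Fin n → ℂ |
    ∃ τ : unitInterval × unitInterval, edgePt x i τ.1 = edgePt x j τ.2} := by
  have hC : IsClosed {p : (Fin n → ℂ) × (unitInterval × unitInterval) |
      edgePt p.1 i p.2.1 = edgePt p.1 j p.2.2} := by
    unfold edgePt
    exact isClosed_eq (by fun_prop) (by fun_prop)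
  have := isClosedMap_fst_of_compactSpace _ hC
  convert this using 1
  ext x
  simp only [mem_ofPred_eq, mem_image, Prod.exists, exists_and_right, exists_eq_right]

theorem disjoint_iff_not_meet {n : ℕ} {x : Fin n → ℂ} {i j : Fin n} :
    Disjoint ((Polygon.mk x).edgeSet ℝ i) ((Polygon.mk x).edgeSet ℝ j) ↔
      ¬ ∃ τ : unitInterval × unitInterval, edgePt x i τ.1 = edgePt x j τ.2 := by
  rw [disjoint_left]
  constructor
  · rintro h ⟨τ, hτ⟩
    exact h (edgePt_mem x i τ.1.2) (hτ ▸ edgePt_mem x j τ.2.2)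
  · intro h y hi hj
    obtain ⟨s, s0, s1, hs⟩ := mem_edge_iff.1 hi
    obtain ⟨t, t0, t1, ht⟩ := mem_edge_iff.1 hj
    exact h ⟨(⟨s, s0, s1⟩, ⟨t, t0, t1⟩), hs.symm.trans ht⟩

/-- Distinctness of vertices is open, the angle condition at consecutive edges is open by
`consecutive_iff`, and disjointness of compact edges is open because meeting is closed. -/
theorem eventually_isSimple {n : ℕ} (hn : 2 ≤ n) {x : Fin n → ℂ}
    (hx : (Polygon.mk x).IsSimple) : ∀ᶠ y in 𝓝 x, (Polygon.mk y).IsSimple := by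
  have hinj : ∀ i j, i ≠ j → x i ≠ x j := fun i j hij h => hij (hx.injective h)
  have hr : ∀ i, x i ≠ x (finRotate n i) := fun i => hinj _ _ (finRotate_ne hn i).symm
  have E1 : ∀ᶠ y in 𝓝 x, ∀ i j, i ≠ j → y i ≠ y j := by
    refine eventually_all.2 fun i => eventually_all.2 fun j => ?_
    by_cases hij : i = j
    · exact Eventually.of_forall fun y h => absurd hij h
    · have : ∀ᶠ y in 𝓝 x, y i - y j ≠ 0 := by
        have hc : Continuous fun y : Fin n → ℂ => y i - y j := by fun_prop
        exact hc.continuousAt.eventually_ne (sub_ne_zero.2 (hinj i j hij))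
      filter_upwards [this] with y hy _ using sub_ne_zero.1 hy
  have E2 : ∀ᶠ y in 𝓝 x, ∀ i,
      -((y (finRotate n (finRotate n i)) - y (finRotate n i)) / (y i - y (finRotate n i))) ∈
        slitPlane := by
    refine eventually_all.2 fun i => ?_
    have hc : ContinuousAt (fun y : Fin n → ℂ => -((y (finRotate n (finRotate n i)) -
        y (finRotate n i)) / (y i - y (finRotate n i)))) x := by
      have h1 : Continuous fun y : Fin n → ℂ =>
          y (finRotate n (finRotate n i)) - y (finRotate n i) := by fun_prop
      have h2 : Continuous fun y : Fin n → ℂ => y i - y (finRotate n i) := by fun_prop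
      exact (h1.continuousAt.div₀ h2.continuousAt (sub_ne_zero.2 (hr i))).neg
    exact hc.eventually (isOpen_slitPlane.mem_nhds
      ((consecutive_iff (hr i) (hr _)).1 (hx.consecutive i)))
  have E3 : ∀ᶠ y in 𝓝 x, ∀ i j, i ≠ j → j ≠ finRotate n i → i ≠ finRotate n j →
      ¬ ∃ τ : unitInterval × unitInterval, edgePt y i τ.1 = edgePt y j τ.2 := by
    refine eventually_all.2 fun i => eventually_all.2 fun j => ?_
    by_cases h : i ≠ j ∧ j ≠ finRotate n i ∧ i ≠ finRotate n j
    · filter_upwards [(isClosed_edges_meet i j).isOpen_compl.mem_nhds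
        (disjoint_iff_not_meet.1 (hx.disjoint i j h.1 h.2.1 h.2.2))] with y hy _ _ _ using hy
    · exact Eventually.of_forall fun y h1 h2 h3 => absurd ⟨h1, h2, h3⟩ h
  filter_upwards [E1, E2, E3] with y y1 y2 y3
  have hr' : ∀ i, y i ≠ y (finRotate n i) := fun i => y1 _ _ (finRotate_ne hn i).symm
  exact ⟨fun i j h => by_contra fun hij => y1 i j hij h,
    fun i => (consecutive_iff (hr' i) (hr' _)).2 (y2 i),
    fun i j h1 h2 h3 => disjoint_iff_not_meet.2 (y3 i j h1 h2 h3)⟩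

end SquarePeg

end

section

open Set Complex ComplexConjugate Filter Topology

namespace SquarePeg

/-! ### Polygons with the same polygonal line -/

theorem inscribedSquares_congr {n n' : ℕ} {X : Polygon ℂ n} {Y : Polygon ℂ n'}
    (hb : Y.boundary ℝ = X.boundary ℝ) : Y.inscribedSquares = X.inscribedSquares := by
  simp only [Polygon.inscribedSquares, hb]

/-- This lets a polygon be reindexed, or given additional flat vertices, without losing genericity.
An additional vertex only has to avoid the corners of the inscribed squares. -/
theorem isGeneric_of_boundary_eq {n n' : ℕ} {X : Polygon ℂ n} {Y : Polygon ℂ n'}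
    (hX : X.IsGeneric) (hb : Y.boundary ℝ = X.boundary ℝ)
    (hl : ∀ j, ∃ i, Y.edgeLine j ≤ X.edgeLine i)
    (hv : ∀ S ∈ X.inscribedSquares, ∀ j, Y.vertices j ∉ S) : Y.IsGeneric := by
  refine ⟨fun S hS j => hv S (inscribedSquares_congr hb ▸ hS) j, ?_⟩
  intro e a v a' v' hv0 hv0' h h'
  choose φ hφ using hl
  exact hX.square_unique (fun k => φ (e k)) a v a' v' hv0 hv0' (fun k => hφ _ (h k))
    fun k => hφ _ (h' k)

/-! ### Cyclic shifts of the vertices. -/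

section

variable {n : ℕ} {f : ℕ → ℂ}

theorem periodic_mod (hf : ∀ a, f (a + n) = f a) (a : ℕ) : f (a % n) = f a := by
  conv_rhs => rw [← Nat.mod_add_div a n]
  have : ∀ b c, f (b + n * c) = f b := by
    intro b c
    induction c with
    | zero => simp
    | succ c ih => rw [Nat.mul_succ, ← add_assoc, hf, ih]
  rw [this]

theorem periodic_mod_succ (hf : ∀ a, f (a + n) = f a) (a : ℕ) : f (a % n + 1) = f (a + 1) := by
  rw [← periodic_mod hf (a % n + 1), ← periodic_mod hf (a + 1), Nat.mod_add_mod]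

theorem mem_ngon_boundary_of_periodic (hn : 0 < n) (hf : ∀ a, f (a + n) = f a) {y : ℂ} :
    y ∈ (ngon n f).boundary ℝ ↔ ∃ a, y ∈ segment ℝ (f a) (f (a + 1)) := by
  rw [mem_ngon_boundary (by simpa using hf 0)]
  constructor
  · rintro ⟨a, -, h⟩
    exact ⟨a, h⟩
  · rintro ⟨a, h⟩
    exact ⟨a % n, Nat.mod_lt a hn, by rwa [periodic_mod hf, periodic_mod_succ hf]⟩

theorem boundary_ngon_shift (hn : 0 < n) (hf : ∀ a, f (a + n) = f a) (c : ℕ) :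
    (ngon n fun a => f (a + c)).boundary ℝ = (ngon n f).boundary ℝ := by
  ext y
  rw [mem_ngon_boundary_of_periodic hn hf, mem_ngon_boundary_of_periodic hn fun a => by
    rw [show a + n + c = a + c + n by omega, hf]]
  constructor
  · rintro ⟨a, h⟩
    exact ⟨a + c, by rwa [show a + c + 1 = a + 1 + c by omega]⟩
  · rintro ⟨a, h⟩
    -- A shift by `c` is undone by a shift by `(n - 1) * c`, since together they make a multiple of
    -- `n`.
    have e : ∀ b, f (b + (n - 1) * c + c) = f b := by
      intro b
      have : b + (n - 1) * c + c = b + n * c := by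
        obtain ⟨m, rfl⟩ : ∃ m, n = m + 1 := ⟨n - 1, by omega⟩
        simp only [Nat.add_sub_cancel]
        ring
      rw [this, ← periodic_mod hf, Nat.add_mul_mod_self_left, periodic_mod hf]
    refine ⟨a + (n - 1) * c, ?_⟩
    rw [show a + (n - 1) * c + 1 = a + 1 + (n - 1) * c by omega, e, e]
    exact h

theorem isGeneric_ngon_shift (hn : 0 < n) (hf : ∀ a, f (a + n) = f a) (c : ℕ)
    (h : (ngon n f).IsGeneric) : (ngon n fun a => f (a + c)).IsGeneric := by
  refine isGeneric_of_boundary_eq h (boundary_ngon_shift hn hf c) (fun j => ?_) fun S hS j => ?_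
  · refine ⟨⟨(j + c) % n, Nat.mod_lt _ hn⟩, le_of_eq ?_⟩
    rw [ngon_edgeLine (by rw [zero_add, add_comm, hf]), ngon_edgeLine (by simpa using hf 0)]
    simp only
    rw [periodic_mod hf, periodic_mod_succ hf, show (j : ℕ) + c + 1 = j + 1 + c by omega]
  · have := h.vertex_notMem S hS ⟨(j + c) % n, Nat.mod_lt _ hn⟩
    rwa [show (ngon n f) ⟨(j + c) % n, Nat.mod_lt _ hn⟩ = f (j + c) from periodic_mod hf _] at this

theorem SimpleLoop.isSimple_shift (hf : SimpleLoop n f) (hn : 3 ≤ n) (c : ℕ) :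
    (ngon n fun a => f (a + c)).IsSimple := by
  rw [isSimple_ngon_iff hn (by rw [zero_add, add_comm, hf.periodic])]
  refine ⟨fun a b hab hb => hf.ne _ _ (by omega) (by omega), fun a b y hab hb hya hyb => ?_⟩
  rw [show a + 1 + c = a + c + 1 by omega] at hya
  rw [show b + 1 + c = b + c + 1 by omega] at hyb
  rcases hf.edge (a + c) (b + c) y (by omega) (by omega) hya hyb with ⟨h, h'⟩ | ⟨h, h'⟩
  · exact Or.inl ⟨by omega, h'⟩
  · obtain rfl : a = 0 := by omega
    exact Or.inr ⟨rfl, by omega, h'⟩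

end

/-! ### Simple polygonal chains -/

/-- The polygonal line with vertices `g 0, …, g k` is simple. -/
structure SimpleChain (k : ℕ) (g : ℕ → ℂ) : Prop where
  ne : ∀ a b, a < b → b ≤ k → g a ≠ g b
  edge : ∀ a b y, a < b → b < k → y ∈ segment ℝ (g a) (g (a + 1)) →
    y ∈ segment ℝ (g b) (g (b + 1)) → b = a + 1 ∧ y = g b

namespace SimpleChain

variable {k : ℕ} {g : ℕ → ℂ}

theorem of_isSimple {n : ℕ} (hn : 3 ≤ n) (hk : k + 1 ≤ n) (hg : g n = g 0)
    (h : (ngon n g).IsSimple) : SimpleChain k g := by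
  rw [isSimple_ngon_iff hn hg] at h
  refine ⟨fun a b hab hb => h.1 a b hab (by omega), fun a b y hab hb hya hyb => ?_⟩
  rcases h.2 a b y hab (by omega) hya hyb with h | ⟨-, h, -⟩
  · exact h
  · omega

theorem congr {h : ℕ → ℂ} (hg : SimpleChain k g) (e : ∀ a ≤ k, h a = g a) : SimpleChain k h := by
  refine ⟨fun a b hab hb => ?_, fun a b y hab hb => ?_⟩
  · rw [e a (by omega), e b hb]
    exact hg.ne a b hab hb
  · rw [e a (by omega), e (a + 1) (by omega), e b (by omega), e (b + 1) (by omega)]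
    exact hg.edge a b y hab hb

theorem eq_of_last_mem (hg : SimpleChain k g) {a : ℕ} (ha : a < k)
    (h : g k ∈ segment ℝ (g a) (g (a + 1))) : k = a + 1 := by
  by_contra hne
  obtain ⟨j, rfl⟩ : ∃ j, k = j + 1 := ⟨k - 1, by omega⟩
  exact hg.ne j (j + 1) (by omega) le_rfl
    (hg.edge a j _ (by omega) (by omega) h (right_mem_segment ℝ _ _)).2.symm

theorem eq_of_first_mem (hg : SimpleChain k g) {a : ℕ} (ha : a < k)
    (h : g 0 ∈ segment ℝ (g a) (g (a + 1))) : a = 0 := by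
  by_contra hne
  exact hg.ne 0 a (by omega) (by omega)
    (hg.edge 0 a _ (by omega) ha (left_mem_segment ℝ _ _) h).2

theorem isSimple_close (hg : SimpleChain k g) (hk : 2 ≤ k) (h0 : g (k + 1) = g 0)
    (h : ∀ a < k, ∀ y ∈ segment ℝ (g a) (g (a + 1)), y ∈ segment ℝ (g k) (g 0) →
      y = g k ∨ y = g 0) : (ngon (k + 1) g).IsSimple := by
  rw [isSimple_ngon_iff (by omega) h0]
  refine ⟨fun a b hab hb => hg.ne a b hab (by omega), fun a b y hab hb hya hyb => ?_⟩
  rcases eq_or_lt_of_le (Nat.le_of_lt_succ hb) with rfl | hb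
  · rw [h0] at hyb
    rcases h a hab y hya hyb with rfl | rfl
    · exact Or.inl ⟨hg.eq_of_last_mem hab hya, rfl⟩
    · exact Or.inr ⟨hg.eq_of_first_mem hab hya, rfl, rfl⟩
  · exact Or.inl (hg.edge a b y hab hb hya hyb)

theorem mem_chord (hk : 2 ≤ k) (h0 : g (k + 1) = g 0) (h : (ngon (k + 1) g).IsSimple)
    {a : ℕ} (ha : a < k) {y : ℂ} (hy : y ∈ segment ℝ (g a) (g (a + 1)))
    (hyc : y ∈ segment ℝ (g k) (g 0)) : y = g k ∨ y = g 0 := by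
  rw [isSimple_ngon_iff (by omega) h0] at h
  rcases h.2 a k y ha (by omega) hy (by rwa [h0]) with ⟨-, h⟩ | ⟨-, -, h⟩
  · exact Or.inl h
  · exact Or.inr h

theorem isSimple_snoc (hg : SimpleChain k g) (hk : 1 ≤ k) (h0 : g (k + 2) = g 0)
    (h1 : ∀ a < k, ∀ y ∈ segment ℝ (g a) (g (a + 1)), y ∈ segment ℝ (g k) (g (k + 1)) → y = g k)
    (h2 : ∀ a < k, ∀ y ∈ segment ℝ (g a) (g (a + 1)), y ∈ segment ℝ (g (k + 1)) (g 0) → y = g 0)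
    (h3 : ∀ y ∈ segment ℝ (g k) (g (k + 1)), y ∈ segment ℝ (g (k + 1)) (g 0) → y = g (k + 1)) :
    (ngon (k + 2) g).IsSimple := by
  rw [isSimple_ngon_iff (by omega) h0]
  -- If the new vertex were on the chain, the two disjointness conditions would identify it with
  -- both ends of the chain.
  have hlast : ∀ a ≤ k, g a ≠ g (k + 1) := by
    intro a ha h
    obtain ⟨c, hc, hac⟩ : ∃ c < k, g a ∈ segment ℝ (g c) (g (c + 1)) := by
      rcases eq_or_lt_of_le ha with rfl | ha
      · obtain ⟨j, rfl⟩ : ∃ j, a = j + 1 := ⟨a - 1, by omega⟩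
        exact ⟨j, by omega, right_mem_segment ℝ _ _⟩
      · exact ⟨a, ha, left_mem_segment ℝ _ _⟩
    have e1 := h1 c hc _ hac (h ▸ right_mem_segment ℝ _ _)
    have e2 := h2 c hc _ hac (h ▸ left_mem_segment ℝ _ _)
    exact hg.ne 0 k (by omega) le_rfl (e2.symm.trans e1)
  refine ⟨fun a b hab hb => ?_, fun a b y hab hb hya hyb => ?_⟩
  · rcases eq_or_lt_of_le (Nat.le_of_lt_succ hb) with rfl | hb
    · exact hlast a (by omega)
    · exact hg.ne a b hab (by omega)
  · rcases lt_trichotomy b k with hbk | rfl | hbk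
    · exact Or.inl (hg.edge a b y hab hbk hya hyb)
    · obtain rfl := h1 a hab y hya hyb
      exact Or.inl ⟨hg.eq_of_last_mem hab hya, rfl⟩
    · obtain rfl : b = k + 1 := by omega
      rw [h0] at hyb
      rcases eq_or_lt_of_le (Nat.le_of_lt_succ hab) with rfl | ha
      · exact Or.inl ⟨rfl, h3 y hya hyb⟩
      · obtain rfl := h2 a ha y hya hyb
        exact Or.inr ⟨hg.eq_of_first_mem ha hya, rfl, rfl⟩

end SimpleChain

/-- The sequence `g 0, …, g k, M, g 0, g 0, …`. -/
def snoc (k : ℕ) (g : ℕ → ℂ) (M : ℂ) (a : ℕ) : ℂ :=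
  if a ≤ k then g a else if a = k + 1 then M else g 0

section

variable {k : ℕ} {g : ℕ → ℂ} {M : ℂ}

theorem snoc_of_le {a : ℕ} (h : a ≤ k) : snoc k g M a = g a := if_pos h

theorem snoc_succ : snoc k g M (k + 1) = M := by simp [snoc]

theorem snoc_zero : snoc k g M 0 = g 0 := snoc_of_le (Nat.zero_le k)

theorem snoc_closed : snoc k g M (k + 2) = snoc k g M 0 := by simp [snoc]

theorem SimpleChain.isSimple_ngon_snoc (hg : SimpleChain k g) (hk : 1 ≤ k)
    (h1 : ∀ a < k, ∀ y ∈ segment ℝ (g a) (g (a + 1)), y ∈ segment ℝ (g k) M → y = g k)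
    (h2 : ∀ a < k, ∀ y ∈ segment ℝ (g a) (g (a + 1)), y ∈ segment ℝ M (g 0) → y = g 0)
    (h3 : ∀ y ∈ segment ℝ (g k) M, y ∈ segment ℝ M (g 0) → y = M) :
    (ngon (k + 2) (snoc k g M)).IsSimple := by
  refine (hg.congr fun a ha => snoc_of_le ha).isSimple_snoc hk snoc_closed ?_ ?_ ?_
  · intro a ha
    rw [snoc_of_le ha.le, snoc_of_le (Nat.succ_le_of_lt ha), snoc_of_le le_rfl, snoc_succ]
    exact h1 a ha
  · intro a ha
    rw [snoc_of_le ha.le, snoc_of_le (Nat.succ_le_of_lt ha), snoc_zero, snoc_succ]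
    exact h2 a ha
  · rw [snoc_of_le le_rfl, snoc_zero, snoc_succ]
    exact h3

end

/-! ### Inserting a vertex in the last edge -/

section

variable {p q M : ℂ} {s : ℝ}

theorem mem_segment_split (h0 : 0 < s) (h1 : s < 1) (hM : M = p + s • (q - p)) {y : ℂ} :
    y ∈ segment ℝ p q ↔ y ∈ segment ℝ p M ∨ y ∈ segment ℝ M q := by
  have hMs : M ∈ segment ℝ p q := mem_segment_iff.2 ⟨s, h0.le, h1.le, hM⟩
  constructor
  · intro hy
    obtain ⟨t, t0, t1, rfl⟩ := mem_segment_iff.1 hy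
    rcases le_total t s with hts | hts
    · refine Or.inl (mem_segment_iff.2 ⟨t / s, by positivity, (div_le_one h0).2 hts, ?_⟩)
      rw [hM, add_sub_cancel_left, smul_smul, div_mul_cancel₀ _ h0.ne']
    · refine Or.inr (mem_segment_iff.2 ⟨(t - s) / (1 - s),
        div_nonneg (by linarith) (by linarith), (div_le_one (by linarith)).2 (by linarith), ?_⟩)
      have h : q - M = (1 - s) • (q - p) := by rw [hM, sub_smul, one_smul]; ring
      rw [h, smul_smul, div_mul_cancel₀ _ (by linarith), hM, sub_smul]
      ring
  · rintro (hy | hy)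
    · exact (convex_segment p q).segment_subset (left_mem_segment ℝ _ _) hMs hy
    · exact (convex_segment p q).segment_subset hMs (right_mem_segment ℝ _ _) hy

theorem eq_of_mem_split (h0 : 0 < s) (h1 : s < 1) (hpq : p ≠ q) (hM : M = p + s • (q - p)) {y : ℂ}
    (hy : y ∈ segment ℝ p M) (hy' : y ∈ segment ℝ M q) : y = M := by
  obtain ⟨t, t0, t1, ht⟩ := mem_segment_iff.1 hy
  obtain ⟨u, u0, u1, hu⟩ := mem_segment_iff.1 hy'
  have hc : ((t * s - s - u * (1 - s) : ℝ) : ℂ) * (q - p) = 0 := by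
    rw [ht, hM] at hu
    simp only [real_smul] at hu
    push_cast
    linear_combination hu
  have := (mul_eq_zero.1 hc).resolve_right (sub_ne_zero.2 hpq.symm)
  have h : t * s - s - u * (1 - s) = 0 := by exact_mod_cast this
  have hu0 : u = 0 := by
    nlinarith [mul_nonneg (sub_nonneg.2 t1) h0.le, mul_nonneg u0 (sub_nonneg.2 h1.le)]
  rw [hu, hu0, zero_smul, add_zero]

end

section

variable {k : ℕ} {g : ℕ → ℂ} {M : ℂ} {s : ℝ}

theorem isSimple_insert (hk : 2 ≤ k) (hg : g (k + 1) = g 0) (h : (ngon (k + 1) g).IsSimple)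
    (h0 : 0 < s) (h1 : s < 1) (hM : M = g k + s • (g 0 - g k)) :
    (ngon (k + 2) (snoc k g M)).IsSimple := by
  have hc : SimpleChain k g := SimpleChain.of_isSimple (by omega) le_rfl hg h
  have hne : g k ≠ g 0 := (hc.ne 0 k (by omega) le_rfl).symm
  have hMp : M ≠ g k := by
    rw [hM, Ne, add_eq_left, smul_eq_zero, sub_eq_zero]
    exact fun h => h.elim h0.ne' hne.symm
  have hMq : M ≠ g 0 := by
    intro h
    have : ((s - 1 : ℝ) : ℂ) * (g 0 - g k) = 0 := by
      rw [hM, real_smul] at h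
      push_cast
      linear_combination h
    rcases mul_eq_zero.1 this with h' | h'
    · have : s - 1 = 0 := by exact_mod_cast h'
      linarith
    · exact hne (sub_eq_zero.1 h').symm
  have hsp := fun y => @mem_segment_split _ _ _ _ h0 h1 hM y
  refine hc.isSimple_ngon_snoc (by omega) ?_ ?_ fun y => eq_of_mem_split h0 h1 hne hM
  · intro a ha y hy hyc
    refine (SimpleChain.mem_chord hk hg h ha hy ((hsp y).2 (Or.inl hyc))).resolve_right ?_
    rintro rfl
    exact hMq (eq_of_mem_split h0 h1 hne hM hyc (right_mem_segment ℝ _ _)).symm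
  · intro a ha y hy hyc
    refine (SimpleChain.mem_chord hk hg h ha hy ((hsp y).2 (Or.inr hyc))).resolve_left ?_
    rintro rfl
    exact hMp (eq_of_mem_split h0 h1 hne hM (left_mem_segment ℝ _ _) hyc).symm

theorem boundary_insert (hg : g (k + 1) = g 0)
    (h0 : 0 < s) (h1 : s < 1) (hM : M = g k + s • (g 0 - g k)) :
    (ngon (k + 2) (snoc k g M)).boundary ℝ = (ngon (k + 1) g).boundary ℝ := by
  ext y
  rw [mem_ngon_boundary hg, mem_ngon_boundary snoc_closed]
  have e1 : segment ℝ (snoc k g M k) (snoc k g M (k + 1)) = segment ℝ (g k) M := by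
    rw [snoc_of_le le_rfl, snoc_succ]
  have e2 : segment ℝ (snoc k g M (k + 1)) (snoc k g M (k + 1 + 1)) = segment ℝ M (g 0) := by
    rw [snoc_succ, snoc_closed, snoc_zero]
  have e3 : ∀ a < k, segment ℝ (snoc k g M a) (snoc k g M (a + 1)) =
      segment ℝ (g a) (g (a + 1)) := fun a ha => by
    rw [snoc_of_le ha.le, snoc_of_le (Nat.succ_le_of_lt ha)]
  constructor
  · rintro ⟨a, ha, hy⟩
    rcases lt_trichotomy a k with hak | rfl | hak
    · exact ⟨a, by omega, by rwa [e3 a hak] at hy⟩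
    · exact ⟨a, by omega, by rw [hg, mem_segment_split h0 h1 hM]; rw [e1] at hy; exact Or.inl hy⟩
    · obtain rfl : a = k + 1 := by omega
      exact ⟨k, by omega, by rw [hg, mem_segment_split h0 h1 hM]; rw [e2] at hy; exact Or.inr hy⟩
  · rintro ⟨a, ha, hy⟩
    rcases eq_or_lt_of_le (Nat.le_of_lt_succ ha) with rfl | hak
    · rw [hg, mem_segment_split h0 h1 hM] at hy
      rcases hy with hy | hy
      · exact ⟨a, by omega, by rwa [e1]⟩
      · exact ⟨a + 1, by omega, by rwa [e2]⟩
    · exact ⟨a, by omega, by rwa [e3 a hak]⟩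

/-- The two parts of the divided edge span lines contained in the old one, and `hs` keeps the new
vertex away from all corners of inscribed squares. -/
theorem isGeneric_insert (hg : g (k + 1) = g 0) (h : (ngon (k + 1) g).IsGeneric)
    (h0 : 0 < s) (h1 : s < 1) (hs : s ∉ cornerParams (ngon (k + 1) g).vertices)
    (hM : M = g k + s • (g 0 - g k)) :
    (ngon (k + 2) (snoc k g M)).IsGeneric := by
  refine isGeneric_of_boundary_eq h (boundary_insert hg h0 h1 hM) (fun j => ?_) fun S hS j => ?_
  · have hMl : M ∈ line[ℝ, g k, g 0] := by
      rw [hM, add_comm]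
      exact smul_vsub_vadd_mem_affineSpan_pair s (g k) (g 0)
    rw [ngon_edgeLine snoc_closed]
    rcases lt_trichotomy (j : ℕ) k with hjk | hjk | hjk
    · refine ⟨⟨j, by omega⟩, le_of_eq ?_⟩
      rw [ngon_edgeLine hg, snoc_of_le hjk.le, snoc_of_le (Nat.succ_le_of_lt hjk)]
    · refine ⟨⟨k, by omega⟩, ?_⟩
      rw [ngon_edgeLine hg, hjk, snoc_of_le le_rfl, snoc_succ]
      simp only [hg]
      exact affineSpan_pair_le_of_mem_of_mem (left_mem_affineSpan_pair ℝ _ _) hMl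
    · refine ⟨⟨k, by omega⟩, ?_⟩
      have : (j : ℕ) = k + 1 := by have := j.2; omega
      rw [ngon_edgeLine hg, this, snoc_succ, snoc_closed, snoc_zero]
      simp only [hg]
      exact affineSpan_pair_le_of_mem_of_mem hMl (right_mem_affineSpan_pair ℝ _ _)
  · by_cases hj : (j : ℕ) ≤ k
    · have := h.vertex_notMem S hS ⟨j, by omega⟩
      rwa [show (ngon (k + 2) (snoc k g M)).vertices j = g j from snoc_of_le hj]
    · have hj' : (j : ℕ) = k + 1 := by have := j.2; omega
      rw [show (ngon (k + 2) (snoc k g M)).vertices j = M by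
        simp only [ngon, hj', snoc_succ]]
      intro hMS
      obtain ⟨v, hv, -⟩ := exists_labelled hS hMS
      refine hs ⟨(M, v), hv, 0, ⟨k, by omega⟩, ?_⟩
      rw [edgePt, ngon_finRotate hg]
      simpa [ngon, hg] using hM

end

end SquarePeg

end

section

open Set Complex ComplexConjugate Filter Topology

namespace SquarePeg

/-! ### Cutting off an ear -/

/-- The last vertex of the polygon with vertices `g 0, …, g (k + 1)` is an ear: the triangle spanned
by this vertex and its neighbours meets the remaining edges only in the neighbours. -/
structure LastEar (k : ℕ) (g : ℕ → ℂ) : Prop where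
  corner : crs (g k - g (k + 1)) (g 0 - g (k + 1)) ≠ 0
  empty : ∀ a < k, ∀ y ∈ segment ℝ (g a) (g (a + 1)),
    0 ≤ coA (g (k + 1)) (g k) (g 0) y → 0 ≤ coB (g (k + 1)) (g k) (g 0) y →
    coA (g (k + 1)) (g k) (g 0) y + coB (g (k + 1)) (g k) (g 0) y ≤ 1 → y = g k ∨ y = g 0

/-- The corner `x` pushed towards the midpoint of `p` and `q`, which it reaches at time `1`. -/
noncomputable def pushed (x p q : ℂ) (t : ℝ) : ℂ := x + (t / 2) • ((p - x) + (q - x))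

theorem coA_pushed {x p q : ℂ} (hD : crs (p - x) (q - x) ≠ 0) (t : ℝ) :
    coA x p q (pushed x p q t) = t / 2 := by
  have : crs (p - x + (q - x)) (q - x) = crs (p - x) (q - x) := by simp [crs]; ring
  rw [coA, pushed, add_sub_cancel_left, crs_smul_left, this, mul_div_cancel_right₀ _ hD]

theorem coB_pushed {x p q : ℂ} (hD : crs (p - x) (q - x) ≠ 0) (t : ℝ) :
    coB x p q (pushed x p q t) = t / 2 := by
  rw [coB, pushed, add_sub_cancel_left, crs_smul, crs_add, crs_self, zero_add,
    mul_div_cancel_right₀ _ hD]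

theorem pushed_zero (x p q : ℂ) : pushed x p q 0 = x := by simp [pushed]

theorem pushed_one (x p q : ℂ) : pushed x p q 1 = p + (1 / 2 : ℝ) • (q - p) := by
  simp only [pushed, real_smul]
  push_cast
  ring

namespace LastEar

variable {k : ℕ} {g : ℕ → ℂ}

/-- The moving tip stays inside the ear, so its two edges do too, and there the chain has only the
points `g k` and `g 0`. At `t = 1` the tip is a flat vertex on the base, which is still allowed in a
simple polygon. -/
theorem isSimple_pushed (he : LastEar k g) (hc : SimpleChain k g) (hk : 1 ≤ k) {t : ℝ}
    (t0 : 0 ≤ t) (t1 : t ≤ 1) :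
    (ngon (k + 2) (snoc k g (pushed (g (k + 1)) (g k) (g 0) t))).IsSimple := by
  set x := g (k + 1) with hx
  set p := g k with hp
  set q := g 0 with hq
  have hD : crs (p - x) (q - x) ≠ 0 := he.corner
  have hA := coA_pushed hD t
  have hB := coB_pushed hD t
  set M := pushed x p q t with hM
  have hleft : ∀ s : ℝ, coA x p q (p + s • (M - p)) = 1 - s + s * t / 2 ∧
      coB x p q (p + s • (M - p)) = s * t / 2 := fun s => by
    rw [coA_line, coB_line, hA, hB, coA_left hD, coB_left]
    constructor <;> ring
  have hright : ∀ s : ℝ, coA x p q (M + s • (q - M)) = (1 - s) * t / 2 ∧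
      coB x p q (M + s • (q - M)) = s + (1 - s) * t / 2 := fun s => by
    rw [coA_line, coB_line, hA, hB, coA_right, coB_right hD]
    constructor <;> ring
  refine hc.isSimple_ngon_snoc hk ?_ ?_ ?_
  · intro a ha y hy hy'
    obtain ⟨s, s0, s1, rfl⟩ := mem_segment_iff.1 hy'
    obtain ⟨eA, eB⟩ := hleft s
    have st0 : 0 ≤ s * t := mul_nonneg s0 t0
    have st1 : s * t ≤ s := mul_le_of_le_one_right s0 t1
    refine (he.empty a ha _ hy (by rw [eA]; linarith) (by rw [eB]; linarith)
      (by rw [eA, eB]; linarith)).resolve_right fun h => ?_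
    rw [h, coB_right hD] at eB
    linarith
  · intro a ha y hy hy'
    obtain ⟨s, s0, s1, rfl⟩ := mem_segment_iff.1 hy'
    obtain ⟨eA, eB⟩ := hright s
    have st0 : 0 ≤ (1 - s) * t := mul_nonneg (by linarith) t0
    have st1 : (1 - s) * t ≤ 1 - s := mul_le_of_le_one_right (by linarith) t1
    refine (he.empty a ha _ hy (by rw [eA]; linarith) (by rw [eB]; linarith)
      (by rw [eA, eB]; linarith)).resolve_left fun h => ?_
    rw [h, coA_left hD] at eA
    linarith
  · intro y hy hy'
    obtain ⟨s, s0, s1, rfl⟩ := mem_segment_iff.1 hy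
    obtain ⟨u, u0, u1, hu⟩ := mem_segment_iff.1 hy'
    obtain ⟨eA, -⟩ := hleft s
    obtain ⟨eA', -⟩ := hright u
    rw [hu, eA'] at eA
    obtain rfl : s = 1 := by nlinarith [mul_nonneg u0 t0, mul_nonneg (sub_nonneg.2 s1) t0]
    rw [one_smul, add_sub_cancel]

theorem isSimple_cut (he : LastEar k g) (hc : SimpleChain k g) (hk : 2 ≤ k) :
    (ngon (k + 1) g).IsSimple := by
  have e : ngon (k + 1) g = ngon (k + 1) (fun a => if a ≤ k then g a else g 0) := by
    simp only [ngon]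
    congr 1
    funext i
    rw [if_pos (by omega)]
  rw [e]
  refine (hc.congr fun a ha => if_pos ha).isSimple_close hk (by simp) fun a ha y hy hy' => ?_
  simp only [if_pos ha.le, if_pos (Nat.succ_le_of_lt ha), le_refl, Nat.zero_le, if_true] at hy hy' ⊢
  rw [segment_symm] at hy'
  obtain ⟨h1, h2, h3⟩ := coord_of_mem_base he.corner hy'
  exact he.empty a ha y hy h1 h2 h3.le

end LastEar

/-- Simple polygons are approximated by generic ones. -/
theorem exists_near {n : ℕ} (hn : 3 ≤ n) {x : Fin n → ℂ} (hx : (Polygon.mk x).IsSimple) {η : ℝ}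
    (hη : 0 < η) : ∃ y : Fin n → ℂ, (Polygon.mk y).IsSimple ∧ (Polygon.mk y).IsGeneric ∧
      (∀ a b c d, a ≠ b → d ≠ a → d ≠ b → d ≠ c → crs (y b - y a) (y d - y c) ≠ 0) ∧
      ∀ i, ‖y i - x i‖ ≤ η := by
  have hd := MeasureTheory.Measure.dense_of_ae ((ae_isGeneric hn).and (ae_general_position n)) x
  obtain ⟨y, ⟨hys, hyb⟩, hyg, hyp⟩ := mem_closure_iff_nhds.1 hd _
    (inter_mem (eventually_isSimple (by omega) hx) (Metric.closedBall_mem_nhds x hη))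
  exact ⟨y, hys, hyg, hyp, fun i => by
    rw [← dist_eq_norm]; exact (dist_le_pi_dist y x i).trans hyb⟩

theorem exists_param_notMem {B : Set ℝ} (hB : B.Finite) {ε : ℝ} (hε : 0 < ε) :
    ∃ s, 0 < s ∧ s < 1 ∧ |s - 1 / 2| ≤ ε ∧ s ∉ B := by
  have hinf : (Ioo (1 / 2) (min 1 (1 / 2 + ε))).Infinite :=
    Ioo_infinite (lt_min (by norm_num) (by linarith))
  obtain ⟨s, ⟨h1, h2⟩, hs⟩ := hinf.exists_notMem_finite hB
  have h3 := h2.trans_le (min_le_left _ _)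
  have h4 := h2.trans_le (min_le_right _ _)
  exact ⟨s, by linarith, h3, by rw [abs_of_pos (by linarith)]; linarith, hs⟩

/-- The path pushes the tip to the midpoint of the base. Near its end stands a generic approximation
of the polygon without the tip, given an extra flat vertex on the last edge; this vertex changes
neither the polygonal line nor the number of squares. -/
theorem LastEar.exists_modEq {k : ℕ} {g : ℕ → ℂ} (he : LastEar k g) (hk : 2 ≤ k)
    (hg : g (k + 2) = g 0) (hs : (ngon (k + 2) g).IsSimple) (hgen : (ngon (k + 2) g).IsGeneric) :
    ∃ Y : Polygon ℂ (k + 1), Y.IsSimple ∧ Y.IsGeneric ∧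
      (ngon (k + 2) g).inscribedSquares.ncard ≡ Y.inscribedSquares.ncard [MOD 2] := by
  have hc : SimpleChain k g := SimpleChain.of_isSimple (by omega) (by omega) hg hs
  let X : ℝ → Fin (k + 2) → ℂ := fun t =>
    (ngon (k + 2) (snoc k g (pushed (g (k + 1)) (g k) (g 0) t))).vertices
  have hX : Continuous X := by
    refine continuous_pi fun i => ?_
    simp only [X, ngon, snoc, pushed]
    split_ifs <;> fun_prop
  obtain ⟨η, hη, H⟩ := parity_of_path (by omega) hX fun t ht => he.isSimple_pushed hc (by omega)
    ht.1 ht.2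
  obtain ⟨y, hys, hyg, -, hyn⟩ := exists_near (by omega) (he.isSimple_cut hc hk)
    (show 0 < η / 2 by positivity)
  set f := loop (by omega) y with hf
  have hf0 : f (k + 1) = f 0 := by simpa using loop_add (by omega) y 0
  have hfy : ngon (k + 1) f = ⟨y⟩ := ngon_loop _ y
  have hys' : (ngon (k + 1) f).IsSimple := hfy ▸ hys
  have hyg' : (ngon (k + 1) f).IsGeneric := hfy ▸ hyg
  have hfn : ∀ a ≤ k, ‖f a - g a‖ ≤ η / 2 := fun a ha => by
    rw [hf, loop_val _ y (Nat.lt_succ_of_le ha)]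
    exact hyn ⟨a, Nat.lt_succ_of_le ha⟩
  have hL : 0 < ‖f 0 - f k‖ + 1 := by positivity
  -- The midpoint itself may be a corner of a square, so a nearby parameter is used. The error `η /
  -- 2` from this shift and two errors `η / 4` from the ends add up to `η`.
  obtain ⟨s, s0, s1, hse, hsB⟩ := exists_param_notMem
    (finite_cornerParams (by omega) hys' hyg')
    (show 0 < η / 2 / (‖f 0 - f k‖ + 1) by positivity)
  set M := f k + s • (f 0 - f k) with hM
  refine ⟨⟨y⟩, hys, hyg, ?_⟩
  have hcount : (ngon (k + 2) (snoc k f M)).inscribedSquares = (Polygon.mk y).inscribedSquares := by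
    rw [← hfy]
    exact inscribedSquares_congr (boundary_insert hf0 s0 s1 hM)
  rw [← hcount]
  refine H _ _ hs hgen (isSimple_insert hk hf0 hys' s0 s1 hM)
    (isGeneric_insert hf0 hyg' s0 s1 hsB hM) (fun i => ?_) fun i => ?_
  · have : X 0 i = g i := by
      simp only [X, ngon, snoc, pushed_zero]
      split_ifs with h1 h2
      · rfl
      · rw [h2]
      · have := i.2
        omega
    rw [this, sub_self, norm_zero]
    exact hη.le
  · simp only [X, ngon, snoc]
    split_ifs with h1 h2
    · exact (hfn i h1).trans (by linarith)
    · have e : M - pushed (g (k + 1)) (g k) (g 0) 1 = (s - 1 / 2) • (f 0 - f k) +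
          (1 / 2 : ℝ) • (f k - g k) + (1 / 2 : ℝ) • (f 0 - g 0) := by
        rw [pushed_one, hM]
        simp only [real_smul]
        push_cast
        ring
      rw [e]
      have n1 : ‖(s - 1 / 2) • (f 0 - f k)‖ ≤ η / 2 := by
        rw [norm_smul, Real.norm_eq_abs]
        calc |s - 1 / 2| * ‖f 0 - f k‖
            ≤ η / 2 / (‖f 0 - f k‖ + 1) * (‖f 0 - f k‖ + 1) := by gcongr; linarith
          _ = η / 2 := div_mul_cancel₀ _ hL.ne'
      have n2 : ∀ a ≤ k, ‖(1 / 2 : ℝ) • (f a - g a)‖ ≤ η / 4 := fun a ha => by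
        rw [norm_smul, Real.norm_of_nonneg (by norm_num)]
        linarith [hfn a ha]
      calc _ ≤ ‖(s - 1 / 2) • (f 0 - f k)‖ + ‖(1 / 2 : ℝ) • (f k - g k)‖ +
            ‖(1 / 2 : ℝ) • (f 0 - g 0)‖ := norm_add₃_le
        _ ≤ η := by linarith [n1, n2 k le_rfl, n2 0 (Nat.zero_le k)]
    · exact (hfn 0 (Nat.zero_le k)).trans (by linarith)

/-- In a loop in general position, some rotation of the indices makes the last vertex an ear. -/
theorem SimpleLoop.exists_lastEar {k : ℕ} {f : ℕ → ℂ} (hf : SimpleLoop (k + 2) f) (hk : 2 ≤ k) :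
    ∃ c, LastEar k fun a => f (a + c) := by
  obtain ⟨r, hr, h⟩ := hf.exists_ear (by omega)
  have e1 : f (k + (r + 2)) = f r := by
    rw [show k + (r + 2) = r + (k + 2) by omega, hf.periodic]
  have e2 : f (k + 1 + (r + 2)) = f (r + 1) := by
    rw [show k + 1 + (r + 2) = r + 1 + (k + 2) by omega, hf.periodic]
  refine ⟨r + 2, ?_, fun a ha y hy => ?_⟩
  · simp only [e1, e2, zero_add]
    exact hf.crs_corner_ne_zero hr
  · simp only [e1, e2, zero_add]
    exact h (a + (r + 2)) (by omega) (by omega) y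
      (by rwa [show a + (r + 2) + 1 = a + 1 + (r + 2) by omega])

/-- The number of squares inscribed in a generic simple polygon is odd. -/
theorem odd_ncard_inscribedSquares {n : ℕ} (hn : 3 ≤ n) {X : Polygon ℂ n} (hs : X.IsSimple)
    (hg : X.IsGeneric) : Odd X.inscribedSquares.ncard := by
  induction n, hn using Nat.le_induction with
  | base => exact odd_ncard_of_triangle hs hg
  | succ n hn ih =>
    obtain ⟨k, rfl⟩ : ∃ k, n = k + 1 := ⟨n - 1, by omega⟩
    have hk : 2 ≤ k := by omega
    obtain ⟨x⟩ := X
    -- The constant path allows the polygon to be replaced by a nearby one that is also in general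
    -- position, as the search for an ear requires.
    obtain ⟨η, hη, H⟩ := parity_of_path (X := fun _ => x) (by omega) continuous_const
      fun _ _ => hs
    obtain ⟨y, hys, hyg, hyp, hyn⟩ := exists_near (by omega) hs hη
    have h1 := H x y hs hg hys hyg (fun i => by simpa using hη.le) hyn
    have hf := simpleLoop_of_isSimple (by omega) hys hyp
    set f := loop (by omega) y
    have hfy : ngon (k + 2) f = ⟨y⟩ := ngon_loop _ y
    obtain ⟨c, hc⟩ := hf.exists_lastEar hk
    have hcount : (ngon (k + 2) fun a => f (a + c)).inscribedSquares =
        (Polygon.mk y).inscribedSquares := by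
      rw [← hfy]
      exact inscribedSquares_congr (boundary_ngon_shift (by omega) hf.periodic c)
    obtain ⟨Y, hYs, hYg, h2⟩ := hc.exists_modEq hk
      (by simp only [zero_add]; rw [add_comm, hf.periodic]) (hf.isSimple_shift (by omega) c)
      (isGeneric_ngon_shift (by omega) hf.periodic c (hfy ▸ hyg))
    rw [hcount] at h2
    have h3 := ih hYs hYg
    rw [Nat.odd_iff] at h3 ⊢
    exact Eq.trans (h1.trans h2) h3

end SquarePeg

end

theorem theorem1 :
    -- every generic simple polygon has an odd (in particular finite) number of inscribed squares
    (∀ (n : ℕ), 3 ≤ n → ∀ X : Polygon ℂ n, X.IsSimple → X.IsGeneric →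
      X.inscribedSquares.Finite ∧ Odd X.inscribedSquares.ncard) ∧
    -- almost all `n`-gons, viewed as points of `ℝ²ⁿ`, are generic
    (∀ (n : ℕ), 3 ≤ n →
      ∀ᵐ x ∂(MeasureTheory.volume : MeasureTheory.Measure (Fin n → ℂ)),
        (Polygon.mk x).IsGeneric) ∧
    -- every right triangle is a simple polygon with exactly two inscribed squares
    (∀ X : Polygon ℂ 3, AffineIndependent ℝ X.vertices →
      (∃ i : Fin 3, EuclideanGeometry.angle (X (i + 1)) (X i) (X (i + 2)) = Real.pi / 2) →
      X.IsSimple ∧ X.inscribedSquares.ncard = 2) := by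
  exact ⟨fun n hn X hs hg => ⟨SquarePeg.finite_inscribedSquares hg,
      SquarePeg.odd_ncard_inscribedSquares hn hs hg⟩,
    fun n hn => SquarePeg.ae_isGeneric hn,
    fun X h ha => SquarePeg.right_triangle h ha⟩
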